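/- **Setup.** Let $R$ be a principal ideal domain of characteristic $0$, and let $\mathbb F$ be a field which is an $R$-algebra. "Super" means $\mathbb Z/2$-graded, and $|v|$ is the parity of a homogeneous $v$. Tensor powers carry the usual signs: $(a\otimes a')(v\otimes v')=(-1)^{|a'||v|}av\otimes a'v'$, and $\mathfrak S_d$ acts on $V^{\otimes d}$ by signed place permutations. Fix integers $\ell\ge 1$, $n\ge1$ and $0\le d\le n$. Let $I=\{0<1<\dots<\ell\}$. *Modified divided powers.* Let $V_R$ be a free $R$-supermodule with a homogeneous basis $B=B_{\mathfrak a}\sqcup B_{\mathfrak c}\sqcup B_{\bar 1}$, where $B_{\mathfrak a}\sqcup B_{\mathfrak c}$ are the even basis elements. For a word $b=b_1\cdots b_d$ in $B$ without repeated odd letters, put $y_b=\big(\prod_{c\in B_{\mathfrak c}}\#\{k: b_k=c\}!\big)\sum_{b'\sim b}\pm\, b'_1\otimes\dots\otimes b'_d$. Here $b'$ runs over the distinct rearrangements of $b$, and the signs are those that make $y_b$ invariant under $\mathfrak S_d$, with the sign of $b$ itself equal to $+$. Then $\tilde\Gamma^dV_R\subseteq V_R^{\otimes d}$ is the $R$-span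 of the $y_b$. *Extended zigzag algebra.* $\mathsf Z_R$ is the $R$-superalgebra given by the quiver with vertices $0,\dots,\ell$ and arrows $\mathsf a_{j+1,j}\colon j\to j+1$, $\mathsf a_{j,j+1}\colon j+1\to j$ for $0\le j<\ell$. Its relations are: paths of length $\ge3$ vanish; paths of length two that are not cycles vanish; all cycles of length two at the same vertex are equal; $\mathsf a_{\ell,\ell-1}\mathsf a_{\ell-1,\ell}=0$. The parity is the path length mod 2, and $\mathsf e_i$ denotes the path of length $0$ at $i$. It has the basis of all $\mathsf e_i$ (in $B_{\mathfrak a}$), $\mathsf c_j=\mathsf a_{j,j+1}\mathsf a_{j+1,j}$ for $0\le j<\ell$ (in $B_{\mathfrak c}$), and the odd arrows. Let $\tau$ be the $R$-linear map on $\mathsf Z_R$ with $\tau(\mathsf e_i)=\mathsf e_i$, $\tau(\mathsf a_{i,j})=\mathsf a_{j,i}$, $\tau(\mathsf c_j)=-\mathsf c_j$. *The algebra.* The superalgebra $M_n(\mathsf Z_R)$ has the basis $\xi_{r,s}^{b}$ (the matrix with entry $b$ in position $(r,s)$ and $0$ elsewhere), split according to the type of $b$. Put $T^{\mathsf Z}(n,d)=\mathbb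 F\otimes_R\tilde\Gamma^dM_n(\mathsf Z_R)$, a superalgebra under the product of $M_n(\mathsf Z_R)^{\otimes d}$. Let $\tau_{n,d}$ be its anti-involution induced by $\big(\xi_{r,s}^b\mapsto\xi_{s,r}^{\tau(b)}\big)^{\otimes d}$. *The modules.* Let $\Pi\mathsf T(0)_R$ be the $\mathsf Z_R$-supermodule with one odd basis vector, fixed by $\mathsf e_0$ and killed by the other basis elements of $\mathsf Z_R$. For $i>0$ let $\Pi\mathsf T(i)_R=\mathsf Z_R\mathsf e_{i-1}$, with the basis of those basis elements of $\mathsf Z_R$ that lie in it. The $M_n(\mathsf Z_R)$-supermodule $\mathrm{Col}_n(\Pi\mathsf T(i)_R)$ of column vectors has the induced basis. Put $\mathscr T_i^d=\mathbb F\otimes_R\tilde\Gamma^d\mathrm{Col}_n(\Pi\mathsf T(i)_R)$, a $T^{\mathsf Z}(n,d)$-supermodule. *Weights.* $\Lambda^I(n,d)$ is the set of all $\mu=(\mu^{(0)},\dots,\mu^{(\ell)})$ with $\mu^{(i)}\in\mathbb Z_{\ge0}^n$ and $\sum_{i,r}\mu^{(i)}_r=d$. Its subset $\Lambda^I_+(n,d)$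 consists of those $\mu$ in which every $\mu^{(i)}$ is weakly decreasing. Put $\|\mu\|=(|\mu^{(i)}|)_{i\in I}$. Then $\lambda\le_I\mu$ means that either $\|\lambda\|\ne\|\mu\|$ and $\sum_{j\ge i}|\lambda^{(j)}|\le\sum_{j\ge i}|\mu^{(j)}|$ for all $i$, or $\|\lambda\|=\|\mu\|$ and $\lambda^{(i)}\trianglelefteq\mu^{(i)}$ in the dominance order for all $i$. The idempotent $\eta_\mu\in T^{\mathsf Z}(n,d)$ is the sum of all $\xi_{r_1,r_1}^{\mathsf e_{i_1}}\otimes\dots\otimes\xi_{r_d,r_d}^{\mathsf e_{i_d}}$ in which each pair $(i,r)$ occurs exactly $\mu^{(i)}_r$ times among the $(i_k,r_k)$. A *weight* of a module $V$ is a $\mu\in\Lambda^I(n,d)$ with $\eta_\mu V\ne0$. The multicomposition with $i$-th component $(1^d,0,\dots,0)$, respectively $(d,0,\dots,0)$, and all other components zero is denoted $\iota_i(1^d)$, respectively $\iota_i(d)$. *Tilting modules.* Write $T=T^{\mathsf Z}(n,d)$. For $\lambda\in\Lambda_+^I(n,d)$ let $\tilde T$ be the quotient of $T$ by the two-sided ideal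 generated by the $\eta_\mu$ with $\mu\in\Lambda^I_+(n,d)$, $\mu>_I\lambda$, and let $\tilde\eta_\lambda$ be the image of $\eta_\lambda$. Put $\Delta(\lambda)=\tilde T\tilde\eta_\lambda$ and $\nabla(\lambda)=(\tilde\eta_\lambda\tilde T)^*$, with the action $(af)(v)=(-1)^{|a||f|+|a||v|}f(va)$. A $T$-supermodule is *tilting* if it has a finite filtration by subsupermodules whose factors are isomorphic to modules $\Delta(\lambda)$, and also one whose factors are isomorphic to modules $\nabla(\lambda)$. Here isomorphisms of supermodules may be even or odd. **Proposition.** Let $i\in I$. 1. The $T^{\mathsf Z}(n,d)$-supermodule $\mathscr T_i^d$ is tilting. 2. $\iota_i(1^d)$ is the unique maximal weight of $\mathscr T_i^d$ with respect to $\le_I$. 3. If $i>0$, then $\mathscr T_i^d$ is isomorphic, by an even isomorphism, to $T^{\mathsf Z}(n,d)\,\eta_{\iota_{i-1}(d)}$, and so it is projective. It carries an even nondegenerate $\mathbb F$-bilinear form that is $\tau_{n,d}$-contravariant: $(xv,w)=(-1)^{|x||v|}(v,\tau_{n,d}(x)w)$ for all homogeneous $x\in T^{\mathsf Z}(n,d)$,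 $v\in\mathscr T_i^d$ and all $w\in\mathscr T_i^d$. Equivalently, $\mathscr T_i^d$ is $\tau_{n,d}$-self-dual. -/

import Mathlib

open scoped TensorProduct Matrix.Module

namespace ZigSchur

/-! ### Signs -/

section Signs

/-- `⟨v, w⟩ = #{(k, l) | k > l, |v_k| = |w_l| = 1}` for words with parities `p`, `q`. -/
def koszul {d : ℕ} (p q : Fin d → ZMod 2) : ℕ :=
  (Finset.univ.filter fun kl : Fin d × Fin d => kl.2 < kl.1 ∧ p kl.1 = 1 ∧ q kl.2 = 1).card

/-- `⟨σ; v⟩ = #{(k, l) | k < l, σ⁻¹ k > σ⁻¹ l, |v_k| = |v_l| = 1}`, so that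
`(v_1 ⊗ ⋯ ⊗ v_d)^σ = (-1)^⟨σ; v⟩ v_{σ 1} ⊗ ⋯ ⊗ v_{σ d}`. -/
def permKoszul {d : ℕ} (σ : Equiv.Perm (Fin d)) (p : Fin d → ZMod 2) : ℕ :=
  (Finset.univ.filter fun kl : Fin d × Fin d =>
    kl.1 < kl.2 ∧ σ.symm kl.2 < σ.symm kl.1 ∧ p kl.1 = 1 ∧ p kl.2 = 1).card

/-- `⟨b⟩ = #{(k, l) | k < l, |b_k| = |b_l| = 1, b_k > b_l}`, for a fixed total order on the
finite set `B` of letters. -/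
noncomputable def inversions {B : Type*} [Fintype B] (par : B → ZMod 2) {d : ℕ}
    (b : Fin d → B) : ℕ :=
  (Finset.univ.filter fun kl : Fin d × Fin d => kl.1 < kl.2 ∧ par (b kl.1) = 1 ∧
    par (b kl.2) = 1 ∧ Fintype.equivFin B (b kl.2) < Fintype.equivFin B (b kl.1)).card

theorem neg_one_pow_card {R ι : Type*} [CommRing R] (s : Finset ι) (P : ι → Prop)
    [DecidablePred P] :
    (-1 : R) ^ (s.filter P).card = ∏ x ∈ s, if P x then (-1 : R) else 1 := by
  rw [Finset.prod_ite, Finset.prod_const, Finset.prod_const_one, mul_one]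

theorem prod_pairs {R : Type*} [CommRing R] {d : ℕ} (g h : Fin d × Fin d → R)
    (hlt : ∀ k l, k < l → g (k, l) * g (l, k) = h (k, l) * h (l, k))
    (hd : ∀ k, g (k, k) = h (k, k)) : ∏ x, g x = ∏ x, h x := by
  have key : ∀ f : Fin d × Fin d → R, ∏ x, f x =
      (∏ x ∈ Finset.univ.filter (fun x : Fin d × Fin d => x.1 < x.2), f (x.1, x.2) * f (x.2, x.1))
        * ∏ x ∈ Finset.univ.filter (fun x : Fin d × Fin d => x.1 = x.2), f (x.1, x.1) := by
    intro f
    have h1 : ∏ x ∈ Finset.univ.filter (fun x : Fin d × Fin d => x.1 < x.2), f (x.2, x.1)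
        = ∏ x ∈ Finset.univ.filter (fun x : Fin d × Fin d => x.2 < x.1), f x := by
      refine Finset.prod_nbij' Prod.swap Prod.swap ?_ ?_ ?_ ?_ ?_ <;> simp
    rw [Finset.prod_mul_distrib, h1]
    rw [← Finset.prod_filter_mul_prod_filter_not Finset.univ
      (fun x : Fin d × Fin d => x.1 < x.2), mul_assoc]
    congr 1
    rw [← Finset.prod_filter_mul_prod_filter_not
      (Finset.univ.filter (fun x : Fin d × Fin d => ¬ x.1 < x.2))
      (fun x : Fin d × Fin d => x.2 < x.1), Finset.filter_filter, Finset.filter_filter]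
    congr 1
    · apply Finset.prod_congr _ (fun _ _ => rfl)
      ext x; simp; intro h; exact h.le
    · apply Finset.prod_congr
      · ext x; simp; constructor
        · intro h; exact le_antisymm h.2 h.1
        · intro h; simp [h]
      · intro x hx
        simp at hx
        rw [← Prod.mk.eta (p := x), hx]
  rw [key g, key h]
  congr 1
  · apply Finset.prod_congr rfl
    intro x hx
    exact hlt _ _ (by simpa using hx)
  · apply Finset.prod_congr rfl
    intro x _
    exact hd _

theorem prod_perm_pairs {R : Type*} [CommRing R] {d : ℕ} (σ : Equiv.Perm (Fin d))
    (g : Fin d × Fin d → R) : ∏ x, g x = ∏ x : Fin d × Fin d, g (σ.symm x.1, σ.symm x.2) :=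
  (Equiv.prod_comp (σ.symm.prodCongr σ.symm) g).symm

theorem zmod2_cases (x : ZMod 2) : x = 0 ∨ x = 1 := by
  revert x; decide

theorem sign_perm_mul {R : Type*} [CommRing R] {d : ℕ} (σ : Equiv.Perm (Fin d))
    (p q : Fin d → ZMod 2) :
    (-1 : R) ^ permKoszul σ p * (-1) ^ permKoszul σ q * (-1) ^ koszul (p ∘ σ) (q ∘ σ) =
      (-1) ^ permKoszul σ (p + q) * (-1) ^ koszul p q := by
  simp only [permKoszul, koszul, neg_one_pow_card]
  rw [prod_perm_pairs σ (fun x : Fin d × Fin d =>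
    if x.2 < x.1 ∧ (p ∘ σ) x.1 = 1 ∧ (q ∘ σ) x.2 = 1 then (-1 : R) else 1)]
  simp only [← Finset.prod_mul_distrib]
  apply prod_pairs
  · intro k l hkl
    have hne : σ.symm k ≠ σ.symm l := fun h => hkl.ne (σ.symm.injective h)
    have hs : (1 : ZMod 2) + 1 = 0 := by decide
    rcases lt_or_gt_of_ne hne with h | h <;>
    rcases zmod2_cases (p k) with h1 | h1 <;> rcases zmod2_cases (p l) with h2 | h2 <;>
    rcases zmod2_cases (q k) with h3 | h3 <;> rcases zmod2_cases (q l) with h4 | h4 <;>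
    simp [h1, h2, h3, h4, h, h.not_gt, hkl, hkl.not_gt, hs]
  · intro k
    simp

theorem sign_koszul_add_left {R : Type*} [CommRing R] {d : ℕ} (p p' q : Fin d → ZMod 2) :
    (-1 : R) ^ koszul (p + p') q = (-1) ^ koszul p q * (-1) ^ koszul p' q := by
  simp only [koszul, neg_one_pow_card]
  rw [← Finset.prod_mul_distrib]
  apply Finset.prod_congr rfl
  intro x _
  have hs : (1 : ZMod 2) + 1 = 0 := by decide
  by_cases h : x.2 < x.1 <;>
  rcases zmod2_cases (p x.1) with h1 | h1 <;> rcases zmod2_cases (p' x.1) with h2 | h2 <;>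
  rcases zmod2_cases (q x.2) with h3 | h3 <;> simp [h, h1, h2, h3, hs]

theorem sign_koszul_add_right {R : Type*} [CommRing R] {d : ℕ} (p q q' : Fin d → ZMod 2) :
    (-1 : R) ^ koszul p (q + q') = (-1) ^ koszul p q * (-1) ^ koszul p q' := by
  simp only [koszul, neg_one_pow_card]
  rw [← Finset.prod_mul_distrib]
  apply Finset.prod_congr rfl
  intro x _
  have hs : (1 : ZMod 2) + 1 = 0 := by decide
  by_cases h : x.2 < x.1 <;>
  rcases zmod2_cases (p x.1) with h1 | h1 <;> rcases zmod2_cases (q x.2) with h2 | h2 <;>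
  rcases zmod2_cases (q' x.2) with h3 | h3 <;> simp [h, h1, h2, h3, hs]

theorem koszul_zero_left {d : ℕ} (q : Fin d → ZMod 2) : koszul (0 : Fin d → ZMod 2) q = 0 := by
  simp [koszul]

theorem koszul_zero_right {d : ℕ} (q : Fin d → ZMod 2) : koszul q (0 : Fin d → ZMod 2) = 0 := by
  simp [koszul]

theorem sign_inversions {R B : Type*} [CommRing R] [Fintype B] (par : B → ZMod 2) {d : ℕ}
    (b : Fin d → B) (hb : ∀ k l, k ≠ l → b k = b l → par (b k) = 0) (σ : Equiv.Perm (Fin d)) :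
    (-1 : R) ^ inversions par (b ∘ σ) =
      (-1) ^ permKoszul σ (par ∘ b) * (-1) ^ inversions par b := by
  simp only [permKoszul, inversions, neg_one_pow_card]
  rw [prod_perm_pairs σ (fun x : Fin d × Fin d =>
    if x.1 < x.2 ∧ par ((b ∘ σ) x.1) = 1 ∧ par ((b ∘ σ) x.2) = 1 ∧
      Fintype.equivFin B ((b ∘ σ) x.2) < Fintype.equivFin B ((b ∘ σ) x.1) then (-1 : R) else 1)]
  rw [← Finset.prod_mul_distrib]
  apply prod_pairs
  · intro k l hkl
    have hne : σ.symm k ≠ σ.symm l := fun h => hkl.ne (σ.symm.injective h)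
    by_cases h1 : par (b k) = 1
    · by_cases h2 : par (b l) = 1
      · have hbne : Fintype.equivFin B (b k) ≠ Fintype.equivFin B (b l) := by
          intro h
          have := hb k l hkl.ne ((Fintype.equivFin B).injective h)
          rw [this] at h1
          exact absurd h1 (by decide)
        rcases lt_or_gt_of_ne hne with h | h <;> rcases lt_or_gt_of_ne hbne with h' | h' <;>
        simp [h1, h2, h, h', h.not_gt, h'.not_gt, hkl, hkl.not_gt]
      · simp [h2]
    · simp [h1]
  · intro k
    simp

theorem sign_swap {R : Type*} [CommRing R] {d : ℕ} (p : Fin d → ZMod 2) (k l : Fin d)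
    (hkl : k < l) (hk : p k = 1) (hl : p l = 1) :
    (-1 : R) ^ permKoszul (Equiv.swap k l) p = -1 := by
  classical
  set M := Finset.univ.filter fun m : Fin d => k < m ∧ m < l ∧ p m = 1 with hM
  have h : (Finset.univ.filter fun kl : Fin d × Fin d => kl.1 < kl.2 ∧
      (Equiv.swap k l).symm kl.2 < (Equiv.swap k l).symm kl.1 ∧ p kl.1 = 1 ∧ p kl.2 = 1) =
      insert (k, l) (M.image (fun m => (k, m)) ∪ M.image (fun m => (m, l))) := by
    ext ⟨i, j⟩
    simp only [hM, Finset.mem_filter, Finset.mem_univ,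
      true_and, Finset.mem_insert, Finset.mem_union, Finset.mem_image, Prod.mk.injEq]
    simp only [Equiv.symm_swap, Equiv.swap_apply_def]
    constructor
    · rintro ⟨h1, h2, h3, h4⟩
      by_cases hi : i = k
      · by_cases hj : j = l
        · exact Or.inl ⟨hi, hj⟩
        · refine Or.inr (Or.inl ⟨j, ⟨by omega, ?_, h4⟩, hi.symm, rfl⟩)
          split_ifs at h2 <;> omega
      · by_cases hj : j = l
        · refine Or.inr (Or.inr ⟨i, ⟨?_, by omega, h3⟩, rfl, hj.symm⟩)
          split_ifs at h2 <;> omega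
        · exfalso
          split_ifs at h2 <;> omega
    · rintro (⟨rfl, rfl⟩ | ⟨m, ⟨h1, h2, h3⟩, rfl, rfl⟩ | ⟨m, ⟨h1, h2, h3⟩, rfl, rfl⟩)
      · refine ⟨hkl, ?_, hk, hl⟩
        split_ifs <;> omega
      · refine ⟨h1, ?_, hk, h3⟩
        split_ifs <;> omega
      · refine ⟨h2, ?_, h3, hl⟩
        split_ifs <;> omega
  rw [permKoszul, h, Finset.card_insert_of_notMem, Finset.card_union_of_disjoint,
    Finset.card_image_of_injective, Finset.card_image_of_injective]
  · rw [pow_succ, pow_add, ← mul_pow]; simp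
  · intro a b h; simpa using h
  · intro a b h; simpa using h
  · rw [Finset.disjoint_left]
    simp only [hM, Finset.mem_image, Finset.mem_filter, Finset.mem_univ, true_and]
    rintro _ ⟨m, h1, rfl⟩ ⟨m', h2, h3⟩
    simp only [Prod.mk.injEq] at h3
    omega
  · simp only [hM, Finset.mem_union, Finset.mem_image, Finset.mem_filter, Finset.mem_univ,
      true_and, Prod.mk.injEq]
    rintro (⟨m, h1, _, h2⟩ | ⟨m, h1, h2, _⟩) <;> omega

end Signs

/-! ### Modified divided powers -/

/-- A calibration, recorded on a homogeneous basis indexed by `B`: the parity of each basis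
element, and the set of those basis elements that span the complement `𝔠` of `𝔞` in the even
part. The elements that are even and not in `𝔠` span `𝔞`. -/
structure Calib (B : Type*) where
  par : B → ZMod 2
  isC : B → Prop
  par_of_isC : ∀ b, isC b → par b = 0

section ModDiv

open scoped Classical

variable {B : Type*}

/-- `Seq(B, d)`: words in which no odd letter is repeated. -/
def Calib.Seq (κ : Calib B) {d : ℕ} (b : Fin d → B) : Prop :=
  ∀ k l, k ≠ l → b k = b l → κ.par (b k) = 0

theorem Calib.Seq.comp {κ : Calib B} {d : ℕ} {b : Fin d → B} (hb : κ.Seq b) (σ : Equiv.Perm (Fin d)) :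
    κ.Seq (b ∘ σ) :=
  fun k l hkl h => hb (σ k) (σ l) (fun h' => hkl (σ.injective h')) h

theorem Calib.eq_zero_of_not_seq {R : Type*} [CommRing R] [IsDomain R] [CharZero R] {d : ℕ} (κ : Calib B) (w : (Fin d → B) → R)
    (hinv : ∀ (σ : Equiv.Perm (Fin d)) (b : Fin d → B),
      w (b ∘ σ) = (-1) ^ permKoszul σ (κ.par ∘ b) * w b)
    (b : Fin d → B) (hb : ¬ κ.Seq b) : w b = 0 := by
  simp only [Calib.Seq, not_forall] at hb
  obtain ⟨k, l, hkl, hbkl, hp⟩ := hb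
  have hp1 : κ.par (b k) = 1 := (zmod2_cases _).resolve_left hp
  have h1 := hinv (Equiv.swap k l) b
  have h2 : b ∘ Equiv.swap k l = b := by
    ext m
    simp only [Function.comp_apply, Equiv.swap_apply_def]
    split_ifs with h h' <;> simp_all
  have h3 : ((-1 : R)) ^ permKoszul (Equiv.swap k l) (κ.par ∘ b) = -1 := by
    have hl1 : κ.par (b l) = 1 := by rw [← hbkl]; exact hp1
    rcases lt_or_gt_of_ne hkl with h | h
    · exact sign_swap _ k l h hp1 hl1
    · rw [Equiv.swap_comm]
      exact sign_swap _ l k h hl1 hp1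
  rw [h2, h3] at h1
  have : (2 : R) * w b = 0 := by linear_combination h1
  exact (mul_eq_zero.mp this).resolve_left two_ne_zero

/-- The word `b` with its letters outside `𝔠` made pairwise distinct. -/
noncomputable def Calib.mark (κ : Calib B) {d : ℕ} (b : Fin d → B) : Fin d → B ⊕ Fin d :=
  fun k => if κ.isC (b k) then Sum.inl (b k) else Sum.inr k

theorem Calib.mark_eq (κ : Calib B) {d : ℕ} (b : Fin d → B) {k l : Fin d} (hkl : k ≠ l)
    (h : κ.mark b k = κ.mark b l) : κ.isC (b k) ∧ b k = b l := by
  unfold Calib.mark at h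
  split_ifs at h with h1 h2
  · exact ⟨h1, by simpa using h⟩
  · exact absurd (by simpa using h) hkl

variable [Fintype B]

/-- `[b]^!_𝔠 = ∏_{β ∈ B_𝔠} [b : β]!`. -/
noncomputable def Calib.cFact (κ : Calib B) {d : ℕ} (b : Fin d → B) : ℕ :=
  ∏ β : B, if κ.isC β then (Fintype.card {k // b k = β}).factorial else 1

/-- The element `y_b = [b]^!_𝔠 ∑_{b' ∼ b} (-1)^{⟨b⟩ + ⟨b'⟩} b'_1 ⊗ ⋯ ⊗ b'_d` of `V^{⊗ d}`. Here and
below an element of `V^{⊗ d}` is given by the function that sends a word `b'` to the coefficient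
of `b'_1 ⊗ ⋯ ⊗ b'_d`. -/
noncomputable def Calib.y (R : Type*) [CommRing R] (κ : Calib B) {d : ℕ} (b : Fin d → B) :
    (Fin d → B) → R :=
  fun b' => if ∃ σ : Equiv.Perm (Fin d), b ∘ σ = b' then
    (κ.cFact b : R) * (-1) ^ (inversions κ.par b + inversions κ.par b') else 0

/-- The modified divided power `Γ̃^d V = span {y_b | b ∈ Seq(B, d)} ⊆ V^{⊗ d}`. -/
noncomputable def Calib.modDiv (R : Type*) [CommRing R] (κ : Calib B) (d : ℕ) :
    Submodule R ((Fin d → B) → R) :=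
  Submodule.span R {w | ∃ b : Fin d → B, κ.Seq b ∧ w = κ.y R b}

variable {R : Type*} [CommRing R] {d : ℕ}

theorem Calib.cFact_comp (κ : Calib B) (b : Fin d → B) (σ : Equiv.Perm (Fin d)) :
    κ.cFact (b ∘ σ) = κ.cFact b := by
  unfold Calib.cFact
  refine Finset.prod_congr rfl fun β _ => ?_
  have : Fintype.card {k // (b ∘ σ) k = β} = Fintype.card {k // b k = β} :=
    Fintype.card_congr (σ.subtypeEquiv fun a => by simp)
  rw [this]

theorem sign_sq (n : ℕ) : ((-1 : R) ^ n) * (-1) ^ n = 1 := by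
  rw [← mul_pow]; simp

/-- Elements of `Γ̃^d V` are the invariant tensors with suitably divisible coefficients. -/
theorem Calib.mem_modDiv [IsDomain R] [CharZero R] (κ : Calib B) (w : (Fin d → B) → R) :
    w ∈ κ.modDiv R d ↔
      (∀ (σ : Equiv.Perm (Fin d)) (b : Fin d → B),
        w (b ∘ σ) = (-1) ^ permKoszul σ (κ.par ∘ b) * w b) ∧
      ∀ b : Fin d → B, (κ.cFact b : R) ∣ w b := by
  constructor
  · intro hw
    induction hw using Submodule.span_induction with
    | mem w hw =>
      obtain ⟨b, hb, rfl⟩ := hw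
      constructor
      · intro σ b'
        simp only [Calib.y]
        by_cases h : ∃ τ : Equiv.Perm (Fin d), b ∘ τ = b'
        · obtain ⟨τ, rfl⟩ := h
          rw [if_pos ⟨τ * σ, by ext; simp⟩, if_pos ⟨τ, rfl⟩]
          rw [pow_add, pow_add, sign_inversions κ.par _ (hb.comp τ) σ]
          ring
        · rw [if_neg h, if_neg, mul_zero]
          rintro ⟨τ, hτ⟩
          exact h ⟨τ * σ⁻¹, by
            ext k; simpa using congrFun hτ (σ⁻¹ k)⟩
      · intro b'
        simp only [Calib.y]
        split_ifs with h
        · obtain ⟨τ, rfl⟩ := h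
          rw [κ.cFact_comp]
          exact Dvd.intro _ rfl
        · exact dvd_zero _
    | zero => simp
    | add x y _ _ hx hy =>
      exact ⟨fun σ b => by simp [hx.1, hy.1, mul_add], fun b => dvd_add (hx.2 b) (hy.2 b)⟩
    | smul r x _ hx =>
      refine ⟨fun σ b => ?_, fun b => Dvd.dvd.mul_left (hx.2 b) r⟩
      simp only [Pi.smul_apply, hx.1, smul_eq_mul]; ring
  · rintro ⟨hinv, hdvd⟩
    have hzero := κ.eq_zero_of_not_seq w hinv
    choose r hr using hdvd
    let s : Setoid (Fin d → B) :=
      ⟨fun b b' => ∃ σ : Equiv.Perm (Fin d), b ∘ σ = b', fun b => ⟨1, by simp⟩,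
        fun {b b'} h => by
          obtain ⟨σ, rfl⟩ := h
          exact ⟨σ⁻¹, by ext; simp⟩,
        fun {b b' b''} h h' => by
          obtain ⟨σ, rfl⟩ := h
          obtain ⟨τ, rfl⟩ := h'
          exact ⟨σ * τ, by ext; simp⟩⟩
    have hsum : w = ∑ q : Quotient s, (if κ.Seq q.out then r q.out else 0) • κ.y R q.out := by
      ext b
      rw [Finset.sum_apply, Finset.sum_eq_single (Quotient.mk s b)]
      · have hout : ∃ σ : Equiv.Perm (Fin d), (Quotient.mk s b).out ∘ σ = b :=
          Quotient.exact (Quotient.out_eq (Quotient.mk s b))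
        obtain ⟨σ, hσ⟩ := hout
        generalize (Quotient.mk s b).out = c at hσ
        subst hσ
        have hy : κ.y R c (c ∘ σ) = (κ.cFact c : R) *
            (-1) ^ (inversions κ.par c + inversions κ.par (c ∘ σ)) := if_pos ⟨σ, rfl⟩
        rw [Pi.smul_apply, smul_eq_mul, hy, hinv]
        by_cases hc : κ.Seq c
        · rw [if_pos hc, hr c, pow_add, sign_inversions κ.par _ hc σ]
          linear_combination (-(-1) ^ permKoszul σ (κ.par ∘ c) * κ.cFact c * r c) *
            sign_sq (R := R) (inversions κ.par c)
        · rw [hzero c hc, if_neg hc]; simp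
      · intro q _ hq
        have hy : κ.y R q.out b = 0 := if_neg ?_
        · rw [Pi.smul_apply, hy, smul_zero]
        intro h
        apply hq
        rw [← Quotient.out_eq q]
        exact Quotient.sound h
      · simp
    rw [hsum]
    refine Submodule.sum_mem _ fun q _ => ?_
    split_ifs with h
    · exact Submodule.smul_mem _ _ (Submodule.subset_span ⟨_, h, rfl⟩)
    · simp


theorem card_fiber_prod_dvd {ι κ : Type*} [Fintype ι] (f : Fin d → ι) (g : Fin d → κ) (i : κ) :
    ∏ j : ι, (Nat.card {k // f k = j ∧ g k = i}).factorial ∣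
      (Nat.card {k // g k = i}).factorial := by
  have h : Nat.card {k // g k = i} = ∑ j : ι, Nat.card {k // f k = j ∧ g k = i} := by
    simp only [Nat.card_eq_fintype_card]
    rw [Fintype.card_subtype, Finset.card_eq_sum_card_fiberwise (f := f) (t := Finset.univ)
      (by simp)]
    refine Finset.sum_congr rfl fun j _ => ?_
    rw [Fintype.card_subtype, Finset.filter_filter]
    congr 1
    ext k; simp [and_comm]
  rw [h]
  exact Nat.prod_factorial_dvd_factorial_sum _ _

theorem Calib.card_mark (κ : Calib B) (b : Fin d → B) :
    Fintype.card {σ : Equiv.Perm (Fin d) // κ.mark b ∘ σ = κ.mark b} = κ.cFact b := by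
  rw [DomMulAct.stabilizer_card, Fintype.prod_sum_type]
  have h2 : ∀ m : Fin d, (Fintype.card {k // κ.mark b k = Sum.inr m}).factorial = 1 := by
    intro m
    have : Fintype.card {k // κ.mark b k = Sum.inr m} ≤ 1 := by
      rw [Fintype.card_le_one_iff]
      rintro ⟨k, hk⟩ ⟨l, hl⟩
      by_contra hkl
      have hkl' : k ≠ l := fun h => hkl (by simp [h])
      have h := κ.mark_eq b hkl' (hk.trans hl.symm)
      simp [Calib.mark, h.1] at hk
    interval_cases Fintype.card {k // κ.mark b k = Sum.inr m} <;> rfl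
  rw [Finset.prod_eq_one (fun m _ => h2 m), mul_one]
  unfold Calib.cFact
  refine Finset.prod_congr rfl fun β _ => ?_
  split_ifs with hβ
  · congr 1
    apply Fintype.card_congr
    refine Equiv.subtypeEquivRight fun k => ?_
    unfold Calib.mark
    constructor
    · intro h
      split_ifs at h
      simpa using h
    · rintro rfl
      rw [if_pos hβ]
  · have : IsEmpty {k // κ.mark b k = Sum.inl β} := by
      constructor
      rintro ⟨k, hk⟩
      unfold Calib.mark at hk
      split_ifs at hk with h
      exact hβ (by simpa [show b k = β by simpa using hk] using h)
    simp

theorem card_dvd_sum_of_invariant {G X : Type*} [Group G] [Fintype G] [MulAction G X] [Fintype X]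
    (f : X → R) (hf : ∀ (g : G) x, f (g • x) = f x)
    (hd : ∀ x, ((Nat.card (MulAction.stabilizer G x) : ℕ) : R) ∣ f x) :
    ((Fintype.card G : ℕ) : R) ∣ ∑ x, f x := by
  rw [← Finset.sum_fiberwise (s := Finset.univ)
    (g := fun x : X => (Quotient.mk (MulAction.orbitRel G X) x)) f]
  refine Finset.dvd_sum fun q _ => ?_
  induction q using Quotient.inductionOn with
  | h x =>
  have hconst : ∀ y ∈ Finset.univ.filter (fun y : X =>
      Quotient.mk (MulAction.orbitRel G X) y = Quotient.mk (MulAction.orbitRel G X) x),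
      f y = f x := by
    intro y hy
    have hy' := (Finset.mem_filter.mp hy).2
    obtain ⟨g, rfl⟩ := Quotient.exact hy'
    exact hf g x
  rw [Finset.sum_congr rfl hconst, Finset.sum_const, nsmul_eq_mul]
  have hcard : (Finset.univ.filter (fun y : X =>
      Quotient.mk (MulAction.orbitRel G X) y = Quotient.mk (MulAction.orbitRel G X) x)).card =
      Nat.card (MulAction.orbit G x) := by
    rw [← Fintype.card_subtype, ← Nat.card_eq_fintype_card]
    exact Nat.card_congr (Equiv.subtypeEquivRight fun y => by
      rw [Quotient.eq]; rfl)
  rw [hcard]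
  have h := MulAction.card_orbit_mul_card_stabilizer_eq_card_group G x
  have h' : Nat.card (MulAction.orbit G x) * Nat.card (MulAction.stabilizer G x) =
      Fintype.card G := by
    rw [← h, Nat.card_eq_fintype_card, Nat.card_eq_fintype_card]
  rw [← h', Nat.cast_mul]
  exact mul_dvd_mul_left _ (hd x)

/-- The action of `A^{⊗ d}` on `V^{⊗ d}` with the sign `(-1)^⟨a, v⟩`,
`(a_1 ⊗ ⋯ ⊗ a_d)(v_1 ⊗ ⋯ ⊗ v_d) = (-1)^⟨a, v⟩ a_1 v_1 ⊗ ⋯ ⊗ a_d v_d`,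
where `K a v b` is the coefficient of `b` in `a v` for basis elements `a`, `v`, `b`. -/
noncomputable def tAct {BA BV : Type*} [Fintype BA] [Fintype BV] (cA : Calib BA) (cV : Calib BV)
    (K : BA → BV → BV → R) (x : (Fin d → BA) → R) (v : (Fin d → BV) → R) : (Fin d → BV) → R :=
  fun b => ∑ a : Fin d → BA, ∑ c : Fin d → BV,
    x a * v c * ((-1) ^ koszul (cA.par ∘ a) (cV.par ∘ c) * ∏ k, K (a k) (c k) (b k))

theorem tAct_mem [IsDomain R] [CharZero R] {BA BV : Type*} [Fintype BA] [Fintype BV]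
    (cA : Calib BA) (cV : Calib BV) (K : BA → BV → BV → R)
    (hpar : ∀ a c b, K a c b ≠ 0 → cV.par b = cA.par a + cV.par c)
    (hcal : ∀ a c b, K a c b ≠ 0 → cA.par a = 0 → ¬ cA.isC a → cV.par c = 0 → ¬ cV.isC c →
      ¬ cV.isC b)
    {x : (Fin d → BA) → R} {v : (Fin d → BV) → R} (hx : x ∈ cA.modDiv R d)
    (hv : v ∈ cV.modDiv R d) : tAct cA cV K x v ∈ cV.modDiv R d := by
  rw [Calib.mem_modDiv] at hx hv ⊢
  obtain ⟨hx, hxd⟩ := hx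
  obtain ⟨hv, hvd⟩ := hv
  set F : (Fin d → BV) → (Fin d → BA) → (Fin d → BV) → R := fun b a c =>
    x a * v c * ((-1) ^ koszul (cA.par ∘ a) (cV.par ∘ c) * ∏ k, K (a k) (c k) (b k)) with hF
  have hFcomp : ∀ (σ : Equiv.Perm (Fin d)) b a c, F (b ∘ σ) (a ∘ σ) (c ∘ σ) =
      (-1) ^ permKoszul σ (cV.par ∘ b) * F b a c := by
    intro σ b a c
    have hprod : ∏ k, K ((a ∘ σ) k) ((c ∘ σ) k) ((b ∘ σ) k) = ∏ k, K (a k) (c k) (b k) :=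
      Equiv.prod_comp σ fun k => K (a k) (c k) (b k)
    simp only [hF, hx σ a, hv σ c]
    rw [hprod]
    by_cases h0 : ∏ k, K (a k) (c k) (b k) = 0
    · simp [h0]
    · have hb : cV.par ∘ b = cA.par ∘ a + cV.par ∘ c := by
        ext k
        exact (hpar _ _ _ (Finset.prod_ne_zero_iff.mp h0 k (Finset.mem_univ k)))
      rw [hb]
      have := sign_perm_mul (R := R) σ (cA.par ∘ a) (cV.par ∘ c)
      simp only [Function.comp_assoc] at this
      linear_combination (x a * v c * ∏ k, K (a k) (c k) (b k)) * this
  constructor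
  · intro σ b
    change ∑ a, ∑ c, F (b ∘ σ) a c = _ * ∑ a, ∑ c, F b a c
    rw [← Equiv.sum_comp (Equiv.arrowCongr σ.symm (Equiv.refl BA)), Finset.mul_sum]
    refine Finset.sum_congr rfl fun a _ => ?_
    rw [← Equiv.sum_comp (Equiv.arrowCongr σ.symm (Equiv.refl BV)), Finset.mul_sum]
    refine Finset.sum_congr rfl fun c _ => ?_
    exact hFcomp σ b a c
  · intro b
    change _ ∣ ∑ a, ∑ c, F b a c
    rw [← Fintype.sum_prod_type' (fun a c => F b a c),
      ← Equiv.sum_comp (Equiv.arrowProdEquivProdArrow (Fin d) (fun _ => BA) (fun _ => BV))]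
    let H : Subgroup (Equiv.Perm (Fin d)) :=
      { carrier := {σ | cV.mark b ∘ σ = cV.mark b}
        one_mem' := by ext; simp
        mul_mem' := by
          intro σ τ hσ hτ
          change cV.mark b ∘ (σ ∘ τ) = cV.mark b
          rw [← Function.comp_assoc]
          rw [show cV.mark b ∘ σ = cV.mark b from hσ]; exact hτ
        inv_mem' := by
          intro σ hσ
          change cV.mark b ∘ (σ⁻¹ : Equiv.Perm (Fin d)) = cV.mark b
          conv_lhs => rw [← show cV.mark b ∘ σ = cV.mark b from hσ]
          ext; simp }
    let act : MulAction H (Fin d → BA × BV) :=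
      { smul := fun σ u => u ∘ (σ.1⁻¹ : Equiv.Perm (Fin d))
        one_smul := fun u => rfl
        mul_smul := fun σ τ u => by
          change u ∘ _ = (u ∘ _) ∘ _
          ext k <;> simp }
    have hcardH : Fintype.card H = cV.cFact b := by
      rw [← Calib.card_mark]
      exact Fintype.card_congr (Equiv.refl _)
    rw [← hcardH]
    have hHb : ∀ σ : H, b ∘ σ.1 = b ∧ ∀ k, ¬ cV.isC (b k) → σ.1 k = k := by
      intro σ
      have hσ : ∀ k, cV.mark b (σ.1 k) = cV.mark b k := fun k => congrFun σ.2 k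
      refine ⟨?_, ?_⟩
      · ext k
        by_cases h : σ.1 k = k
        · simp [h]
        · exact (cV.mark_eq b h (hσ k)).2
      · intro k hk
        by_contra h
        obtain ⟨h1, h2⟩ := cV.mark_eq b h (hσ k)
        rw [h2] at h1
        exact hk h1
    apply card_dvd_sum_of_invariant
    · intro σ u
      have hσ := hHb σ⁻¹
      have h := hFcomp (σ⁻¹ : H).1 b (fun k => (u k).1) (fun k => (u k).2)
      rw [hσ.1] at h
      have hs : permKoszul (σ⁻¹ : H).1 (cV.par ∘ b) = 0 := by
        rw [permKoszul, Finset.card_eq_zero, Finset.filter_eq_empty_iff]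
        rintro ⟨k, l⟩ _ ⟨h1, h2, h3, h4⟩
        have hnc : ∀ m, (cV.par ∘ b) m = 1 → ¬ cV.isC (b m) := by
          intro m hm hc
          have := cV.par_of_isC _ hc
          simp only [Function.comp_apply, this] at hm
          exact absurd hm (by decide)
        have e : ∀ m, (cV.par ∘ b) m = 1 → ((σ⁻¹ : H).1).symm m = m := by
          intro m hm
          rw [Equiv.symm_apply_eq]
          exact (hσ.2 m (hnc m hm)).symm
        simp only at h1 h2 h3 h4
        rw [e _ h3, e _ h4] at h2
        exact absurd h1 h2.not_gt
      rw [hs, pow_zero, one_mul] at h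
      exact h
    · intro u
      set a : Fin d → BA := fun k => (u k).1 with ha
      set c : Fin d → BV := fun k => (u k).2 with hc
      change _ ∣ F b a c
      by_cases h0 : F b a c = 0
      · rw [h0]; exact dvd_zero _
      have hxa : x a ≠ 0 := fun h => h0 (by simp [hF, h])
      have hvc : v c ≠ 0 := fun h => h0 (by simp [hF, h])
      have hK : ∀ k, K (a k) (c k) (b k) ≠ 0 := by
        intro k hk
        apply h0
        simp only [hF]
        rw [Finset.prod_eq_zero (Finset.mem_univ k) hk]
        simp
      have hsa : cA.Seq a := by
        by_contra h
        exact hxa (cA.eq_zero_of_not_seq x hx a h)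
      have hsc : cV.Seq c := by
        by_contra h
        exact hvc (cV.eq_zero_of_not_seq v hv c h)
      have hst : Nat.card (MulAction.stabilizer H u) =
          ∏ i : (BV ⊕ Fin d) × BA × BV,
            (Fintype.card {k // (cV.mark b k, a k, c k) = i}).factorial := by
        rw [← DomMulAct.stabilizer_card, ← Nat.card_eq_fintype_card]
        refine Nat.card_congr
          { toFun := fun σ => ⟨σ.1.1, ?_⟩
            invFun := fun σ => ⟨⟨σ.1, ?_⟩, ?_⟩
            left_inv := fun σ => rfl
            right_inv := fun σ => rfl }
        · have h1 := σ.1.2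
          have h2 : u ∘ (σ.1.1⁻¹ : Equiv.Perm (Fin d)) = u := σ.2
          ext1 k
          have h3 := congrFun h2 (σ.1.1 k)
          rw [Function.comp_apply,
            show (σ.1.1⁻¹ : Equiv.Perm (Fin d)) (σ.1.1 k) = k from σ.1.1.symm_apply_apply k] at h3
          have h4 : cV.mark b (σ.1.1 k) = cV.mark b k := congrFun h1 k
          simp only [Function.comp_apply, h4, ha, hc, ← h3]
        · ext1 k
          exact congrArg Prod.fst (congrFun σ.2 k)
        · change u ∘ (σ.1⁻¹ : Equiv.Perm (Fin d)) = u
          ext1 k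
          have h1 := congrArg Prod.snd (congrFun σ.2 (σ.1⁻¹ k))
          rw [Function.comp_apply,
            show σ.1 ((σ.1⁻¹ : Equiv.Perm (Fin d)) k) = k from σ.1.apply_symm_apply k] at h1
          exact h1.symm
      rw [hst]
      have hdvd : ∏ i : (BV ⊕ Fin d) × BA × BV,
            (Fintype.card {k // (cV.mark b k, a k, c k) = i}).factorial ∣
          cA.cFact a * cV.cFact c := by
        have hsplit : ∀ i : (BV ⊕ Fin d) × BA × BV,
            (Fintype.card {k // (cV.mark b k, a k, c k) = i}).factorial =
            (if cA.isC i.2.1 then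
              (Fintype.card {k // (cV.mark b k, a k, c k) = i}).factorial else 1) *
            (if cA.isC i.2.1 then 1 else
              (Fintype.card {k // (cV.mark b k, a k, c k) = i}).factorial) := by
          intro i; split_ifs <;> simp
        rw [Finset.prod_congr rfl (fun i _ => hsplit i), Finset.prod_mul_distrib]
        apply mul_dvd_mul
        · rw [← Equiv.prod_comp (Equiv.prodAssoc (BV ⊕ Fin d) BA BV),
            Fintype.prod_prod_type, Fintype.prod_prod_type]
          simp only [Equiv.prodAssoc_apply]
          rw [Finset.prod_comm]
          unfold Calib.cFact
          refine Finset.prod_dvd_prod_of_dvd _ _ fun α _ => ?_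
          by_cases hα : cA.isC α
          · simp only [hα, if_true, ← Nat.card_eq_fintype_card]
            rw [← Fintype.prod_prod_type']
            refine dvd_trans (dvd_of_eq ?_)
              (card_fiber_prod_dvd (fun k => (cV.mark b k, c k)) a α)
            refine Finset.prod_congr rfl fun i _ => ?_
            congr 1
            refine Nat.card_congr (Equiv.subtypeEquivRight fun k => ?_)
            simp only [Prod.ext_iff]; tauto
          · simp [hα]
        · rw [← Equiv.prod_comp (Equiv.prodAssoc (BV ⊕ Fin d) BA BV),
            Fintype.prod_prod_type]
          simp only [Equiv.prodAssoc_apply]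
          rw [Finset.prod_comm]
          unfold Calib.cFact
          refine Finset.prod_dvd_prod_of_dvd _ _ fun γ _ => ?_
          by_cases hγ : cV.isC γ
          · simp only [hγ, if_true, ← Nat.card_eq_fintype_card]
            refine dvd_trans ?_ (card_fiber_prod_dvd (fun k => (cV.mark b k, a k)) c γ)
            refine Finset.prod_dvd_prod_of_dvd _ _ fun i _ => ?_
            split_ifs
            · exact one_dvd _
            · apply dvd_of_eq
              congr 1
              refine Nat.card_congr (Equiv.subtypeEquivRight fun k => ?_)
              simp only [Prod.ext_iff]; tauto
          · simp only [hγ, if_false]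
            apply dvd_of_eq
            refine Finset.prod_eq_one fun i _ => ?_
            split_ifs with hα
            · rfl
            have hle : Fintype.card {k // (cV.mark b k, a k, c k) = (i.1, i.2, γ)} ≤ 1 := by
              rw [Fintype.card_le_one_iff]
              rintro ⟨k, hk⟩ ⟨l, hl⟩
              by_contra hkl
              have hkl' : k ≠ l := fun h => hkl (by simp [h])
              simp only [Prod.ext_iff] at hk hl
              have h1 := (cV.mark_eq b hkl' (hk.1.trans hl.1.symm)).1
              have h2 := hsa k l hkl' (hk.2.1.trans hl.2.1.symm)
              have h3 := hsc k l hkl' (hk.2.2.trans hl.2.2.symm)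
              rw [← hk.2.1] at hα
              rw [← hk.2.2] at hγ
              exact hcal _ _ _ (hK k) h2 hα h3 hγ h1
            generalize Fintype.card {k // (cV.mark b k, a k, c k) = (i.1, i.2, γ)} = m at hle
            interval_cases m <;> rfl
      refine dvd_trans (Nat.cast_dvd_cast hdvd) ?_
      rw [Nat.cast_mul]
      exact dvd_mul_of_dvd_left (mul_dvd_mul (hxd a) (hvd c)) _

end ModDiv

/-! ### Calibrated superalgebras and supermodules -/

/-- A calibrated `R`-superalgebra structure on `A`, recorded on a homogeneous basis: the
multiplication is even, and the span `𝔞` of the basis elements which are even and not in `𝔠`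
is a unital subalgebra. -/
structure CalAlg (R A B : Type*) [CommRing R] [Ring A] [Algebra R A] where
  basis : Module.Basis B R A
  cal : Calib B
  par_mul : ∀ a c b, basis.repr (basis a * basis c) b ≠ 0 → cal.par b = cal.par a + cal.par c
  cal_mul : ∀ a c b, basis.repr (basis a * basis c) b ≠ 0 → cal.par a = 0 → ¬ cal.isC a →
    cal.par c = 0 → ¬ cal.isC c → ¬ cal.isC b
  cal_one : ∀ b, basis.repr (1 : A) b ≠ 0 → cal.par b = 0 ∧ ¬ cal.isC b

/-- A calibrated supermodule `V` over a calibrated superalgebra: the action is even and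
`𝔞 V_𝔞 ⊆ V_𝔞`. -/
structure CalMod {R A B : Type*} [CommRing R] [Ring A] [Algebra R A] (𝒜 : CalAlg R A B)
    (V BV : Type*) [AddCommGroup V] [Module R V] [Module A V] where
  basis : Module.Basis BV R V
  cal : Calib BV
  par_smul : ∀ a c b, basis.repr (𝒜.basis a • basis c) b ≠ 0 →
    cal.par b = 𝒜.cal.par a + cal.par c
  cal_smul : ∀ a c b, basis.repr (𝒜.basis a • basis c) b ≠ 0 → 𝒜.cal.par a = 0 →
    ¬ 𝒜.cal.isC a → cal.par c = 0 → ¬ cal.isC c → ¬ cal.isC b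

section TensorPowers

variable {R A B V BV : Type*} [CommRing R] [Ring A] [Algebra R A] [Fintype B]
  [AddCommGroup V] [Module R V] [Module A V] [IsScalarTower R A V] [Fintype BV]

theorem factor_ne_zero {R ι : Type*} [CommRing R] [Fintype ι] {f : ι → R} (h : ∏ k, f k ≠ 0)
    (k : ι) : f k ≠ 0 :=
  fun hk => h (Finset.prod_eq_zero (Finset.mem_univ k) hk)

theorem tAct_assoc {BA BC : Type*} [Fintype BA] [Fintype BC] {d : ℕ} (cA : Calib BA)
    (cC : Calib BC) (KA : BA → BA → BA → R) (KC : BA → BC → BC → R)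
    (hA : ∀ a c b, KA a c b ≠ 0 → cA.par b = cA.par a + cA.par c)
    (hC : ∀ a c b, KC a c b ≠ 0 → cC.par b = cA.par a + cC.par c)
    (hassoc : ∀ a a' v w, ∑ b, KA a a' b * KC b v w = ∑ u, KC a' v u * KC a u w)
    (x y : (Fin d → BA) → R) (v : (Fin d → BC) → R) :
    tAct cA cC KC (tAct cA cA KA x y) v = tAct cA cC KC x (tAct cA cC KC y v) := by
  ext w
  let s : (Fin d → BA) → (Fin d → BA) → (Fin d → BC) → R := fun a a' c =>
    (-1) ^ koszul (cA.par ∘ a) (cA.par ∘ a') * (-1) ^ koszul (cA.par ∘ a) (cC.par ∘ c) *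
      (-1) ^ koszul (cA.par ∘ a') (cC.par ∘ c)
  have hprod : ∀ (a a' : Fin d → BA) (c : Fin d → BC),
      ∑ b : Fin d → BA, (∏ k, KA (a k) (a' k) (b k)) * ∏ k, KC (b k) (c k) (w k) =
      ∑ u : Fin d → BC, (∏ k, KC (a' k) (c k) (u k)) * ∏ k, KC (a k) (u k) (w k) := by
    intro a a' c
    simp only [← Finset.prod_mul_distrib]
    have h1 := Finset.prod_univ_sum (fun _ : Fin d => (Finset.univ : Finset BA))
      (fun k b => KA (a k) (a' k) b * KC b (c k) (w k))
    have h2 := Finset.prod_univ_sum (fun _ : Fin d => (Finset.univ : Finset BC))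
      (fun k u => KC (a' k) (c k) u * KC (a k) u (w k))
    rw [Fintype.piFinset_univ] at h1 h2
    rw [← h1, ← h2]
    exact Finset.prod_congr rfl fun k _ => hassoc _ _ _ _
  have hL : tAct cA cC KC (tAct cA cA KA x y) v w = ∑ a, ∑ a', ∑ c, x a * y a' * v c * (s a a' c *
      ∑ b : Fin d → BA, (∏ k, KA (a k) (a' k) (b k)) * ∏ k, KC (b k) (c k) (w k)) := by
    simp only [tAct, Finset.sum_mul, Finset.mul_sum]
    rw [Finset.sum_congr rfl fun b _ => Finset.sum_comm]
    rw [Finset.sum_comm]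
    refine Finset.sum_congr rfl fun a _ => ?_
    rw [Finset.sum_congr rfl fun b _ => Finset.sum_comm]
    rw [Finset.sum_comm]
    refine Finset.sum_congr rfl fun a' _ => ?_
    rw [Finset.sum_comm]
    refine Finset.sum_congr rfl fun c _ => ?_
    refine Finset.sum_congr rfl fun b _ => ?_
    by_cases h0 : ∏ k, KA (a k) (a' k) (b k) = 0
    · simp [h0]
    · have hb : cA.par ∘ b = cA.par ∘ a + cA.par ∘ a' := by
        ext k
        exact hA _ _ _ (factor_ne_zero h0 k)
      rw [hb, sign_koszul_add_left]
      simp only [s]; ring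
  have hR : tAct cA cC KC x (tAct cA cC KC y v) w = ∑ a, ∑ a', ∑ c, x a * y a' * v c * (s a a' c *
      ∑ u : Fin d → BC, (∏ k, KC (a' k) (c k) (u k)) * ∏ k, KC (a k) (u k) (w k)) := by
    simp only [tAct, Finset.sum_mul, Finset.mul_sum]
    refine Finset.sum_congr rfl fun a _ => ?_
    rw [Finset.sum_comm]
    refine Finset.sum_congr rfl fun a' _ => ?_
    rw [Finset.sum_comm]
    refine Finset.sum_congr rfl fun c _ => ?_
    refine Finset.sum_congr rfl fun u _ => ?_
    by_cases h0 : ∏ k, KC (a' k) (c k) (u k) = 0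
    · simp [h0]
    · have hb : cC.par ∘ u = cA.par ∘ a' + cC.par ∘ c := by
        ext k
        exact hC _ _ _ (factor_ne_zero h0 k)
      rw [hb, sign_koszul_add_right]
      simp only [s]; ring
  rw [hL, hR]
  simp only [hprod]

/-- The coefficient of `b` in the product of basis elements `a c`. -/
noncomputable def CalAlg.coef (𝒜 : CalAlg R A B) (a c b : B) : R :=
  𝒜.basis.repr (𝒜.basis a * 𝒜.basis c) b

/-- The coefficient of `b` in `a v`, for basis elements. -/
noncomputable def CalMod.coef {𝒜 : CalAlg R A B} (ℳ : CalMod 𝒜 V BV) (a : B) (v b : BV) : R :=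
  ℳ.basis.repr (𝒜.basis a • ℳ.basis v) b

theorem CalMod.coef_assoc {𝒜 : CalAlg R A B} (ℳ : CalMod 𝒜 V BV) (a a' : B) (v w : BV) :
    ∑ b, 𝒜.coef a a' b * ℳ.coef b v w = ∑ u, ℳ.coef a' v u * ℳ.coef a u w := by
  have h : (𝒜.basis a * 𝒜.basis a') • ℳ.basis v = 𝒜.basis a • 𝒜.basis a' • ℳ.basis v :=
    mul_smul _ _ _
  have h1 := congrArg (fun z => ℳ.basis.repr z w) h
  beta_reduce at h1
  rw [← 𝒜.basis.sum_repr (𝒜.basis a * 𝒜.basis a'), ← ℳ.basis.sum_repr (𝒜.basis a' • ℳ.basis v),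
    Finset.sum_smul, Finset.smul_sum] at h1
  have hc : ∀ (r : R) (z : A) (m : V), z • r • m = r • z • m := fun r z m => by
    rw [← algebraMap_smul A r m, ← mul_smul, ← Algebra.commutes, mul_smul, algebraMap_smul]
  simpa [CalAlg.coef, CalMod.coef, hc, smul_assoc] using h1

theorem CalAlg.coef_assoc (𝒜 : CalAlg R A B) (a a' v w : B) :
    ∑ b, 𝒜.coef a a' b * 𝒜.coef b v w = ∑ u, 𝒜.coef a' v u * 𝒜.coef a u w :=
  CalMod.coef_assoc (V := A) (BV := B) (𝒜 := 𝒜)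
    ⟨𝒜.basis, 𝒜.cal, 𝒜.par_mul, 𝒜.cal_mul⟩ a a' v w

/-- The superalgebra `A^{⊗ d}`. -/
def CalAlg.TPow (_ : CalAlg R A B) (d : ℕ) : Type _ := (Fin d → B) → R

/-- The `A^{⊗ d}`-supermodule `V^{⊗ d}`. -/
def CalMod.TPow {𝒜 : CalAlg R A B} (_ : CalMod 𝒜 V BV) (d : ℕ) : Type _ := (Fin d → BV) → R

noncomputable instance (𝒜 : CalAlg R A B) (d : ℕ) : AddCommGroup (𝒜.TPow d) :=
  inferInstanceAs (AddCommGroup ((Fin d → B) → R))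

noncomputable instance (𝒜 : CalAlg R A B) (d : ℕ) : Module R (𝒜.TPow d) :=
  inferInstanceAs (Module R ((Fin d → B) → R))

noncomputable instance {𝒜 : CalAlg R A B} (ℳ : CalMod 𝒜 V BV) (d : ℕ) :
    AddCommGroup (ℳ.TPow d) :=
  inferInstanceAs (AddCommGroup ((Fin d → BV) → R))

noncomputable instance {𝒜 : CalAlg R A B} (ℳ : CalMod 𝒜 V BV) (d : ℕ) : Module R (ℳ.TPow d) :=
  inferInstanceAs (Module R ((Fin d → BV) → R))

/-- The unit `1 ⊗ ⋯ ⊗ 1` of `A^{⊗ d}`. -/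
noncomputable def CalAlg.oneT (𝒜 : CalAlg R A B) (d : ℕ) : (Fin d → B) → R :=
  fun b => ∏ k, 𝒜.basis.repr (1 : A) (b k)

section
variable {BA BC : Type*} [Fintype BA] [Fintype BC] {d : ℕ} (cA : Calib BA) (cC : Calib BC)
    (K : BA → BC → BC → R)

theorem tAct_add_left (x y : (Fin d → BA) → R) (v : (Fin d → BC) → R) :
    tAct cA cC K (x + y) v = tAct cA cC K x v + tAct cA cC K y v := by
  ext b; simp [tAct, add_mul, Finset.sum_add_distrib]

theorem tAct_add_right (x : (Fin d → BA) → R) (v w : (Fin d → BC) → R) :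
    tAct cA cC K x (v + w) = tAct cA cC K x v + tAct cA cC K x w := by
  ext b; simp [tAct, add_mul, mul_add, Finset.sum_add_distrib]

theorem tAct_smul_left (r : R) (x : (Fin d → BA) → R) (v : (Fin d → BC) → R) :
    tAct cA cC K (r • x) v = r • tAct cA cC K x v := by
  ext b; simp [tAct, Finset.mul_sum, mul_assoc]

theorem tAct_smul_right (r : R) (x : (Fin d → BA) → R) (v : (Fin d → BC) → R) :
    tAct cA cC K x (r • v) = r • tAct cA cC K x v := by
  ext b
  simp only [tAct, Pi.smul_apply, smul_eq_mul, Finset.mul_sum]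
  refine Finset.sum_congr rfl fun a _ => Finset.sum_congr rfl fun c _ => by ring

theorem tAct_zero_left (v : (Fin d → BC) → R) : tAct cA cC K (0 : (Fin d → BA) → R) v = 0 := by
  ext b; simp [tAct]

theorem tAct_zero_right (x : (Fin d → BA) → R) : tAct cA cC K x (0 : (Fin d → BC) → R) = 0 := by
  ext b; simp [tAct]

end

theorem CalMod.oneT_act {𝒜 : CalAlg R A B} (ℳ : CalMod 𝒜 V BV) {d : ℕ} (v : (Fin d → BV) → R) :
    tAct 𝒜.cal ℳ.cal ℳ.coef (𝒜.oneT d) v = v := by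
  classical
  ext b
  have h1 : ∀ c b : BV, ∑ a, 𝒜.basis.repr (1 : A) a * ℳ.coef a c b = if c = b then 1 else 0 := by
    intro c b
    have h := one_smul A (ℳ.basis c)
    rw [← 𝒜.basis.sum_repr 1, Finset.sum_smul] at h
    have h' := congrArg (fun z => ℳ.basis.repr z b) h
    simpa [CalMod.coef, smul_assoc, Finsupp.single_apply] using h'
  have h2 : ∀ c : Fin d → BV, ∑ a : Fin d → B, 𝒜.oneT d a *
      ((-1) ^ koszul (𝒜.cal.par ∘ a) (ℳ.cal.par ∘ c) * ∏ k, ℳ.coef (a k) (c k) (b k)) =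
      if c = b then 1 else 0 := by
    intro c
    have h3 := Finset.prod_univ_sum (fun _ : Fin d => (Finset.univ : Finset B))
      (fun k a => 𝒜.basis.repr (1 : A) a * ℳ.coef a (c k) (b k))
    rw [Fintype.piFinset_univ] at h3
    simp only [h1] at h3
    have h4 : (∏ k, if c k = b k then (1 : R) else 0) = if c = b then 1 else 0 := by
      split_ifs with h
      · simp [h]
      · obtain ⟨k, hk⟩ := Function.ne_iff.mp h
        exact Finset.prod_eq_zero (Finset.mem_univ k) (by simp [hk])
    rw [← h4, h3]
    refine Finset.sum_congr rfl fun a _ => ?_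
    rw [Finset.prod_mul_distrib]
    by_cases h0 : 𝒜.oneT d a = 0
    · rw [h0, zero_mul]
      unfold CalAlg.oneT at h0
      rw [h0, zero_mul]
    · have : 𝒜.cal.par ∘ a = 0 := by
        ext k
        exact (𝒜.cal_one _ (factor_ne_zero h0 k)).1
      rw [this, koszul_zero_left]
      simp [CalAlg.oneT]
  simp only [tAct]
  rw [Finset.sum_comm]
  have h5 : ∀ c : Fin d → BV, ∑ a : Fin d → B, 𝒜.oneT d a * v c *
      ((-1) ^ koszul (𝒜.cal.par ∘ a) (ℳ.cal.par ∘ c) * ∏ k, ℳ.coef (a k) (c k) (b k)) =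
      v c * if c = b then 1 else 0 := by
    intro c
    rw [← h2 c, Finset.mul_sum]
    exact Finset.sum_congr rfl fun a _ => by ring
  simp only [h5]
  simp

theorem CalAlg.act_oneT (𝒜 : CalAlg R A B) {d : ℕ} (v : (Fin d → B) → R) :
    tAct 𝒜.cal 𝒜.cal 𝒜.coef v (𝒜.oneT d) = v := by
  classical
  ext b
  have h1 : ∀ c b : B, ∑ a, 𝒜.basis.repr (1 : A) a * 𝒜.coef c a b = if c = b then 1 else 0 := by
    intro c b
    have h := mul_one (𝒜.basis c)
    rw [← 𝒜.basis.sum_repr 1, Finset.mul_sum] at h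
    have h' := congrArg (fun z => 𝒜.basis.repr z b) h
    simpa [CalAlg.coef, Finsupp.single_apply] using h'
  have h2 : ∀ c : Fin d → B, ∑ a : Fin d → B, v c * 𝒜.oneT d a *
      ((-1) ^ koszul (𝒜.cal.par ∘ c) (𝒜.cal.par ∘ a) * ∏ k, 𝒜.coef (c k) (a k) (b k)) =
      v c * if c = b then 1 else 0 := by
    intro c
    have h3 := Finset.prod_univ_sum (fun _ : Fin d => (Finset.univ : Finset B))
      (fun k a => 𝒜.basis.repr (1 : A) a * 𝒜.coef (c k) a (b k))
    rw [Fintype.piFinset_univ] at h3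
    simp only [h1] at h3
    have h4 : (∏ k, if c k = b k then (1 : R) else 0) = if c = b then 1 else 0 := by
      split_ifs with h
      · simp [h]
      · obtain ⟨k, hk⟩ := Function.ne_iff.mp h
        exact Finset.prod_eq_zero (Finset.mem_univ k) (by simp [hk])
    rw [← h4, h3, Finset.mul_sum]
    refine Finset.sum_congr rfl fun a _ => ?_
    rw [Finset.prod_mul_distrib]
    by_cases h0 : 𝒜.oneT d a = 0
    · rw [h0, mul_zero, zero_mul]
      unfold CalAlg.oneT at h0
      rw [h0, zero_mul, mul_zero]
    · have : 𝒜.cal.par ∘ a = 0 := by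
        ext k
        exact (𝒜.cal_one _ (factor_ne_zero h0 k)).1
      rw [this, koszul_zero_right]
      simp [CalAlg.oneT, mul_assoc]
  simp only [tAct, h2]
  simp

noncomputable instance (𝒜 : CalAlg R A B) (d : ℕ) : Ring (𝒜.TPow d) :=
  { (inferInstance : AddCommGroup (𝒜.TPow d)) with
    mul := fun x y => tAct 𝒜.cal 𝒜.cal 𝒜.coef x y
    one := 𝒜.oneT d
    mul_assoc := tAct_assoc _ _ _ _ 𝒜.par_mul 𝒜.par_mul 𝒜.coef_assoc
    one_mul := fun v => CalMod.oneT_act (V := A) (BV := B) (𝒜 := 𝒜)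
      ⟨𝒜.basis, 𝒜.cal, 𝒜.par_mul, 𝒜.cal_mul⟩ v
    mul_one := fun v => 𝒜.act_oneT v
    left_distrib := fun x y z => tAct_add_right _ _ _ x y z
    right_distrib := fun x y z => tAct_add_left _ _ _ x y z
    zero_mul := fun x => tAct_zero_left _ _ _ x
    mul_zero := fun x => tAct_zero_right _ _ _ x }

noncomputable instance (𝒜 : CalAlg R A B) (d : ℕ) : Algebra R (𝒜.TPow d) :=
  Algebra.ofModule (fun r x y => tAct_smul_left _ _ _ r x y)
    (fun r x y => tAct_smul_right _ _ _ r x y)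

noncomputable instance {𝒜 : CalAlg R A B} (ℳ : CalMod 𝒜 V BV) (d : ℕ) :
    Module (𝒜.TPow d) (ℳ.TPow d) where
  smul := fun x v => tAct 𝒜.cal ℳ.cal ℳ.coef x v
  one_smul := fun v => ℳ.oneT_act v
  mul_smul := tAct_assoc _ _ _ _ 𝒜.par_mul ℳ.par_smul ℳ.coef_assoc
  smul_zero := fun x => tAct_zero_right _ _ _ x
  smul_add := fun x v w => tAct_add_right _ _ _ x v w
  add_smul := fun x y v => tAct_add_left _ _ _ x y v
  zero_smul := fun v => tAct_zero_left _ _ _ v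

instance {𝒜 : CalAlg R A B} (ℳ : CalMod 𝒜 V BV) (d : ℕ) :
    IsScalarTower R (𝒜.TPow d) (ℳ.TPow d) :=
  ⟨fun r x v => tAct_smul_left _ _ _ r x v⟩

variable [IsDomain R] [CharZero R]

theorem CalAlg.oneT_mem (𝒜 : CalAlg R A B) (d : ℕ) : 𝒜.oneT d ∈ 𝒜.cal.modDiv R d := by
  rw [Calib.mem_modDiv]
  constructor
  · intro σ b
    have hs : 𝒜.oneT d (b ∘ σ) = 𝒜.oneT d b :=
      Equiv.prod_comp σ fun k => 𝒜.basis.repr (1 : A) (b k)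
    rw [hs]
    by_cases h0 : 𝒜.oneT d b = 0
    · simp [h0]
    · have : permKoszul σ (𝒜.cal.par ∘ b) = 0 := by
        rw [permKoszul, Finset.card_eq_zero, Finset.filter_eq_empty_iff]
        rintro ⟨k, l⟩ _ ⟨_, _, h3, _⟩
        have h := (𝒜.cal_one _ (factor_ne_zero h0 k)).1
        simp [h] at h3
      simp [this]
  · intro b
    by_cases h0 : 𝒜.oneT d b = 0
    · simp [h0]
    · have : 𝒜.cal.cFact b = 1 := by
        unfold Calib.cFact
        refine Finset.prod_eq_one fun β _ => ?_
        split_ifs with hβ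
        · have : IsEmpty {k // b k = β} := ⟨by
            rintro ⟨k, rfl⟩
            exact (𝒜.cal_one _ (factor_ne_zero h0 k)).2 hβ⟩
          simp
        · rfl
      simp [this]

/-- `Γ̃^d A`, a unital subalgebra of `A^{⊗ d}`. -/
noncomputable def CalAlg.modPow (𝒜 : CalAlg R A B) (d : ℕ) : Subalgebra R (𝒜.TPow d) where
  carrier := {x | x ∈ 𝒜.cal.modDiv R d}
  mul_mem' := fun hx hy => tAct_mem 𝒜.cal 𝒜.cal 𝒜.coef 𝒜.par_mul 𝒜.cal_mul hx hy
  add_mem' := fun hx hy => (𝒜.cal.modDiv R d).add_mem hx hy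
  algebraMap_mem' := fun r => by
    rw [Algebra.algebraMap_eq_smul_one]
    exact (𝒜.cal.modDiv R d).smul_mem r (𝒜.oneT_mem d)

/-- `Γ̃^d V`, a `Γ̃^d A`-submodule of `V^{⊗ d}`. -/
noncomputable def CalMod.modPow {𝒜 : CalAlg R A B} (ℳ : CalMod 𝒜 V BV) (d : ℕ) :
    Submodule (𝒜.modPow d) (ℳ.TPow d) where
  carrier := {v | v ∈ ℳ.cal.modDiv R d}
  add_mem' := fun hx hy => (ℳ.cal.modDiv R d).add_mem hx hy
  zero_mem' := (ℳ.cal.modDiv R d).zero_mem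
  smul_mem' := fun x _ hv => tAct_mem 𝒜.cal ℳ.cal ℳ.coef ℳ.par_smul ℳ.cal_smul x.2 hv

end TensorPowers

/-! ### Parity, anti-involutions and extension of scalars -/

/-- The sign `(-1)^x`. -/
def sg (R : Type*) [CommRing R] (x : ZMod 2) : R := (-1) ^ x.val

theorem sg_add (R : Type*) [CommRing R] (x y : ZMod 2) : sg R (x + y) = sg R x * sg R y := by
  rcases zmod2_cases x with rfl | rfl <;> rcases zmod2_cases y with rfl | rfl <;>
    simp [sg, show (1 : ZMod 2) + 1 = 0 by decide, show ZMod.val (1 : ZMod 2) = 1 from rfl]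

section Structure

variable {R A B V BV : Type*} [CommRing R] [Ring A] [Algebra R A] [Fintype B]
  [AddCommGroup V] [Module R V] [Module A V] [IsScalarTower R A V] [Fintype BV]

/-- The tensors of parity `δ`. -/
def Calib.gr {B : Type*} (R : Type*) [CommRing R] (κ : Calib B) (d : ℕ) (δ : ZMod 2) :
    Submodule R ((Fin d → B) → R) where
  carrier := {w | ∀ b, w b ≠ 0 → ∑ k, κ.par (b k) = δ}
  add_mem' := by
    intro x y hx hy b hb
    by_cases h : x b = 0
    · exact hy b (by simpa [h] using hb)
    · exact hx b h
  zero_mem' := by intro b hb; simp at hb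
  smul_mem' := by
    intro r x hx b hb
    exact hx b fun h => hb (by simp [h])

variable [IsDomain R] [CharZero R]

/-- The part of parity `δ` of `Γ̃^d A`. -/
noncomputable def CalAlg.gr (𝒜 : CalAlg R A B) (d : ℕ) (δ : ZMod 2) :
    Submodule R (𝒜.modPow d) where
  carrier := {x | x.1 ∈ 𝒜.cal.gr R d δ}
  add_mem' := fun hx hy => (𝒜.cal.gr R d δ).add_mem hx hy
  zero_mem' := (𝒜.cal.gr R d δ).zero_mem
  smul_mem' := fun r _ hx => (𝒜.cal.gr R d δ).smul_mem r hx

/-- The part of parity `δ` of `Γ̃^d V`. -/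
noncomputable def CalMod.gr {𝒜 : CalAlg R A B} (ℳ : CalMod 𝒜 V BV) (d : ℕ) (δ : ZMod 2) :
    Submodule R (ℳ.modPow d) where
  carrier := {x | x.1 ∈ ℳ.cal.gr R d δ}
  add_mem' := fun hx hy => (ℳ.cal.gr R d δ).add_mem hx hy
  zero_mem' := (ℳ.cal.gr R d δ).zero_mem
  smul_mem' := fun r _ hx => (ℳ.cal.gr R d δ).smul_mem r hx

theorem Calib.parInv_mem (κ : Calib B) {d : ℕ} {x : (Fin d → B) → R} (hx : x ∈ κ.modDiv R d) :
    (fun b => sg R (∑ k, κ.par (b k)) * x b) ∈ κ.modDiv R d := by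
  rw [Calib.mem_modDiv] at hx ⊢
  refine ⟨fun σ b => ?_, fun b => Dvd.dvd.mul_left (hx.2 b) _⟩
  have : ∑ k, κ.par ((b ∘ σ) k) = ∑ k, κ.par (b k) := Equiv.sum_comp σ fun k => κ.par (b k)
  rw [this, hx.1]
  ring

/-- The parity involution `x ↦ (-1)^|x| x` of the superalgebra `Γ̃^d A`. -/
noncomputable def CalAlg.parInv (𝒜 : CalAlg R A B) (d : ℕ) : 𝒜.modPow d →ₐ[R] 𝒜.modPow d :=
  AlgHom.ofLinearMap
    { toFun := fun x => ⟨fun b => sg R (∑ k, 𝒜.cal.par (b k)) * x.1 b, 𝒜.cal.parInv_mem x.2⟩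
      map_add' := fun x y => Subtype.ext (funext fun b => mul_add _ (x.1 b) (y.1 b))
      map_smul' := fun r x => Subtype.ext (funext fun b => mul_left_comm _ r (x.1 b)) }
    (Subtype.ext (funext fun b => by
      change sg R _ * 𝒜.oneT d b = 𝒜.oneT d b
      by_cases h0 : 𝒜.oneT d b = 0
      · simp [h0]
      · have : ∑ k, 𝒜.cal.par (b k) = 0 :=
          Finset.sum_eq_zero fun k _ => (𝒜.cal_one _ (factor_ne_zero h0 k)).1
        rw [this]; simp [sg]))
    (fun x y => Subtype.ext (funext fun b => by
      change sg R _ * tAct 𝒜.cal 𝒜.cal 𝒜.coef x.1 y.1 b =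
        tAct 𝒜.cal 𝒜.cal 𝒜.coef (fun a => sg R (∑ k, 𝒜.cal.par (a k)) * x.1 a)
          (fun c => sg R (∑ k, 𝒜.cal.par (c k)) * y.1 c) b
      simp only [tAct, Finset.mul_sum]
      refine Finset.sum_congr rfl fun a _ => Finset.sum_congr rfl fun c _ => ?_
      by_cases h0 : ∏ k, 𝒜.coef (a k) (c k) (b k) = 0
      · simp [h0]
      · have : ∑ k, 𝒜.cal.par (b k) = ∑ k, 𝒜.cal.par (a k) + ∑ k, 𝒜.cal.par (c k) := by
          rw [← Finset.sum_add_distrib]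
          exact Finset.sum_congr rfl fun k _ => 𝒜.par_mul _ _ _ (factor_ne_zero h0 k)
        rw [this, sg_add]
        ring))

/-- `τ` permutes the basis of `A` up to scalars, preserving parities and the calibration. -/
def CalAlg.Monomial (𝒜 : CalAlg R A B) (τ : A →ₗ[R] A) : Prop :=
  ∃ (ρ : Equiv.Perm B) (ε : B → R), ∀ a, τ (𝒜.basis a) = ε a • 𝒜.basis (ρ a) ∧
    𝒜.cal.par (ρ a) = 𝒜.cal.par a ∧ (𝒜.cal.isC (ρ a) ↔ 𝒜.cal.isC a)

/-- `τ^{⊗ d}` on `A^{⊗ d}`. -/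
noncomputable def CalAlg.tauT (𝒜 : CalAlg R A B) (τ : A →ₗ[R] A) (d : ℕ) :
    ((Fin d → B) → R) →ₗ[R] ((Fin d → B) → R) where
  toFun := fun x b => ∑ a : Fin d → B, x a * ∏ k, 𝒜.basis.repr (τ (𝒜.basis (a k))) (b k)
  map_add' := fun x y => funext fun b => by simp [add_mul, Finset.sum_add_distrib]
  map_smul' := fun r x => funext fun b => by simp [Finset.mul_sum, mul_assoc]

theorem CalAlg.tauT_mem (𝒜 : CalAlg R A B) {τ : A →ₗ[R] A} (hτ : 𝒜.Monomial τ) {d : ℕ}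
    {x : (Fin d → B) → R} (hx : x ∈ 𝒜.cal.modDiv R d) : 𝒜.tauT τ d x ∈ 𝒜.cal.modDiv R d := by
  classical
  obtain ⟨ρ, ε, h⟩ := hτ
  have key : ∀ b, 𝒜.tauT τ d x b = x (ρ.symm ∘ b) * ∏ k, ε (ρ.symm (b k)) := by
    intro b
    change ∑ a : Fin d → B, x a * ∏ k, 𝒜.basis.repr (τ (𝒜.basis (a k))) (b k) = _
    rw [Finset.sum_eq_single (ρ.symm ∘ b)]
    · congr 1
      refine Finset.prod_congr rfl fun k _ => ?_
      simp [(h _).1]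
    · intro a _ ha
      obtain ⟨k, hk⟩ := Function.ne_iff.mp ha
      rw [Finset.prod_eq_zero (Finset.mem_univ k), mul_zero]
      rw [(h _).1]
      have : ρ (a k) ≠ b k := fun h' => hk (by simp [← h'])
      simp [this]
    · simp
  have hpar : ∀ b, 𝒜.cal.par (ρ.symm b) = 𝒜.cal.par b := fun b => by
    rw [← (h (ρ.symm b)).2.1, Equiv.apply_symm_apply]
  have hC : ∀ b, 𝒜.cal.isC (ρ.symm b) ↔ 𝒜.cal.isC b := fun b => by
    rw [← (h (ρ.symm b)).2.2, Equiv.apply_symm_apply]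
  rw [Calib.mem_modDiv] at hx ⊢
  constructor
  · intro σ b
    rw [key, key, ← Function.comp_assoc, hx.1]
    have h1 : ∏ k, ε (ρ.symm ((b ∘ σ) k)) = ∏ k, ε (ρ.symm (b k)) :=
      Equiv.prod_comp σ fun k => ε (ρ.symm (b k))
    have h2 : 𝒜.cal.par ∘ (ρ.symm ∘ b) = 𝒜.cal.par ∘ b := funext fun k => hpar _
    rw [h1, h2, mul_assoc]
  · intro b
    rw [key]
    refine Dvd.dvd.mul_right ?_ _
    have : 𝒜.cal.cFact b = 𝒜.cal.cFact (ρ.symm ∘ b) := by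
      unfold Calib.cFact
      rw [← Equiv.prod_comp ρ]
      refine Finset.prod_congr rfl fun β _ => ?_
      have h1 : Nat.card {k // b k = ρ β} = Nat.card {k // (ρ.symm ∘ b) k = β} :=
        Nat.card_congr (Equiv.subtypeEquivRight fun k => by
          simp [Equiv.symm_apply_eq])
      simp only [(h β).2.2, ← Nat.card_eq_fintype_card, h1]
    rw [this]
    exact hx.2 _

/-- The restriction `τ_d` of `τ^{⊗ d}` to `Γ̃^d A`. -/
noncomputable def CalAlg.tau (𝒜 : CalAlg R A B) {τ : A →ₗ[R] A} (hτ : 𝒜.Monomial τ) (d : ℕ) :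
    𝒜.modPow d →ₗ[R] 𝒜.modPow d where
  toFun := fun x => ⟨𝒜.tauT τ d x.1, 𝒜.tauT_mem hτ x.2⟩
  map_add' := fun x y => Subtype.ext ((𝒜.tauT τ d).map_add x.1 y.1)
  map_smul' := fun r x => Subtype.ext ((𝒜.tauT τ d).map_smul r x.1)

end Structure

/-- Extension of scalars: the `R`-algebra `S` acts on the `R`-module `N`, hence `F ⊗ S` acts on
`F ⊗ N`. -/
noncomputable def extAct (R F S N : Type*) [CommRing R] [CommRing F] [Algebra R F] [Ring S]
    [Algebra R S] [AddCommGroup N] [Module R N] [Module S N] [IsScalarTower R S N] :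
    F ⊗[R] S →ₐ[F] Module.End F (F ⊗[R] N) :=
  (LinearMap.tensorProductEnd R F N).comp
    (Algebra.TensorProduct.map (AlgHom.id F F) (Algebra.lsmul R R N))

/-- The module `F ⊗_R N`, considered over `F ⊗_R S`. -/
def Ext (R F N : Type*) [CommRing R] [CommRing F] [Algebra R F] [AddCommGroup N] [Module R N] :
    Type _ := F ⊗[R] N

section Ext

variable (R F S N : Type*) [CommRing R] [CommRing F] [Algebra R F] [Ring S]
    [Algebra R S] [AddCommGroup N] [Module R N] [Module S N] [IsScalarTower R S N]

noncomputable instance : AddCommGroup (Ext R F N) := inferInstanceAs (AddCommGroup (F ⊗[R] N))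

noncomputable instance : Module F (Ext R F N) := inferInstanceAs (Module F (F ⊗[R] N))

noncomputable instance : Module (F ⊗[R] S) (Ext R F N) :=
  Module.compHom (F ⊗[R] N) (extAct R F S N).toRingHom

instance : IsScalarTower F (F ⊗[R] S) (Ext R F N) :=
  ⟨fun r x v => by
    change extAct R F S N (r • x) v = r • extAct R F S N x v
    rw [map_smul]; rfl⟩

end Ext

/-! ### Standard and costandard modules, filtrations -/

section HighestWeight

/-- An `F`-superalgebra `T`, with its homogeneous parts `gr δ`, its parity involution
`x ↦ (-1)^|x| x`, and a family of elements `e l` indexed by a set `L` with a strict order. -/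
structure HWData (F T L : Type*) [Field F] [Ring T] [Algebra F T] where
  gr : ZMod 2 → Submodule F T
  inv : T →ₐ[F] T
  inv_gr : ∀ δ x, x ∈ gr δ → inv x = sg F δ • x
  e : L → T
  lt : L → L → Prop

variable {F T L : Type*} [Field F] [Ring T] [Algebra F T] (H : HWData F T L)

/-- The ideal `T^{>l}`, generated by the `e m` with `m > l`. -/
def HWData.ideal (l : L) : TwoSidedIdeal T := TwoSidedIdeal.span {x | ∃ m, H.lt l m ∧ x = H.e m}

/-- `T̃ = T / T^{>l}`. -/
abbrev HWData.Quot (l : L) : Type _ := (H.ideal l).ringCon.Quotient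

/-- The quotient map `T → T̃`. -/
def HWData.proj (l : L) : T →ₐ[F] H.Quot l := RingCon.mkₐ F (H.ideal l).ringCon

/-- The standard module `Δ(l) = T̃ ẽ_l`. -/
def HWData.Delta (l : L) : Type _ := (Ideal.span {H.proj l (H.e l)} : Ideal (H.Quot l))

/-- The right `T`-module `Δ^op(l) = ẽ_l T̃`. -/
def HWData.deltaOp (l : L) : Submodule F (H.Quot l) :=
  LinearMap.range (LinearMap.mulLeft F (H.proj l (H.e l)))

/-- The costandard module `∇(l) = Δ^op(l)^*`. -/
def HWData.Nabla (l : L) : Type _ := Module.Dual F (H.deltaOp l)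

noncomputable instance (l : L) : AddCommGroup (H.Delta l) :=
  inferInstanceAs (AddCommGroup (Ideal.span {H.proj l (H.e l)} : Ideal (H.Quot l)))

noncomputable instance (l : L) : Module F (H.Delta l) :=
  inferInstanceAs (Module F (Ideal.span {H.proj l (H.e l)} : Ideal (H.Quot l)))

noncomputable instance (l : L) : Module T (H.Delta l) :=
  Module.compHom (Ideal.span {H.proj l (H.e l)} : Ideal (H.Quot l)) (H.proj l).toRingHom

noncomputable instance (l : L) : AddCommGroup (H.Nabla l) :=
  inferInstanceAs (AddCommGroup (Module.Dual F (H.deltaOp l)))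

noncomputable instance (l : L) : Module F (H.Nabla l) :=
  inferInstanceAs (Module F (Module.Dual F (H.deltaOp l)))

/-- The right action `v ↦ v a` on `Δ^op(l)`. -/
def HWData.opAct (l : L) (a : T) : H.deltaOp l →ₗ[F] H.deltaOp l :=
  (LinearMap.mulRight F (H.proj l a)).restrict fun v hv => by
    obtain ⟨w, rfl⟩ := hv
    exact ⟨w * H.proj l a, by simp [mul_assoc]⟩

theorem HWData.opAct_one (l : L) : H.opAct l (H.inv 1) = LinearMap.id :=
  LinearMap.ext fun v => Subtype.ext <| by
    change v.1 * H.proj l (H.inv 1) = v.1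
    simp

theorem HWData.opAct_mul (l : L) (a b : T) :
    H.opAct l (H.inv (a * b)) = (H.opAct l (H.inv b)).comp (H.opAct l (H.inv a)) :=
  LinearMap.ext fun v => Subtype.ext <| by
    change v.1 * H.proj l (H.inv (a * b)) = v.1 * H.proj l (H.inv a) * H.proj l (H.inv b)
    simp [mul_assoc]

theorem HWData.opAct_add (l : L) (a b : T) :
    H.opAct l (H.inv (a + b)) = H.opAct l (H.inv a) + H.opAct l (H.inv b) :=
  LinearMap.ext fun v => Subtype.ext <| by
    change v.1 * H.proj l (H.inv (a + b)) = v.1 * H.proj l (H.inv a) + v.1 * H.proj l (H.inv b)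
    simp [mul_add]

theorem HWData.opAct_zero (l : L) : H.opAct l (H.inv 0) = 0 :=
  LinearMap.ext fun v => Subtype.ext <| by
    change v.1 * H.proj l (H.inv 0) = 0
    simp

/-- The left action on `∇(l)`, `(a f)(v) = (-1)^(|a||f| + |a||v|) f(v a)`. As `f(v a) ≠ 0` forces
`|f| = |v| + |a|`, the sign is `(-1)^|a|`. -/
noncomputable instance (l : L) : Module T (H.Nabla l) where
  smul := fun a (f : Module.Dual F (H.deltaOp l)) =>
    (f.comp (H.opAct l (H.inv a)) : Module.Dual F (H.deltaOp l))
  one_smul := fun f => by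
    change LinearMap.comp (f : Module.Dual F (H.deltaOp l)) (H.opAct l (H.inv 1)) = f
    rw [H.opAct_one]; rfl
  mul_smul := fun a b f => by
    change LinearMap.comp (f : Module.Dual F (H.deltaOp l)) (H.opAct l (H.inv (a * b))) = _
    rw [H.opAct_mul]; rfl
  smul_zero := fun a => LinearMap.zero_comp _
  smul_add := fun a f g => LinearMap.add_comp _ _ _
  add_smul := fun a b f => by
    change LinearMap.comp (f : Module.Dual F (H.deltaOp l)) (H.opAct l (H.inv (a + b))) = _
    rw [H.opAct_add]; exact LinearMap.comp_add _ _ _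
  zero_smul := fun f => by
    change LinearMap.comp (f : Module.Dual F (H.deltaOp l)) (H.opAct l (H.inv 0)) = 0
    rw [H.opAct_zero]; exact LinearMap.comp_zero _

/-- The part of parity `δ` of `Δ(l)`. -/
def HWData.deltaGr (l : L) (δ : ZMod 2) : Submodule F (H.Delta l) where
  carrier := {v | v.1 ∈ (H.gr δ).map (H.proj l).toLinearMap}
  add_mem' := fun hx hy => Submodule.add_mem ((H.gr δ).map (H.proj l).toLinearMap) hx hy
  zero_mem' := Submodule.zero_mem ((H.gr δ).map (H.proj l).toLinearMap)
  smul_mem' := fun r _ hx => Submodule.smul_mem ((H.gr δ).map (H.proj l).toLinearMap) r hx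

/-- The part of parity `δ` of `∇(l)`: the functions that vanish on vectors of other parity. -/
def HWData.nablaGr (l : L) (δ : ZMod 2) : Submodule F (H.Nabla l) :=
  show Submodule F (Module.Dual F (H.deltaOp l)) from
  { carrier := {f | ∀ δ' ≠ δ, ∀ v : H.deltaOp l,
      v.1 ∈ (H.gr δ').map (H.proj l).toLinearMap → f v = 0}
    add_mem' := fun {f g} hf hg δ' h v hv => by
      rw [LinearMap.add_apply, hf δ' h v hv, hg δ' h v hv, add_zero]
    zero_mem' := fun _ _ _ _ => rfl
    smul_mem' := fun r f hf δ' h v hv => by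
      rw [LinearMap.smul_apply, hf δ' h v hv, smul_zero] }

variable {V W : Type*} [AddCommGroup V] [Module F V] [Module T V] [AddCommGroup W] [Module F W]
  [Module T W]

/-- `φ` is an isomorphism of `T`-supermodules of parity `ε`: it shifts parities by `ε` and
`φ(a v) = (-1)^(ε|a|) a φ(v)`. -/
def HWData.IsSuperIso (grV : ZMod 2 → Submodule F V) (grW : ZMod 2 → Submodule F W) (ε : ZMod 2)
    (φ : V ≃ₗ[F] W) : Prop :=
  (∀ δ, ∀ v ∈ grV δ, φ v ∈ grW (δ + ε)) ∧
    ∀ δ, ∀ a ∈ H.gr δ, ∀ v, φ (a • v) = sg F (ε * δ) • a • φ v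

/-- A `T`-submodule spanned by its homogeneous elements. -/
def IsHomogeneousSub (grV : ZMod 2 → Submodule F V) (U : Submodule T V) : Prop :=
  ∀ v ∈ U, ∃ v₀ ∈ grV 0, ∃ v₁ ∈ grV 1, v₀ ∈ U ∧ v₁ ∈ U ∧ v = v₀ + v₁

variable [IsScalarTower F T V]

/-- The part of parity `δ` of the subquotient `U / U'`. -/
def subquotGr (grV : ZMod 2 → Submodule F V) (U U' : Submodule T V) (δ : ZMod 2) :
    Submodule F (U ⧸ U'.submoduleOf U) :=
  ((grV δ).comap (U.subtype.restrictScalars F)).map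
    ((U'.submoduleOf U).mkQ.restrictScalars F)

/-- `V` has a finite filtration by subsupermodules in which every factor is isomorphic, by an even
or odd isomorphism, to one of the supermodules `X l`. -/
def HWData.HasFiltration (grV : ZMod 2 → Submodule F V) {X : L → Type*}
    [∀ l, AddCommGroup (X l)] [∀ l, Module F (X l)] [∀ l, Module T (X l)]
    (grX : ∀ l, ZMod 2 → Submodule F (X l)) : Prop :=
  ∃ (m : ℕ) (U : Fin (m + 1) → Submodule T V), Monotone U ∧ U 0 = ⊥ ∧ U (Fin.last m) = ⊤ ∧
    (∀ r, IsHomogeneousSub grV (U r)) ∧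
    ∀ r : Fin m, ∃ (l : L) (ε : ZMod 2)
      (φ : (U r.succ ⧸ (U r.castSucc).submoduleOf (U r.succ)) ≃ₗ[F] X l),
      H.IsSuperIso (subquotGr grV (U r.succ) (U r.castSucc)) (grX l) ε φ

/-- `V` is tilting: it has both a standard and a costandard filtration. -/
def HWData.IsTilting (grV : ZMod 2 → Submodule F V) : Prop :=
  H.HasFiltration grV H.deltaGr ∧ H.HasFiltration grV H.nablaGr

end HighestWeight

/-! ### The extended zigzag algebra -/

section Zigzag

open scoped Classical

/-- The bilinear map with structure constants `K`. -/
def bil {R A V W : Type*} [CommRing R] [Fintype A] [Fintype V] (K : A → V → W → R) (x : A → R)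
    (v : V → R) : W → R :=
  fun w => ∑ a, ∑ c, x a * v c * K a c w

theorem bil_assoc {R A V : Type*} [CommRing R] [Fintype A] [Fintype V] (KA : A → A → A → R)
    (KV : A → V → V → R)
    (h : ∀ a a' v w, ∑ b, KA a a' b * KV b v w = ∑ u, KV a' v u * KV a u w)
    (x y : A → R) (v : V → R) : bil KV (bil KA x y) v = bil KV x (bil KV y v) := by
  ext w
  have hL : bil KV (bil KA x y) v w =
      ∑ a, ∑ a', ∑ c, x a * y a' * v c * ∑ b, KA a a' b * KV b c w := by
    simp only [bil, Finset.sum_mul, Finset.mul_sum]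
    rw [Finset.sum_congr rfl fun b _ => Finset.sum_comm, Finset.sum_comm]
    refine Finset.sum_congr rfl fun a _ => ?_
    rw [Finset.sum_congr rfl fun b _ => Finset.sum_comm, Finset.sum_comm]
    refine Finset.sum_congr rfl fun a' _ => ?_
    rw [Finset.sum_comm]
    exact Finset.sum_congr rfl fun c _ => Finset.sum_congr rfl fun b _ => by ring
  have hR : bil KV x (bil KV y v) w =
      ∑ a, ∑ a', ∑ c, x a * y a' * v c * ∑ u, KV a' c u * KV a u w := by
    simp only [bil, Finset.sum_mul, Finset.mul_sum]
    refine Finset.sum_congr rfl fun a _ => ?_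
    rw [Finset.sum_comm]
    refine Finset.sum_congr rfl fun a' _ => ?_
    rw [Finset.sum_comm]
    exact Finset.sum_congr rfl fun c _ => Finset.sum_congr rfl fun b _ => by ring
  simp only [hL, hR, h]

theorem sum_ind {R ι : Type*} [CommRing R] [Fintype ι] (p : ι → Prop)
    [DecidablePred p] [Decidable (∃ a, p a)] (h : ∀ a b, p a → p b → a = b) :
    ∑ a, (if p a then (1 : R) else 0) = if ∃ a, p a then 1 else 0 := by
  by_cases hp : ∃ a, p a
  · obtain ⟨a, ha⟩ := hp
    rw [if_pos ⟨a, ha⟩, Finset.sum_eq_single a, if_pos ha]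
    · intro b _ hb
      rw [if_neg fun h' => hb (h _ _ h' ha)]
    · simp
  · rw [if_neg hp]
    exact Finset.sum_eq_zero fun a _ => if_neg fun h' => hp ⟨a, h'⟩

/-- There is a nonzero path of length `g` from `j` to `i`: either `g = 0` and `i = j`, or `g = 1`
and `i`, `j` are neighbours, or `g = 2` and `i = j < ℓ`. -/
def ZValid (ℓ : ℕ) (i j g : ℕ) : Prop :=
  (g = 0 ∧ i = j) ∨ (g = 1 ∧ (i = j + 1 ∨ j = i + 1)) ∨ (g = 2 ∧ i = j ∧ i < ℓ)

/-- The basis of the extended zigzag algebra: `(i, i, 0)` is `e_i`, `(i, j, 1)` is `a_{i,j}` and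
`(j, j, 2)` is `c_j = a_{j,j+1} a_{j+1,j}`. -/
def ZPath (ℓ : ℕ) : Type :=
  {p : Fin (ℓ + 1) × Fin (ℓ + 1) × Fin 3 // ZValid ℓ p.1 p.2.1 p.2.2}

noncomputable instance (ℓ : ℕ) : Fintype (ZPath ℓ) :=
  inferInstanceAs (Fintype {p : Fin (ℓ + 1) × Fin (ℓ + 1) × Fin 3 // ZValid ℓ p.1 p.2.1 p.2.2})

variable {ℓ : ℕ}

/-- The end point of a path (paths are composed from right to left). -/
def ZPath.tgt (p : ZPath ℓ) : Fin (ℓ + 1) := p.1.1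

/-- The starting point of a path. -/
def ZPath.src (p : ZPath ℓ) : Fin (ℓ + 1) := p.1.2.1

/-- The length of a path. -/
def ZPath.deg (p : ZPath ℓ) : Fin 3 := p.1.2.2

theorem ZPath.valid (p : ZPath ℓ) : ZValid ℓ p.tgt p.src p.deg := p.2

theorem ZPath.ext {p q : ZPath ℓ} (h1 : p.tgt = q.tgt) (h2 : p.src = q.src)
    (h3 : p.deg = q.deg) : p = q :=
  Subtype.ext (Prod.ext h1 (Prod.ext h2 h3))

/-- The path of length zero at `i`. -/
def ZPath.e (i : Fin (ℓ + 1)) : ZPath ℓ := ⟨(i, i, 0), Or.inl ⟨rfl, rfl⟩⟩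

/-- The product of the paths `q` and `r` is `p`. -/
def ZPath.IsComp (q r p : ZPath ℓ) : Prop :=
  q.src = r.tgt ∧ p.tgt = q.tgt ∧ p.src = r.src ∧ (p.deg : ℕ) = q.deg + r.deg

/-- The extended zigzag algebra `𝖹` over `R`: the path algebra of the double of the quiver
`0 - 1 - ⋯ - ℓ`, modulo all paths of length at least three, all paths of length two that are not
cycles, all differences of cycles of length two at the same vertex, and `a_{ℓ,ℓ-1} a_{ℓ-1,ℓ}`.
Elements are given by their coordinates in the basis of paths. -/
def Zig (R : Type*) (ℓ : ℕ) : Type _ := ZPath ℓ → R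

variable {R : Type*} [CommRing R]

noncomputable instance : AddCommGroup (Zig R ℓ) := inferInstanceAs (AddCommGroup (ZPath ℓ → R))

noncomputable instance : Module R (Zig R ℓ) := inferInstanceAs (Module R (ZPath ℓ → R))

/-- Structure constants of the zigzag algebra. -/
noncomputable def zigK (R : Type*) [CommRing R] (q r p : ZPath ℓ) : R :=
  if q.IsComp r p then 1 else 0

theorem zigK_assoc (a a' v w : ZPath ℓ) :
    ∑ b, zigK R a a' b * zigK R b v w = ∑ u, zigK R a' v u * zigK R a u w := by
  simp only [zigK, ite_mul, one_mul, zero_mul, ← ite_and]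
  rw [sum_ind, sum_ind]
  · refine if_congr ?_ rfl rfl
    constructor
    · rintro ⟨b, ⟨h1, h2, h3, h4⟩, h5, h6, h7, h8⟩
      have ha := a.valid
      have ha' := a'.valid
      have hv := v.valid
      have hw := w.valid
      have hw2 : (w.deg : ℕ) < 3 := w.deg.2
      refine ⟨⟨(a'.tgt, v.src, ⟨a'.deg + v.deg, by omega⟩), ?_⟩, ⟨h3 ▸ h5, rfl, rfl, rfl⟩,
        h1, h6.trans h2, h7, ?_⟩
      · change ZValid ℓ a'.tgt v.src (a'.deg + v.deg)
        simp only [Fin.ext_iff] at *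
        unfold ZValid at *
        omega
      · change (w.deg : ℕ) = a.deg + (a'.deg + v.deg)
        omega
    · rintro ⟨u, ⟨h1, h2, h3, h4⟩, h5, h6, h7, h8⟩
      have ha := a.valid
      have ha' := a'.valid
      have hv := v.valid
      have hw := w.valid
      have hw2 : (w.deg : ℕ) < 3 := w.deg.2
      refine ⟨⟨(a.tgt, a'.src, ⟨a.deg + a'.deg, by omega⟩), ?_⟩, ⟨h5.trans h2, rfl, rfl, rfl⟩,
        h1, h6, h7.trans h3, ?_⟩
      · change ZValid ℓ a.tgt a'.src (a.deg + a'.deg)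
        simp only [Fin.ext_iff] at *
        unfold ZValid at *
        omega
      · change (w.deg : ℕ) = (a.deg + a'.deg) + v.deg
        omega
  · rintro u u' ⟨⟨-, h2, h3, h4⟩, -⟩ ⟨⟨-, h2', h3', h4'⟩, -⟩
    exact ZPath.ext (h2.trans h2'.symm) (h3.trans h3'.symm) (Fin.ext (h4.trans h4'.symm))
  · rintro u u' ⟨⟨-, h2, h3, h4⟩, -⟩ ⟨⟨-, h2', h3', h4'⟩, -⟩
    exact ZPath.ext (h2.trans h2'.symm) (h3.trans h3'.symm) (Fin.ext (h4.trans h4'.symm))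

/-- The unit `∑ e_i` of the zigzag algebra. -/
noncomputable def zigOne (R : Type*) [CommRing R] : ZPath ℓ → R :=
  fun p => if p.deg = 0 then 1 else 0

theorem ZPath.eq_e {p : ZPath ℓ} (h : p.deg = 0) : p = ZPath.e p.src := by
  have := p.valid
  have h' : (p.deg : ℕ) = 0 := by simp [h]
  refine ZPath.ext (Fin.ext ?_) rfl h
  change (p.tgt : ℕ) = p.src
  unfold ZValid at this
  omega

/-- Sums against the unit. -/
theorem sum_zigOne (f : ZPath ℓ → R) : ∑ p, zigOne R p * f p = ∑ i, f (ZPath.e i) := by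
  simp only [zigOne, ite_mul, one_mul, zero_mul]
  rw [← Finset.sum_filter]
  refine (Finset.sum_nbij' ZPath.e ZPath.src ?_ ?_ ?_ ?_ ?_).symm
  · intro i _; exact Finset.mem_filter.mpr ⟨Finset.mem_univ _, rfl⟩
  · intro p _; simp
  · intro i _; rfl
  · intro p hp; exact (ZPath.eq_e (by simpa using hp)).symm
  · intro i _; rfl

theorem zigK_e (i : Fin (ℓ + 1)) (q p : ZPath ℓ) :
    zigK R (ZPath.e i) q p = if i = q.tgt ∧ q = p then 1 else 0 := by
  unfold zigK
  refine if_congr ⟨?_, ?_⟩ rfl rfl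
  · rintro ⟨h1, h2, h3, h4⟩
    refine ⟨h1, ZPath.ext (h1.symm.trans h2.symm) h3.symm (Fin.ext ?_)⟩
    simpa [ZPath.e, ZPath.deg] using h4.symm
  · rintro ⟨h1, rfl⟩
    exact ⟨h1, h1.symm, rfl, by simp [ZPath.e, ZPath.deg]⟩

theorem zigK_e_right (i : Fin (ℓ + 1)) (q p : ZPath ℓ) :
    zigK R q (ZPath.e i) p = if i = q.src ∧ q = p then 1 else 0 := by
  unfold zigK
  refine if_congr ⟨?_, ?_⟩ rfl rfl
  · rintro ⟨h1, h2, h3, h4⟩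
    refine ⟨h1.symm, ZPath.ext h2.symm (h1.trans h3.symm) (Fin.ext ?_)⟩
    simpa [ZPath.e, ZPath.deg] using h4.symm
  · rintro ⟨h1, rfl⟩
    exact ⟨h1.symm, rfl, h1.symm, by simp [ZPath.e, ZPath.deg]⟩

theorem bil_add_left {A V W : Type*} [Fintype A] [Fintype V] (K : A → V → W → R)
    (x y : A → R) (v : V → R) : bil K (x + y) v = bil K x v + bil K y v := by
  ext b; simp [bil, add_mul, Finset.sum_add_distrib]

theorem bil_add_right {A V W : Type*} [Fintype A] [Fintype V] (K : A → V → W → R)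
    (x : A → R) (v w : V → R) : bil K x (v + w) = bil K x v + bil K x w := by
  ext b; simp [bil, add_mul, mul_add, Finset.sum_add_distrib]

theorem bil_smul_left {A V W : Type*} [Fintype A] [Fintype V] (K : A → V → W → R)
    (r : R) (x : A → R) (v : V → R) : bil K (r • x) v = r • bil K x v := by
  ext b; simp [bil, Finset.mul_sum, mul_assoc]

theorem bil_smul_right {A V W : Type*} [Fintype A] [Fintype V] (K : A → V → W → R)
    (r : R) (x : A → R) (v : V → R) : bil K x (r • v) = r • bil K x v := by
  ext b
  simp only [bil, Pi.smul_apply, smul_eq_mul, Finset.mul_sum]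
  exact Finset.sum_congr rfl fun a _ => Finset.sum_congr rfl fun c _ => by ring

theorem bil_zero_left {A V W : Type*} [Fintype A] [Fintype V] (K : A → V → W → R)
    (v : V → R) : bil K 0 v = 0 := by
  ext b; simp [bil]

theorem bil_zero_right {A V W : Type*} [Fintype A] [Fintype V] (K : A → V → W → R)
    (x : A → R) : bil K x 0 = 0 := by
  ext b; simp [bil]

theorem bil_single {A V W : Type*} [Fintype A] [Fintype V] (K : A → V → W → R) (a : A) (c : V) :
    bil K (Pi.single a 1) (Pi.single c 1) = K a c := by
  ext w
  simp only [bil]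
  rw [Finset.sum_eq_single a, Finset.sum_eq_single c]
  · simp
  · intro b _ hb; simp [hb]
  · simp
  · intro b _ hb; simp [hb]
  · simp

theorem bil_zigOne {V : Type*} [Fintype V] (K : ZPath ℓ → V → V → R) (f : V → Fin (ℓ + 1))
    (h : ∀ i v w, K (ZPath.e i) v w = if i = f v ∧ v = w then 1 else 0) (v : V → R) :
    bil K (zigOne R) v = v := by
  ext w
  simp only [bil]
  rw [Finset.sum_comm]
  have : ∀ c, ∑ a, zigOne R a * v c * K a c w = ∑ a, zigOne R a * (v c * K a c w) :=
    fun c => Finset.sum_congr rfl fun a _ => mul_assoc _ _ _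
  simp only [this, sum_zigOne, h]
  rw [Finset.sum_eq_single w]
  · simp
  · intro c _ hc; simp [hc]
  · simp

noncomputable instance : Ring (Zig R ℓ) :=
  { (inferInstance : AddCommGroup (Zig R ℓ)) with
    mul := fun x y => bil (zigK R) x y
    one := zigOne R
    mul_assoc := bil_assoc _ _ zigK_assoc
    one_mul := bil_zigOne _ _ zigK_e
    mul_one := fun v => by
      change bil (zigK R) v (zigOne R) = v
      refine Eq.trans ?_ (bil_zigOne (fun a c p => zigK R c a p) _ zigK_e_right v)
      ext w
      simp only [bil]
      rw [Finset.sum_comm]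
      exact Finset.sum_congr rfl fun a _ => Finset.sum_congr rfl fun c _ => by ring
    left_distrib := bil_add_right _
    right_distrib := bil_add_left _
    zero_mul := bil_zero_left _
    mul_zero := bil_zero_right _ }

noncomputable instance : Algebra R (Zig R ℓ) :=
  Algebra.ofModule (bil_smul_left _) (fun r x y => bil_smul_right _ r x y)

/-- The calibration of the zigzag algebra: the paths of length one are odd, and `𝔠` is spanned by
the paths of length two. -/
def zigCal (ℓ : ℕ) : Calib (ZPath ℓ) where
  par := fun p => ((p.deg : ℕ) : ZMod 2)
  isC := fun p => p.deg = 2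
  par_of_isC := fun p h => by rw [h]; rfl

/-- The basis of paths. -/
noncomputable def zigBasis (R : Type*) [CommRing R] (ℓ : ℕ) :
    Module.Basis (ZPath ℓ) R (Zig R ℓ) :=
  show Module.Basis (ZPath ℓ) R (ZPath ℓ → R) from Pi.basisFun R (ZPath ℓ)

theorem zigBasis_mul (a c b : ZPath ℓ) :
    (zigBasis R ℓ).repr (zigBasis R ℓ a * zigBasis R ℓ c) b = zigK R a c b := by
  have h : ∀ p, zigBasis R ℓ p = (Pi.single p 1 : ZPath ℓ → R) := fun p => Pi.basisFun_apply R _ p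
  change (bil (zigK R) (zigBasis R ℓ a) (zigBasis R ℓ c)) b = _
  rw [h, h, bil_single]

theorem zigK_ne_zero {a c b : ZPath ℓ} (h : zigK R a c b ≠ 0) : a.IsComp c b := by
  by_contra h'
  exact h (if_neg h')

/-- The calibrated superalgebra `𝖹`. -/
noncomputable def zig (R : Type*) [CommRing R] (ℓ : ℕ) : CalAlg R (Zig R ℓ) (ZPath ℓ) where
  basis := zigBasis R ℓ
  cal := zigCal ℓ
  par_mul := fun a c b h => by
    rw [zigBasis_mul] at h
    have := (zigK_ne_zero h).2.2.2
    change ((b.deg : ℕ) : ZMod 2) = ((a.deg : ℕ) : ZMod 2) + ((c.deg : ℕ) : ZMod 2)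
    rw [this, Nat.cast_add]
  cal_mul := fun a c b h ha ha' hc hc' => by
    rw [zigBasis_mul] at h
    have h4 := (zigK_ne_zero h).2.2.2
    change ((a.deg : ℕ) : ZMod 2) = 0 at ha
    change ((c.deg : ℕ) : ZMod 2) = 0 at hc
    change ¬ a.deg = 2 at ha'
    change ¬ c.deg = 2 at hc'
    change ¬ b.deg = 2
    generalize a.deg = x, c.deg = y, b.deg = z at *
    revert x y z
    decide
  cal_one := fun b h => by
    have h0 : b.deg = 0 := by
      by_contra h'
      exact h (if_neg h')
    change ((b.deg : ℕ) : ZMod 2) = 0 ∧ ¬ b.deg = 2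
    rw [h0]
    decide

/-- The basis of `ΠT(i)`: for `i > 0`, `ΠT(i) = 𝖹 e_{i-1}` has as its basis the paths that start
at `i - 1`, given here by their end point and length. The module `ΠT(0)` is spanned by one odd
vector `v_0`, given by `(0, 1)`. -/
def TB (ℓ : ℕ) (i : Fin (ℓ + 1)) : Type :=
  {p : Fin (ℓ + 1) × Fin 3 // (p.2 = 0 ∧ (p.1 : ℕ) + 1 = i) ∨
    (p.2 = 1 ∧ (p.1 = i ∨ (p.1 : ℕ) + 2 = i)) ∨ (p.2 = 2 ∧ (p.1 : ℕ) + 1 = i)}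

noncomputable instance (ℓ : ℕ) (i : Fin (ℓ + 1)) : Fintype (TB ℓ i) :=
  inferInstanceAs (Fintype {p : Fin (ℓ + 1) × Fin 3 // (p.2 = 0 ∧ (p.1 : ℕ) + 1 = i) ∨
    (p.2 = 1 ∧ (p.1 = i ∨ (p.1 : ℕ) + 2 = i)) ∨ (p.2 = 2 ∧ (p.1 : ℕ) + 1 = i)})

/-- `ΠT(i)`, the parity shift of the indecomposable tilting `𝖹`-supermodule `T(i)`. -/
def PiT (R : Type*) (ℓ : ℕ) (i : Fin (ℓ + 1)) : Type _ := TB ℓ i → R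

variable {i : Fin (ℓ + 1)}

noncomputable instance : AddCommGroup (PiT R ℓ i) := inferInstanceAs (AddCommGroup (TB ℓ i → R))

noncomputable instance : Module R (PiT R ℓ i) := inferInstanceAs (Module R (TB ℓ i → R))

/-- The product of the path `q` and the basis vector `v` is `w`. -/
def TB.IsComp (q : ZPath ℓ) (v w : TB ℓ i) : Prop :=
  q.src = v.1.1 ∧ w.1.1 = q.tgt ∧ (w.1.2 : ℕ) = q.deg + v.1.2

/-- Structure constants of `ΠT(i)`. -/
noncomputable def tbK (R : Type*) [CommRing R] (q : ZPath ℓ) (v w : TB ℓ i) : R :=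
  if TB.IsComp q v w then 1 else 0

theorem TB.valid (v : TB ℓ i) : ((v.1.2 : ℕ) = 0 ∧ (v.1.1 : ℕ) + 1 = i) ∨
    ((v.1.2 : ℕ) = 1 ∧ ((v.1.1 : ℕ) = i ∨ (v.1.1 : ℕ) + 2 = i)) ∨
    ((v.1.2 : ℕ) = 2 ∧ (v.1.1 : ℕ) + 1 = i) := by
  obtain ⟨⟨t, g⟩, h⟩ := v
  rcases h with ⟨h1, h2⟩ | ⟨h1, h2 | h2⟩ | ⟨h1, h2⟩
  · exact Or.inl ⟨congrArg Fin.val h1, h2⟩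
  · exact Or.inr (Or.inl ⟨congrArg Fin.val h1, Or.inl (congrArg Fin.val h2)⟩)
  · exact Or.inr (Or.inl ⟨congrArg Fin.val h1, Or.inr h2⟩)
  · exact Or.inr (Or.inr ⟨congrArg Fin.val h1, h2⟩)

theorem tbK_assoc (a a' : ZPath ℓ) (v w : TB ℓ i) :
    ∑ b, zigK R a a' b * tbK R b v w = ∑ u : TB ℓ i, tbK R a' v u * tbK R a u w := by
  simp only [zigK, tbK, ite_mul, one_mul, zero_mul, ← ite_and]
  rw [sum_ind, sum_ind]
  · refine if_congr ?_ rfl rfl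
    have ha := a.valid
    have ha' := a'.valid
    have hv := v.valid
    have hw := w.valid
    have hi := i.2
    constructor
    · rintro ⟨b, ⟨h1, h2, h3, h4⟩, h5, h6, h8⟩
      refine ⟨⟨(a'.tgt, ⟨a'.deg + v.1.2, by omega⟩), ?_⟩, ⟨h3 ▸ h5, rfl, rfl⟩,
        h1, h6.trans h2, ?_⟩
      · simp only [Fin.ext_iff] at *
        unfold ZValid at *
        simp
        omega
      · change (w.1.2 : ℕ) = a.deg + (a'.deg + v.1.2)
        omega
    · rintro ⟨u, ⟨h1, h2, h4⟩, h5, h6, h8⟩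
      refine ⟨⟨(a.tgt, a'.src, ⟨a.deg + a'.deg, by omega⟩), ?_⟩, ⟨h5.trans h2, rfl, rfl, rfl⟩,
        h1, h6, ?_⟩
      · change ZValid ℓ a.tgt a'.src (a.deg + a'.deg)
        simp only [Fin.ext_iff] at *
        unfold ZValid at *
        omega
      · change (w.1.2 : ℕ) = (a.deg + a'.deg) + v.1.2
        omega
  · rintro u u' ⟨⟨-, h2, h4⟩, -⟩ ⟨⟨-, h2', h4'⟩, -⟩
    exact Subtype.ext (Prod.ext (h2.trans h2'.symm) (Fin.ext (h4.trans h4'.symm)))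
  · rintro u u' ⟨⟨-, h2, h3, h4⟩, -⟩ ⟨⟨-, h2', h3', h4'⟩, -⟩
    exact ZPath.ext (h2.trans h2'.symm) (h3.trans h3'.symm) (Fin.ext (h4.trans h4'.symm))

theorem tbK_e (j : Fin (ℓ + 1)) (v w : TB ℓ i) :
    tbK R (ZPath.e j) v w = if j = v.1.1 ∧ v = w then 1 else 0 := by
  unfold tbK
  refine if_congr ⟨?_, ?_⟩ rfl rfl
  · rintro ⟨h1, h2, h4⟩
    refine ⟨h1, Subtype.ext (Prod.ext (h1.symm.trans h2.symm) (Fin.ext ?_))⟩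
    simpa [ZPath.e, ZPath.deg] using h4.symm
  · rintro ⟨h1, rfl⟩
    exact ⟨h1, h1.symm, by simp [ZPath.e, ZPath.deg]⟩

noncomputable instance : Module (Zig R ℓ) (PiT R ℓ i) where
  smul := fun x v => bil (tbK R) x v
  one_smul := bil_zigOne _ _ tbK_e
  mul_smul := bil_assoc _ _ tbK_assoc
  smul_zero := bil_zero_right _
  smul_add := bil_add_right _
  add_smul := bil_add_left _
  zero_smul := bil_zero_left _

instance : IsScalarTower R (Zig R ℓ) (PiT R ℓ i) := ⟨bil_smul_left _⟩

/-- The basis of `ΠT(i)`. -/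
noncomputable def tbBasis (R : Type*) [CommRing R] (ℓ : ℕ) (i : Fin (ℓ + 1)) :
    Module.Basis (TB ℓ i) R (PiT R ℓ i) :=
  show Module.Basis (TB ℓ i) R (TB ℓ i → R) from Pi.basisFun R (TB ℓ i)

theorem tbBasis_smul (a : ZPath ℓ) (c b : TB ℓ i) :
    (tbBasis R ℓ i).repr ((zig R ℓ).basis a • tbBasis R ℓ i c) b = tbK R a c b := by
  have h : ∀ p, zigBasis R ℓ p = (Pi.single p 1 : ZPath ℓ → R) := fun p => Pi.basisFun_apply R _ p
  have h' : ∀ p, tbBasis R ℓ i p = (Pi.single p 1 : TB ℓ i → R) :=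
    fun p => Pi.basisFun_apply R _ p
  change (bil (tbK R) (zigBasis R ℓ a) (tbBasis R ℓ i c)) b = _
  rw [h, h', bil_single]

theorem tbK_ne_zero {a : ZPath ℓ} {c b : TB ℓ i} (h : tbK R a c b ≠ 0) : TB.IsComp a c b := by
  by_contra h'
  exact h (if_neg h')

/-- The calibrated `𝖹`-supermodule `ΠT(i)`. -/
noncomputable def piT (R : Type*) [CommRing R] (ℓ : ℕ) (i : Fin (ℓ + 1)) :
    CalMod (zig R ℓ) (PiT R ℓ i) (TB ℓ i) where
  basis := tbBasis R ℓ i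
  cal :=
    { par := fun p => ((p.1.2 : ℕ) : ZMod 2)
      isC := fun p => p.1.2 = 2
      par_of_isC := fun p h => by rw [h]; rfl }
  par_smul := fun a c b h => by
    rw [tbBasis_smul] at h
    have := (tbK_ne_zero h).2.2
    change ((b.1.2 : ℕ) : ZMod 2) = ((a.deg : ℕ) : ZMod 2) + ((c.1.2 : ℕ) : ZMod 2)
    rw [this, Nat.cast_add]
  cal_smul := fun a c b h ha ha' hc hc' => by
    rw [tbBasis_smul] at h
    have h4 := (tbK_ne_zero h).2.2
    change ((a.deg : ℕ) : ZMod 2) = 0 at ha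
    change ¬ a.deg = 2 at ha'
    change ((c.1.2 : ℕ) : ZMod 2) = 0 at hc
    change ¬ c.1.2 = 2 at hc'
    change ¬ b.1.2 = 2
    generalize a.deg = x, c.1.2 = y, b.1.2 = z at *
    revert x y z
    decide

end Zigzag

/-! ### Matrices and columns -/

section Matrices

variable {R A B V BV : Type*} [CommRing R] [Ring A] [Algebra R A] [AddCommGroup V] [Module R V]
  [Module A V]

theorem matrix_repr {n : ℕ} (b : Module.Basis B R A) (M : Matrix (Fin n) (Fin n) A) (r s : Fin n)
    (k : B) : (b.matrix (Fin n) (Fin n)).repr M (r, s, k) = b.repr (M r s) k := by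
  simp [Module.Basis.matrix, Module.Basis.repr_reindex_apply, -Module.Basis.repr_reindex]

theorem matrix_mul_ne_zero {n : ℕ} (b : Module.Basis B R A) (x y z : Fin n × Fin n × B)
    (h : (b.matrix (Fin n) (Fin n)).repr
      (b.matrix (Fin n) (Fin n) x * b.matrix (Fin n) (Fin n) y) z ≠ 0) :
    b.repr (b x.2.2 * b y.2.2) z.2.2 ≠ 0 := by
  obtain ⟨r, s, k⟩ := x
  obtain ⟨r', s', k'⟩ := y
  obtain ⟨r'', s'', k''⟩ := z
  intro h0
  apply h
  rw [matrix_repr, Module.Basis.matrix_apply, Module.Basis.matrix_apply]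
  by_cases hs : s = r'
  · subst hs
    rw [Matrix.single_mul_single_same, Matrix.single_apply]
    split_ifs
    · exact h0
    · simp
  · rw [Matrix.single_mul_single_of_ne _ _ _ _ hs]
    simp

theorem matrix_one_ne_zero {n : ℕ} (b : Module.Basis B R A) (z : Fin n × Fin n × B)
    (h : (b.matrix (Fin n) (Fin n)).repr (1 : Matrix (Fin n) (Fin n) A) z ≠ 0) :
    b.repr (1 : A) z.2.2 ≠ 0 := by
  obtain ⟨r, s, k⟩ := z
  intro h0
  apply h
  rw [matrix_repr, Matrix.one_apply]
  split_ifs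
  · exact h0
  · simp

/-- The matrix superalgebra `M_n(A)` with the basis `ξ_{r,s}^b`, calibrated by `M_n(𝔞)` and
`M_n(𝔠)`. -/
noncomputable def CalAlg.mat (𝒜 : CalAlg R A B) (n : ℕ) :
    CalAlg R (Matrix (Fin n) (Fin n) A) (Fin n × Fin n × B) where
  basis := 𝒜.basis.matrix (Fin n) (Fin n)
  cal :=
    { par := fun x => 𝒜.cal.par x.2.2
      isC := fun x => 𝒜.cal.isC x.2.2
      par_of_isC := fun x => 𝒜.cal.par_of_isC x.2.2 }
  par_mul := fun _ _ _ h => 𝒜.par_mul _ _ _ (matrix_mul_ne_zero _ _ _ _ h)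
  cal_mul := fun _ _ _ h => 𝒜.cal_mul _ _ _ (matrix_mul_ne_zero _ _ _ _ h)
  cal_one := fun _ h => 𝒜.cal_one _ (matrix_one_ne_zero _ _ h)

/-- The basis of `Col_n(V) = V^n`: the column `(r, c)` has the basis vector `c` in position `r`. -/
noncomputable def colBasis (b : Module.Basis BV R V) (n : ℕ) :
    Module.Basis (Fin n × BV) R (Fin n → V) :=
  (Pi.basis fun _ : Fin n => b).reindex (Equiv.sigmaEquivProd _ _)

theorem col_smul_ne_zero {n : ℕ} (b : Module.Basis B R A) (c : Module.Basis BV R V)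
    (x : Fin n × Fin n × B) (y z : Fin n × BV)
    (h : (colBasis c n).repr (b.matrix (Fin n) (Fin n) x • colBasis c n y) z ≠ 0) :
    c.repr (b x.2.2 • c y.2) z.2 ≠ 0 := by
  obtain ⟨r, s, k⟩ := x
  obtain ⟨r', k'⟩ := y
  obtain ⟨r'', k''⟩ := z
  intro h0
  apply h
  have h1 : colBasis c n (r', k') = Pi.single r' (c k') := by simp [colBasis]
  rw [Module.Basis.matrix_apply, h1, Matrix.Module.single_smul]
  have h2 : ∀ v : Fin n → V, (colBasis c n).repr v (r'', k'') = c.repr (v r'') k'' := by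
    intro v; simp [colBasis]
  rw [h2]
  by_cases hr : r'' = r
  · subst hr
    by_cases hs : s = r'
    · subst hs; simpa using h0
    · simp [hs]
  · simp [hr]

/-- The `M_n(A)`-supermodule `Col_n(V)`, calibrated by `Col_n(V_𝔞)` and `Col_n(V_𝔠)`. -/
noncomputable def CalMod.col {𝒜 : CalAlg R A B} (ℳ : CalMod 𝒜 V BV) (n : ℕ) :
    CalMod (𝒜.mat n) (Fin n → V) (Fin n × BV) where
  basis := colBasis ℳ.basis n
  cal :=
    { par := fun x => ℳ.cal.par x.2
      isC := fun x => ℳ.cal.isC x.2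
      par_of_isC := fun x => ℳ.cal.par_of_isC x.2 }
  par_smul := fun _ _ _ h => ℳ.par_smul _ _ _ (col_smul_ne_zero _ _ _ _ _ h)
  cal_smul := fun _ _ _ h => ℳ.cal_smul _ _ _ (col_smul_ne_zero _ _ _ _ _ h)

end Matrices

/-! ### Multicompositions -/

section Weights

variable {ℓ n : ℕ}

/-- An `I`-multicomposition `(μ^(0), …, μ^(ℓ))`, where `I = {0, …, ℓ}`, with components in
`Λ(n)`. -/
abbrev MComp (ℓ n : ℕ) : Type := Fin (ℓ + 1) → Fin n → ℕ

/-- `Λ^I(n, d)`. -/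
def IsMComp (d : ℕ) (μ : MComp ℓ n) : Prop := ∑ i, ∑ r, μ i r = d

/-- `Λ_+^I(n, d)`. -/
def MPart (ℓ n d : ℕ) : Type := {μ : MComp ℓ n // IsMComp d μ ∧ ∀ i, Antitone (μ i)}

/-- `∑_{j ≥ i} |μ^(j)|`. -/
def upSum (μ : MComp ℓ n) (i : Fin (ℓ + 1)) : ℕ := ∑ j ∈ Finset.Ici i, ∑ r, μ j r

/-- The partial order `≤_I`: either `‖μ‖ ◁_I ‖ν‖`, or `‖μ‖ = ‖ν‖` and `μ^(i) ⊴ ν^(i)` in the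
dominance order, for all `i`. -/
def leI (μ ν : MComp ℓ n) : Prop :=
  ((∀ i, upSum μ i ≤ upSum ν i) ∧ ∃ i, ∑ r, μ i r ≠ ∑ r, ν i r) ∨
    ((∀ i, ∑ r, μ i r = ∑ r, ν i r) ∧
      ∀ i s, ∑ r ∈ Finset.Iic s, μ i r ≤ ∑ r ∈ Finset.Iic s, ν i r)

/-- The multicomposition `ι_i(1^d)` (for `d ≤ n`). -/
def iotaOnes (n d : ℕ) (i : Fin (ℓ + 1)) : MComp ℓ n :=
  fun j r => if j = i ∧ (r : ℕ) < d then 1 else 0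

/-- The multicomposition `ι_i(d) = ι_i((d, 0, …, 0))`. -/
def iotaRow (n d : ℕ) (i : Fin (ℓ + 1)) : MComp ℓ n :=
  fun j r => if j = i ∧ (r : ℕ) = 0 then d else 0

end Weights

/-! ### The algebra `T^𝖹(n, d)` -/

section Tau

variable (R : Type*) [CommRing R] {ℓ : ℕ}

/-- The reversed path. -/
def ZPath.rev (p : ZPath ℓ) : ZPath ℓ := ⟨(p.src, p.tgt, p.deg), by
  have := p.valid
  change ZValid ℓ p.src p.tgt p.deg
  unfold ZValid at *
  omega⟩

theorem ZPath.rev_rev (p : ZPath ℓ) : p.rev.rev = p := rfl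

/-- The sign in `τ(e_i) = e_i`, `τ(a_{i,j}) = a_{j,i}`, `τ(c_j) = -c_j`. -/
def tauSign (p : ZPath ℓ) : R := if p.deg = 2 then -1 else 1

/-- The anti-involution `τ` of `𝖹`. -/
def zigTau (ℓ : ℕ) : Zig R ℓ →ₗ[R] Zig R ℓ where
  toFun := fun x p => tauSign R p * x p.rev
  map_add' := fun x y => funext fun p => mul_add _ (x p.rev) (y p.rev)
  map_smul' := fun r x => funext fun p => mul_left_comm _ r (x p.rev)

/-- The anti-involution `ξ_{r,s}^b ↦ ξ_{s,r}^{τ(b)}` of `M_n(𝖹)`. -/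
noncomputable def matTau (ℓ n : ℕ) :
    Matrix (Fin n) (Fin n) (Zig R ℓ) →ₗ[R] Matrix (Fin n) (Fin n) (Zig R ℓ) where
  toFun := fun X r s => zigTau R ℓ (X s r)
  map_add' := fun X Y => funext fun r => funext fun s => (zigTau R ℓ).map_add (X s r) (Y s r)
  map_smul' := fun c X => funext fun r => funext fun s => (zigTau R ℓ).map_smul c (X s r)

theorem matTau_monomial (ℓ n : ℕ) : ((zig R ℓ).mat n).Monomial (matTau R ℓ n) := by
  classical
  refine ⟨⟨fun x => (x.2.1, x.1, x.2.2.rev), fun x => (x.2.1, x.1, x.2.2.rev), fun _ => rfl,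
    fun _ => rfl⟩, fun x => tauSign R x.2.2, ?_⟩
  rintro ⟨r, s, p⟩
  refine ⟨?_, rfl, Iff.rfl⟩
  change matTau R ℓ n ((zigBasis R ℓ).matrix (Fin n) (Fin n) (r, s, p)) =
    tauSign R p • (zigBasis R ℓ).matrix (Fin n) (Fin n) (s, r, p.rev)
  have h : ∀ p, zigBasis R ℓ p = (Pi.single p 1 : ZPath ℓ → R) := fun p => Pi.basisFun_apply R _ p
  have h1 : zigTau R ℓ (zigBasis R ℓ p) = tauSign R p • zigBasis R ℓ p.rev := by
    refine funext fun q => ?_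
    change tauSign R q * zigBasis R ℓ p q.rev = tauSign R p * zigBasis R ℓ p.rev q
    rw [h, h]
    by_cases hq : q = p.rev
    · subst hq
      simp [ZPath.rev_rev]
      rfl
    · have : q.rev ≠ p := fun h' => hq (by rw [← h', ZPath.rev_rev])
      simp [hq, this]
  rw [Module.Basis.matrix_apply, Module.Basis.matrix_apply]
  refine Matrix.ext fun r' s' => ?_
  change zigTau R ℓ (Matrix.single r s (zigBasis R ℓ p) s' r') =
    tauSign R p • Matrix.single s r (zigBasis R ℓ p.rev) r' s'
  rw [Matrix.single_apply, Matrix.single_apply]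
  by_cases hrs : r = s' ∧ s = r'
  · rw [if_pos hrs, if_pos hrs.symm, h1]
  · rw [if_neg hrs, if_neg fun h' => hrs h'.symm, map_zero, smul_zero]

end Tau

theorem sg_algebraMap (R F : Type*) [CommRing R] [Field F] [Algebra R F] (δ : ZMod 2) :
    algebraMap R F (sg R δ) = sg F δ := by
  simp [sg]

section TZ

open scoped Classical

variable (R F : Type*) [CommRing R] [IsDomain R] [CharZero R] [Field F] [Algebra R F] (ℓ n d : ℕ)

/-- `T^𝖹(n, d)_R = Γ̃^d M_n(𝖹_R)`. -/
noncomputable abbrev TZR : Subalgebra R (((zig R ℓ).mat n).TPow d) := ((zig R ℓ).mat n).modPow d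

/-- `T^𝖹(n, d) = F ⊗_R T^𝖹(n, d)_R`. -/
abbrev TZ : Type _ := F ⊗[R] TZR R ℓ n d

/-- `𝒯_i^d = F ⊗_R Γ̃^d Col_n(ΠT(i)_R)`. -/
abbrev TT (i : Fin (ℓ + 1)) : Type _ := Ext R F (((piT R ℓ i).col n).modPow d)

/-- The part of parity `δ` of `T^𝖹(n, d)`. -/
noncomputable def TZgr (δ : ZMod 2) : Submodule F (TZ R F ℓ n d) :=
  (((zig R ℓ).mat n).gr d δ).baseChange F

/-- The parity involution of `T^𝖹(n, d)`. -/
noncomputable def TZinv : TZ R F ℓ n d →ₐ[F] TZ R F ℓ n d :=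
  Algebra.TensorProduct.map (AlgHom.id F F) (((zig R ℓ).mat n).parInv d)

/-- The part of parity `δ` of `𝒯_i^d`. -/
noncomputable def TTgr (i : Fin (ℓ + 1)) (δ : ZMod 2) : Submodule F (TT R F ℓ n d i) :=
  show Submodule F (F ⊗[R] ((piT R ℓ i).col n).modPow d) from
    (((piT R ℓ i).col n).gr d δ).baseChange F

theorem TZinv_gr (δ : ZMod 2) (x : TZ R F ℓ n d) (hx : x ∈ TZgr R F ℓ n d δ) :
    TZinv R F ℓ n d x = sg F δ • x := by
  obtain ⟨t, rfl⟩ := hx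
  induction t using TensorProduct.induction_on with
  | zero => simp
  | tmul r y =>
    obtain ⟨y, hy⟩ := y
    have h : ((zig R ℓ).mat n).parInv d y = sg R δ • y := Subtype.ext <| funext fun b => by
      change sg R (∑ k, ((zig R ℓ).mat n).cal.par (b k)) * y.1 b = sg R δ * y.1 b
      by_cases h0 : y.1 b = 0
      · rw [h0, mul_zero, mul_zero]
      · rw [hy b h0]
    change Algebra.TensorProduct.map (AlgHom.id F F) (((zig R ℓ).mat n).parInv d) (r ⊗ₜ y) =
      sg F δ • (r ⊗ₜ[R] y)
    rw [Algebra.TensorProduct.map_tmul, h, TensorProduct.tmul_smul, ← sg_algebraMap R F,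
      algebraMap_smul]
    rfl
  | add x y hx hy => rw [map_add, map_add, hx, hy, smul_add]

/-- The coordinates of `η_μ`: the sum of all words that contain, for all `i` and `r`, the letter
`ξ_{r,r}^{e_i}` exactly `μ^(i)_r` times, and no other letters. This is the product
`η_{μ^(0)}^{e_0} * ⋯ * η_{μ^(ℓ)}^{e_ℓ}`. -/
noncomputable def etaFun (μ : MComp ℓ n) : (Fin d → Fin n × Fin n × ZPath ℓ) → R :=
  fun b => if (∀ k, ∃ i r, b k = (r, r, ZPath.e i)) ∧
    ∀ i r, Fintype.card {k // b k = (r, r, ZPath.e i)} = μ i r then 1 else 0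

theorem etaFun_mem (μ : MComp ℓ n) : etaFun R ℓ n d μ ∈ ((zig R ℓ).mat n).cal.modDiv R d := by
  rw [Calib.mem_modDiv]
  constructor
  · intro σ b
    have h1 : etaFun R ℓ n d μ (b ∘ σ) = etaFun R ℓ n d μ b := by
      unfold etaFun
      refine if_congr (and_congr ?_ ?_) rfl rfl
      · exact σ.forall_congr_left.trans (by simp)
      · refine forall_congr' fun i => forall_congr' fun r => ?_
        have : Fintype.card {k // (b ∘ σ) k = (r, r, ZPath.e i)} =
            Fintype.card {k // b k = (r, r, ZPath.e i)} :=
          Fintype.card_congr (σ.subtypeEquiv fun a => by simp)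
        rw [this]
    rw [h1]
    by_cases h0 : etaFun R ℓ n d μ b = 0
    · simp [h0]
    · have hb : ∀ k, ∃ i r, b k = (r, r, ZPath.e i) := by
        by_contra h'
        exact h0 (if_neg fun h => h' h.1)
      have : permKoszul σ (((zig R ℓ).mat n).cal.par ∘ b) = 0 := by
        rw [permKoszul, Finset.card_eq_zero, Finset.filter_eq_empty_iff]
        rintro ⟨k, l⟩ _ ⟨_, _, h3, _⟩
        obtain ⟨i, r, h⟩ := hb k
        change ((((b k).2.2.deg : Fin 3) : ℕ) : ZMod 2) = 1 at h3
        rw [h] at h3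
        exact absurd h3 (by simp [ZPath.e, ZPath.deg])
      simp [this]
  · intro b
    by_cases h0 : etaFun R ℓ n d μ b = 0
    · simp [h0]
    · have hb : ∀ k, ∃ i r, b k = (r, r, ZPath.e i) := by
        by_contra h'
        exact h0 (if_neg fun h => h' h.1)
      have : ((zig R ℓ).mat n).cal.cFact b = 1 := by
        unfold Calib.cFact
        refine Finset.prod_eq_one fun β _ => ?_
        split_ifs with hβ
        · have : IsEmpty {k // b k = β} := ⟨by
            rintro ⟨k, rfl⟩
            obtain ⟨i, r, h⟩ := hb k
            change (b k).2.2.deg = 2 at hβ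
            rw [h] at hβ
            exact absurd hβ (by simp [ZPath.e, ZPath.deg])⟩
          simp
        · rfl
      simp [this]

/-- The weight idempotent `η_μ` of `T^𝖹(n, d)`. -/
noncomputable def eta (μ : MComp ℓ n) : TZ R F ℓ n d := 1 ⊗ₜ ⟨etaFun R ℓ n d μ, etaFun_mem R ℓ n d μ⟩

/-- The superalgebra `T^𝖹(n, d)` with its standard idempotents `η_λ`, `λ ∈ Λ_+^I(n, d)`, and the
partial order `≤_I`. -/
noncomputable def TZdata : HWData F (TZ R F ℓ n d) (MPart ℓ n d) where
  gr := TZgr R F ℓ n d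
  inv := TZinv R F ℓ n d
  inv_gr := TZinv_gr R F ℓ n d
  e := fun l => eta R F ℓ n d l.1
  lt := fun l m => leI l.1 m.1 ∧ l ≠ m

/-- The anti-involution `τ_{n,d}` of `T^𝖹(n, d)`, `η_{r,s}^b ↦ η_{s,r}^{τ(b)}`. -/
noncomputable def TZtau (ℓ n d : ℕ) : TZ R F ℓ n d →ₗ[F] TZ R F ℓ n d :=
  (((zig R ℓ).mat n).tau (matTau_monomial R ℓ n) d).baseChange F

/-- `𝒯_i^d` is a tilting supermodule over `T^𝖹(n, d)`. -/
def TTIsTilting (i : Fin (ℓ + 1)) : Prop :=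
  (TZdata R F ℓ n d).IsTilting (TTgr R F ℓ n d i)

/-- `μ ∈ Λ^I(n, d)` is a weight of `𝒯_i^d`: the weight space `η_μ 𝒯_i^d` is not zero. -/
def TTIsWeight (i : Fin (ℓ + 1)) (μ : MComp ℓ n) : Prop :=
  IsMComp d μ ∧ ∃ v : TT R F ℓ n d i, eta R F ℓ n d μ • v ≠ 0

/-- `μ` is a maximal weight of `𝒯_i^d`. -/
def TTIsMaxWeight (i : Fin (ℓ + 1)) (μ : MComp ℓ n) : Prop :=
  TTIsWeight R F ℓ n d i μ ∧ ∀ ν, TTIsWeight R F ℓ n d i ν → leI μ ν → ν = μ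

/-- There is an even isomorphism of `T^𝖹(n, d)`-supermodules `𝒯_i^d ≃ T^𝖹(n, d) η_μ`. -/
def TTIsoProj (i : Fin (ℓ + 1)) (μ : MComp ℓ n) : Prop :=
  ∃ φ : TT R F ℓ n d i ≃ₗ[TZ R F ℓ n d] (Ideal.span {eta R F ℓ n d μ} : Ideal (TZ R F ℓ n d)),
    ∀ δ, ∀ v ∈ TTgr R F ℓ n d i δ, (φ v : TZ R F ℓ n d) ∈ TZgr R F ℓ n d δ

/-- The form `B` on `𝒯_i^d` is even, nondegenerate and `τ_{n,d}`-contravariant. Equivalently,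
`v ↦ B(v, -)` is an even isomorphism from `𝒯_i^d` to its `τ_{n,d}`-dual. -/
def TTIsContra (i : Fin (ℓ + 1)) (B : LinearMap.BilinForm F (TT R F ℓ n d i)) : Prop :=
  (∀ δ δ', δ ≠ δ' → ∀ v ∈ TTgr R F ℓ n d i δ, ∀ w ∈ TTgr R F ℓ n d i δ', B v w = 0) ∧
    Function.Bijective B ∧
    ∀ δ δ', ∀ x ∈ TZgr R F ℓ n d δ, ∀ v ∈ TTgr R F ℓ n d i δ', ∀ w,
      B (x • v) w = sg F (δ * δ') * B v (TZtau R F ℓ n d x • w)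

end TZ

end ZigSchur

/-! The argument starts from the two-step filtration of `ΠT(i)`. The vectors `a_{i,i-1}` and
`c_{i-1}` (for `i = 0` only `v_0`) span a submodule; call them up letters. For `i > 0` the quotient
is spanned by the classes of `e_{i-1}` and, when `i > 1`, `a_{i-2,i-1}`. Hence the orbit sums of
words with at least `t` up letters span submodules of `𝒯_i^d` (`upMod`). The layer with exactly `t`
up letters is generated by the orbit sum of `gen t`: the letters `a_{i,i-1}` in the rows `1, …, t`
and `d - t` copies of `e_{i-1}` in row `1`. Its weight `λ_t` has `(1^t)` in colour `i` and `(d-t)`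
in colour `i - 1`, and no weight above `λ_t` occurs in the layer (`wt_le_gen`).

The layer is therefore a quotient of `Δ(λ_t)`, and the work lies in showing that nothing is lost
(`mul_eta_mem_ideal`). Modulo the ideal `T^{>λ_t}`, the space `T η` is spanned by orbit sums `y_b`
of matrix words whose columns are the coloured rows of `gen t`. Three relations cut these down to
one for each basis vector of the layer. A letter that does not lower the colour by its length
factors through a higher colour, so `y_b` lies in the ideal (`MY_mem_ideal_of_bad`). Merging two of
the first `t` rows into one gives a weight that strictly dominates, and the product of orbit sums
through it shows that exchanging two of the first `t` places changes `y_b` only by a sign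
(`IsLift.swap_mem`). The same product kills a word that would produce a repeated odd letter
(`IsLift.mem_of_eq`). The remaining orbit sums act on the generator by signs times distinct basis
vectors, hence are independent (`mul_eta_mem`).

These products come from one formula: up to a product of factorials, `y_q v` is the symmetrization
of `q v` for a single word `q` (`smul_tAct_y`). Factorials, and the number two, are cancelled over
`R`, a domain of characteristic zero, before scalars are extended to `F`. For this reason the
relations hold over every `F`.

Costandard filtrations follow by duality. The symmetry of `ΠT(i)` that exchanges `e_{i-1}` and
`c_{i-1}` and fixes the arrows gives a contravariant form on the tensor power. It exchanges the two
kinds of even letters, so on the modified divided power the form is divisible by `d!` and the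
quotient has a monomial Gram matrix with entries `±1` (`tform_ys`); it stays nondegenerate over `F`.
Orthogonal complements turn a chain with standard factors into one with costandard factors
(`exists_superIso_nabla`, `isTilting_of_chain`).

The weight statement is the case `t = d` of `wt_le_gen`: the weight `ι_i(1^d)` is even the greatest
one. For `i > 0` and `t = 0` the generator `e_{i-1} ⊗ ⋯ ⊗ e_{i-1}` in row `1` satisfies no relation
beyond its weight, so `T η` maps isomorphically onto `𝒯_i^d` (`ofProj_bijective`). -/

namespace ZigSchur

/-! ### Orbit sums in modified divided powers -/

section OrbitSums

open scoped Classical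

variable {B R : Type*} [CommRing R] {d : ℕ}

/-- The place permutation action on tensors. -/
noncomputable def Calib.act (κ : Calib B) (σ : Equiv.Perm (Fin d)) (w : (Fin d → B) → R) :
    (Fin d → B) → R :=
  fun b => (-1) ^ permKoszul σ (κ.par ∘ b) * w (b ∘ σ)

/-- The tensor with the single word `b`. -/
noncomputable def word (R : Type*) [CommRing R] (b : Fin d → B) : (Fin d → B) → R := Pi.single b 1

theorem word_apply (b b' : Fin d → B) : word R b b' = if b' = b then 1 else 0 :=
  Pi.single_apply b 1 b'

/-- The calibration in which the roles of `𝔞` and `𝔠` are exchanged. -/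
def Calib.swap (κ : Calib B) : Calib B where
  par := κ.par
  isC := fun b => κ.par b = 0 ∧ ¬ κ.isC b
  par_of_isC := fun _ h => h.1

theorem sign_mul_self (n : ℕ) : ((-1 : R) ^ n) * (-1) ^ n = 1 := by
  rw [← mul_pow]; simp

theorem Calib.act_eq_of_inv (κ : Calib B) {w : (Fin d → B) → R} (σ : Equiv.Perm (Fin d))
    (hw : ∀ (σ : Equiv.Perm (Fin d)) (b : Fin d → B),
      w (b ∘ σ) = (-1) ^ permKoszul σ (κ.par ∘ b) * w b) : κ.act σ w = w := by
  funext b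
  rw [Calib.act, hw, ← mul_assoc, sign_mul_self, one_mul]

theorem Calib.act_smul (κ : Calib B) (σ : Equiv.Perm (Fin d)) (r : R) (w : (Fin d → B) → R) :
    κ.act σ (r • w) = r • κ.act σ w := by
  funext b; simp only [Calib.act, Pi.smul_apply, smul_eq_mul]; ring

theorem Calib.act_add (κ : Calib B) (σ : Equiv.Perm (Fin d)) (v w : (Fin d → B) → R) :
    κ.act σ (v + w) = κ.act σ v + κ.act σ w := by
  funext b; simp only [Calib.act, Pi.add_apply]; ring

/-- Reindexing both sums by `σ` leaves only signs to compare. Where the structure constants do not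
vanish the parities add up, and `sign_perm_mul` applies. -/
theorem tAct_act {BA BV : Type*} [Fintype BA] [Fintype BV] (cA : Calib BA) (cV : Calib BV)
    (K : BA → BV → BV → R) (hpar : ∀ a c b, K a c b ≠ 0 → cV.par b = cA.par a + cV.par c)
    (σ : Equiv.Perm (Fin d)) (x : (Fin d → BA) → R) (v : (Fin d → BV) → R) :
    tAct cA cV K (cA.act σ x) (cV.act σ v) = cV.act σ (tAct cA cV K x v) := by
  funext b
  simp only [tAct, Calib.act, Finset.mul_sum]
  rw [← Equiv.sum_comp (Equiv.arrowCongr σ.symm (Equiv.refl BA))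
    (fun a => ∑ c, (-1) ^ permKoszul σ (cV.par ∘ b) * (x a * v c *
      ((-1) ^ koszul (cA.par ∘ a) (cV.par ∘ c) * ∏ k, K (a k) (c k) ((b ∘ σ) k))))]
  refine Finset.sum_congr rfl fun a _ => ?_
  rw [← Equiv.sum_comp (Equiv.arrowCongr σ.symm (Equiv.refl BV))
    (fun c => (-1) ^ permKoszul σ (cV.par ∘ b) * (x _ * v c *
      ((-1) ^ koszul (cA.par ∘ _) (cV.par ∘ c) * ∏ k, K _ (c k) ((b ∘ σ) k))))]
  refine Finset.sum_congr rfl fun c _ => ?_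
  change _ = (-1) ^ permKoszul σ (cV.par ∘ b) * (x (a ∘ σ) * v (c ∘ σ) *
    ((-1) ^ koszul (cA.par ∘ a ∘ σ) (cV.par ∘ c ∘ σ) * ∏ k, K ((a ∘ σ) k) ((c ∘ σ) k) ((b ∘ σ) k)))
  have hprod : ∏ k, K ((a ∘ σ) k) ((c ∘ σ) k) ((b ∘ σ) k) = ∏ k, K (a k) (c k) (b k) :=
    Equiv.prod_comp σ fun k => K (a k) (c k) (b k)
  rw [hprod]
  by_cases h0 : ∏ k, K (a k) (c k) (b k) = 0
  · simp [h0]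
  · have hb : cV.par ∘ b = cA.par ∘ a + cV.par ∘ c := by
      ext k
      exact hpar _ _ _ (factor_ne_zero h0 k)
    have h1 := sign_perm_mul (R := R) σ (cA.par ∘ a) (cV.par ∘ c)
    rw [← hb] at h1
    simp only [Function.comp_assoc] at h1
    have h2 := sign_mul_self (R := R) (koszul (cA.par ∘ a ∘ σ) (cV.par ∘ c ∘ σ))
    have h3 := sign_mul_self (R := R) (koszul (cA.par ∘ a) (cV.par ∘ c))
    generalize ((-1 : R) ^ koszul (cA.par ∘ a ∘ σ) (cV.par ∘ c ∘ σ)) = e1 at *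
    generalize ((-1 : R) ^ koszul (cA.par ∘ a) (cV.par ∘ c)) = e2 at *
    linear_combination (x (a ∘ σ) * v (c ∘ σ) * ∏ k, K (a k) (c k) (b k)) * (e1 * e2 * h1 +
      (-1) ^ permKoszul σ (cV.par ∘ b) * e1 * h3 -
      (-1) ^ permKoszul σ (cA.par ∘ a) * (-1) ^ permKoszul σ (cV.par ∘ c) * e2 * h2)

theorem tAct_sum_left {ι BA BV : Type*} [Fintype BA] [Fintype BV] {cA : Calib BA} {cV : Calib BV}
    {K : BA → BV → BV → R} (s : Finset ι) (x : ι → (Fin d → BA) → R)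
    (v : (Fin d → BV) → R) : tAct cA cV K (∑ j ∈ s, x j) v = ∑ j ∈ s, tAct cA cV K (x j) v := by
  induction s using Finset.induction_on with
  | empty => simp [tAct_zero_left]
  | insert a s ha ih => rw [Finset.sum_insert ha, Finset.sum_insert ha, tAct_add_left, ih]

theorem Calib.mark_comp_eq_iff (κ : Calib B) (b : Fin d → B) (σ : Equiv.Perm (Fin d)) :
    κ.mark b ∘ σ = κ.mark b ↔ ∀ k, k ≠ σ k → κ.isC (b k) ∧ b k = b (σ k) := by
  constructor
  · intro hσ k hk
    exact κ.mark_eq b hk (congrFun hσ k).symm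
  · intro hσ
    funext k
    by_cases hk : k = σ k
    · simp [← hk]
    · obtain ⟨h1, h2⟩ := hσ k hk
      simp only [Function.comp_apply, Calib.mark]
      rw [← h2, if_pos h1, if_pos h1]

/-- The product of factorials is the order of the stabilizer of the marked word, so it only sees
which pairs of places carry equal letters of `𝔠`. This compares words over different alphabets. -/
theorem Calib.cFact_congr {B' : Type*} [Fintype B] [Fintype B'] (κ : Calib B) (κ' : Calib B')
    (b : Fin d → B) (b' : Fin d → B')
    (h : ∀ k l, k ≠ l → ((κ.isC (b k) ∧ b k = b l) ↔ (κ'.isC (b' k) ∧ b' k = b' l))) :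
    κ.cFact b = κ'.cFact b' := by
  rw [← κ.card_mark, ← κ'.card_mark]
  refine Fintype.card_congr (Equiv.subtypeEquivRight fun σ => ?_)
  rw [κ.mark_comp_eq_iff, κ'.mark_comp_eq_iff]
  exact forall_congr' fun k => forall_congr' fun hk => h k (σ k) hk

/-- The rearrangement relation on words. -/
def wordSetoid (B : Type*) (d : ℕ) : Setoid (Fin d → B) where
  r := fun b b' => ∃ σ : Equiv.Perm (Fin d), b ∘ σ = b'
  iseqv := ⟨fun b => ⟨1, by simp⟩,
    fun {b b'} h => by obtain ⟨σ, rfl⟩ := h; exact ⟨σ⁻¹, by ext; simp⟩,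
    fun {b b' b''} h h' => by
      obtain ⟨σ, rfl⟩ := h
      obtain ⟨τ, rfl⟩ := h'
      exact ⟨σ * τ, by ext; simp⟩⟩

/-- A chosen rearrangement of a word, depending only on its orbit. -/
noncomputable abbrev rep (q : Quotient (wordSetoid B d)) : Fin d → B := q.out

theorem exists_rep (b : Fin d → B) :
    ∃ (q : Quotient (wordSetoid B d)) (σ : Equiv.Perm (Fin d)), rep q ∘ σ = b :=
  ⟨Quotient.mk _ b, Quotient.exact (s := wordSetoid B d) (Quotient.out_eq _)⟩

variable [Fintype B]

/-- Odd letters occur at most once and contribute a factor one; the repeated even letters are shared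
out between the calibration and its swap. -/
theorem Calib.card_stab (κ : Calib B) {b : Fin d → B} (hb : κ.Seq b) :
    Fintype.card {σ : Equiv.Perm (Fin d) // b ∘ σ = b} = κ.swap.cFact b * κ.cFact b := by
  rw [DomMulAct.stabilizer_card]
  unfold Calib.cFact
  rw [← Finset.prod_mul_distrib]
  refine Finset.prod_congr rfl fun β _ => ?_
  by_cases h1 : κ.isC β
  · simp [Calib.swap, h1]
  · by_cases h2 : κ.par β = 0
    · simp [Calib.swap, h1, h2]
    · have : Fintype.card {k // b k = β} ≤ 1 := by
        rw [Fintype.card_le_one_iff]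
        rintro ⟨k, hk⟩ ⟨l, hl⟩
        by_contra hkl
        exact h2 (hk ▸ hb k l (fun h => hkl (by simp [h])) (hk.trans hl.symm))
      simp only [Calib.swap, h1, h2, if_false, false_and, mul_one]
      interval_cases Fintype.card {k // b k = β} <;> rfl

/-- Symmetrizing a word produces each of its rearrangements as often as the stabilizer has elements.
The element `y` contains only the `𝔠`-half of this order, so the `𝔞`-half remains as a scalar. -/
theorem Calib.sum_act_word (κ : Calib B) {b : Fin d → B} (hb : κ.Seq b) :
    ∑ σ : Equiv.Perm (Fin d), κ.act σ (word R b) = (κ.swap.cFact b : R) • κ.y R b := by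
  funext b'
  rw [Finset.sum_apply, Pi.smul_apply]
  simp only [Calib.act, Calib.y, word_apply, smul_eq_mul]
  by_cases h : ∃ τ : Equiv.Perm (Fin d), b ∘ τ = b'
  · rw [if_pos h]
    obtain ⟨τ, rfl⟩ := h
    have h1 : ∀ σ : Equiv.Perm (Fin d), (-1 : R) ^ permKoszul σ (κ.par ∘ b ∘ τ) *
        (if (b ∘ τ) ∘ σ = b then 1 else 0) =
        (-1) ^ (inversions κ.par b + inversions κ.par (b ∘ τ)) *
          (if (b ∘ τ) ∘ σ = b then 1 else 0) := by
      intro σ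
      split_ifs with hσ
      · have := sign_inversions (R := R) κ.par (b ∘ τ) (hb.comp τ) σ
        rw [hσ] at this
        rw [pow_add, this, mul_one, mul_one, mul_assoc, sign_mul_self, mul_one]
      · simp
    rw [Finset.sum_congr rfl fun σ _ => h1 σ, ← Finset.mul_sum, Finset.sum_boole]
    have h2 : (Finset.univ.filter fun σ : Equiv.Perm (Fin d) => (b ∘ τ) ∘ σ = b).card =
        κ.swap.cFact b * κ.cFact b := by
      rw [← κ.card_stab hb, ← Fintype.card_subtype]
      refine Fintype.card_congr ((Equiv.mulLeft τ).subtypeEquiv fun σ => ?_)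
      simp [Function.comp_assoc]
    rw [h2]
    push_cast
    ring
  · rw [if_neg h, mul_zero]
    refine Finset.sum_eq_zero fun σ _ => ?_
    rw [if_neg, mul_zero]
    intro hσ
    exact h ⟨σ⁻¹, by rw [← hσ]; funext k; simp⟩

theorem Calib.cFact_ne_zero [IsDomain R] [CharZero R] (κ : Calib B) (b : Fin d → B) :
    (κ.cFact b : R) ≠ 0 := by
  rw [Nat.cast_ne_zero]
  refine Finset.prod_ne_zero_iff.mpr fun β _ => ?_
  split_ifs
  · exact Nat.factorial_ne_zero _
  · exact one_ne_zero

theorem Calib.y_comp (κ : Calib B) {b : Fin d → B} (hb : κ.Seq b) (σ : Equiv.Perm (Fin d)) :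
    κ.y R (b ∘ σ) = (-1 : R) ^ permKoszul σ (κ.par ∘ b) • κ.y R b := by
  funext b'
  rw [Pi.smul_apply]
  have : (∃ τ : Equiv.Perm (Fin d), (b ∘ σ) ∘ τ = b') ↔ ∃ τ : Equiv.Perm (Fin d), b ∘ τ = b' :=
    ⟨fun ⟨τ, h⟩ => ⟨σ * τ, h⟩, fun ⟨τ, h⟩ => ⟨σ⁻¹ * τ, by rw [← h]; funext k; simp⟩⟩
  simp only [Calib.y, this]
  split_ifs
  · rw [κ.cFact_comp, pow_add, sign_inversions κ.par b hb, smul_eq_mul, pow_add]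
    ring
  · simp

/-- The element `y_b`, understood as zero if an odd letter is repeated in `b`. -/
noncomputable def Calib.ys (R : Type*) [CommRing R] (κ : Calib B) (b : Fin d → B) :
    κ.modDiv R d :=
  if h : κ.Seq b then ⟨κ.y R b, Submodule.subset_span ⟨b, h, rfl⟩⟩ else 0

theorem Calib.ys_of_seq (κ : Calib B) {b : Fin d → B} (h : κ.Seq b) :
    (κ.ys R b : (Fin d → B) → R) = κ.y R b := by
  rw [Calib.ys, dif_pos h]

theorem Calib.ys_of_not_seq (κ : Calib B) {b : Fin d → B} (h : ¬ κ.Seq b) : κ.ys R b = 0 := by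
  rw [Calib.ys, dif_neg h]

theorem sign_cases (n : ℕ) : (-1 : R) ^ n = 1 ∨ (-1 : R) ^ n = -1 := neg_one_pow_eq_or R n

theorem Calib.ys_comp (κ : Calib B) (b : Fin d → B) (σ : Equiv.Perm (Fin d)) :
    ∃ ε : R, (ε = 1 ∨ ε = -1) ∧ κ.ys R (b ∘ σ) = ε • κ.ys R b := by
  by_cases h : κ.Seq b
  · refine ⟨_, sign_cases (permKoszul σ (κ.par ∘ b)), Subtype.ext ?_⟩
    rw [Submodule.coe_smul, κ.ys_of_seq h, κ.ys_of_seq (h.comp σ), κ.y_comp h]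
  · refine ⟨1, Or.inl rfl, ?_⟩
    rw [κ.ys_of_not_seq h, κ.ys_of_not_seq, smul_zero]
    intro h'
    apply h
    have := h'.comp σ⁻¹
    rwa [show (b ∘ σ) ∘ (σ⁻¹ : Equiv.Perm (Fin d)) = b by funext k; simp] at this

theorem Calib.y_self (κ : Calib B) (b : Fin d → B) : κ.y R b b = κ.cFact b := by
  rw [Calib.y, if_pos ⟨1, rfl⟩, pow_add, sign_mul_self, mul_one]

variable [IsDomain R] [CharZero R]

/-- The coefficient of `y_b`. -/
noncomputable def Calib.coord (R : Type*) [CommRing R] [IsDomain R] [CharZero R] (κ : Calib B)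
    (b : Fin d → B) : κ.modDiv R d →ₗ[R] R where
  toFun := fun w => (((κ.mem_modDiv w.1).mp w.2).2 b).choose
  map_add' := fun v w => by
    -- The quotients are chosen one by one; linearity holds because they are unique, the factorial
    -- being nonzero in `R`.
    refine mul_left_cancel₀ (κ.cFact_ne_zero (R := R) b) ?_
    rw [mul_add, ← (((κ.mem_modDiv v.1).mp v.2).2 b).choose_spec,
      ← (((κ.mem_modDiv w.1).mp w.2).2 b).choose_spec,
      ← (((κ.mem_modDiv (v + w).1).mp (v + w).2).2 b).choose_spec]
    rfl
  map_smul' := fun r w => by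
    refine mul_left_cancel₀ (κ.cFact_ne_zero (R := R) b) ?_
    rw [← (((κ.mem_modDiv (r • w).1).mp (r • w).2).2 b).choose_spec, smul_eq_mul,
      RingHom.id_apply, mul_left_comm, ← (((κ.mem_modDiv w.1).mp w.2).2 b).choose_spec]
    rfl

theorem Calib.coord_spec (κ : Calib B) (b : Fin d → B) (w : κ.modDiv R d) :
    (κ.cFact b : R) * κ.coord R b w = w.1 b :=
  (((κ.mem_modDiv w.1).mp w.2).2 b).choose_spec.symm

theorem Calib.coord_eq_iff (κ : Calib B) (b : Fin d → B) (w : κ.modDiv R d) (r : R) :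
    κ.coord R b w = r ↔ w.1 b = κ.cFact b * r := by
  rw [← κ.coord_spec]
  exact (mul_right_inj' (κ.cFact_ne_zero b)).symm

theorem Calib.coord_comp (κ : Calib B) (b : Fin d → B) (σ : Equiv.Perm (Fin d))
    (w : κ.modDiv R d) :
    κ.coord R (b ∘ σ) w = (-1) ^ permKoszul σ (κ.par ∘ b) * κ.coord R b w := by
  rw [Calib.coord_eq_iff, κ.cFact_comp, ((κ.mem_modDiv w.1).mp w.2).1, ← κ.coord_spec]
  ring

theorem Calib.coord_of_not_seq (κ : Calib B) {b : Fin d → B} (hb : ¬ κ.Seq b)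
    (w : κ.modDiv R d) : κ.coord R b w = 0 := by
  rw [Calib.coord_eq_iff, mul_zero]
  exact κ.eq_zero_of_not_seq _ ((κ.mem_modDiv w.1).mp w.2).1 b hb

theorem Calib.coord_ys_self (κ : Calib B) {b : Fin d → B} (hb : κ.Seq b) :
    κ.coord R b (κ.ys R b) = 1 := by
  rw [Calib.coord_eq_iff, κ.ys_of_seq hb, κ.y_self, mul_one]

theorem Calib.coord_ys_of_ne (κ : Calib B) {b b' : Fin d → B}
    (h : ¬ ∃ σ : Equiv.Perm (Fin d), b' ∘ σ = b) : κ.coord R b (κ.ys R b') = 0 := by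
  rw [Calib.coord_eq_iff, mul_zero]
  by_cases hb : κ.Seq b'
  · rw [κ.ys_of_seq hb, Calib.y, if_neg h]
  · rw [κ.ys_of_not_seq hb]; rfl

/-- By invariance a tensor is zero once its coordinates at one representative of every orbit are
zero. Apply this to the difference of the two sides; orbits with a repeated odd letter contribute
nothing to either. -/
theorem Calib.eq_sum_coord (κ : Calib B) (w : κ.modDiv R d) :
    w = ∑ q : Quotient (wordSetoid B d), κ.coord R (rep q) w • κ.ys R (rep q) := by
  have key : ∀ w' : κ.modDiv R d, (∀ q : Quotient (wordSetoid B d), κ.coord R (rep q) w' = 0) →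
      w' = 0 := by
    intro w' h
    refine Subtype.ext (funext fun b => ?_)
    obtain ⟨q, σ, rfl⟩ := exists_rep b
    rw [← κ.coord_spec, κ.coord_comp, h, mul_zero, mul_zero]
    rfl
  rw [← sub_eq_zero]
  refine key _ fun q => ?_
  rw [map_sub, map_sum, Finset.sum_eq_single q]
  · rw [map_smul, smul_eq_mul, sub_eq_zero]
    by_cases hq : κ.Seq (rep q)
    · rw [κ.coord_ys_self hq, mul_one]
    · rw [κ.coord_of_not_seq hq, zero_mul]
  · intro q' _ hq'
    rw [map_smul, κ.coord_ys_of_ne, smul_zero]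
    rintro h
    apply hq'
    rw [← Quotient.out_eq q', ← Quotient.out_eq q]
    exact Quotient.sound h
  · simp

/-! ### Products as symmetrizations -/

section Factor

variable {BA BV : Type*} [Fintype BA] [Fintype BV] {cA : Calib BA} {cV : Calib BV}
  {K : BA → BV → BV → R}

/-- The product of `y_q` with an invariant tensor. -/
theorem smul_tAct_y (hpar : ∀ a c b, K a c b ≠ 0 → cV.par b = cA.par a + cV.par c)
    {q : Fin d → BA} (hq : cA.Seq q) {v : (Fin d → BV) → R} (hv : v ∈ cV.modDiv R d) :
    (cA.swap.cFact q : R) • tAct cA cV K (cA.y R q) v =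
      ∑ σ : Equiv.Perm (Fin d), cV.act σ (tAct cA cV K (word R q) v) := by
  -- The scalar turns `y_q` into the sum of all `σ q`, and since `v` is fixed by `σ`, `(σ q) v = (σ
  -- q)(σ v) = σ (q v)`.
  rw [← tAct_smul_left, ← cA.sum_act_word hq, tAct_sum_left]
  refine Finset.sum_congr rfl fun σ _ => ?_
  rw [← tAct_act cA cV K hpar, cV.act_eq_of_inv σ ((cV.mem_modDiv v).mp hv).1]

end Factor

end OrbitSums


/-! ### Standard and costandard filtrations from a chain of submodules -/

section HighestWeight

variable {F T L : Type*} [Field F] [Ring T] [Algebra F T]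

theorem zmod2_add_self (δ : ZMod 2) : δ + δ = 0 := by revert δ; decide

theorem sg_mul_self (δ : ZMod 2) : sg F δ * sg F δ = 1 := by
  rw [sg, ← mul_pow]; simp

theorem sg_zero : sg F 0 = 1 := by simp [sg]

/-- The gradings of `T` are compatible with the product, and the `e l` are even idempotents. -/
structure HWData.Super (H : HWData F T L) : Prop where
  split : ∀ (δ : ZMod 2) (x : T), ∃ a ∈ H.gr δ, ∃ b ∈ H.gr (δ + 1), x = a + b
  mul_mem : ∀ {δ δ' : ZMod 2} {x y : T}, x ∈ H.gr δ → y ∈ H.gr δ' → x * y ∈ H.gr (δ + δ')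
  e_mem : ∀ l, H.e l ∈ H.gr 0
  e_mul : ∀ l, H.e l * H.e l = H.e l

variable {V : Type*} [AddCommGroup V] [Module F V] [Module T V]

/-- `V` is a supermodule. -/
structure HWData.SuperMod (H : HWData F T L) (grV : ZMod 2 → Submodule F V) : Prop where
  split : ∀ (δ : ZMod 2) (v : V), ∃ a ∈ grV δ, ∃ b ∈ grV (δ + 1), v = a + b
  disj : ∀ {δ : ZMod 2} {v : V}, v ∈ grV δ → v ∈ grV (δ + 1) → v = 0
  smul_mem : ∀ {δ δ' : ZMod 2} {x : T} {v : V}, x ∈ H.gr δ → v ∈ grV δ' → x • v ∈ grV (δ + δ')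

/-- `τ` is an even involutive super anti-automorphism that fixes the `e l`. -/
structure HWData.AntiInv (H : HWData F T L) (τ : T →ₗ[F] T) : Prop where
  gr : ∀ {δ : ZMod 2} {x : T}, x ∈ H.gr δ → τ x ∈ H.gr δ
  invol : ∀ x, τ (τ x) = x
  mul : ∀ {δ δ' : ZMod 2} {x y : T}, x ∈ H.gr δ → y ∈ H.gr δ' →
    τ (x * y) = sg F (δ * δ') • (τ y * τ x)
  e : ∀ l, τ (H.e l) = H.e l

/-- `B` is an even nondegenerate contravariant form. -/
structure HWData.Contra (H : HWData F T L) (τ : T →ₗ[F] T) (grV : ZMod 2 → Submodule F V)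
    (B : LinearMap.BilinForm F V) : Prop where
  even : ∀ {δ δ' : ZMod 2}, δ ≠ δ' → ∀ {v w : V}, v ∈ grV δ → w ∈ grV δ' → B v w = 0
  bij : Function.Bijective B
  contra : ∀ {δ δ' : ZMod 2} {x : T} {v : V}, x ∈ H.gr δ → v ∈ grV δ' → ∀ w,
    B (x • v) w = sg F (δ * δ') * B v (τ x • w)

variable (H : HWData F T L)

/-- The automorphism `x ↦ (-1)^(ε|x|) x`. -/
noncomputable def HWData.twist (ε : ZMod 2) : T →ₐ[F] T :=
  if ε = 0 then AlgHom.id F T else H.inv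

theorem HWData.twist_gr (ε : ZMod 2) {δ : ZMod 2} {x : T} (hx : x ∈ H.gr δ) :
    H.twist ε x = sg F (ε * δ) • x := by
  rcases zmod2_cases ε with rfl | rfl
  · simp [HWData.twist, sg_zero]
  · simp [HWData.twist, H.inv_gr δ x hx]

variable {H}

theorem HWData.Super.twist_twist (hH : H.Super) (ε : ZMod 2) (x : T) :
    H.twist ε (H.twist ε x) = x := by
  obtain ⟨a, ha, b, hb, rfl⟩ := hH.split 0 x
  simp only [map_add, H.twist_gr ε ha, H.twist_gr ε hb, map_smul, smul_smul, sg_mul_self, one_smul]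

theorem HWData.Super.twist_e (hH : H.Super) (ε : ZMod 2) (l : L) :
    H.twist ε (H.e l) = H.e l := by
  rw [H.twist_gr ε (hH.e_mem l), mul_zero, sg_zero, one_smul]

theorem HWData.ideal_induction {l : L} {P : T → Prop} (mem : ∀ m, H.lt l m → P (H.e m))
    (zero : P 0) (add : ∀ x y, P x → P y → P (x + y)) (neg : ∀ x, P x → P (-x))
    (left : ∀ a x, P x → P (a * x)) (right : ∀ a x, P x → P (x * a)) {x : T}
    (hx : x ∈ H.ideal l) : P x :=
  TwoSidedIdeal.span_induction (p := fun x _ => P x)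
    (fun x h => by obtain ⟨m, hm, rfl⟩ := h; exact mem m hm) zero
    (fun x y _ _ => add x y) (fun x _ => neg x) (fun a x _ => left a x) (fun a x _ => right a x) hx

theorem HWData.e_mem_ideal {l m : L} (h : H.lt l m) : H.e m ∈ H.ideal l :=
  TwoSidedIdeal.subset_span ⟨m, h, rfl⟩

theorem HWData.Super.twist_mem_ideal (hH : H.Super) (ε : ZMod 2) {l : L} {x : T}
    (hx : x ∈ H.ideal l) : H.twist ε x ∈ H.ideal l := by
  refine H.ideal_induction (P := fun x => H.twist ε x ∈ H.ideal l) (fun m hm => ?_) ?_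
    (fun x y hx hy => ?_) (fun x hx => ?_) (fun a x hx => ?_) (fun a x hx => ?_) hx
  · rw [hH.twist_e]; exact H.e_mem_ideal hm
  · rw [map_zero]; exact (H.ideal l).zero_mem
  · rw [map_add]; exact (H.ideal l).add_mem hx hy
  · rw [map_neg]; exact (H.ideal l).neg_mem hx
  · rw [map_mul]; exact (H.ideal l).mul_mem_left _ _ hx
  · rw [map_mul]; exact (H.ideal l).mul_mem_right _ _ hx

theorem HWData.Super.twist_mem_iff (hH : H.Super) (ε : ZMod 2) {l : L} {x : T} :
    H.twist ε x ∈ H.ideal l ↔ x ∈ H.ideal l :=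
  ⟨fun h => by simpa [hH.twist_twist] using hH.twist_mem_ideal ε h, hH.twist_mem_ideal ε⟩

theorem HWData.smul_mem_ideal {l : L} (r : F) {x : T} (hx : x ∈ H.ideal l) :
    r • x ∈ H.ideal l := by
  rw [← one_mul x, ← smul_mul_assoc]
  exact TwoSidedIdeal.mul_mem_left _ _ _ hx

theorem HWData.AntiInv.twist {τ : T →ₗ[F] T} (hτ : H.AntiInv τ) (hH : H.Super) (ε : ZMod 2)
    (x : T) : H.twist ε (τ x) = τ (H.twist ε x) := by
  obtain ⟨a, ha, b, hb, rfl⟩ := hH.split 0 x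
  simp only [map_add, H.twist_gr ε ha, H.twist_gr ε hb, map_smul, H.twist_gr ε (hτ.gr ha),
    H.twist_gr ε (hτ.gr hb)]

/-- Hiding the sign in a twist gives a formula linear in `x`, so it holds for inhomogeneous `x` as
well. -/
theorem HWData.AntiInv.mul_left {τ : T →ₗ[F] T} (hτ : H.AntiInv τ) (hH : H.Super) {δ : ZMod 2}
    {a : T} (ha : a ∈ H.gr δ) (x : T) : τ (a * x) = τ (H.twist δ x) * τ a := by
  obtain ⟨y, hy, z, hz, rfl⟩ := hH.split 0 x
  simp only [mul_add, map_add, H.twist_gr δ hy, H.twist_gr δ hz, map_smul, hτ.mul ha hy,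
    hτ.mul ha hz, add_mul, smul_mul_assoc]

theorem HWData.AntiInv.mul_right {τ : T →ₗ[F] T} (hτ : H.AntiInv τ) (hH : H.Super) {δ : ZMod 2}
    {a : T} (ha : a ∈ H.gr δ) (x : T) : τ (x * a) = τ a * τ (H.twist δ x) := by
  obtain ⟨y, hy, z, hz, rfl⟩ := hH.split 0 x
  simp only [mul_add, map_add, H.twist_gr δ hy, H.twist_gr δ hz, map_smul, hτ.mul hy ha,
    hτ.mul hz ha, add_mul, mul_smul_comm, mul_comm δ]

/-- The generators are fixed by `τ`, products are reversed up to a twist, and twists preserve the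
ideal. -/
theorem HWData.AntiInv.mem_ideal {τ : T →ₗ[F] T} (hτ : H.AntiInv τ) (hH : H.Super) {l : L} {x : T}
    (hx : x ∈ H.ideal l) : τ x ∈ H.ideal l := by
  refine H.ideal_induction (P := fun x => τ x ∈ H.ideal l) (fun m hm => ?_) ?_
    (fun x y hx hy => ?_) (fun x hx => ?_) (fun x y hy => ?_) (fun x y hy => ?_) hx
  · rw [hτ.e]; exact H.e_mem_ideal hm
  · rw [map_zero]; exact (H.ideal l).zero_mem
  · rw [map_add]; exact (H.ideal l).add_mem hx hy
  · rw [map_neg]; exact (H.ideal l).neg_mem hx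
  · obtain ⟨a, ha, b, hb, rfl⟩ := hH.split 0 x
    rw [add_mul, map_add, hτ.mul_left hH ha, hτ.mul_left hH hb, ← hτ.twist hH, ← hτ.twist hH]
    exact (H.ideal l).add_mem ((H.ideal l).mul_mem_right _ _ (hH.twist_mem_ideal _ hy))
        ((H.ideal l).mul_mem_right _ _ (hH.twist_mem_ideal _ hy))
  · obtain ⟨a, ha, b, hb, rfl⟩ := hH.split 0 x
    rw [mul_add, map_add, hτ.mul_right hH ha, hτ.mul_right hH hb, ← hτ.twist hH, ← hτ.twist hH]
    exact (H.ideal l).add_mem ((H.ideal l).mul_mem_left _ _ (hH.twist_mem_ideal _ hy))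
        ((H.ideal l).mul_mem_left _ _ (hH.twist_mem_ideal _ hy))

/-- Both submodules are stable under `T`, so only the generators need testing. This is how a missing
set of higher weights makes a layer a module over the quotient algebra. -/
theorem HWData.ideal_smul_mem {V : Type*} [AddCommGroup V] [Module T V] {l : L}
    {U U' : Submodule T V} (h : ∀ m, H.lt l m → ∀ u ∈ U, H.e m • u ∈ U') {x : T}
    (hx : x ∈ H.ideal l) {u : V} (hu : u ∈ U) : x • u ∈ U' := by
  refine H.ideal_induction (P := fun x => ∀ u ∈ U, x • u ∈ U') h (fun u _ => by simp)
    (fun x y hx hy u hu => ?_) (fun x hx u hu => ?_) (fun x y hy u hu => ?_)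
    (fun x y hy u hu => ?_) hx u hu
  · rw [add_smul]; exact U'.add_mem (hx u hu) (hy u hu)
  · rw [neg_smul]; exact U'.neg_mem (hx u hu)
  · rw [mul_smul]; exact U'.smul_mem _ (hy u hu)
  · rw [mul_smul]; exact hy _ (U.smul_mem _ hu)

theorem HWData.proj_eq_zero {l : L} {x : T} : H.proj l x = 0 ↔ x ∈ H.ideal l := by
  rw [TwoSidedIdeal.mem_iff, ← RingCon.eq]
  rfl

theorem HWData.proj_surjective (l : L) : Function.Surjective (H.proj l) :=
  RingCon.mk'_surjective _

/-- `T` maps onto `Δ(l)`, with the twist by `ε`. -/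
noncomputable def HWData.toDelta (H : HWData F T L) (l : L) (ε : ZMod 2) : T →ₗ[F] H.Delta l where
  toFun := fun x => ⟨H.proj l (H.twist ε x) * H.proj l (H.e l),
    Ideal.mul_mem_left _ _ (Ideal.subset_span rfl)⟩
  map_add' := fun x y => Subtype.ext (by
    change _ = H.proj l (H.twist ε x) * H.proj l (H.e l) + H.proj l (H.twist ε y) * H.proj l (H.e l)
    simp only [map_add, add_mul])
  map_smul' := fun r x => Subtype.ext (by
    change _ = r • (H.proj l (H.twist ε x) * H.proj l (H.e l))
    simp only [map_smul, smul_mul_assoc])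

theorem HWData.toDelta_val (l : L) (ε : ZMod 2) (x : T) :
    (H.toDelta l ε x).1 = H.proj l (H.twist ε x * H.e l) := by
  rw [map_mul]; rfl

theorem HWData.toDelta_surjective (hH : H.Super) (l : L) (ε : ZMod 2) :
    Function.Surjective (H.toDelta l ε) := by
  rintro ⟨v, hv⟩
  obtain ⟨a, ha⟩ := Ideal.mem_span_singleton'.mp hv
  obtain ⟨x, rfl⟩ := H.proj_surjective l a
  refine ⟨H.twist ε x, Subtype.ext ?_⟩
  rw [HWData.toDelta_val, hH.twist_twist, map_mul]
  exact ha

/-- The twist is an automorphism that fixes `e l` and preserves the ideal, so the kernel does not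
depend on `ε`. -/
theorem HWData.toDelta_eq_zero (hH : H.Super) (l : L) (ε : ZMod 2) (x : T) :
    H.toDelta l ε x = 0 ↔ x * H.e l ∈ H.ideal l := by
  rw [← hH.twist_mem_iff ε, map_mul, hH.twist_e, ← H.proj_eq_zero, ← HWData.toDelta_val]
  exact Subtype.ext_iff

theorem HWData.toDelta_mul (l : L) (ε : ZMod 2) (a x : T) :
    H.toDelta l ε (a * x) = H.twist ε a • H.toDelta l ε x := Subtype.ext (by
  change _ = H.proj l (H.twist ε a) * (H.toDelta l ε x).1
  rw [HWData.toDelta_val, HWData.toDelta_val, ← map_mul (H.proj l), map_mul (H.twist ε), mul_assoc])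

theorem HWData.Contra.contra' {τ : T →ₗ[F] T} (hτ : H.AntiInv τ)
    {grV : ZMod 2 → Submodule F V} {B : LinearMap.BilinForm F V} (hB : H.Contra τ grV B)
    {δ δ' : ZMod 2} {x : T} {v : V} (hx : x ∈ H.gr δ) (hv : v ∈ grV δ') (w : V) :
    B v (x • w) = sg F (δ * δ') * B (τ x • v) w := by
  rw [hB.contra (hτ.gr hx) hv, hτ.invol, ← mul_assoc, sg_mul_self, one_mul]

/-- The orthogonal complement of a homogeneous submodule. -/
def HWData.Contra.perp {τ : T →ₗ[F] T} (hτ : H.AntiInv τ) (hH : H.Super)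
    {grV : ZMod 2 → Submodule F V} {B : LinearMap.BilinForm F V} (hB : H.Contra τ grV B)
    (U : Submodule T V) (hU : IsHomogeneousSub grV U) : Submodule T V where
  carrier := {w | ∀ v ∈ U, B v w = 0}
  add_mem' := fun {x y} hx hy v hv => by rw [map_add, hx v hv, hy v hv, add_zero]
  zero_mem' := fun v _ => map_zero _
  smul_mem' := fun x w hw v hv => by
    -- Contravariance is available for homogeneous arguments only, so both the vector and the scalar
    -- are split by parity.
    obtain ⟨v₀, h0, v₁, h1, h0', h1', rfl⟩ := hU v hv
    obtain ⟨a, ha, b, hb, rfl⟩ := hH.split 0 x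
    simp only [map_add, add_smul, LinearMap.add_apply]
    rw [hB.contra' hτ ha h0, hB.contra' hτ ha h1, hB.contra' hτ hb h0, hB.contra' hτ hb h1,
      hw _ (U.smul_mem _ h0'), hw _ (U.smul_mem _ h1'), hw _ (U.smul_mem _ h0'),
      hw _ (U.smul_mem _ h1')]
    simp

theorem HWData.Contra.perp_homogeneous {τ : T →ₗ[F] T} (hτ : H.AntiInv τ) (hH : H.Super)
    {grV : ZMod 2 → Submodule F V} (hV : H.SuperMod grV) {B : LinearMap.BilinForm F V}
    (hB : H.Contra τ grV B) (U : Submodule T V) (hU : IsHomogeneousSub grV U) :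
    IsHomogeneousSub grV (hB.perp hτ hH U hU) := by
  intro w hw
  obtain ⟨a, ha, b, hb, rfl⟩ := hV.split 0 w
  rw [zero_add] at hb
  have key : ∀ v ∈ U, B v a = 0 ∧ B v b = 0 := by
    intro v hv
    obtain ⟨v₀, h0, v₁, h1, h0', h1', rfl⟩ := hU v hv
    have e0 := hw v₀ h0'
    have e1 := hw v₁ h1'
    rw [map_add, hB.even (by decide) h0 hb, add_zero] at e0
    rw [map_add, hB.even (by decide) h1 ha, zero_add] at e1
    simp only [map_add, LinearMap.add_apply]
    rw [e0, e1, hB.even (by decide) h0 hb, hB.even (by decide) h1 ha]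
    simp
  exact ⟨a, ha, b, hb, fun v hv => (key v hv).1, fun v hv => (key v hv).2, rfl⟩

variable [IsScalarTower F T V]

/-- Both sides are quotients of `T`, by `x ↦ x w` and by `toDelta`. The ideal maps `U` into `U'` by
`h2`, and `e l` fixes `w`, so one kernel contains the other; `h4` is the opposite inclusion and `h3`
the surjectivity. The twist in `toDelta` accounts for the parity `ε` of `w`. -/
theorem exists_superIso_delta (hH : H.Super) {grV : ZMod 2 → Submodule F V} (hV : H.SuperMod grV)
    {U U' : Submodule T V} (hU' : IsHomogeneousSub grV U') {ε : ZMod 2} {w : V}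
    (hwU : w ∈ U) (hw : w ∈ grV ε) {l : L} (h1 : H.e l • w = w)
    (h2 : ∀ m, H.lt l m → ∀ u ∈ U, H.e m • u ∈ U') (h3 : ∀ u ∈ U, ∃ x : T, u - x • w ∈ U')
    (h4 : ∀ x : T, x • w ∈ U' → x * H.e l ∈ H.ideal l) :
    ∃ φ : (U ⧸ U'.submoduleOf U) ≃ₗ[F] H.Delta l,
      H.IsSuperIso (subquotGr grV U U') (H.deltaGr l) ε φ := by
  let G : T →ₗ[F] (U ⧸ U'.submoduleOf U) :=
    { toFun := fun x => (U'.submoduleOf U).mkQ ⟨x • w, U.smul_mem x hwU⟩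
      map_add' := fun x y => by
        rw [← map_add]; congr 1; exact Subtype.ext (add_smul x y w)
      map_smul' := fun r x => by
        change _ = r • (U'.submoduleOf U).mkQ.restrictScalars F ⟨x • w, U.smul_mem x hwU⟩
        rw [← map_smul]
        change _ = (U'.submoduleOf U).mkQ (r • ⟨x • w, U.smul_mem x hwU⟩)
        congr 1; exact Subtype.ext (smul_assoc r x w) }
  have hG0 : ∀ x, G x = 0 ↔ x • w ∈ U' := fun x => by
    change Submodule.Quotient.mk _ = _ ↔ _
    rw [Submodule.Quotient.mk_eq_zero]
    rfl
  have hGs : Function.Surjective G := by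
    intro v
    obtain ⟨⟨u, hu⟩, rfl⟩ := Submodule.mkQ_surjective _ v
    obtain ⟨x, hx⟩ := h3 u hu
    refine ⟨x, Eq.symm ?_⟩
    change Submodule.Quotient.mk _ = Submodule.Quotient.mk _
    rw [Submodule.Quotient.eq]
    exact hx
  have hker : LinearMap.ker G = LinearMap.ker (H.toDelta l ε) := by
    ext x
    rw [LinearMap.mem_ker, LinearMap.mem_ker, hG0, HWData.toDelta_eq_zero hH]
    refine ⟨h4 x, fun h => ?_⟩
    rw [← h1, ← mul_smul]
    exact HWData.ideal_smul_mem h2 h hwU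
  let φ : (U ⧸ U'.submoduleOf U) ≃ₗ[F] H.Delta l :=
    ((G.quotKerEquivOfSurjective hGs).symm.trans (Submodule.quotEquivOfEq _ _ hker)).trans
      ((H.toDelta l ε).quotKerEquivOfSurjective (HWData.toDelta_surjective hH l ε))
  have hφ : ∀ x, φ (G x) = H.toDelta l ε x := by
    intro x
    have : (G.quotKerEquivOfSurjective hGs).symm (G x) = Submodule.Quotient.mk x := by
      rw [LinearEquiv.symm_apply_eq]; rfl
    simp only [φ, LinearEquiv.trans_apply, this]
    rfl
  refine ⟨φ, ?_, ?_⟩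
  · rintro δ _ ⟨⟨u, hu⟩, huδ, rfl⟩
    change u ∈ grV δ at huδ
    obtain ⟨x, hx⟩ := h3 u hu
    -- The preimage `x` of a homogeneous class need not be homogeneous. Its part `b` of the wrong
    -- parity sends `w` into `U'`, because `U'` contains the homogeneous parts of its elements;
    -- hence `a` represents the same class.
    obtain ⟨a, ha, b, hb, rfl⟩ := hH.split (δ + ε) x
    have haw : a • w ∈ grV δ := by
      have := hV.smul_mem ha hw
      rwa [add_assoc, zmod2_add_self, add_zero] at this
    have hbw : b • w ∈ grV (δ + 1) := by
      have := hV.smul_mem hb hw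
      rwa [show δ + ε + 1 + ε = δ + 1 + (ε + ε) by ring, zmod2_add_self, add_zero] at this
    obtain ⟨p, q, hp, hq, hpU, hqU, hpq⟩ : ∃ p q, p ∈ grV δ ∧ q ∈ grV (δ + 1) ∧ p ∈ U' ∧ q ∈ U' ∧
        u - (a + b) • w = p + q := by
      obtain ⟨v₀, h0, v₁, h1, h0', h1', h⟩ := hU' _ hx
      rcases zmod2_cases δ with rfl | rfl
      · exact ⟨v₀, v₁, h0, h1, h0', h1', h⟩
      · exact ⟨v₁, v₀, h1, h0, h1', h0', by rw [h, add_comm]⟩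
    have hz : b • w + q = 0 := by
      refine hV.disj (δ := δ) ?_ ((grV (δ + 1)).add_mem hbw hq)
      have : b • w + q = u - a • w - p := by
        have : u - a • w - b • w = p + q := by rw [← hpq, add_smul]; abel
        rw [sub_sub, sub_eq_iff_eq_add] at this
        rw [this]; abel
      rw [this]
      exact (grV δ).sub_mem ((grV δ).sub_mem huδ haw) hp
    have hb0 : G b = 0 := by
      rw [hG0, eq_neg_of_add_eq_zero_left hz]
      exact U'.neg_mem hqU
    have hv : (U'.submoduleOf U).mkQ.restrictScalars F ⟨u, hu⟩ = G a := by
      have : G (a + b) = (U'.submoduleOf U).mkQ.restrictScalars F ⟨u, hu⟩ := by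
        refine Eq.symm ?_
        change Submodule.Quotient.mk _ = Submodule.Quotient.mk _
        rw [Submodule.Quotient.eq]
        exact hx
      rw [← this, map_add, hb0, add_zero]
    rw [hv, hφ]
    refine ⟨H.twist ε a * H.e l, ?_, (HWData.toDelta_val l ε a).symm⟩
    have := hH.mul_mem ha (hH.e_mem l)
    rw [add_zero] at this
    change _ ∈ H.gr _
    rw [H.twist_gr ε ha, smul_mul_assoc]
    exact Submodule.smul_mem _ _ this
  · intro δ a ha v
    obtain ⟨x, rfl⟩ := hGs v
    have h : a • G x = G (a * x) := by
      change a • (U'.submoduleOf U).mkQ _ = (U'.submoduleOf U).mkQ _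
      rw [← map_smul]; congr 1; exact Subtype.ext (mul_smul a x w).symm
    have hs : ∀ (r : F) (y : H.Delta l), (r • a) • y = r • a • y := fun r y => Subtype.ext (by
      change H.proj l (r • a) * y.1 = r • (H.proj l a * y.1)
      rw [map_smul, smul_mul_assoc])
    rw [h, hφ, hφ, HWData.toDelta_mul, H.twist_gr ε ha, hs]

/-- A vector outside `U` is detected by a linear form that vanishes on `U`. By nondegeneracy this
form is the pairing with some `w`, which then lies in the complement. -/
theorem HWData.Contra.mem_of_perp [FiniteDimensional F V] {τ : T →ₗ[F] T} (hτ : H.AntiInv τ)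
    (hH : H.Super) {grV : ZMod 2 → Submodule F V} {B : LinearMap.BilinForm F V}
    (hB : H.Contra τ grV B) (U : Submodule T V) (hU : IsHomogeneousSub grV U) {v : V}
    (hv : ∀ w ∈ hB.perp hτ hH U hU, B v w = 0) : v ∈ U := by
  by_contra hvU
  obtain ⟨f, hf, hfU⟩ := Submodule.exists_le_ker_of_notMem (p := U.restrictScalars F) hvU
  obtain ⟨w, rfl⟩ := ((LinearMap.flip_bijective_iff₁ (B := B)).mpr hB.bij).2 f
  exact hf (hv w fun u hu => hfU hu)

/-- The surjection `x ↦ ẽ_l x̃` of `T` onto `Δ^op(l)`. -/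
noncomputable def HWData.toOp (H : HWData F T L) (l : L) : T →ₗ[F] H.deltaOp l :=
  (LinearMap.mulLeft F (H.proj l (H.e l))).rangeRestrict ∘ₗ (H.proj l).toLinearMap

theorem HWData.toOp_val (l : L) (x : T) : (H.toOp l x).1 = H.proj l (H.e l * x) := by
  rw [map_mul]; rfl

theorem HWData.toOp_surjective (l : L) : Function.Surjective (H.toOp l) :=
  (LinearMap.surjective_rangeRestrict _).comp (H.proj_surjective l)

theorem HWData.toOp_eq_zero {l : L} {x : T} : H.toOp l x = 0 ↔ H.e l * x ∈ H.ideal l := by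
  rw [← H.proj_eq_zero, ← HWData.toOp_val]
  exact Subtype.ext_iff

/-- The pairing `(v, x) ↦ B(w, x v)` identifies the quotient of the complements with the dual of
`ẽ_l T̃`. It depends only on the class of `e_l x` because the ideal carries `U'^⊥` into `U^⊥` and
`e_l` fixes `w`. The hypotheses on `w` are those of the standard case. -/
theorem exists_superIso_nabla [FiniteDimensional F V] [FiniteDimensional F T] (hH : H.Super)
    {grV : ZMod 2 → Submodule F V} (hV : H.SuperMod grV) {τ : T →ₗ[F] T} (hτ : H.AntiInv τ)
    {B : LinearMap.BilinForm F V} (hB : H.Contra τ grV B)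
    {U U' : Submodule T V} (hUh : IsHomogeneousSub grV U)
    (hU' : IsHomogeneousSub grV U') {ε : ZMod 2} {w : V}
    (hwU : w ∈ U) (hw : w ∈ grV ε) {l : L} (h1 : H.e l • w = w)
    (h2 : ∀ m, H.lt l m → ∀ u ∈ U, H.e m • u ∈ U') (h3 : ∀ u ∈ U, ∃ x : T, u - x • w ∈ U')
    (h4 : ∀ x : T, x • w ∈ U' → x * H.e l ∈ H.ideal l) :
    ∃ φ : (hB.perp hτ hH U' hU' ⧸ (hB.perp hτ hH U hUh).submoduleOf (hB.perp hτ hH U' hU')) ≃ₗ[F]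
        H.Nabla l,
      H.IsSuperIso (subquotGr grV (hB.perp hτ hH U' hU') (hB.perp hτ hH U hUh))
        (H.nablaGr l) ε φ := by
  set P := hB.perp hτ hH U hUh with hP
  set P' := hB.perp hτ hH U' hU' with hP'
  have h2' : ∀ m, H.lt l m → ∀ v ∈ P', H.e m • v ∈ P := by
    intro m hm v hv u hu
    obtain ⟨u₀, h0, u₁, h1, h0', h1', rfl⟩ := hUh u hu
    rw [map_add, LinearMap.add_apply, hB.contra' hτ (hH.e_mem m) h0, hB.contra' hτ (hH.e_mem m) h1,
      hτ.e, hv _ (h2 m hm _ h0'), hv _ (h2 m hm _ h1'), mul_zero, mul_zero, add_zero]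
  have hJ : ∀ {x : T}, x ∈ H.ideal l → ∀ v ∈ P', B w (x • v) = 0 := fun hx v hv =>
    H.ideal_smul_mem h2' hx hv w hwU
  have hwe : ∀ v, B w (H.e l • v) = B w v := fun v => by
    rw [hB.contra' hτ (hH.e_mem l) hw, hτ.e, h1, zero_mul, sg_zero, one_mul]
  -- Two signs have to be absorbed: `(-1)^|a|` from the action on the costandard module and
  -- `(-1)^(ε|a|)` from an isomorphism of parity `ε`.
  set θ := H.twist (ε + 1) with hθ
  have hθJ : ∀ {x : T}, H.e l * x ∈ H.ideal l → ∀ v ∈ P', B w (θ x • v) = 0 := by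
    intro x hx v hv
    have := hJ (hH.twist_mem_ideal (ε + 1) hx) v hv
    rwa [map_mul, hH.twist_e, mul_smul, hwe] at this
  have : FiniteDimensional F (H.deltaOp l) := Module.Finite.of_surjective _ (H.toOp_surjective l)
  obtain ⟨s, hs⟩ := (H.toOp l).exists_rightInverse_of_surjective
    (LinearMap.range_eq_top.mpr (H.toOp_surjective l))
  -- The functional is written with a linear section `s` of `T → ẽ_l T̃`; by `hΦ` its value does not
  -- depend on that choice.
  let Φ : P' →ₗ[F] Module.Dual F (H.deltaOp l) :=
    { toFun := fun v =>
        { toFun := fun u => B w (θ (s u) • v.1)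
          map_add' := fun u u' => by rw [map_add, map_add, add_smul, map_add]
          map_smul' := fun r u => by
            rw [map_smul s, map_smul θ, smul_assoc, map_smul (B w), RingHom.id_apply] }
      map_add' := fun v v' => LinearMap.ext fun u => by
        change B w (θ (s u) • (v.1 + v'.1)) = _
        rw [smul_add, map_add]; rfl
      map_smul' := fun r v => LinearMap.ext fun u => by
        change B w (θ (s u) • (r • v.1)) = r • B w (θ (s u) • v.1)
        rw [← map_smul, ← algebraMap_smul T r v.1, ← algebraMap_smul T r (θ (s u) • v.1),
          ← mul_smul, ← mul_smul, Algebra.commutes] }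
  have hΦ : ∀ v x, Φ v (H.toOp l x) = B w (θ x • v.1) := by
    intro v x
    change B w (θ (s (H.toOp l x)) • v.1) = _
    rw [← sub_eq_zero, ← map_sub, ← sub_smul, ← map_sub]
    refine hθJ ?_ v.1 v.2
    rw [← H.toOp_eq_zero, map_sub, sub_eq_zero]
    exact LinearMap.congr_fun hs _
  have hθθ : ∀ x, θ (θ x) = x := hH.twist_twist (ε + 1)
  -- `Φ v = 0` says that `v` is orthogonal to `T w`. As `U = T w + U'` and `v` is orthogonal to
  -- `U'`, this means orthogonality to `U`.
  have hΦ0 : ∀ v, Φ v = 0 ↔ v.1 ∈ P := by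
    intro v
    constructor
    · intro h u hu
      have h' : ∀ x : T, B w (x • v.1) = 0 := fun x => by
        rw [← hθθ x, ← hΦ v, h]; rfl
      obtain ⟨x, hx⟩ := h3 u hu
      have e : B u v.1 = B (x • w) v.1 := by
        rw [← sub_eq_zero, ← LinearMap.sub_apply, ← map_sub]
        exact v.2 _ hx
      obtain ⟨a, ha, b, hb, rfl⟩ := hH.split 0 x
      rw [e, add_smul, map_add, LinearMap.add_apply, hB.contra ha hw, hB.contra hb hw, h', h',
        mul_zero, mul_zero, add_zero]
    · intro h
      refine LinearMap.ext fun u => ?_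
      exact P.smul_mem _ h w hwU
  -- In finite dimension it suffices that the transposed map is injective. If `B(w, y v) = 0` for
  -- all `v` in `U'^⊥`, then moving `y` across the form puts `τ(y) w`, up to a twist, into `U'^⊥⊥ =
  -- U'`. By `h4` then `τ(y) e_l` lies in the ideal, and applying `τ` again gives `e_l y`.
  have hΦs : Function.Surjective Φ := by
    rw [← LinearMap.flip_injective_iff₂, injective_iff_map_eq_zero]
    intro u hu
    obtain ⟨x, rfl⟩ := H.toOp_surjective l u
    have hx : ∀ v ∈ P', B w (θ x • v) = 0 := fun v hv => by
      have := LinearMap.congr_fun hu ⟨v, hv⟩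
      rw [← hΦ ⟨v, hv⟩]; exact this
    generalize hy : θ x = y at hx
    have hyJ : H.e l * y ∈ H.ideal l := by
      obtain ⟨a, ha, b, hb, hab⟩ := hH.split 0 y
      have hz : (τ (H.twist ε y)) • w ∈ U' := by
        refine hB.mem_of_perp hτ hH U' hU' fun v hv => ?_
        rw [← hx v hv, hab, add_smul, map_add (B w), hB.contra' hτ ha hw, hB.contra' hτ hb hw,
          map_add, map_add, H.twist_gr ε ha, H.twist_gr ε hb, map_smul τ, map_smul τ, add_smul,
          smul_assoc, smul_assoc, map_add B, map_smul B, map_smul B, mul_comm ε, mul_comm ε]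
        rfl
      have h5 := hτ.mem_ideal hH (h4 _ hz)
      rw [hτ.mul_right hH (hH.e_mem l), hτ.twist hH, hτ.invol, hτ.e,
        show H.twist 0 = AlgHom.id F T from if_pos rfl, AlgHom.id_apply,
        ← hH.twist_e ε, ← map_mul] at h5
      exact (hH.twist_mem_iff ε).mp h5
    rw [H.toOp_eq_zero, ← hH.twist_mem_iff (ε + 1), map_mul, hH.twist_e]
    change H.e l * θ x ∈ _
    rw [hy]
    exact hyJ
  have hker : LinearMap.ker Φ = (P.submoduleOf P').restrictScalars F := by
    ext v
    rw [LinearMap.mem_ker, hΦ0]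
    rfl
  let φ : (P' ⧸ P.submoduleOf P') ≃ₗ[F] Module.Dual F (H.deltaOp l) :=
    ((Submodule.Quotient.restrictScalarsEquiv F (P.submoduleOf P')).symm.trans
      (Submodule.quotEquivOfEq _ _ hker.symm)).trans (Φ.quotKerEquivOfSurjective hΦs)
  have hφ : ∀ v, φ ((P.submoduleOf P').mkQ v) = Φ v := fun v => rfl
  refine ⟨φ, ?_, ?_⟩
  · rintro δ _ ⟨v, hv, rfl⟩
    change v.1 ∈ grV δ at hv
    change φ ((P.submoduleOf P').mkQ v) ∈ H.nablaGr l _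
    rw [hφ]
    rintro δ' hδ' u ⟨y, hy, hyu⟩
    have hu : u = H.toOp l y := by
      refine Subtype.ext ?_
      rw [H.toOp_val]
      obtain ⟨x, hx⟩ := H.toOp_surjective l u
      rw [map_mul]
      change H.proj l y = u.1 at hyu
      rw [hyu, ← hx, H.toOp_val, ← map_mul, ← mul_assoc, hH.e_mul]
    rw [hu]
    refine (hΦ v y).trans ?_
    rw [hθ, H.twist_gr _ hy, smul_assoc, map_smul, hB.even ?_ hw (hV.smul_mem hy hv), smul_zero]
    intro h
    apply hδ'
    rw [h, add_comm δ' δ, ← add_assoc, zmod2_add_self, zero_add]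
  · intro δ a ha v
    obtain ⟨v, rfl⟩ := Submodule.mkQ_surjective _ v
    rw [← map_smul]
    refine (hφ (a • v)).trans ?_
    let N : H.Nabla l := Φ v
    change Φ (a • v) = (sg F (ε * δ) • a • N : H.Nabla l)
    refine LinearMap.ext fun u => ?_
    obtain ⟨x, rfl⟩ := H.toOp_surjective l u
    refine (hΦ (a • v) x).trans ?_
    change B w (θ x • a • v.1) = sg F (ε * δ) • Φ v (H.opAct l (H.inv a) (H.toOp l x))
    have e : H.opAct l (H.inv a) (H.toOp l x) = H.toOp l (x * H.inv a) := Subtype.ext (by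
      rw [H.toOp_val, ← mul_assoc, map_mul, ← H.toOp_val]; rfl)
    rw [e, hΦ, map_mul, H.inv_gr δ a ha, map_smul θ, hθ, H.twist_gr (ε + 1) ha, mul_smul_comm,
      mul_smul_comm, smul_assoc, smul_assoc, map_smul (B w), map_smul (B w), smul_smul,
      smul_smul, ← sg_add, smul_smul, ← sg_add,
      show ε * δ + δ + (ε + 1) * δ = (ε * δ + ε * δ) + (δ + δ) by ring, zmod2_add_self,
      zmod2_add_self, add_zero, sg_zero, one_smul]

/-- A chain of homogeneous submodules whose factors are generated by highest weight vectors, in a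
module with a contravariant form, shows that the module is tilting. -/
theorem isTilting_of_chain [FiniteDimensional F V] [FiniteDimensional F T] (hH : H.Super)
    {grV : ZMod 2 → Submodule F V} (hV : H.SuperMod grV) {τ : T →ₗ[F] T} (hτ : H.AntiInv τ)
    {B : LinearMap.BilinForm F V} (hB : H.Contra τ grV B) {m : ℕ}
    (U : Fin (m + 1) → Submodule T V) (hmono : Monotone U) (hbot : U 0 = ⊥)
    (htop : U (Fin.last m) = ⊤) (hhom : ∀ r, IsHomogeneousSub grV (U r))
    (hgen : ∀ r : Fin m, ∃ (l : L) (ε : ZMod 2) (w : V), w ∈ U r.succ ∧ w ∈ grV ε ∧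
      H.e l • w = w ∧ (∀ k, H.lt l k → ∀ u ∈ U r.succ, H.e k • u ∈ U r.castSucc) ∧
      (∀ u ∈ U r.succ, ∃ x : T, u - x • w ∈ U r.castSucc) ∧
      ∀ x : T, x • w ∈ U r.castSucc → x * H.e l ∈ H.ideal l) :
    H.IsTilting grV := by
  -- Complements reverse inclusions, so the costandard chain runs through the indices backwards.
  refine ⟨⟨m, U, hmono, hbot, htop, hhom, fun r => ?_⟩,
    ⟨m, fun r => hB.perp hτ hH (U r.rev) (hhom r.rev), ?_, ?_, ?_, fun r => ?_, fun r => ?_⟩⟩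
  · obtain ⟨l, ε, w, h0, h1, h2, h3, h4, h5⟩ := hgen r
    exact ⟨l, ε, exists_superIso_delta hH hV (hhom _) h0 h1 h2 h3 h4 h5⟩
  · intro r s hrs w hw v hv
    exact hw v (hmono (Fin.rev_le_rev.mpr hrs) hv)
  · rw [eq_bot_iff]
    intro w hw
    rw [Submodule.mem_bot]
    have h : B.flip w = 0 := LinearMap.ext fun v => hw v (by
      rw [Fin.rev_zero, htop]; trivial)
    exact ((LinearMap.flip_bijective_iff₁ (B := B)).mpr hB.bij).1 (h.trans (map_zero _).symm)
  · rw [eq_top_iff]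
    intro w _ v hv
    rw [Fin.rev_last, hbot, Submodule.mem_bot] at hv
    rw [hv, map_zero, LinearMap.zero_apply]
  · exact hB.perp_homogeneous hτ hH hV _ _
  · obtain ⟨l, ε, w, h0, h1, h2, h3, h4, h5⟩ := hgen r.rev
    refine ⟨l, ε, ?_⟩
    rw [← Fin.rev_castSucc] at h0
    rw [← Fin.rev_succ] at h5
    simp only [← Fin.rev_castSucc, ← Fin.rev_succ] at h3 h4
    exact exists_superIso_nabla hH hV hτ hB (hhom _) (hhom _) h0 h1 h2 h3 h4 h5

end HighestWeight


/-! ### Products of orbit sums -/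

section Products

open scoped Classical

variable {R : Type*} [CommRing R] [IsDomain R] [CharZero R] {d : ℕ}
  {BA BV : Type*} [Fintype BA] [Fintype BV] {cA : Calib BA} {cV : Calib BV}
  {Q : BA → BV → BV → Prop}

theorem tAct_word_apply {R : Type*} [CommRing R] (q : Fin d → BA) (v : (Fin d → BV) → R)
    (b : Fin d → BV) :
    tAct cA cV (fun a c b => if Q a c b then (1 : R) else 0) (word R q) v b =
      ∑ c : Fin d → BV, v c * ((-1) ^ koszul (cA.par ∘ q) (cV.par ∘ c) *
        if ∀ k, Q (q k) (c k) (b k) then 1 else 0) := by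
  rw [tAct, Finset.sum_eq_single q]
  · refine Finset.sum_congr rfl fun c _ => ?_
    rw [word_apply, if_pos rfl, one_mul, Finset.prod_boole]
    simp
  · intro a _ ha
    refine Finset.sum_eq_zero fun c _ => ?_
    rw [word_apply, if_neg ha, zero_mul, zero_mul]
  · simp

theorem y_eq_zero_of_not {R : Type*} [CommRing R] {b b' : Fin d → BV}
    (h : ¬ ∃ σ : Equiv.Perm (Fin d), b ∘ σ = b') : cV.y R b b' = 0 := if_neg h

/-- If `r` is the only rearrangement of `r` that can be multiplied by `q`, and the product is `b`,
then `y_q y_r = ± y_b`. -/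
theorem tAct_y_y (hpar : ∀ a c b, Q a c b → cV.par b = cA.par a + cV.par c)
    {q : Fin d → BA} {r b : Fin d → BV} (hq : cA.Seq q) (hr : cV.Seq r) (hb : cV.Seq b)
    (hc : cV.cFact r = 1) (hA : cA.swap.cFact q = cV.swap.cFact b)
    (hQ : ∀ k, Q (q k) (r k) (b k))
    (huniq : ∀ (σ : Equiv.Perm (Fin d)) (b' : Fin d → BV), (∀ k, Q (q k) (r (σ k)) (b' k)) →
      r ∘ σ = r ∧ b' = b) :
    ∃ ε : R, (ε = 1 ∨ ε = -1) ∧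
      tAct cA cV (fun a c b => if Q a c b then (1 : R) else 0) (cA.y R q) (cV.y R r) =
        ε • cV.y R b := by
  refine ⟨_, sign_cases (koszul (cA.par ∘ q) (cV.par ∘ r)), ?_⟩
  -- After multiplication by this nonzero factor the left side is a symmetrization of a single word,
  -- and by `hA` the same factor appears on the right.
  refine smul_right_injective _ (cA.swap.cFact_ne_zero (R := R) q) ?_
  have h1 : tAct cA cV (fun a c b => if Q a c b then (1 : R) else 0) (word R q) (cV.y R r) =
      (-1 : R) ^ koszul (cA.par ∘ q) (cV.par ∘ r) • word R b := by
    funext b'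
    rw [tAct_word_apply, Finset.sum_eq_single r, Pi.smul_apply, word_apply, cV.y_self, hc,
      Nat.cast_one, one_mul, smul_eq_mul]
    · congr 1
      refine if_congr ⟨fun h => (huniq 1 b' h).2, ?_⟩ rfl rfl
      rintro rfl
      exact hQ
    · intro c _ hcr
      by_cases h : ∃ σ : Equiv.Perm (Fin d), r ∘ σ = c
      · obtain ⟨σ, rfl⟩ := h
        simp only [Function.comp_apply]
        rw [if_neg (fun h => hcr (huniq σ b' h).1), mul_zero, mul_zero]
      · rw [y_eq_zero_of_not h, zero_mul]
    · simp
  beta_reduce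
  rw [smul_tAct_y (K := fun a c b => if Q a c b then (1 : R) else 0)
    (fun a c b h => hpar a c b (by by_contra h'; exact h (if_neg h'))) hq
    (Submodule.subset_span ⟨r, hr, rfl⟩), h1]
  simp only [Calib.act_smul]
  rw [← Finset.smul_sum, cV.sum_act_word hb, hA, smul_comm]

theorem permKoszul_eq_zero {σ : Equiv.Perm (Fin d)} {p : Fin d → ZMod 2}
    (h : ∀ k, p k = 1 → σ k = k) : permKoszul σ p = 0 := by
  rw [permKoszul, Finset.card_eq_zero, Finset.filter_eq_empty_iff]
  rintro ⟨k, l⟩ _ ⟨h1, h2, h3, h4⟩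
  have e : ∀ m, p m = 1 → σ.symm m = m := fun m hm => by
    rw [Equiv.symm_apply_eq]; exact (h m hm).symm
  simp only at h1 h2 h3 h4
  rw [e _ h3, e _ h4] at h2
  exact absurd h1 h2.not_gt

/-- If exactly the two rearrangements `r` and `r ∘ σ` of `r` can be multiplied by `q`, with
products `b` and `b'`, then a multiple of `y_q y_r` is a combination of `y_b` and `y_{b'}`. -/
theorem smul_tAct_y_y (hpar : ∀ a c b, Q a c b → cV.par b = cA.par a + cV.par c)
    {q : Fin d → BA} {r b b' : Fin d → BV} {σ : Equiv.Perm (Fin d)}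
    (hq : cA.Seq q) (hr : cV.Seq r) (hb : cV.Seq b) (hb' : cV.Seq b')
    (hc : cV.cFact r = 1) (hσ : ∀ k, cV.par (r k) = 1 → σ k = k) (hrσ : r ∘ σ ≠ r)
    (hQ : ∀ k, Q (q k) (r k) (b k)) (hQ' : ∀ k, Q (q k) (r (σ k)) (b' k))
    (huniq : ∀ (ρ : Equiv.Perm (Fin d)) (u : Fin d → BV), (∀ k, Q (q k) (r (ρ k)) (u k)) →
      (r ∘ ρ = r ∧ u = b) ∨ (r ∘ ρ = r ∘ σ ∧ u = b')) :
    (cA.swap.cFact q : R) •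
      tAct cA cV (fun a c b => if Q a c b then (1 : R) else 0) (cA.y R q) (cV.y R r) =
        (cV.swap.cFact b : R) • (-1 : R) ^ koszul (cA.par ∘ q) (cV.par ∘ r) • cV.y R b +
        (cV.swap.cFact b' : R) • (-1 : R) ^ koszul (cA.par ∘ q) (cV.par ∘ r ∘ σ) •
          cV.y R b' := by
  -- Since `σ` moves only even letters there is no sign, and `hc` makes the coefficient one.
  have hyr : cV.y R r (r ∘ σ) = 1 := by
    rw [((cV.mem_modDiv _).mp (Submodule.subset_span ⟨r, hr, rfl⟩)).1, cV.y_self, hc,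
      permKoszul_eq_zero (p := cV.par ∘ r) hσ]
    simp
  have h1 : tAct cA cV (fun a c b => if Q a c b then (1 : R) else 0) (word R q) (cV.y R r) =
      (-1 : R) ^ koszul (cA.par ∘ q) (cV.par ∘ r) • word R b +
        (-1 : R) ^ koszul (cA.par ∘ q) (cV.par ∘ r ∘ σ) • word R b' := by
    funext u
    rw [tAct_word_apply, Finset.sum_eq_add r (r ∘ σ) hrσ.symm, Pi.add_apply, Pi.smul_apply,
      Pi.smul_apply, word_apply, word_apply, cV.y_self, hc, hyr, Nat.cast_one, one_mul, one_mul,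
      smul_eq_mul, smul_eq_mul]
    · congr 1
      · congr 1
        refine if_congr ⟨fun h => ?_, ?_⟩ rfl rfl
        · rcases huniq 1 u h with h | h
          · exact h.2
          · exact absurd h.1.symm hrσ
        · rintro rfl; exact hQ
      · congr 1
        refine if_congr ⟨fun h => ?_, ?_⟩ rfl rfl
        · rcases huniq σ u h with h | h
          · exact absurd h.1 hrσ
          · exact h.2
        · rintro rfl; exact hQ'
    · rintro c _ ⟨hc1, hc2⟩
      by_cases h : ∃ ρ : Equiv.Perm (Fin d), r ∘ ρ = c
      · obtain ⟨ρ, rfl⟩ := h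
        rw [if_neg, mul_zero, mul_zero]
        intro h
        rcases huniq ρ u h with h | h
        · exact hc1 h.1
        · exact hc2 h.1
      · rw [y_eq_zero_of_not h, zero_mul]
    · simp
    · simp
  rw [smul_tAct_y (K := fun a c b => if Q a c b then (1 : R) else 0)
    (fun a c b h => hpar a c b (by by_contra h'; exact h (if_neg h'))) hq
    (Submodule.subset_span ⟨r, hr, rfl⟩), h1]
  simp only [Calib.act_smul, Calib.act_add]
  rw [Finset.sum_add_distrib, ← Finset.smul_sum, ← Finset.smul_sum, cV.sum_act_word hb,
    cV.sum_act_word hb', smul_comm ((-1 : R) ^ _), smul_comm ((-1 : R) ^ _)]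

end Products

/-! ### Extension of scalars -/

section BaseChange

variable {R F S M : Type*} [CommRing R] [Field F] [Algebra R F]
  [AddCommGroup M] [Module R M]

/-- The extension of a linear form to `F ⊗ M`. -/
noncomputable def formF (F : Type*) [Field F] [Algebra R F] (f : M →ₗ[R] R) : F ⊗[R] M →ₗ[F] F :=
  LinearMap.liftBaseChange F (Algebra.linearMap R F ∘ₗ f)

theorem formF_tmul (f : M →ₗ[R] R) (r : F) (m : M) :
    formF F f (r ⊗ₜ m) = r * algebraMap R F (f m) := by
  simp [formF]

/-- An expansion over `R` with linear coordinates survives the extension of scalars, so orbit sums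
still span over `F`. -/
theorem eq_sum_formF {ι : Type*} [Fintype ι] {y : ι → M} {co : ι → M →ₗ[R] R}
    (h : ∀ m, m = ∑ q, co q m • y q) (v : F ⊗[R] M) :
    v = ∑ q, formF F (co q) v • ((1 : F) ⊗ₜ[R] y q) := by
  induction v using TensorProduct.induction_on with
  | zero => simp
  | tmul r m =>
    conv_lhs => rw [h m, TensorProduct.tmul_sum]
    refine Finset.sum_congr rfl fun q _ => ?_
    rw [formF_tmul, TensorProduct.tmul_smul, TensorProduct.smul_tmul', TensorProduct.smul_tmul',
      smul_eq_mul, mul_one, Algebra.smul_def, mul_comm]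
  | add v w hv hw =>
    conv_lhs => rw [hv, hw]
    rw [← Finset.sum_add_distrib]
    refine Finset.sum_congr rfl fun q _ => ?_
    rw [map_add, add_smul]

theorem finite_of_eq_sum {ι : Type*} [Fintype ι] {y : ι → M} {co : ι → M →ₗ[R] R}
    (h : ∀ m, m = ∑ q, co q m • y q) : FiniteDimensional F (F ⊗[R] M) := by
  have : Module.Finite R M := ⟨⟨(Set.finite_range y).toFinset, by
    rw [eq_top_iff]
    intro m _
    rw [h m]
    refine Submodule.sum_mem _ fun q _ => Submodule.smul_mem _ _ (Submodule.subset_span ?_)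
    simp⟩⟩
  exact Module.Finite.base_change R F M

/-- Reduces identities for homogeneous elements over `F` to pure tensors with a homogeneous factor
over `R`. -/
theorem baseChange_induction {N : Submodule R M} {P : F ⊗[R] M → Prop} {v : F ⊗[R] M}
    (hv : v ∈ N.baseChange F) (h0 : P 0) (hadd : ∀ v w, P v → P w → P (v + w))
    (ht : ∀ (r : F), ∀ m ∈ N, P (r ⊗ₜ m)) : P v := by
  obtain ⟨t, rfl⟩ := hv
  induction t using TensorProduct.induction_on with
  | zero => rw [map_zero]; exact h0
  | tmul r m => exact ht r m.1 m.2
  | add x y hx hy => rw [map_add]; exact hadd _ _ hx hy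

variable [Ring S] [Algebra R S] [Module S M] [IsScalarTower R S M]

theorem ext_smul_tmul (r r' : F) (s : S) (m : M) :
    (r ⊗ₜ[R] s : F ⊗[R] S) • (show Ext R F M from r' ⊗ₜ[R] m) =
      (show Ext R F M from (r * r') ⊗ₜ[R] (s • m)) := by
  change extAct R F S M (r ⊗ₜ s) (r' ⊗ₜ m) = _
  simp only [extAct, AlgHom.comp_apply, Algebra.TensorProduct.map_tmul]
  rw [LinearMap.tensorProductEnd]
  simp [LinearMap.tensorProduct, TensorProduct.smul_tmul']

end BaseChange


/-! ### Letters, structure constants and weights -/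

section Letters

open scoped Classical

variable {ℓ n : ℕ} {i : Fin (ℓ + 1)}

/-- Letters of `M_n(𝖹)`. -/
abbrev ML (ℓ n : ℕ) : Type := Fin n × Fin n × ZPath ℓ

/-- Letters of `Col_n(ΠT(i))`. -/
abbrev CL (ℓ n : ℕ) (i : Fin (ℓ + 1)) : Type := Fin n × TB ℓ i

/-- A colour together with a row. -/
abbrev CR (ℓ n : ℕ) : Type := Fin (ℓ + 1) × Fin n

/-- The coloured row of a matrix letter. -/
def mrow (b : ML ℓ n) : CR ℓ n := (b.2.2.tgt, b.1)

/-- The coloured column of a matrix letter. -/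
def mcol (b : ML ℓ n) : CR ℓ n := (b.2.2.src, b.2.1)

/-- The degree of a matrix letter. -/
def mdeg (b : ML ℓ n) : ℕ := b.2.2.deg

/-- The coloured row of a column letter. -/
def crow (c : CL ℓ n i) : CR ℓ n := (c.2.1.1, c.1)

/-- The degree of a column letter. -/
def cdeg (c : CL ℓ n i) : ℕ := c.2.1.2

/-- A path is determined by its end points and its length. Coloured row, coloured column and degree
thus serve as coordinates for letters, and the combinatorics below uses nothing else. -/
theorem ML.ext' {a b : ML ℓ n} (h1 : mrow a = mrow b) (h2 : mcol a = mcol b)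
    (h3 : mdeg a = mdeg b) : a = b :=
  Prod.ext (Prod.ext_iff.mp h1).2 (Prod.ext (Prod.ext_iff.mp h2).2
    (ZPath.ext (Prod.ext_iff.mp h1).1 (Prod.ext_iff.mp h2).1 (Fin.ext h3)))

theorem CL.ext' {a b : CL ℓ n i} (h1 : crow a = crow b) (h3 : cdeg a = cdeg b) : a = b :=
  Prod.ext (Prod.ext_iff.mp h1).2 (Subtype.ext (Prod.ext (Prod.ext_iff.mp h1).1 (Fin.ext h3)))

/-- The letter with given coloured row, coloured column and degree. -/
def mkM (p q : CR ℓ n) (g : ℕ) (h : ZValid ℓ p.1 q.1 g) : ML ℓ n :=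
  (p.2, q.2, ⟨(p.1, q.1, ⟨g, by unfold ZValid at h; omega⟩), h⟩)

theorem ML.valid (b : ML ℓ n) : ZValid ℓ (mrow b).1 (mcol b).1 (mdeg b) := b.2.2.valid

theorem CL.valid (c : CL ℓ n i) : (cdeg c = 0 ∧ ((crow c).1 : ℕ) + 1 = i) ∨
    (cdeg c = 1 ∧ (((crow c).1 : ℕ) = i ∨ ((crow c).1 : ℕ) + 2 = i)) ∨
    (cdeg c = 2 ∧ ((crow c).1 : ℕ) + 1 = i) := c.2.valid

/-- The product of the matrix letters `a` and `c` is `b`. -/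
def MQ (a c b : ML ℓ n) : Prop :=
  mcol a = mrow c ∧ mrow b = mrow a ∧ mcol b = mcol c ∧ mdeg b = mdeg a + mdeg c

/-- The product of the matrix letter `a` and the column letter `c` is `b`. -/
def CQ (a : ML ℓ n) (c b : CL ℓ n i) : Prop :=
  mcol a = crow c ∧ crow b = mrow a ∧ cdeg b = mdeg a + cdeg c

/-- The calibration of `M_n(𝖹)`. -/
def matCal (ℓ n : ℕ) : Calib (ML ℓ n) where
  par := fun b => (mdeg b : ZMod 2)
  isC := fun b => b.2.2.deg = 2
  par_of_isC := fun b h => by rw [mdeg, h]; rfl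

/-- The calibration of `Col_n(ΠT(i))`. -/
def colCal (ℓ n : ℕ) (i : Fin (ℓ + 1)) : Calib (CL ℓ n i) where
  par := fun b => (cdeg b : ZMod 2)
  isC := fun b => b.2.1.2 = 2
  par_of_isC := fun b h => by rw [cdeg, h]; rfl

theorem mat_isC {b : ML ℓ n} : (matCal ℓ n).isC b ↔ mdeg b = 2 :=
  Fin.ext_iff

theorem col_isC {b : CL ℓ n i} : (colCal ℓ n i).isC b ↔ cdeg b = 2 :=
  Fin.ext_iff

theorem MQ.par {a c b : ML ℓ n} (h : MQ a c b) :
    (matCal ℓ n).par b = (matCal ℓ n).par a + (matCal ℓ n).par c := by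
  change ((mdeg b : ℕ) : ZMod 2) = ((mdeg a : ℕ) : ZMod 2) + ((mdeg c : ℕ) : ZMod 2)
  rw [h.2.2.2, Nat.cast_add]

theorem CQ.par {a : ML ℓ n} {c b : CL ℓ n i} (h : CQ a c b) :
    (colCal ℓ n i).par b = (matCal ℓ n).par a + (colCal ℓ n i).par c := by
  change ((cdeg b : ℕ) : ZMod 2) = ((mdeg a : ℕ) : ZMod 2) + ((cdeg c : ℕ) : ZMod 2)
  rw [h.2.2, Nat.cast_add]

theorem MQ.unique {a c b b' : ML ℓ n} (h : MQ a c b) (h' : MQ a c b') : b = b' :=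
  ML.ext' (h.2.1.trans h'.2.1.symm) (h.2.2.1.trans h'.2.2.1.symm) (h.2.2.2.trans h'.2.2.2.symm)

theorem CQ.unique {a : ML ℓ n} {c b b' : CL ℓ n i} (h : CQ a c b) (h' : CQ a c b') : b = b' :=
  CL.ext' (h.2.1.trans h'.2.1.symm) (h.2.2.trans h'.2.2.symm)

variable (R : Type*) [CommRing R] {d : ℕ}

/-- The product on `M_n(𝖹)^{⊗ d}`. -/
noncomputable abbrev mmul (x v : (Fin d → ML ℓ n) → R) : (Fin d → ML ℓ n) → R :=
  tAct (matCal ℓ n) (matCal ℓ n) (fun a c b => if MQ a c b then (1 : R) else 0) x v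

/-- The action of `M_n(𝖹)^{⊗ d}` on `Col_n(ΠT(i))^{⊗ d}`. -/
noncomputable abbrev cmul (x : (Fin d → ML ℓ n) → R) (v : (Fin d → CL ℓ n i) → R) :
    (Fin d → CL ℓ n i) → R :=
  tAct (matCal ℓ n) (colCal ℓ n i) (fun a c b => if CQ a c b then (1 : R) else 0) x v

/-- Basis elements multiply to zero or to a single basis element with coefficient one, so the
product is encoded by the relation `MQ`. -/
theorem coef_mat (a c b : ML ℓ n) :
    ((zig R ℓ).mat n).coef a c b = if MQ a c b then 1 else 0 := by
  obtain ⟨r, s, p⟩ := a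
  obtain ⟨r', s', p'⟩ := c
  obtain ⟨r'', s'', p''⟩ := b
  unfold CalAlg.coef
  change (((zigBasis R ℓ).matrix (Fin n) (Fin n)).repr _ _ : R) = _
  rw [matrix_repr]
  change (zigBasis R ℓ).repr (((zigBasis R ℓ).matrix (Fin n) (Fin n) (r, s, p) *
    (zigBasis R ℓ).matrix (Fin n) (Fin n) (r', s', p')) r'' s'') p'' = _
  rw [Module.Basis.matrix_apply, Module.Basis.matrix_apply]
  have hiff : MQ (r, s, p) (r', s', p') (r'', s'', p'') ↔
      (s = r' ∧ r = r'' ∧ s' = s'') ∧ p.IsComp p' p'' := by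
    simp only [MQ, mrow, mcol, mdeg, ZPath.IsComp, Prod.mk.injEq]
    tauto
  by_cases hs : s = r'
  · subst hs
    rw [Matrix.single_mul_single_same, Matrix.single_apply]
    by_cases h : r = r'' ∧ s' = s''
    · rw [if_pos h, zigBasis_mul, zigK]
      refine if_congr ?_ rfl rfl
      rw [hiff]
      simp [h]
    · rw [if_neg h, if_neg]
      · simp
      · rw [hiff]; tauto
  · rw [Matrix.single_mul_single_of_ne _ _ _ _ hs, if_neg]
    · simp
    · rw [hiff]; tauto

theorem coef_col (a : ML ℓ n) (c b : CL ℓ n i) :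
    ((piT R ℓ i).col n).coef a c b = if CQ a c b then 1 else 0 := by
  obtain ⟨r, s, p⟩ := a
  obtain ⟨r', p'⟩ := c
  obtain ⟨r'', p''⟩ := b
  unfold CalMod.coef
  change ((colBasis (tbBasis R ℓ i) n).repr ((zigBasis R ℓ).matrix (Fin n) (Fin n) (r, s, p) •
    colBasis (tbBasis R ℓ i) n (r', p')) (r'', p'') : R) = _
  have h1 : colBasis (tbBasis R ℓ i) n (r', p') = Pi.single r' (tbBasis R ℓ i p') := by
    simp [colBasis]
  have h2 : ∀ v : Fin n → PiT R ℓ i, (colBasis (tbBasis R ℓ i) n).repr v (r'', p'') =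
      (tbBasis R ℓ i).repr (v r'') p'' := by
    intro v; simp [colBasis]
  rw [h2, h1, Module.Basis.matrix_apply, Matrix.Module.single_smul]
  have hiff : CQ (r, s, p) (r', p') (r'', p'') ↔
      (s = r' ∧ r'' = r) ∧ TB.IsComp p p' p'' := by
    simp only [CQ, mrow, mcol, mdeg, crow, cdeg, TB.IsComp, Prod.mk.injEq]
    tauto
  by_cases hs : s = r'
  · subst hs
    by_cases h : r'' = r
    · subst h
      rw [Pi.single_eq_same, Pi.single_eq_same]
      refine (tbBasis_smul p p' p'').trans ?_
      rw [tbK]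
      refine if_congr ?_ rfl rfl
      rw [hiff]
      simp
    · rw [Pi.single_eq_of_ne h, if_neg]
      · simp
      · rw [hiff]; tauto
  · rw [Pi.single_eq_of_ne hs, smul_zero, Pi.single_zero, if_neg]
    · simp
    · rw [hiff]; tauto

/-! ### Products in the modified divided powers, in terms of letters -/

section Mul

variable [IsDomain R] [CharZero R]

theorem TZR_mul_val (x y : TZR R ℓ n d) : (x * y).1 = mmul R x.1 y.1 := by
  have h : ((zig R ℓ).mat n).coef = fun a c b => if MQ a c b then (1 : R) else 0 := by
    funext a c b; exact coef_mat R a c b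
  change tAct ((zig R ℓ).mat n).cal ((zig R ℓ).mat n).cal ((zig R ℓ).mat n).coef x.1 y.1 = _
  rw [h]
  rfl

theorem TTR_smul_val (x : TZR R ℓ n d) (v : ((piT R ℓ i).col n).modPow d) :
    (x • v).1 = cmul R x.1 v.1 := by
  have h : ((piT R ℓ i).col n).coef = fun a c b => if CQ a c b then (1 : R) else 0 := by
    funext a c b; exact coef_col R a c b
  change tAct ((zig R ℓ).mat n).cal ((piT R ℓ i).col n).cal ((piT R ℓ i).col n).coef x.1 v.1 = _
  rw [h]
  rfl

end Mul

/-- The weight of a word of coloured rows. -/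
noncomputable def wt (p : Fin d → CR ℓ n) : MComp ℓ n :=
  fun j r => Fintype.card {k // p k = (j, r)}

/-- The letter `ξ_{r,r}^{e_j}`. -/
def idl (p : CR ℓ n) : ML ℓ n := (p.2, p.2, ZPath.e p.1)

theorem mrow_idl (p : CR ℓ n) : mrow (idl p) = p := rfl
theorem mcol_idl (p : CR ℓ n) : mcol (idl p) = p := rfl
theorem mdeg_idl (p : CR ℓ n) : mdeg (idl p) = 0 := rfl

theorem etaFun_eq_zero {μ : MComp ℓ n} {a : Fin d → ML ℓ n} (h : ∀ p, a ≠ idl ∘ p) :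
    etaFun R ℓ n d μ a = 0 := by
  refine if_neg fun h' => h (mrow ∘ a) ?_
  funext k
  obtain ⟨j, r, hk⟩ := h'.1 k
  simp only [Function.comp_apply, hk]
  rfl

theorem etaFun_idl (μ : MComp ℓ n) (p : Fin d → CR ℓ n) :
    etaFun R ℓ n d μ (idl ∘ p) = if wt p = μ then 1 else 0 := by
  refine if_congr ?_ rfl rfl
  have h : ∀ j r, Fintype.card {k // (idl ∘ p) k = (r, r, ZPath.e j)} = wt p j r := fun j r =>
    Fintype.card_congr (Equiv.subtypeEquivRight fun k =>
      ⟨fun h => congrArg mrow h, fun h => by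
        rw [Function.comp_apply, h]; rfl⟩)
  constructor
  · rintro ⟨-, h2⟩
    funext j r
    rw [← h, h2]
  · rintro rfl
    exact ⟨fun k => ⟨(p k).1, (p k).2, rfl⟩, h⟩

/-- A word of length-zero paths is even and keeps exactly the words with its coloured rows. Summing
over all words of weight `μ` gives the projection to the weight `μ`. The relation `Q` is left open
to serve matrices and columns at once. -/
theorem tAct_etaFun {BV : Type*} [Fintype BV] {cV : Calib BV} {Q : ML ℓ n → BV → BV → Prop}
    (row : BV → CR ℓ n) (hQ : ∀ p c b, Q (idl p) c b ↔ p = row b ∧ c = b) (μ : MComp ℓ n)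
    (v : (Fin d → BV) → R) :
    tAct (matCal ℓ n) cV (fun a c b => if Q a c b then (1 : R) else 0) (etaFun R ℓ n d μ) v =
      fun b => if wt (row ∘ b) = μ then v b else 0 := by
  funext b
  rw [tAct, Finset.sum_eq_single (idl ∘ row ∘ b), Finset.sum_eq_single b, etaFun_idl]
  · have h1 : (matCal ℓ n).par ∘ (idl ∘ row ∘ b) = 0 := by
      funext k
      change ((mdeg (idl (row (b k))) : ℕ) : ZMod 2) = 0
      rw [mdeg_idl, Nat.cast_zero]
    rw [h1, koszul_zero_left, Finset.prod_eq_one]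
    · split_ifs <;> simp
    · intro k _
      exact if_pos ((hQ _ _ _).mpr ⟨rfl, rfl⟩)
  · intro c _ hc
    obtain ⟨k, hk⟩ := Function.ne_iff.mp hc
    rw [Finset.prod_eq_zero (Finset.mem_univ k), mul_zero, mul_zero]
    exact if_neg fun h => hk ((hQ _ _ _).mp h).2
  · simp
  · intro a _ ha
    refine Finset.sum_eq_zero fun c _ => ?_
    by_cases hp : ∃ p, a = idl ∘ p
    · obtain ⟨p, rfl⟩ := hp
      have : p ≠ row ∘ b := fun h => ha (by rw [h])
      obtain ⟨k, hk⟩ := Function.ne_iff.mp this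
      rw [Finset.prod_eq_zero (Finset.mem_univ k), mul_zero, mul_zero]
      exact if_neg fun h => hk ((hQ _ _ _).mp h).1
    · rw [etaFun_eq_zero R (fun p h => hp ⟨p, h⟩), zero_mul, zero_mul]
  · simp

theorem MQ_idl_left (p : CR ℓ n) (c b : ML ℓ n) : MQ (idl p) c b ↔ p = mrow b ∧ c = b := by
  constructor
  · rintro ⟨h1, h2, h3, h4⟩
    rw [mcol_idl] at h1
    rw [mrow_idl] at h2
    rw [mdeg_idl, zero_add] at h4
    exact ⟨h2.symm, ML.ext' (h1.symm.trans h2.symm) h3.symm h4.symm⟩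
  · rintro ⟨rfl, rfl⟩
    exact ⟨rfl, rfl, rfl, (zero_add _).symm⟩

theorem MQ_idl_right (p : CR ℓ n) (a b : ML ℓ n) : MQ a (idl p) b ↔ p = mcol b ∧ a = b := by
  constructor
  · rintro ⟨h1, h2, h3, h4⟩
    rw [mrow_idl] at h1
    rw [mcol_idl] at h3
    rw [mdeg_idl, add_zero] at h4
    exact ⟨h3.symm, ML.ext' h2.symm (h1.trans h3.symm) h4.symm⟩
  · rintro ⟨rfl, rfl⟩
    exact ⟨rfl, rfl, rfl, (add_zero _).symm⟩

theorem CQ_idl (p : CR ℓ n) (c b : CL ℓ n i) : CQ (idl p) c b ↔ p = crow b ∧ c = b := by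
  constructor
  · rintro ⟨h1, h2, h4⟩
    rw [mcol_idl] at h1
    rw [mrow_idl] at h2
    rw [mdeg_idl, zero_add] at h4
    exact ⟨h2.symm, CL.ext' (h1.symm.trans h2.symm) h4.symm⟩
  · rintro ⟨rfl, rfl⟩
    exact ⟨rfl, rfl, (zero_add _).symm⟩

theorem eta_mmul (μ : MComp ℓ n) (v : (Fin d → ML ℓ n) → R) :
    mmul R (etaFun R ℓ n d μ) v = fun b => if wt (mrow ∘ b) = μ then v b else 0 :=
  tAct_etaFun R mrow MQ_idl_left μ v

theorem eta_cmul (μ : MComp ℓ n) (v : (Fin d → CL ℓ n i) → R) :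
    cmul R (etaFun R ℓ n d μ) v = fun b => if wt (crow ∘ b) = μ then v b else 0 :=
  tAct_etaFun R crow CQ_idl μ v

theorem mmul_eta (μ : MComp ℓ n) (x : (Fin d → ML ℓ n) → R) :
    mmul R x (etaFun R ℓ n d μ) = fun b => if wt (mcol ∘ b) = μ then x b else 0 := by
  funext b
  rw [mmul, tAct, Finset.sum_comm, Finset.sum_eq_single (idl ∘ mcol ∘ b),
    Finset.sum_eq_single b, etaFun_idl]
  · have h1 : (matCal ℓ n).par ∘ (idl ∘ mcol ∘ b) = 0 := by
      funext k
      change ((mdeg (idl (mcol (b k))) : ℕ) : ZMod 2) = 0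
      rw [mdeg_idl, Nat.cast_zero]
    rw [h1, koszul_zero_right, Finset.prod_eq_one]
    · split_ifs <;> simp
    · intro k _
      exact if_pos ((MQ_idl_right _ _ _).mpr ⟨rfl, rfl⟩)
  · intro c _ hc
    obtain ⟨k, hk⟩ := Function.ne_iff.mp hc
    rw [Finset.prod_eq_zero (Finset.mem_univ k), mul_zero, mul_zero]
    exact if_neg fun h => hk ((MQ_idl_right _ _ _).mp h).2
  · simp
  · intro a _ ha
    refine Finset.sum_eq_zero fun c _ => ?_
    by_cases hp : ∃ p, a = idl ∘ p
    · obtain ⟨p, rfl⟩ := hp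
      have : p ≠ mcol ∘ b := fun h => ha (by rw [h])
      obtain ⟨k, hk⟩ := Function.ne_iff.mp this
      rw [Finset.prod_eq_zero (Finset.mem_univ k), mul_zero, mul_zero]
      exact if_neg fun h => hk ((MQ_idl_right _ _ _).mp h).1
    · rw [etaFun_eq_zero R (fun p h => hp ⟨p, h⟩), mul_zero, zero_mul]
  · simp

end Letters


/-! ### Orbit sums in `T^𝖹(n, d)` and `𝒯_i^d` -/

section Orbits

open scoped Classical

variable (R F : Type*) [CommRing R] [IsDomain R] [CharZero R] [Field F] [Algebra R F]
  {ℓ n d : ℕ} {i : Fin (ℓ + 1)}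

/-- `T^𝖹(n, d)_R` as a modified divided power. -/
noncomputable def mLin : TZR R ℓ n d ≃ₗ[R] (matCal ℓ n).modDiv R d where
  toFun := fun x => ⟨x.1, x.2⟩
  invFun := fun x => ⟨x.1, x.2⟩
  map_add' := fun _ _ => rfl
  map_smul' := fun _ _ => rfl
  left_inv := fun _ => rfl
  right_inv := fun _ => rfl

/-- `Γ̃^d Col_n(ΠT(i))_R` as a modified divided power. -/
noncomputable def cLin : ((piT R ℓ i).col n).modPow d ≃ₗ[R] (colCal ℓ n i).modDiv R d where
  toFun := fun x => ⟨x.1, x.2⟩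
  invFun := fun x => ⟨x.1, x.2⟩
  map_add' := fun _ _ => rfl
  map_smul' := fun _ _ => rfl
  left_inv := fun _ => rfl
  right_inv := fun _ => rfl

/-- The element `y_b` of `T^𝖹(n, d)_R`. -/
noncomputable def mY (b : Fin d → ML ℓ n) : TZR R ℓ n d := (mLin R).symm ((matCal ℓ n).ys R b)

/-- The element `y_b` of `Γ̃^d Col_n(ΠT(i))_R`. -/
noncomputable def cY (b : Fin d → CL ℓ n i) : ((piT R ℓ i).col n).modPow d :=
  (cLin R).symm ((colCal ℓ n i).ys R b)

/-- The coefficient of `y_b`. -/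
noncomputable def mco (b : Fin d → ML ℓ n) : TZR R ℓ n d →ₗ[R] R :=
  (matCal ℓ n).coord R b ∘ₗ (mLin R).toLinearMap

/-- The coefficient of `y_b`. -/
noncomputable def cco (b : Fin d → CL ℓ n i) : ((piT R ℓ i).col n).modPow d →ₗ[R] R :=
  (colCal ℓ n i).coord R b ∘ₗ (cLin R).toLinearMap

theorem TZR_eq_sum (x : TZR R ℓ n d) :
    x = ∑ q : Quotient (wordSetoid (ML ℓ n) d), mco R (rep q) x • mY R (rep q) := by
  apply (mLin R).injective
  rw [map_sum]
  simp only [map_smul]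
  exact (matCal ℓ n).eq_sum_coord (mLin R x)

theorem TTR_eq_sum (x : ((piT R ℓ i).col n).modPow d) :
    x = ∑ q : Quotient (wordSetoid (CL ℓ n i) d), cco R (rep q) x • cY R (rep q) := by
  apply (cLin R).injective
  rw [map_sum]
  simp only [map_smul]
  exact (colCal ℓ n i).eq_sum_coord (cLin R x)

variable {R}

theorem cco_eq_zero {b : Fin d → CL ℓ n i} {x : ((piT R ℓ i).col n).modPow d} (h : x.1 b = 0) :
    cco R b x = 0 :=
  ((colCal ℓ n i).coord_eq_iff b (cLin R x) 0).mpr (by rw [mul_zero]; exact h)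

theorem mY_val {b : Fin d → ML ℓ n} (hb : (matCal ℓ n).Seq b) :
    (mY R b).1 = (matCal ℓ n).y R b := (matCal ℓ n).ys_of_seq hb

theorem cY_val {b : Fin d → CL ℓ n i} (hb : (colCal ℓ n i).Seq b) :
    (cY R b).1 = (colCal ℓ n i).y R b := (colCal ℓ n i).ys_of_seq hb

theorem mY_of_not {b : Fin d → ML ℓ n} (hb : ¬ (matCal ℓ n).Seq b) : mY R b = 0 := by
  rw [mY, (matCal ℓ n).ys_of_not_seq hb, map_zero]

theorem cY_of_not {b : Fin d → CL ℓ n i} (hb : ¬ (colCal ℓ n i).Seq b) : cY R b = 0 := by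
  rw [cY, (colCal ℓ n i).ys_of_not_seq hb, map_zero]

theorem mY_apply_eq_zero {b b' : Fin d → ML ℓ n}
    (h : ¬ ∃ σ : Equiv.Perm (Fin d), b ∘ σ = b') : (mY R b).1 b' = 0 := by
  by_cases hb : (matCal ℓ n).Seq b
  · rw [mY_val hb]; exact y_eq_zero_of_not h
  · rw [mY_of_not hb]; rfl

theorem cY_apply_eq_zero {b b' : Fin d → CL ℓ n i}
    (h : ¬ ∃ σ : Equiv.Perm (Fin d), b ∘ σ = b') : (cY R b).1 b' = 0 := by
  by_cases hb : (colCal ℓ n i).Seq b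
  · rw [cY_val hb]; exact y_eq_zero_of_not h
  · rw [cY_of_not hb]; rfl

theorem wt_comp (p : Fin d → CR ℓ n) (σ : Equiv.Perm (Fin d)) : wt (p ∘ σ) = wt p := by
  funext j r
  exact Fintype.card_congr (σ.subtypeEquiv fun a => by simp)

variable (R) in
/-- The weight idempotent `η_μ` of `T^𝖹(n, d)_R`. -/
noncomputable def etaR (μ : MComp ℓ n) : TZR R ℓ n d :=
  ⟨etaFun R ℓ n d μ, etaFun_mem R ℓ n d μ⟩

variable (R) in
theorem eta_eq (μ : MComp ℓ n) : eta R F ℓ n d μ = 1 ⊗ₜ etaR R μ := rfl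

/-- The row weight is constant on the orbit of `b`, so an orbit sum is kept or killed as a whole. -/
theorem etaR_mul_mY (μ : MComp ℓ n) (b : Fin d → ML ℓ n) :
    etaR R μ * mY R b =
      if wt (mrow ∘ b) = μ then mY R b else 0 := by
  refine Subtype.ext (funext fun b' => ?_)
  have h1 := TZR_mul_val R (etaR R μ) (mY R b)
  have h2 := eta_mmul (d := d) R μ (mY R b).1
  refine ((congrFun h1 b').trans (congrFun h2 b')).trans ?_
  by_cases h : ∃ σ : Equiv.Perm (Fin d), b ∘ σ = b'
  · obtain ⟨σ, rfl⟩ := h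
    have e : wt (mrow ∘ b ∘ σ) = wt (mrow ∘ b) := wt_comp (mrow ∘ b) σ
    rw [e]
    split_ifs <;> rfl
  · rw [mY_apply_eq_zero h, ite_self]
    split_ifs
    · exact (mY_apply_eq_zero h).symm
    · rfl

theorem mY_mul_etaR (μ : MComp ℓ n) (b : Fin d → ML ℓ n) :
    mY R b * etaR R μ =
      if wt (mcol ∘ b) = μ then mY R b else 0 := by
  refine Subtype.ext (funext fun b' => ?_)
  have h1 := TZR_mul_val R (mY R b) (etaR R μ)
  have h2 := mmul_eta (d := d) R μ (mY R b).1
  refine ((congrFun h1 b').trans (congrFun h2 b')).trans ?_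
  by_cases h : ∃ σ : Equiv.Perm (Fin d), b ∘ σ = b'
  · obtain ⟨σ, rfl⟩ := h
    have e : wt (mcol ∘ b ∘ σ) = wt (mcol ∘ b) := wt_comp (mcol ∘ b) σ
    rw [e]
    split_ifs <;> rfl
  · rw [mY_apply_eq_zero h, ite_self]
    split_ifs
    · exact (mY_apply_eq_zero h).symm
    · rfl

theorem etaR_smul_cY (μ : MComp ℓ n) (b : Fin d → CL ℓ n i) :
    (etaR R μ : TZR R ℓ n d) • cY R b =
      if wt (crow ∘ b) = μ then cY R b else 0 := by
  refine Subtype.ext (funext fun b' => ?_)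
  have h1 := TTR_smul_val R (etaR R μ) (cY R b)
  have h2 := eta_cmul (d := d) R μ (cY R b).1
  refine ((congrFun h1 b').trans (congrFun h2 b')).trans ?_
  by_cases h : ∃ σ : Equiv.Perm (Fin d), b ∘ σ = b'
  · obtain ⟨σ, rfl⟩ := h
    have e : wt (crow ∘ b ∘ σ) = wt (crow ∘ b) := wt_comp (crow ∘ b) σ
    rw [e]
    split_ifs <;> rfl
  · rw [cY_apply_eq_zero h, ite_self]
    split_ifs
    · exact (cY_apply_eq_zero h).symm
    · rfl

/-! ### Orbit sums after extension of scalars to `F` -/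

variable (R)

/-- The element `1 ⊗ y_b` of `T^𝖹(n, d)`. -/
noncomputable def MY (b : Fin d → ML ℓ n) : TZ R F ℓ n d := 1 ⊗ₜ mY R b

/-- A pure tensor in `𝒯_i^d`. -/
noncomputable def ttmk (r : F) (m : ((piT R ℓ i).col n).modPow d) : TT R F ℓ n d i :=
  (r ⊗ₜ m : F ⊗[R] ((piT R ℓ i).col n).modPow d)

/-- The element `1 ⊗ y_b` of `𝒯_i^d`. -/
noncomputable def CY (b : Fin d → CL ℓ n i) : TT R F ℓ n d i := ttmk R F 1 (cY R b)

/-- The coefficient of `1 ⊗ y_b`. -/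
noncomputable def ccoF (b : Fin d → CL ℓ n i) : TT R F ℓ n d i →ₗ[F] F := formF F (cco R b)

variable {R F}

theorem tt_smul (r r' : F) (s : TZR R ℓ n d) (m : ((piT R ℓ i).col n).modPow d) :
    (r ⊗ₜ[R] s : TZ R F ℓ n d) • ttmk R F r' m = ttmk R F (r * r') (s • m) :=
  ext_smul_tmul r r' s m

theorem TT_induction {P : TT R F ℓ n d i → Prop} (h0 : P 0)
    (hadd : ∀ v w, P v → P w → P (v + w)) (ht : ∀ r m, P (ttmk R F r m)) (v : TT R F ℓ n d i) :
    P v :=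
  TensorProduct.induction_on (motive := P) v h0 ht hadd

theorem TZ_eq_sum (x : TZ R F ℓ n d) :
    x = ∑ q : Quotient (wordSetoid (ML ℓ n) d), formF F (mco R (rep q)) x • MY R F (rep q) :=
  eq_sum_formF (TZR_eq_sum R) x

theorem TT_eq_sum (x : TT R F ℓ n d i) :
    x = ∑ q : Quotient (wordSetoid (CL ℓ n i) d), ccoF R F (rep q) x • CY R F (rep q) :=
  eq_sum_formF (TTR_eq_sum R) x

theorem TT_eq_zero {x : TT R F ℓ n d i} (h : ∀ b, ccoF R F b x = 0) : x = 0 := by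
  rw [TT_eq_sum x]
  exact Finset.sum_eq_zero fun q _ => by rw [h, zero_smul]

instance : FiniteDimensional F (TZ R F ℓ n d) := finite_of_eq_sum (TZR_eq_sum R)

instance : FiniteDimensional F (TT R F ℓ n d i) :=
  finite_of_eq_sum (F := F) (TTR_eq_sum (i := i) (n := n) (d := d) R)

/-- `ε` is a sign. -/
def IsSign {K : Type*} [CommRing K] (ε : K) : Prop := ε = 1 ∨ ε = -1

theorem IsSign.map {R F : Type*} [CommRing R] [Field F] [Algebra R F] {ε : R}
    (h : IsSign ε) : IsSign (algebraMap R F ε) := by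
  rcases h with rfl | rfl
  · exact Or.inl (map_one _)
  · exact Or.inr (by rw [map_neg, map_one])

theorem IsSign.mul {K : Type*} [CommRing K] {ε ε' : K} (h : IsSign ε) (h' : IsSign ε') :
    IsSign (ε * ε') := by
  rcases h with rfl | rfl <;> rcases h' with rfl | rfl <;> simp [IsSign]

theorem IsSign.mul_self {K : Type*} [CommRing K] {ε : K} (h : IsSign ε) : ε * ε = 1 := by
  rcases h with rfl | rfl <;> simp

theorem MY_of_mY_smul {x : TZR R ℓ n d} {b : Fin d → ML ℓ n}
    (h : ∃ ε : R, IsSign ε ∧ x = ε • mY R b) :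
    ∃ ε : F, IsSign ε ∧ (1 : F) ⊗ₜ[R] x = ε • MY R F b := by
  obtain ⟨ε, hε, rfl⟩ := h
  refine ⟨_, hε.map, ?_⟩
  rw [TensorProduct.tmul_smul, algebraMap_smul]
  rfl

theorem CY_of_cY_smul {x : ((piT R ℓ i).col n).modPow d} {b : Fin d → CL ℓ n i}
    (h : ∃ ε : R, IsSign ε ∧ x = ε • cY R b) :
    ∃ ε : F, IsSign ε ∧ ttmk R F 1 x = ε • CY R F b := by
  obtain ⟨ε, hε, rfl⟩ := h
  refine ⟨_, hε.map, ?_⟩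
  have : (1 : F) ⊗ₜ[R] (ε • cY R b) = algebraMap R F ε • ((1 : F) ⊗ₜ[R] cY R b) := by
    rw [TensorProduct.tmul_smul, algebraMap_smul]
  exact this

theorem MY_comp (b : Fin d → ML ℓ n) (σ : Equiv.Perm (Fin d)) :
    ∃ ε : F, IsSign ε ∧ MY R F (b ∘ σ) = ε • MY R F b := by
  obtain ⟨ε, hε, h⟩ := (matCal ℓ n).ys_comp (R := R) b σ
  exact MY_of_mY_smul ⟨ε, hε, by rw [mY, h, map_smul]; rfl⟩

theorem CY_comp (b : Fin d → CL ℓ n i) (σ : Equiv.Perm (Fin d)) :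
    ∃ ε : F, IsSign ε ∧ CY R F (b ∘ σ) = ε • CY R F b := by
  obtain ⟨ε, hε, h⟩ := (colCal ℓ n i).ys_comp (R := R) b σ
  exact CY_of_cY_smul ⟨ε, hε, by rw [cY, h, map_smul]; rfl⟩

theorem MY_of_not {b : Fin d → ML ℓ n} (hb : ¬ (matCal ℓ n).Seq b) : MY R F b = 0 := by
  rw [MY, mY_of_not hb, TensorProduct.tmul_zero]

theorem CY_of_not {b : Fin d → CL ℓ n i} (hb : ¬ (colCal ℓ n i).Seq b) : CY R F b = 0 := by
  have : (1 : F) ⊗ₜ[R] (cY R b) = 0 := by rw [cY_of_not hb, TensorProduct.tmul_zero]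
  exact this

theorem MY_mul_MY (x y : Fin d → ML ℓ n) : MY R F x * MY R F y = 1 ⊗ₜ (mY R x * mY R y) := by
  rw [MY, MY, Algebra.TensorProduct.tmul_mul_tmul, one_mul]

theorem MY_smul_CY (x : Fin d → ML ℓ n) (y : Fin d → CL ℓ n i) :
    MY R F x • CY R F y = ttmk R F 1 (mY R x • cY R y) := by
  rw [MY, CY, tt_smul, one_mul]

theorem eta_mul_MY (μ : MComp ℓ n) (b : Fin d → ML ℓ n) :
    eta R F ℓ n d μ * MY R F b = if wt (mrow ∘ b) = μ then MY R F b else 0 := by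
  rw [MY, eta_eq, Algebra.TensorProduct.tmul_mul_tmul, one_mul, etaR_mul_mY]
  split_ifs
  · rfl
  · rw [TensorProduct.tmul_zero]

theorem MY_mul_eta (μ : MComp ℓ n) (b : Fin d → ML ℓ n) :
    MY R F b * eta R F ℓ n d μ = if wt (mcol ∘ b) = μ then MY R F b else 0 := by
  rw [MY, eta_eq, Algebra.TensorProduct.tmul_mul_tmul, one_mul, mY_mul_etaR]
  split_ifs
  · rfl
  · rw [TensorProduct.tmul_zero]

theorem eta_smul_CY (μ : MComp ℓ n) (b : Fin d → CL ℓ n i) :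
    eta R F ℓ n d μ • CY R F b = if wt (crow ∘ b) = μ then CY R F b else 0 := by
  rw [CY, eta_eq, tt_smul, one_mul, etaR_smul_cY]
  split_ifs
  · rfl
  · exact TensorProduct.tmul_zero _ _

theorem eta_mul_eta (μ : MComp ℓ n) :
    eta R F ℓ n d μ * eta R F ℓ n d μ = eta R F ℓ n d μ := by
  rw [eta_eq, Algebra.TensorProduct.tmul_mul_tmul, one_mul]
  congr 1
  refine Subtype.ext (funext fun b => ?_)
  have h1 := TZR_mul_val (d := d) R (etaR R μ) (etaR R μ)
  have h2 := eta_mmul (d := d) R μ (etaFun R ℓ n d μ)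
  refine ((congrFun h1 b).trans (congrFun h2 b)).trans ?_
  by_cases h : ∃ p, b = idl ∘ p
  · obtain ⟨p, rfl⟩ := h
    change (if wt p = μ then etaFun R ℓ n d μ (idl ∘ p) else 0) = etaFun R ℓ n d μ (idl ∘ p)
    rw [etaFun_idl]
    split_ifs <;> rfl
  · change (if _ then etaFun R ℓ n d μ b else 0) = etaFun R ℓ n d μ b
    rw [etaFun_eq_zero R fun p h' => h ⟨p, h'⟩, ite_self]

theorem ccoF_CY_self {b : Fin d → CL ℓ n i} (hb : (colCal ℓ n i).Seq b) :
    ccoF R F b (CY R F b) = 1 := by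
  refine (formF_tmul (cco R b) 1 (cY R b)).trans ?_
  rw [one_mul, show cco R b (cY R b) = 1 from (colCal ℓ n i).coord_ys_self hb, map_one]

theorem ccoF_CY_of_ne {b b' : Fin d → CL ℓ n i}
    (h : ¬ ∃ σ : Equiv.Perm (Fin d), b' ∘ σ = b) : ccoF R F b (CY R F b') = 0 := by
  refine (formF_tmul (cco R b) 1 (cY R b')).trans ?_
  rw [show cco R b (cY R b') = 0 from (colCal ℓ n i).coord_ys_of_ne h, map_zero, mul_zero]

theorem ccoF_comp (b : Fin d → CL ℓ n i) (σ : Equiv.Perm (Fin d)) (x : TT R F ℓ n d i) :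
    ∃ ε : F, IsSign ε ∧ ccoF R F (b ∘ σ) x = ε * ccoF R F b x := by
  refine ⟨_, IsSign.map (R := R) (F := F) (sign_cases (permKoszul σ ((colCal ℓ n i).par ∘ b))), ?_⟩
  refine TT_induction (P := fun x => ccoF R F (b ∘ σ) x = _ * ccoF R F b x)
    (by rw [map_zero, map_zero, mul_zero]) (fun v w hv hw => ?_) (fun r m => ?_) x
  · rw [map_add, map_add, hv, hw, mul_add]
  · change formF F (cco R (b ∘ σ)) (r ⊗ₜ m) = _ * formF F (cco R b) (r ⊗ₜ m)
    rw [formF_tmul, formF_tmul]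
    have : cco R (b ∘ σ) m = _ := (colCal ℓ n i).coord_comp b σ (cLin R m)
    rw [this, map_mul]
    change _ = _ * (r * algebraMap R F ((colCal ℓ n i).coord R b (cLin R m)))
    ring

end Orbits

/-! ### Gradings -/

section Gradings

open scoped Classical

variable {R F : Type*} [CommRing R] [IsDomain R] [CharZero R] [Field F] [Algebra R F]
  {ℓ n d : ℕ} {i : Fin (ℓ + 1)}

/-- The parity of a word. -/
def Calib.tpar {B : Type*} (κ : Calib B) (b : Fin d → B) : ZMod 2 := ∑ k, κ.par (b k)

theorem Calib.tpar_comp {B : Type*} (κ : Calib B) (b : Fin d → B) (σ : Equiv.Perm (Fin d)) :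
    κ.tpar (b ∘ σ) = κ.tpar b := Equiv.sum_comp σ fun k => κ.par (b k)

theorem MY_mem (b : Fin d → ML ℓ n) : MY R F b ∈ TZgr R F ℓ n d ((matCal ℓ n).tpar b) := by
  refine Submodule.tmul_mem_baseChange_of_mem 1 ?_
  intro b' hb'
  by_contra h
  apply hb'
  refine mY_apply_eq_zero ?_
  rintro ⟨σ, rfl⟩
  exact h ((matCal ℓ n).tpar_comp b σ)

theorem CY_mem (b : Fin d → CL ℓ n i) : CY R F b ∈ TTgr R F ℓ n d i ((colCal ℓ n i).tpar b) := by
  refine Submodule.tmul_mem_baseChange_of_mem (1 : F)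
    (p := ((piT R ℓ i).col n).gr d ((colCal ℓ n i).tpar b)) ?_
  intro b' hb'
  by_contra h
  apply hb'
  refine cY_apply_eq_zero ?_
  rintro ⟨σ, rfl⟩
  exact h ((colCal ℓ n i).tpar_comp b σ)

theorem zmod2_ne {a b : ZMod 2} (h : a ≠ b) : a = b + 1 := by revert a b; decide

theorem zmod2_ne_add_one (a : ZMod 2) : a + 1 ≠ a := by revert a; decide

theorem split_of_sum {ι M : Type*} [Fintype ι] [AddCommGroup M] [Module F M]
    {gr : ZMod 2 → Submodule F M} {y : ι → M} {p : ι → ZMod 2} (hy : ∀ q, y q ∈ gr (p q))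
    (c : ι → F) (δ : ZMod 2) :
    ∃ a ∈ gr δ, ∃ b ∈ gr (δ + 1), ∑ q, c q • y q = a + b := by
  refine ⟨∑ q ∈ Finset.univ.filter (fun q => p q = δ), c q • y q,
    Submodule.sum_mem _ fun q hq => ?_,
    ∑ q ∈ Finset.univ.filter (fun q => ¬ p q = δ), c q • y q, Submodule.sum_mem _ fun q hq => ?_,
    (Finset.sum_filter_add_sum_filter_not _ _ _).symm⟩
  · have := hy q
    rw [(Finset.mem_filter.mp hq).2] at this
    exact Submodule.smul_mem _ _ this
  · have := hy q
    rw [zmod2_ne (Finset.mem_filter.mp hq).2] at this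
    exact Submodule.smul_mem _ _ this

theorem tAct_gr {R : Type*} [CommRing R] {BA BV : Type*} [Fintype BA] [Fintype BV]
    {cA : Calib BA} {cV : Calib BV}
    {Q : BA → BV → BV → Prop} (hpar : ∀ {a c b}, Q a c b → cV.par b = cA.par a + cV.par c)
    {x : (Fin d → BA) → R} {v : (Fin d → BV) → R} {δ δ' : ZMod 2}
    (hx : ∀ b, x b ≠ 0 → cA.tpar b = δ) (hv : ∀ b, v b ≠ 0 → cV.tpar b = δ') (b : Fin d → BV)
    (hb : tAct cA cV (fun a c b => if Q a c b then (1 : R) else 0) x v b ≠ 0) :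
    cV.tpar b = δ + δ' := by
  obtain ⟨a, _, ha⟩ := Finset.exists_ne_zero_of_sum_ne_zero hb
  obtain ⟨c, _, hc⟩ := Finset.exists_ne_zero_of_sum_ne_zero ha
  have h1 := left_ne_zero_of_mul hc
  have h2 := right_ne_zero_of_mul (right_ne_zero_of_mul hc)
  rw [← hx a (left_ne_zero_of_mul h1), ← hv c (right_ne_zero_of_mul h1), Calib.tpar, Calib.tpar,
    Calib.tpar, ← Finset.sum_add_distrib]
  refine Finset.sum_congr rfl fun k _ => hpar ?_
  by_contra h'
  exact factor_ne_zero h2 k (if_neg h')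

theorem TZ_mul_mem {δ δ' : ZMod 2} {x y : TZ R F ℓ n d} (hx : x ∈ TZgr R F ℓ n d δ)
    (hy : y ∈ TZgr R F ℓ n d δ') : x * y ∈ TZgr R F ℓ n d (δ + δ') := by
  refine baseChange_induction (P := fun x : TZ R F ℓ n d => x * y ∈ TZgr R F ℓ n d (δ + δ')) hx ?_
    (fun v w hv hw => ?_) fun r s hs => ?_
  · rw [zero_mul]; exact Submodule.zero_mem _
  · rw [add_mul]; exact Submodule.add_mem _ hv hw
  refine baseChange_induction (P := fun y : TZ R F ℓ n d =>
    (r ⊗ₜ[R] s : TZ R F ℓ n d) * y ∈ TZgr R F ℓ n d (δ + δ')) hy ?_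
    (fun v w hv hw => ?_) fun r' s' hs' => ?_
  · rw [mul_zero]; exact Submodule.zero_mem _
  · rw [mul_add]; exact Submodule.add_mem _ hv hw
  rw [Algebra.TensorProduct.tmul_mul_tmul]
  refine Submodule.tmul_mem_baseChange_of_mem _ ?_
  intro b hb
  rw [TZR_mul_val] at hb
  exact tAct_gr MQ.par hs hs' b hb

theorem TTgr_induction {δ : ZMod 2} {P : TT R F ℓ n d i → Prop} {v : TT R F ℓ n d i}
    (hv : v ∈ TTgr R F ℓ n d i δ) (h0 : P 0) (hadd : ∀ v w, P v → P w → P (v + w))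
    (ht : ∀ r, ∀ m ∈ ((piT R ℓ i).col n).gr d δ, P (ttmk R F r m)) : P v :=
  baseChange_induction (P := P) hv h0 hadd ht

theorem TT_smul_mem {δ δ' : ZMod 2} {x : TZ R F ℓ n d} {v : TT R F ℓ n d i}
    (hx : x ∈ TZgr R F ℓ n d δ) (hv : v ∈ TTgr R F ℓ n d i δ') :
    x • v ∈ TTgr R F ℓ n d i (δ + δ') := by
  refine baseChange_induction (P := fun x : TZ R F ℓ n d => x • v ∈ TTgr R F ℓ n d i (δ + δ')) hx
    ?_ (fun v' w hv hw => ?_) fun r s hs => ?_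
  · exact (zero_smul (TZ R F ℓ n d) v).symm ▸ Submodule.zero_mem _
  · exact (add_smul v' w v).symm ▸ Submodule.add_mem _ hv hw
  refine TTgr_induction (P := fun v : TT R F ℓ n d i => (r ⊗ₜ[R] s : TZ R F ℓ n d) • v ∈
    TTgr R F ℓ n d i (δ + δ')) hv ?_ (fun v w hv hw => ?_) fun r' s' hs' => ?_
  · rw [smul_zero]; exact Submodule.zero_mem _
  · rw [smul_add]; exact Submodule.add_mem _ hv hw
  rw [tt_smul]
  refine Submodule.tmul_mem_baseChange_of_mem (p := ((piT R ℓ i).col n).gr d (δ + δ')) _ ?_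
  intro b hb
  rw [TTR_smul_val] at hb
  exact tAct_gr CQ.par hs hs' b hb

theorem ccoF_eq_zero_of_mem {δ : ZMod 2} {v : TT R F ℓ n d i} (hv : v ∈ TTgr R F ℓ n d i δ)
    {b : Fin d → CL ℓ n i} (hb : (colCal ℓ n i).tpar b ≠ δ) : ccoF R F b v = 0 := by
  refine TTgr_induction (P := fun v : TT R F ℓ n d i => ccoF R F b v = 0) hv (map_zero _)
    (fun v w hv hw => ?_) fun r m hm => ?_
  · rw [map_add, hv, hw, add_zero]
  · refine (formF_tmul (cco R b) r m).trans ?_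
    rw [cco_eq_zero, map_zero, mul_zero]
    by_contra h
    exact hb (hm b h)

variable (R F ℓ n d)

theorem TZ_super : (TZdata R F ℓ n d).Super where
  split := fun δ x => by
    have := split_of_sum (gr := TZgr R F ℓ n d) (fun q => MY_mem (rep q))
      (fun q => formF F (mco R (rep q)) x) δ
    rwa [← TZ_eq_sum x] at this
  mul_mem := TZ_mul_mem
  e_mem := fun l => Submodule.tmul_mem_baseChange_of_mem _ (by
    intro b hb
    by_cases h : ∃ p, b = idl ∘ p
    · obtain ⟨p, rfl⟩ := h
      refine Finset.sum_eq_zero fun k _ => ?_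
      change ((mdeg (idl (p k)) : ℕ) : ZMod 2) = 0
      rw [mdeg_idl, Nat.cast_zero]
    · exact absurd (etaFun_eq_zero R fun p h' => h ⟨p, h'⟩) hb)
  e_mul := fun l => eta_mul_eta l.1

theorem TT_superMod (i : Fin (ℓ + 1)) : (TZdata R F ℓ n d).SuperMod (TTgr R F ℓ n d i) where
  split := fun δ x => by
    have := split_of_sum (gr := TTgr R F ℓ n d i) (fun q => CY_mem (rep q))
      (fun q => ccoF R F (rep q) x) δ
    rwa [← TT_eq_sum x] at this
  disj := fun {δ v} h1 h2 => TT_eq_zero fun b => by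
    by_cases h : (colCal ℓ n i).tpar b = δ
    · refine ccoF_eq_zero_of_mem h2 ?_
      rw [h]
      exact (zmod2_ne_add_one δ).symm
    · exact ccoF_eq_zero_of_mem h1 h
  smul_mem := TT_smul_mem

end Gradings


/-! ### The anti-involution `τ_{n,d}` -/

section SignLemmas

variable {R : Type*} [CommRing R] {d : ℕ}

theorem sg_sum {ι : Type*} (s : Finset ι) (f : ι → ZMod 2) :
    sg R (∑ k ∈ s, f k) = ∏ k ∈ s, sg R (f k) := by
  classical
  induction s using Finset.induction_on with
  | empty => simp [sg]
  | insert a s ha ih => rw [Finset.sum_insert ha, Finset.prod_insert ha, sg_add, ih]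

/-- The two Koszul signs count the pairs of places with `k > l` and with `k < l`, the last product
counts the diagonal. Together they run over all pairs, which is the product of the two total
parities. -/
theorem sign_koszul_comm (p q : Fin d → ZMod 2) :
    (-1 : R) ^ koszul p q * (-1) ^ koszul q p * ∏ k, sg R (p k * q k) =
      sg R ((∑ k, p k) * ∑ k, q k) := by
  have h0 : sg R 0 = 1 := by simp [sg]
  have h1 : sg R 1 = -1 := by simp [sg, show ZMod.val (1 : ZMod 2) = 1 from rfl]
  have hd : ∏ k, sg R (p k * q k) =
      ∏ x : Fin d × Fin d, if x.1 = x.2 then sg R (p x.1 * q x.1) else 1 := by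
    rw [Fintype.prod_prod_type]
    simp
  rw [Finset.sum_mul_sum, sg_sum, Finset.prod_congr rfl fun k _ => sg_sum _ _,
    ← Fintype.prod_prod_type' (fun k l => sg R (p k * q l)), hd]
  simp only [koszul, neg_one_pow_card]
  rw [← Finset.prod_mul_distrib, ← Finset.prod_mul_distrib]
  apply prod_pairs
  · intro k l hkl
    rcases zmod2_cases (p k) with h2 | h2 <;> rcases zmod2_cases (p l) with h3 | h3 <;>
    rcases zmod2_cases (q k) with h4 | h4 <;> rcases zmod2_cases (q l) with h5 | h5 <;>
    simp [h0, h1, h2, h3, h4, h5, hkl, hkl.not_gt, hkl.ne, hkl.ne']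
  · intro k
    simp

/-- The sign of `τ` in degree `g`. -/
def tsg (R : Type*) [CommRing R] (g : ℕ) : R := if g = 2 then -1 else 1

theorem tsg_mul_self (g : ℕ) : tsg R g * tsg R g = 1 := by
  unfold tsg; split_ifs <;> simp

/-- The critical case is `a = c = 1`: reversing a product of two odd arrows costs a sign, which is
what `τ(c_j) = -c_j` provides. -/
theorem tsg_add {a c : ℕ} (h : a + c ≤ 2) :
    tsg R (a + c) = tsg R a * tsg R c * sg R ((a : ZMod 2) * (c : ZMod 2)) := by
  have h1 : sg R 1 = -1 := by simp [sg, show ZMod.val (1 : ZMod 2) = 1 from rfl]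
  have h0 : sg R 0 = 1 := by simp [sg]
  have : a ≤ 2 := by omega
  have : c ≤ 2 := by omega
  interval_cases a <;> interval_cases c <;> first | omega | simp [tsg, h0, h1]

end SignLemmas

/-! ### `τ_{n,d}` as an even involutive super anti-automorphism -/

section Tau

open scoped Classical

variable {R F : Type*} [CommRing R] [IsDomain R] [CharZero R] [Field F] [Algebra R F]
  {ℓ n d : ℕ} {i : Fin (ℓ + 1)}

/-- The reversed letter. -/
def mrev (b : ML ℓ n) : ML ℓ n := (b.2.1, b.1, b.2.2.rev)

theorem mrev_mrev (b : ML ℓ n) : mrev (mrev b) = b := rfl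
theorem mrow_mrev (b : ML ℓ n) : mrow (mrev b) = mcol b := rfl
theorem mcol_mrev (b : ML ℓ n) : mcol (mrev b) = mrow b := rfl
theorem mdeg_mrev (b : ML ℓ n) : mdeg (mrev b) = mdeg b := rfl
theorem mrev_idl (p : CR ℓ n) : mrev (idl p) = idl p := rfl

theorem mdeg_le (b : ML ℓ n) : mdeg b ≤ 2 := by
  have := b.valid; unfold ZValid at this; omega

theorem cdeg_le (c : CL ℓ n i) : cdeg c ≤ 2 := by
  have := c.valid; omega

theorem MQ.rev {a c b : ML ℓ n} : MQ (mrev c) (mrev a) b ↔ MQ a c (mrev b) := by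
  unfold MQ
  rw [mcol_mrev, mrow_mrev, mrow_mrev, mcol_mrev, mdeg_mrev, mdeg_mrev, mrow_mrev, mcol_mrev,
    mdeg_mrev, add_comm (mdeg c), eq_comm (a := mrow c), and_left_comm (a := mrow b = mcol c)]

theorem matTau_repr (R : Type*) [CommRing R] (a b : ML ℓ n) :
    ((zig R ℓ).mat n).basis.repr (matTau R ℓ n (((zig R ℓ).mat n).basis a)) b =
      tsg R (mdeg b) * if a = mrev b then 1 else 0 := by
  have h1 : ∀ (M : Matrix (Fin n) (Fin n) (Zig R ℓ)) (b : ML ℓ n),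
      ((zig R ℓ).mat n).basis.repr M b = M b.1 b.2.1 b.2.2 := fun M b =>
    matrix_repr (zigBasis R ℓ) M b.1 b.2.1 b.2.2
  rw [h1]
  change tauSign R b.2.2 * (((zig R ℓ).mat n).basis a) b.2.1 b.1 b.2.2.rev = _
  rw [show (((zig R ℓ).mat n).basis a) b.2.1 b.1 b.2.2.rev =
    ((zig R ℓ).mat n).basis.repr (((zig R ℓ).mat n).basis a) (mrev b) from (h1 _ (mrev b)).symm,
    Module.Basis.repr_self, Finsupp.single_apply]
  congr 1
  unfold tauSign tsg
  exact if_congr Fin.ext_iff rfl rfl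

/-- The anti-involution on tensors. -/
noncomputable def wrev {R : Type*} [CommRing R] (x : (Fin d → ML ℓ n) → R) : (Fin d → ML ℓ n) → R :=
  fun b => x (mrev ∘ b) * ∏ k, tsg R (mdeg (b k))

variable (R) in
/-- The anti-involution of `T^𝖹(n, d)_R`. -/
noncomputable def tauR (ℓ n d : ℕ) : TZR R ℓ n d →ₗ[R] TZR R ℓ n d :=
  ((zig R ℓ).mat n).tau (matTau_monomial R ℓ n) d

theorem tauR_val (x : TZR R ℓ n d) : (tauR R ℓ n d x).1 = wrev x.1 := by
  funext b
  change ∑ a : Fin d → ML ℓ n, x.1 a * ∏ k, ((zig R ℓ).mat n).basis.repr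
    (matTau R ℓ n (((zig R ℓ).mat n).basis (a k))) (b k) = _
  simp only [matTau_repr, Finset.prod_mul_distrib]
  rw [Finset.sum_eq_single (mrev ∘ b)]
  · simp [wrev]
  · intro a _ ha
    obtain ⟨k, hk⟩ := Function.ne_iff.mp ha
    rw [Finset.prod_eq_zero (i := k) (f := fun k => if a k = mrev (b k) then (1 : R) else 0)
      (Finset.mem_univ k) (if_neg hk), mul_zero, mul_zero]
  · simp

theorem tauR_tauR (x : TZR R ℓ n d) : tauR R ℓ n d (tauR R ℓ n d x) = x := by
  refine Subtype.ext (funext fun b => ?_)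
  rw [tauR_val]
  change (tauR R ℓ n d x).1 (mrev ∘ b) * ∏ k, tsg R (mdeg (b k)) = x.1 b
  rw [tauR_val]
  change x.1 b * (∏ k, tsg R (mdeg (mrev (b k)))) * ∏ k, tsg R (mdeg (b k)) = x.1 b
  rw [mul_assoc, ← Finset.prod_mul_distrib, Finset.prod_eq_one, mul_one]
  exact fun k _ => tsg_mul_self _

theorem tauR_etaR (μ : MComp ℓ n) : tauR R ℓ n d (etaR R μ) = etaR R μ := by
  refine Subtype.ext (funext fun b => ?_)
  rw [tauR_val]
  change etaFun R ℓ n d μ (mrev ∘ b) * ∏ k, tsg R (mdeg (b k)) = etaFun R ℓ n d μ b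
  by_cases h : ∃ p, b = idl ∘ p
  · obtain ⟨p, rfl⟩ := h
    rw [Finset.prod_eq_one, mul_one]
    · rfl
    · intro k _
      rw [Function.comp_apply, mdeg_idl]
      exact if_neg (by decide)
  · rw [etaFun_eq_zero R fun p h' => h ⟨p, h'⟩, etaFun_eq_zero R, zero_mul]
    intro p hp
    refine h ⟨p, funext fun k => ?_⟩
    have := congrFun hp k
    rw [Function.comp_apply, Function.comp_apply] at this
    rw [Function.comp_apply, ← mrev_mrev (b k), this, mrev_idl]

/-- Reversal exchanges the factors letter by letter, at the cost of the signs in `tsg_add`, and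
replaces the Koszul sign of `(a, c)` by that of `(c, a)`. `sign_koszul_comm` adds these up to the
sign of the total parities. -/
theorem wrev_mmul {R : Type*} [CommRing R] {δ δ' : ZMod 2} {x y : (Fin d → ML ℓ n) → R}
    (hx : ∀ b, x b ≠ 0 → (matCal ℓ n).tpar b = δ) (hy : ∀ b, y b ≠ 0 → (matCal ℓ n).tpar b = δ') :
    wrev (mmul R x y) = sg R (δ * δ') • mmul R (wrev y) (wrev x) := by
  funext b
  change (∑ a : Fin d → ML ℓ n, ∑ c : Fin d → ML ℓ n, _) * _ =
    sg R (δ * δ') * (∑ c : Fin d → ML ℓ n, ∑ a : Fin d → ML ℓ n, _)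
  let e : (Fin d → ML ℓ n) ≃ (Fin d → ML ℓ n) :=
    Equiv.arrowCongr (Equiv.refl _) ⟨mrev, mrev, mrev_mrev, mrev_mrev⟩
  rw [Finset.sum_comm, Finset.sum_mul, Finset.mul_sum]
  refine Fintype.sum_equiv e _ _ fun c => ?_
  rw [Finset.sum_mul, Finset.mul_sum]
  refine Fintype.sum_equiv e _ _ fun a => ?_
  change x a * y c * ((-1) ^ koszul ((matCal ℓ n).par ∘ a) ((matCal ℓ n).par ∘ c) *
      ∏ k, if MQ (a k) (c k) (mrev (b k)) then 1 else 0) * ∏ k, tsg R (mdeg (b k)) =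
    sg R (δ * δ') * ((y c * ∏ k, tsg R (mdeg (mrev (c k)))) *
      (x a * ∏ k, tsg R (mdeg (mrev (a k)))) *
      ((-1) ^ koszul ((matCal ℓ n).par ∘ c) ((matCal ℓ n).par ∘ a) *
        ∏ k, if MQ (mrev (c k)) (mrev (a k)) (b k) then 1 else 0))
  by_cases hxa : x a = 0
  · simp [hxa]
  by_cases hyc : y c = 0
  · simp [hyc]
  simp only [MQ.rev, mdeg_mrev]
  by_cases h0 : ∏ k, (if MQ (a k) (c k) (mrev (b k)) then (1 : R) else 0) = 0
  · rw [h0]; simp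
  have hM : ∀ k, MQ (a k) (c k) (mrev (b k)) := fun k => by
    by_contra h'
    exact factor_ne_zero h0 k (if_neg h')
  have hS : ∏ k, tsg R (mdeg (b k)) = (∏ k, tsg R (mdeg (a k))) * (∏ k, tsg R (mdeg (c k))) *
      ∏ k, sg R (((matCal ℓ n).par ∘ a) k * ((matCal ℓ n).par ∘ c) k) := by
    rw [← Finset.prod_mul_distrib, ← Finset.prod_mul_distrib]
    refine Finset.prod_congr rfl fun k _ => ?_
    have h1 : mdeg (b k) = mdeg (a k) + mdeg (c k) := (hM k).2.2.2
    have h2 := mdeg_le (b k)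
    rw [h1] at h2 ⊢
    exact tsg_add h2
  have hK := sign_koszul_comm (R := R) ((matCal ℓ n).par ∘ a) ((matCal ℓ n).par ∘ c)
  have e1 : ∑ k, ((matCal ℓ n).par ∘ a) k = δ := hx a hxa
  have e2 : ∑ k, ((matCal ℓ n).par ∘ c) k = δ' := hy c hyc
  rw [e1, e2] at hK
  rw [hS, ← hK]
  have := sign_mul_self (R := R) (koszul ((matCal ℓ n).par ∘ c) ((matCal ℓ n).par ∘ a))
  generalize (-1 : R) ^ koszul ((matCal ℓ n).par ∘ c) ((matCal ℓ n).par ∘ a) = s at *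
  linear_combination (-(x a * y c * (-1) ^ koszul ((matCal ℓ n).par ∘ a) ((matCal ℓ n).par ∘ c) *
    (∏ k, if MQ (a k) (c k) (mrev (b k)) then (1 : R) else 0) * ((∏ k, tsg R (mdeg (a k))) *
      (∏ k, tsg R (mdeg (c k))) *
      ∏ k, sg R (((matCal ℓ n).par ∘ a) k * ((matCal ℓ n).par ∘ c) k)))) * this

theorem tauR_mul {δ δ' : ZMod 2} {x y : TZR R ℓ n d} (hx : x ∈ ((zig R ℓ).mat n).gr d δ)
    (hy : y ∈ ((zig R ℓ).mat n).gr d δ') :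
    tauR R ℓ n d (x * y) = sg R (δ * δ') • (tauR R ℓ n d y * tauR R ℓ n d x) := by
  have h1 := tauR_val (x * y)
  have h2 : wrev (x * y).1 = _ := congrArg wrev (TZR_mul_val R x y)
  have h3 := wrev_mmul (x := x.1) (y := y.1) hx hy
  have h4 := TZR_mul_val R (tauR R ℓ n d y) (tauR R ℓ n d x)
  have h5 : mmul R (tauR R ℓ n d y).1 (tauR R ℓ n d x).1 = mmul R (wrev y.1) (wrev x.1) :=
    congrArg₂ (mmul R) (tauR_val y) (tauR_val x)
  exact Subtype.ext (((h1.trans h2).trans h3).trans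
    (congrArg (sg R (δ * δ') • ·) (h4.trans h5).symm))

theorem tauR_gr {δ : ZMod 2} {x : TZR R ℓ n d} (hx : x ∈ ((zig R ℓ).mat n).gr d δ) :
    tauR R ℓ n d x ∈ ((zig R ℓ).mat n).gr d δ := by
  intro b hb
  rw [tauR_val] at hb
  exact hx (mrev ∘ b) (left_ne_zero_of_mul (show x.1 (mrev ∘ b) * _ ≠ 0 from hb))

theorem TZtau_tmul (r : F) (x : TZR R ℓ n d) :
    TZtau R F ℓ n d (r ⊗ₜ x) = r ⊗ₜ tauR R ℓ n d x := rfl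

variable (R F ℓ n d)

theorem TZ_antiInv : (TZdata R F ℓ n d).AntiInv (TZtau R F ℓ n d) where
  gr := fun {δ x} hx => by
    refine baseChange_induction (P := fun x => TZtau R F ℓ n d x ∈ TZgr R F ℓ n d δ) hx ?_
      (fun v w hv hw => ?_) fun r s hs => ?_
    · rw [map_zero]; exact Submodule.zero_mem _
    · rw [map_add]; exact Submodule.add_mem _ hv hw
    · rw [TZtau_tmul]
      exact Submodule.tmul_mem_baseChange_of_mem _ (tauR_gr hs)
  invol := fun x => by
    induction x using TensorProduct.induction_on with
    | zero => rw [map_zero, map_zero]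
    | tmul r s => rw [TZtau_tmul, TZtau_tmul, tauR_tauR]
    | add v w hv hw => rw [map_add, map_add, hv, hw]
  mul := fun {δ δ' x y} hx hy => by
    refine baseChange_induction (P := fun x => TZtau R F ℓ n d (x * y) =
      sg F (δ * δ') • (TZtau R F ℓ n d y * TZtau R F ℓ n d x)) hx ?_
      (fun v w hv hw => ?_) fun r s hs => ?_
    · rw [zero_mul, map_zero, mul_zero, smul_zero]
    · rw [add_mul, map_add, map_add, mul_add, smul_add, hv, hw]
    refine baseChange_induction (P := fun y => TZtau R F ℓ n d ((r ⊗ₜ[R] s : TZ R F ℓ n d) * y) =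
      sg F (δ * δ') • (TZtau R F ℓ n d y * TZtau R F ℓ n d (r ⊗ₜ[R] s))) hy ?_
      (fun v w hv hw => ?_) fun r' s' hs' => ?_
    · rw [mul_zero, map_zero, zero_mul, smul_zero]
    · rw [mul_add, map_add, map_add, add_mul, smul_add, hv, hw]
    rw [Algebra.TensorProduct.tmul_mul_tmul, TZtau_tmul, TZtau_tmul, TZtau_tmul,
      Algebra.TensorProduct.tmul_mul_tmul, tauR_mul hs hs', TensorProduct.tmul_smul,
      ← sg_algebraMap R F, algebraMap_smul, mul_comm r]
  e := fun l => (TZtau_tmul 1 (etaR R l.1)).trans (congrArg _ (tauR_etaR l.1))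

end Tau


/-! ### The contravariant form on `𝒯_i^d` -/

section Form

open scoped Classical

variable {ℓ n d : ℕ} {i : Fin (ℓ + 1)}

/-- The dual letter. -/
def star (c : CL ℓ n i) : CL ℓ n i :=
  (c.1, ⟨(c.2.1.1, c.2.1.2.rev), by
    have h := c.2.valid
    have h1 : (c.2.1.2.rev : ℕ) = 2 - c.2.1.2 := by rw [Fin.val_rev]; omega
    have h2 : ((c.2.1.1 : ℕ) = i) ↔ c.2.1.1 = i := Fin.ext_iff.symm
    rw [h2] at h
    simp only [Fin.ext_iff (n := 3)]
    change ((c.2.1.2.rev : ℕ) = 0 ∧ _) ∨ ((c.2.1.2.rev : ℕ) = 1 ∧ _) ∨ ((c.2.1.2.rev : ℕ) = 2 ∧ _)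
    rw [h1]
    omega⟩)

theorem crow_star (c : CL ℓ n i) : crow (star c) = crow c := rfl

theorem cdeg_star (c : CL ℓ n i) : cdeg (star c) = 2 - cdeg c := by
  change (c.2.1.2.rev : ℕ) = 2 - (c.2.1.2 : ℕ)
  rw [Fin.val_rev]
  omega

theorem star_star (c : CL ℓ n i) : star (star c) = c := by
  refine CL.ext' rfl ?_
  rw [cdeg_star, cdeg_star]
  have := cdeg_le c
  omega

theorem par_star (c : CL ℓ n i) : (colCal ℓ n i).par (star c) = (colCal ℓ n i).par c := by
  change ((cdeg (star c) : ℕ) : ZMod 2) = ((cdeg c : ℕ) : ZMod 2)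
  rw [cdeg_star]
  have := cdeg_le c
  interval_cases cdeg c <;> rfl

theorem cpar_zero_iff (c : CL ℓ n i) : (colCal ℓ n i).par c = 0 ↔ cdeg c ≠ 1 := by
  change ((cdeg c : ℕ) : ZMod 2) = 0 ↔ _
  have := cdeg_le c
  interval_cases cdeg c <;> decide

/-- Duality reflects the degrees at `1` and keeps the coloured rows, so the degree difference
between `c` and `b` reappears between `star b` and `star c`. This is adjointness at the level of
letters. -/
theorem CQ.star {a : ML ℓ n} {c b : CL ℓ n i} :
    CQ (mrev a) (star b) (star c) ↔ CQ a c b := by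
  unfold CQ
  rw [mcol_mrev, crow_star, mrow_mrev, crow_star, mdeg_mrev, cdeg_star, cdeg_star]
  have h1 := cdeg_le c
  have h2 := cdeg_le b
  have h3 := mdeg_le a
  constructor
  · rintro ⟨e1, e2, e3⟩
    exact ⟨e2.symm, e1.symm, by omega⟩
  · rintro ⟨e1, e2, e3⟩
    exact ⟨e2.symm, e1.symm, by omega⟩

theorem star_seq {b : Fin d → CL ℓ n i} (hb : (colCal ℓ n i).Seq b) :
    (colCal ℓ n i).Seq (star ∘ b) := fun k l hkl h => by
  rw [Function.comp_apply, par_star]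
  refine hb k l hkl ?_
  rw [← star_star (b k), ← star_star (b l)]
  exact congrArg star h

/-- Duality exchanges the letters of degree `0` and `2`, that is, `𝔞` and `𝔠`. This exchange is what
makes the divided form perfect. -/
theorem cFact_star (b : Fin d → CL ℓ n i) :
    (colCal ℓ n i).cFact (star ∘ b) = (colCal ℓ n i).swap.cFact b := by
  refine Calib.cFact_congr _ _ _ _ fun k l _ => ?_
  change ((colCal ℓ n i).isC (star (b k)) ∧ star (b k) = star (b l)) ↔
    (((colCal ℓ n i).par (b k) = 0 ∧ ¬ (colCal ℓ n i).isC (b k)) ∧ b k = b l)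
  rw [col_isC, col_isC, cpar_zero_iff, cdeg_star]
  have := cdeg_le (b k)
  refine and_congr (by omega) ⟨fun h => ?_, fun h => by rw [h]⟩
  rw [← star_star (b k), ← star_star (b l), h]

/-! ### The form on the full tensor power -/

section
variable (R : Type*) [CommRing R]

/-- The value of the form on a word and its dual. -/
noncomputable def fsign (b : Fin d → CL ℓ n i) : R :=
  (-1) ^ koszul ((colCal ℓ n i).par ∘ b) ((colCal ℓ n i).par ∘ b) * ∏ k, tsg R (cdeg (b k))

variable {R}

/-- The form on tensors. -/
noncomputable def tform (v w : (Fin d → CL ℓ n i) → R) : R :=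
  ∑ b, v b * w (star ∘ b) * fsign R b

/-- In `sign_perm_mul` with both parities equal, the permutation signs square to one and the
parities add up to zero. -/
theorem fsign_comp (b : Fin d → CL ℓ n i) (σ : Equiv.Perm (Fin d)) :
    fsign R (b ∘ σ) = fsign R b := by
  unfold fsign
  have h1 : ∏ k, tsg R (cdeg ((b ∘ σ) k)) = ∏ k, tsg R (cdeg (b k)) :=
    Equiv.prod_comp σ fun k => tsg R (cdeg (b k))
  have h2 := sign_perm_mul (R := R) σ ((colCal ℓ n i).par ∘ b) ((colCal ℓ n i).par ∘ b)
  have h3 : (colCal ℓ n i).par ∘ b + (colCal ℓ n i).par ∘ b = 0 :=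
    funext fun k => zmod2_add_self _
  rw [h3, permKoszul_eq_zero (p := 0) (fun k hk => absurd hk (by simp)), sign_mul_self, pow_zero,
    one_mul, one_mul, Function.comp_assoc] at h2
  rw [h1, h2]

theorem fsign_isSign (b : Fin d → CL ℓ n i) : IsSign (fsign R b) := by
  refine IsSign.mul (sign_cases _) ?_
  refine Finset.prod_induction _ IsSign (fun _ _ => IsSign.mul) (Or.inl rfl) fun k _ => ?_
  unfold tsg
  split_ifs
  · exact Or.inr rfl
  · exact Or.inl rfl

theorem tform_act (σ : Equiv.Perm (Fin d)) (v w : (Fin d → CL ℓ n i) → R) :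
    tform ((colCal ℓ n i).act σ v) ((colCal ℓ n i).act σ w) = tform v w := by
  unfold tform
  refine Fintype.sum_equiv (Equiv.arrowCongr σ.symm (Equiv.refl _)) _ _ fun b => ?_
  change (-1) ^ permKoszul σ ((colCal ℓ n i).par ∘ b) * v (b ∘ σ) *
    ((-1) ^ permKoszul σ ((colCal ℓ n i).par ∘ star ∘ b) * w ((star ∘ b) ∘ σ)) * fsign R b =
    v (b ∘ σ) * w (star ∘ b ∘ σ) * fsign R (b ∘ σ)
  have h : (colCal ℓ n i).par ∘ star ∘ b = (colCal ℓ n i).par ∘ b := funext fun k => par_star _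
  rw [h, fsign_comp, Function.comp_assoc]
  linear_combination (v (b ∘ σ) * w (star ∘ b ∘ σ) * fsign R b) *
    sign_mul_self (R := R) (permKoszul σ ((colCal ℓ n i).par ∘ b))

theorem tform_word (v : (Fin d → CL ℓ n i) → R) (b : Fin d → CL ℓ n i) :
    tform v (word R b) = v (star ∘ b) * fsign R (star ∘ b) := by
  unfold tform
  have h : star ∘ star ∘ b = b := funext fun k => star_star (b k)
  rw [Finset.sum_eq_single (star ∘ b)]
  · rw [h, word_apply, if_pos rfl, mul_one]
  · intro c _ hc
    rw [word_apply, if_neg, mul_zero, zero_mul]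
    rintro rfl
    exact hc (funext fun k => (star_star (c k)).symm)
  · simp

theorem tform_smul_right (r : R) (v w : (Fin d → CL ℓ n i) → R) :
    tform v (r • w) = r * tform v w := by
  unfold tform
  rw [Finset.mul_sum]
  refine Finset.sum_congr rfl fun b _ => ?_
  rw [Pi.smul_apply, smul_eq_mul]
  ring

theorem tform_sum_right {ι : Type*} (s : Finset ι) (v : (Fin d → CL ℓ n i) → R)
    (w : ι → (Fin d → CL ℓ n i) → R) : tform v (∑ q ∈ s, w q) = ∑ q ∈ s, tform v (w q) := by
  unfold tform
  rw [Finset.sum_comm]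
  refine Finset.sum_congr rfl fun b _ => ?_
  rw [Finset.sum_apply, Finset.mul_sum, Finset.sum_mul]

/-- Where the structure constants do not vanish, the parities of the product word `b` are the sums
of those of `a` and `c`. Expanding the quadratic sign in `fsign b` yields the two mixed Koszul
signs, and `sign_koszul_comm` and `tsg_add` absorb the rest. -/
theorem tform_cmul {δ δ' : ZMod 2} {x : (Fin d → ML ℓ n) → R} {v : (Fin d → CL ℓ n i) → R}
    (hx : ∀ b, x b ≠ 0 → (matCal ℓ n).tpar b = δ) (hv : ∀ b, v b ≠ 0 → (colCal ℓ n i).tpar b = δ')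
    (w : (Fin d → CL ℓ n i) → R) :
    tform (cmul R x v) w = sg R (δ * δ') * tform v (cmul R (wrev x) w) := by
  let e : (Fin d → ML ℓ n) ≃ (Fin d → ML ℓ n) :=
    Equiv.arrowCongr (Equiv.refl _) ⟨mrev, mrev, mrev_mrev, mrev_mrev⟩
  let e' : (Fin d → CL ℓ n i) ≃ (Fin d → CL ℓ n i) :=
    Equiv.arrowCongr (Equiv.refl _) ⟨star, star, star_star, star_star⟩
  have hL : tform (cmul R x v) w = ∑ c : Fin d → CL ℓ n i, ∑ a : Fin d → ML ℓ n,
      ∑ b : Fin d → CL ℓ n i, x a * v c * ((-1) ^ koszul ((matCal ℓ n).par ∘ a)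
        ((colCal ℓ n i).par ∘ c) * ∏ k, if CQ (a k) (c k) (b k) then 1 else 0) *
          w (star ∘ b) * fsign R b := by
    simp only [tform, tAct, Finset.sum_mul]
    rw [Finset.sum_comm, Finset.sum_congr rfl fun a _ => Finset.sum_comm, Finset.sum_comm]
  have hR : tform v (cmul R (wrev x) w) = ∑ c : Fin d → CL ℓ n i, ∑ a : Fin d → ML ℓ n,
      ∑ b : Fin d → CL ℓ n i, v c * (wrev x a * w b * ((-1) ^ koszul ((matCal ℓ n).par ∘ a)
        ((colCal ℓ n i).par ∘ b) * ∏ k, if CQ (a k) (b k) (star (c k)) then 1 else 0)) *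
          fsign R c := by
    simp only [tform, tAct, Finset.sum_mul, Finset.mul_sum]
    rfl
  rw [hL, hR, Finset.mul_sum]
  refine Finset.sum_congr rfl fun c _ => ?_
  rw [Finset.mul_sum]
  refine Fintype.sum_equiv e _ _ fun a => ?_
  rw [Finset.mul_sum]
  refine Fintype.sum_equiv e' _ _ fun b => ?_
  change _ = sg R (δ * δ') * (v c * ((x a * ∏ k, tsg R (mdeg (mrev (a k)))) * w (star ∘ b) *
    ((-1) ^ koszul ((matCal ℓ n).par ∘ a) ((colCal ℓ n i).par ∘ star ∘ b) *
      ∏ k, if CQ (mrev (a k)) (star (b k)) (star (c k)) then 1 else 0)) * fsign R c)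
  by_cases hxa : x a = 0
  · simp [hxa]
  by_cases hvc : v c = 0
  · simp [hvc]
  simp only [CQ.star, mdeg_mrev]
  by_cases h0 : ∏ k, (if CQ (a k) (c k) (b k) then (1 : R) else 0) = 0
  · rw [h0]; simp
  have hM : ∀ k, CQ (a k) (c k) (b k) := fun k => by
    by_contra h'
    exact factor_ne_zero h0 k (if_neg h')
  have hb : (colCal ℓ n i).par ∘ b = (matCal ℓ n).par ∘ a + (colCal ℓ n i).par ∘ c :=
    funext fun k => (hM k).par
  have hsb : (colCal ℓ n i).par ∘ star ∘ b = (colCal ℓ n i).par ∘ b := funext fun k => par_star _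
  have hS : ∏ k, tsg R (cdeg (b k)) = (∏ k, tsg R (mdeg (a k))) * (∏ k, tsg R (cdeg (c k))) *
      ∏ k, sg R (((matCal ℓ n).par ∘ a) k * ((colCal ℓ n i).par ∘ c) k) := by
    rw [← Finset.prod_mul_distrib, ← Finset.prod_mul_distrib]
    refine Finset.prod_congr rfl fun k _ => ?_
    have h1 : cdeg (b k) = mdeg (a k) + cdeg (c k) := (hM k).2.2
    have h2 := cdeg_le (b k)
    rw [h1] at h2 ⊢
    exact tsg_add h2
  have hK := sign_koszul_comm (R := R) ((matCal ℓ n).par ∘ a) ((colCal ℓ n i).par ∘ c)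
  have e1 : ∑ k, ((matCal ℓ n).par ∘ a) k = δ := hx a hxa
  have e2 : ∑ k, ((colCal ℓ n i).par ∘ c) k = δ' := hv c hvc
  rw [e1, e2] at hK
  rw [hsb, fsign, fsign, hS, ← hK, hb]
  simp only [sign_koszul_add_left, sign_koszul_add_right]
  have s1 := sign_mul_self (R := R) (koszul ((matCal ℓ n).par ∘ a) ((colCal ℓ n i).par ∘ c))
  generalize (-1 : R) ^ koszul ((matCal ℓ n).par ∘ a) ((colCal ℓ n i).par ∘ c) = s at *
  ring

end

/-! ### The form divided by `d!` -/

variable (R F : Type*) [CommRing R] [IsDomain R] [CharZero R] [Field F] [Algebra R F]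

/-- Up to the factor `swap.cFact b`, `y_b` is the symmetrization of `b`, and `v` is invariant, so
the pairing is `d!` times the one with the word `b`. That one reads off the coefficient of `v` at
`star b`, which is `cFact (star b)` times the coordinate. By `cFact_star` the two factors cancel. -/
theorem tform_ys (v : (colCal ℓ n i).modDiv R d) (b : Fin d → CL ℓ n i) :
    tform v.1 ((colCal ℓ n i).ys R b).1 =
      (d.factorial : R) * (fsign R (star ∘ b) * (colCal ℓ n i).coord R (star ∘ b) v) := by
  by_cases hb : (colCal ℓ n i).Seq b
  · refine mul_left_cancel₀ ((colCal ℓ n i).swap.cFact_ne_zero (R := R) b) ?_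
    rw [(colCal ℓ n i).ys_of_seq hb, ← tform_smul_right, ← (colCal ℓ n i).sum_act_word hb,
      tform_sum_right]
    have h3 : ∀ σ : Equiv.Perm (Fin d), (colCal ℓ n i).act σ v.1 = v.1 := fun σ =>
      (colCal ℓ n i).act_eq_of_inv σ (((colCal ℓ n i).mem_modDiv v.1).mp v.2).1
    have h4 : ∀ σ : Equiv.Perm (Fin d), tform v.1 ((colCal ℓ n i).act σ (word R b)) =
        v.1 (star ∘ b) * fsign R (star ∘ b) := fun σ => by
      rw [← tform_word, ← tform_act σ v.1 (word R b), h3 σ]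
    rw [Finset.sum_congr rfl fun σ _ => h4 σ, Finset.sum_const, Finset.card_univ,
      Fintype.card_perm, Fintype.card_fin, nsmul_eq_mul, ← (colCal ℓ n i).coord_spec, cFact_star]
    ring
  · rw [(colCal ℓ n i).ys_of_not_seq hb, (colCal ℓ n i).coord_of_not_seq, mul_zero, mul_zero]
    · simp [tform]
    · intro h
      have := star_seq h
      rw [show star ∘ star ∘ b = b from funext fun k => star_star (b k)] at this
      exact hb this

theorem factorial_mul_sum_coord (v w : (colCal ℓ n i).modDiv R d) :
    (d.factorial : R) * ∑ q : Quotient (wordSetoid (CL ℓ n i) d), fsign R (star ∘ rep q) *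
      (colCal ℓ n i).coord R (star ∘ rep q) v * (colCal ℓ n i).coord R (rep q) w =
        tform v.1 w.1 := by
  have h1 : w.1 = ∑ q : Quotient (wordSetoid (CL ℓ n i) d),
      (colCal ℓ n i).coord R (rep q) w • ((colCal ℓ n i).ys R (rep q)).1 := by
    conv_lhs => rw [(colCal ℓ n i).eq_sum_coord w]
    exact map_sum ((colCal ℓ n i).modDiv R d).subtype _ _
  rw [h1, tform_sum_right, Finset.mul_sum]
  refine Finset.sum_congr rfl fun q _ => ?_
  rw [tform_smul_right, tform_ys]
  ring

/-- The form on `Γ̃^d Col_n(ΠT(i))_R`. -/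
noncomputable def formR (v w : ((piT R ℓ i).col n).modPow d) : R :=
  ∑ q : Quotient (wordSetoid (CL ℓ n i) d),
    fsign R (star ∘ rep q) * cco R (star ∘ rep q) v * cco R (rep q) w

theorem factorial_mul_formR (v w : ((piT R ℓ i).col n).modPow d) :
    (d.factorial : R) * formR R v w = tform v.1 w.1 :=
  factorial_mul_sum_coord R (cLin R v) (cLin R w)

theorem formR_smul {δ δ' : ZMod 2} {x : TZR R ℓ n d} {v : ((piT R ℓ i).col n).modPow d}
    (hx : x ∈ ((zig R ℓ).mat n).gr d δ) (hv : v ∈ ((piT R ℓ i).col n).gr d δ')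
    (w : ((piT R ℓ i).col n).modPow d) :
    formR R (x • v) w = sg R (δ * δ') * formR R v (tauR R ℓ n d x • w) := by
  -- Contravariance is inherited from the tensor power after multiplication by `d!`. This number may
  -- vanish in `F`, so the cancellation takes place over `R`.
  refine mul_left_cancel₀ (Nat.cast_ne_zero.mpr d.factorial_ne_zero : (d.factorial : R) ≠ 0) ?_
  rw [mul_left_comm, factorial_mul_formR, factorial_mul_formR]
  have h1 : tform (x • v).1 w.1 = tform (cmul R x.1 v.1) w.1 :=
    congrArg (fun u => tform u w.1) (TTR_smul_val R x v)
  have h2 : tform v.1 (tauR R ℓ n d x • w).1 = tform v.1 (cmul R (wrev x.1) w.1) :=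
    congrArg (tform v.1) ((TTR_smul_val R (tauR R ℓ n d x) w).trans
      (congrArg (fun u => cmul R u w.1) (tauR_val x)))
  rw [h1, h2]
  exact tform_cmul hx hv w.1

variable (n d i)

/-- The contravariant form on `𝒯_i^d`. -/
noncomputable def TTform : LinearMap.BilinForm F (TT R F ℓ n d i) :=
  ∑ q : Quotient (wordSetoid (CL ℓ n i) d),
    fsign F (star ∘ rep q) • (ccoF R F (star ∘ rep q)).smulRight (ccoF R F (rep q))

variable {n d i}

theorem TTform_apply (v w : TT R F ℓ n d i) : TTform n d i R F v w =
    ∑ q : Quotient (wordSetoid (CL ℓ n i) d),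
      fsign F (star ∘ rep q) * ccoF R F (star ∘ rep q) v * ccoF R F (rep q) w := by
  simp [TTform, LinearMap.sum_apply, mul_assoc]

theorem algebraMap_fsign (R F : Type*) [CommRing R] [Field F] [Algebra R F]
    (b : Fin d → CL ℓ n i) : algebraMap R F (fsign R b) = fsign F b := by
  simp only [fsign, tsg, map_mul, map_pow, map_neg, map_one, map_prod]
  congr 1
  refine Finset.prod_congr rfl fun k _ => ?_
  split_ifs <;> simp

theorem ccoF_ttmk (b : Fin d → CL ℓ n i) (r : F) (m : ((piT R ℓ i).col n).modPow d) :
    ccoF R F b (ttmk R F r m) = r * algebraMap R F (cco R b m) :=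
  formF_tmul (cco R b) r m

theorem TTform_ttmk (r r' : F) (v w : ((piT R ℓ i).col n).modPow d) :
    TTform n d i R F (ttmk R F r v) (ttmk R F r' w) = r * r' * algebraMap R F (formR R v w) := by
  rw [TTform_apply, formR, map_sum, Finset.mul_sum]
  refine Finset.sum_congr rfl fun q _ => ?_
  rw [ccoF_ttmk, ccoF_ttmk, map_mul, map_mul, algebraMap_fsign]
  ring

variable (ℓ n d i)

/-- In the basis of orbit sums the Gram matrix is monomial with entries `±1`: the vector of `b`
pairs nontrivially only with that of `star b`. -/
theorem TTform_bijective : Function.Bijective (TTform n d i R F) := by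
  have hinj : Function.Injective (TTform n d i R F) := by
    rw [injective_iff_map_eq_zero]
    intro v hv
    refine TT_eq_zero fun b => ?_
    obtain ⟨q, σ, hq⟩ := exists_rep (star ∘ b)
    have hb : b = (star ∘ rep q) ∘ σ := by
      rw [Function.comp_assoc, hq]
      exact funext fun k => (star_star (b k)).symm
    by_cases hs : (colCal ℓ n i).Seq (rep q)
    · have h := LinearMap.congr_fun hv (CY R F (rep q))
      rw [TTform_apply, Finset.sum_eq_single q, ccoF_CY_self hs, mul_one,
        LinearMap.zero_apply] at h
      · obtain ⟨ε, -, hε⟩ := ccoF_comp (F := F) (star ∘ rep q) σ v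
        have hf := (fsign_isSign (R := F) (star ∘ rep q)).mul_self
        have h0 : ccoF R F (star ∘ rep q) v = 0 := by
          rw [← one_mul (ccoF R F (star ∘ rep q) v), ← hf, mul_assoc, h, mul_zero]
        rw [hb, hε, h0, mul_zero]
      · intro q' _ hq'
        rw [ccoF_CY_of_ne, mul_zero]
        rintro ⟨τ, hτ⟩
        apply hq'
        rw [← Quotient.out_eq q', ← Quotient.out_eq q]
        exact (Quotient.sound (s := wordSetoid _ _) ⟨τ, hτ⟩).symm
      · simp
    -- If an odd letter is repeated in the representative, then also in `b`, and the coordinate at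
    -- `b` is identically zero.
    · refine TT_induction (P := fun v => ccoF R F b v = 0) (map_zero _)
        (fun v w hv hw => by rw [map_add, hv, hw, add_zero]) (fun r m => ?_) v
      rw [ccoF_ttmk]
      have : cco R b m = 0 := (colCal ℓ n i).coord_of_not_seq (fun h => hs (by
        have h1 := (star_seq h).comp σ⁻¹
        rwa [← hq, show (rep q ∘ σ) ∘ (σ⁻¹ : Equiv.Perm (Fin d)) = rep q by
          funext k; simp] at h1)) (cLin R m)
      rw [this, map_zero, mul_zero]
  exact ⟨hinj, (LinearMap.injective_iff_surjective_of_finrank_eq_finrank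
    Subspace.dual_finrank_eq.symm).mp hinj⟩

theorem TTform_smul_ttmk {δ δ' : ZMod 2} {s : TZR R ℓ n d} {m : ((piT R ℓ i).col n).modPow d}
    (hs : s ∈ ((zig R ℓ).mat n).gr d δ) (hm : m ∈ ((piT R ℓ i).col n).gr d δ') (r r' : F)
    (w : TT R F ℓ n d i) :
    TTform n d i R F ((r ⊗ₜ[R] s : TZ R F ℓ n d) • ttmk R F r' m) w = sg F (δ * δ') *
      TTform n d i R F (ttmk R F r' m) (TZtau R F ℓ n d (r ⊗ₜ[R] s) • w) := by
  refine TT_induction (P := fun w => TTform n d i R F ((r ⊗ₜ[R] s : TZ R F ℓ n d) •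
    ttmk R F r' m) w = sg F (δ * δ') * TTform n d i R F (ttmk R F r' m)
      (TZtau R F ℓ n d (r ⊗ₜ[R] s) • w)) ?_ (fun w w' hw hw' => ?_) (fun r'' m' => ?_) w
  · rw [smul_zero, map_zero, map_zero, mul_zero]
  · rw [smul_add, map_add, map_add, hw, hw', mul_add]
  rw [TZtau_tmul, tt_smul, tt_smul, TTform_ttmk, TTform_ttmk, formR_smul R hs hm, map_mul,
    sg_algebraMap]
  ring

theorem TTform_smul_tmul {δ δ' : ZMod 2} {s : TZR R ℓ n d} {v : TT R F ℓ n d i}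
    (hs : s ∈ ((zig R ℓ).mat n).gr d δ) (hv : v ∈ TTgr R F ℓ n d i δ') (r : F)
    (w : TT R F ℓ n d i) :
    TTform n d i R F ((r ⊗ₜ[R] s : TZ R F ℓ n d) • v) w = sg F (δ * δ') *
      TTform n d i R F v (TZtau R F ℓ n d (r ⊗ₜ[R] s) • w) := by
  refine TTgr_induction (P := fun v : TT R F ℓ n d i =>
    TTform n d i R F ((r ⊗ₜ[R] s : TZ R F ℓ n d) • v) w =
    sg F (δ * δ') * TTform n d i R F v (TZtau R F ℓ n d (r ⊗ₜ[R] s) • w)) hv ?_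
    (fun v v' hv hv' => ?_) fun r' m hm => TTform_smul_ttmk ℓ n d i R F hs hm r r' w
  · rw [smul_zero, map_zero, LinearMap.zero_apply, LinearMap.zero_apply, mul_zero]
  · rw [smul_add, map_add, map_add, LinearMap.add_apply, LinearMap.add_apply, hv, hv', mul_add]

theorem TTform_smul {δ δ' : ZMod 2} {x : TZ R F ℓ n d} {v : TT R F ℓ n d i}
    (hx : x ∈ TZgr R F ℓ n d δ) (hv : v ∈ TTgr R F ℓ n d i δ') (w : TT R F ℓ n d i) :
    TTform n d i R F (x • v) w =
      sg F (δ * δ') * TTform n d i R F v (TZtau R F ℓ n d x • w) := by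
  refine baseChange_induction (P := fun x : TZ R F ℓ n d => TTform n d i R F (x • v) w =
    sg F (δ * δ') * TTform n d i R F v (TZtau R F ℓ n d x • w)) hx ?_
    (fun x y hx hy => ?_) fun r s hs => TTform_smul_tmul ℓ n d i R F hs hv r w
  · have h1 : (0 : TZ R F ℓ n d) • v = 0 := zero_smul (TZ R F ℓ n d) v
    have h2 : (0 : TZ R F ℓ n d) • w = 0 := zero_smul (TZ R F ℓ n d) w
    have h3 : TZtau R F ℓ n d 0 = 0 := map_zero _
    rw [h3, h1, h2, map_zero, map_zero, LinearMap.zero_apply, mul_zero]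
  · have h1 : (x + y) • v = x • v + y • v := add_smul x y v
    have h3 : TZtau R F ℓ n d (x + y) = TZtau R F ℓ n d x + TZtau R F ℓ n d y := map_add _ x y
    have h2 : (TZtau R F ℓ n d x + TZtau R F ℓ n d y) • w =
      TZtau R F ℓ n d x • w + TZtau R F ℓ n d y • w := add_smul _ _ w
    rw [h3, h1, h2, map_add, map_add, LinearMap.add_apply, hx, hy, mul_add]

theorem TT_contra : (TZdata R F ℓ n d).Contra (TZtau R F ℓ n d) (TTgr R F ℓ n d i)
    (TTform n d i R F) where
  even := fun {δ δ'} hne {v w} hv hw => by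
    rw [TTform_apply]
    refine Finset.sum_eq_zero fun q _ => ?_
    by_cases h : (colCal ℓ n i).tpar (rep q) = δ'
    · rw [ccoF_eq_zero_of_mem hv, mul_zero, zero_mul]
      have : (colCal ℓ n i).tpar (star ∘ rep q) = (colCal ℓ n i).tpar (rep q) :=
        Finset.sum_congr rfl fun k _ => par_star _
      rw [this, h]
      exact hne.symm
    · rw [ccoF_eq_zero_of_mem hw h, mul_zero]
  bij := TTform_bijective ℓ n d i R F
  contra := TTform_smul ℓ n d i R F

theorem TT_isContra : TTIsContra R F ℓ n d i (TTform n d i R F) :=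
  have h := TT_contra ℓ n d i R F
  ⟨fun _ _ hne _ hv _ hw => h.even hne hv hw, h.bij, fun _ _ _ hx _ hv w => h.contra hx hv w⟩

end Form


/-! ### Weights of words -/

section Weights

open scoped Classical

variable {ℓ n d : ℕ} {i : Fin (ℓ + 1)}

theorem wt_apply (p : Fin d → CR ℓ n) (κ : Fin (ℓ + 1)) (r : Fin n) :
    wt p κ r = (Finset.univ.filter fun m => p m = (κ, r)).card :=
  Fintype.card_subtype _

theorem sum_wt (p : Fin d → CR ℓ n) (κ : Fin (ℓ + 1)) (S : Finset (Fin n)) :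
    ∑ r ∈ S, wt p κ r = (Finset.univ.filter fun m => (p m).1 = κ ∧ (p m).2 ∈ S).card := by
  rw [Finset.card_eq_sum_card_fiberwise (f := fun m => (p m).2) (t := S)
    (fun m hm => (Finset.mem_filter.mp hm).2.2)]
  refine Finset.sum_congr rfl fun r hr => ?_
  rw [wt_apply, Finset.filter_filter]
  congr 1
  refine Finset.filter_congr fun m _ => ?_
  constructor
  · intro h; rw [h]; exact ⟨⟨rfl, hr⟩, rfl⟩
  · rintro ⟨⟨h1, -⟩, h2⟩; exact Prod.ext h1 h2

theorem sum_wt_univ (p : Fin d → CR ℓ n) (κ : Fin (ℓ + 1)) :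
    ∑ r, wt p κ r = (Finset.univ.filter fun m => (p m).1 = κ).card := by
  rw [sum_wt]
  congr 1
  exact Finset.filter_congr fun m _ => ⟨fun h => h.1, fun h => ⟨h, Finset.mem_univ _⟩⟩

theorem upSum_wt (p : Fin d → CR ℓ n) (κ : Fin (ℓ + 1)) :
    upSum (wt p) κ = (Finset.univ.filter fun m => κ ≤ (p m).1).card := by
  rw [upSum, Finset.card_eq_sum_card_fiberwise (f := fun m => (p m).1) (t := Finset.Ici κ)
    (fun m hm => Finset.mem_Ici.mpr (Finset.mem_filter.mp hm).2)]
  refine Finset.sum_congr rfl fun j hj => ?_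
  rw [sum_wt_univ, Finset.filter_filter]
  congr 1
  refine Finset.filter_congr fun m _ => ⟨fun h => ⟨?_, h⟩, fun h => h.2⟩
  change κ ≤ (p m).1
  rw [h]
  exact Finset.mem_Ici.mp hj

theorem isMComp_wt (p : Fin d → CR ℓ n) : IsMComp d (wt p) := by
  unfold IsMComp
  rw [Finset.sum_congr rfl fun κ _ => sum_wt_univ p κ,
    ← Finset.card_eq_sum_card_fiberwise (f := fun m => (p m).1) (s := Finset.univ)
      (t := Finset.univ) (fun m _ => Finset.mem_univ _)]
  simp

/-- Equal weights mean fibres of equal size over each coloured row; bijections between the fibres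
glue to a permutation. -/
theorem exists_perm_of_wt_eq {p p' : Fin d → CR ℓ n} (h : wt p = wt p') :
    ∃ σ : Equiv.Perm (Fin d), p' ∘ σ = p := by
  have e : ∀ x : CR ℓ n, {k // p k = x} ≃ {k // p' k = x} := fun x =>
    Fintype.equivOfCardEq (congrFun (congrFun h x.1) x.2)
  exact ⟨Equiv.ofFiberEquiv e, funext fun k => Equiv.ofFiberEquiv_map e k⟩

theorem eq_of_sum_Iic_eq {m : ℕ} {f g : Fin m → ℕ}
    (h : ∀ s, ∑ r ∈ Finset.Iic s, f r = ∑ r ∈ Finset.Iic s, g r) : f = g := by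
  funext s
  induction s using WellFoundedLT.induction with
  | ind s ih =>
    have h1 := h s
    have h2 : ∑ r ∈ Finset.Iio s, f r = ∑ r ∈ Finset.Iio s, g r :=
      Finset.sum_congr rfl fun r hr => ih r (Finset.mem_Iio.mp hr)
    rw [← Finset.Iio_insert, Finset.sum_insert (by simp), Finset.sum_insert (by simp), h2] at h1
    exact add_right_cancel h1

theorem eq_of_sum_Ici_eq {m : ℕ} {f g : Fin m → ℕ}
    (h : ∀ s, ∑ r ∈ Finset.Ici s, f r = ∑ r ∈ Finset.Ici s, g r) : f = g := by
  funext s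
  induction s using WellFoundedGT.induction with
  | ind s ih =>
    have h1 := h s
    have h2 : ∑ r ∈ Finset.Ioi s, f r = ∑ r ∈ Finset.Ioi s, g r :=
      Finset.sum_congr rfl fun r hr => ih r (Finset.mem_Ioi.mp hr)
    rw [← Finset.Ioi_insert, Finset.sum_insert (by simp), Finset.sum_insert (by simp), h2] at h1
    exact add_right_cancel h1

/-- The two alternatives exclude each other once both inequalities hold: equal upper sums would
force equal sizes. In the dominance case the partial sums determine the components. -/
theorem leI_antisymm {μ ν : MComp ℓ n} (h : leI μ ν) (h' : leI ν μ) : μ = ν := by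
  rcases h with ⟨h1, i, h2⟩ | ⟨h1, h2⟩
  · rcases h' with ⟨h3, -⟩ | ⟨h3, -⟩
    · exact absurd (congrFun (eq_of_sum_Ici_eq fun s => le_antisymm (h1 s) (h3 s)) i) h2
    · exact absurd (h3 i).symm h2
  · rcases h' with ⟨-, i, h4⟩ | ⟨-, h4⟩
    · exact absurd (h1 i).symm h4
    · exact funext fun i => eq_of_sum_Iic_eq fun s => le_antisymm (h2 i s) (h4 i s)

/-- Raising colours increases all upper sums, and the strict raise at `m₀` increases the one that
starts at the new colour of `m₀`. The sizes then differ, so the rows play no role. -/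
theorem leI_of_colour {p p' : Fin d → CR ℓ n} (h : ∀ m, (p m).1 ≤ (p' m).1) {m₀ : Fin d}
    (hm : (p m₀).1 < (p' m₀).1) : leI (wt p) (wt p') ∧ wt p ≠ wt p' := by
  have hne : ∃ κ, ∑ r, wt p κ r ≠ ∑ r, wt p' κ r := by
    by_contra! hc
    have h1 : upSum (wt p) (p' m₀).1 = upSum (wt p') (p' m₀).1 :=
      Finset.sum_congr rfl fun κ _ => hc κ
    rw [upSum_wt, upSum_wt] at h1
    refine absurd h1 (Finset.card_lt_card ⟨fun m hm' => ?_, fun hs => ?_⟩).ne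
    · rw [Finset.mem_filter] at hm' ⊢
      exact ⟨hm'.1, hm'.2.trans (h m)⟩
    · have := hs (Finset.mem_filter.mpr ⟨Finset.mem_univ m₀, le_rfl⟩)
      exact absurd (Finset.mem_filter.mp this).2 hm.not_ge
  refine ⟨Or.inl ⟨fun κ => ?_, hne⟩, ?_⟩
  · rw [upSum_wt, upSum_wt]
    refine Finset.card_le_card fun m hm' => ?_
    rw [Finset.mem_filter] at hm' ⊢
    exact ⟨hm'.1, hm'.2.trans (h m)⟩
  · obtain ⟨κ, hκ⟩ := hne
    exact fun h' => hκ (by rw [h'])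

/-! ### The generating words -/

/-- The letter `a_{i,i-1}` (or `v_0`). -/
def topTB (i : Fin (ℓ + 1)) : TB ℓ i := ⟨(i, 1), Or.inr (Or.inl ⟨rfl, Or.inl rfl⟩)⟩

/-- The letter `e_{i-1}`, for `i > 0`. -/
def lowTB (i : Fin (ℓ + 1)) : TB ℓ i :=
  ⟨(⟨i - 1, by omega⟩, if (i : ℕ) = 0 then 1 else 0), by
    by_cases h : (i : ℕ) = 0
    · refine Or.inr (Or.inl ⟨if_pos h, Or.inl (Fin.ext ?_)⟩)
      change (i : ℕ) - 1 = i
      omega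
    · refine Or.inl ⟨if_neg h, ?_⟩
      change (i : ℕ) - 1 + 1 = i
      omega⟩

/-- The word `a_{i,i-1}^{(1)} ⋯ a_{i,i-1}^{(t)} e_{i-1}^{(1)} ⋯ e_{i-1}^{(1)}`, where `x^{(r)}`
denotes the letter `x` in row `r`. -/
def gen (hn : 0 < n) (hd : d ≤ n) (t : ℕ) : Fin d → CL ℓ n i := fun k =>
  if (k : ℕ) < t then (k.castLE hd, topTB i) else (⟨0, hn⟩, lowTB i)

/-- The letters `a_{i,i-1}` and `c_{i-1}` (or `v_0`). -/
def isUp (c : CL ℓ n i) : Prop := ((crow c).1 : ℕ) + cdeg c = i + 1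

/-- The number of letters `a_{i,i-1}` and `c_{i-1}` (or `v_0`). -/
noncomputable def nUp (c : Fin d → CL ℓ n i) : ℕ := (Finset.univ.filter fun k => isUp (c k)).card

/-- Colour plus degree takes two values on `ΠT(i)`: it is `i + 1` on `a_{i,i-1}` and `c_{i-1}`, and
`i - 1` on `e_{i-1}` and `a_{i-2,i-1}`. It separates the two layers of `ΠT(i)`. -/
theorem isUp_or (c : CL ℓ n i) : isUp c ∨ ((crow c).1 : ℕ) + cdeg c + 1 = i := by
  have := c.valid
  unfold isUp
  omega

theorem not_isUp (c : CL ℓ n i) : ¬ isUp c ↔ ((crow c).1 : ℕ) + cdeg c + 1 = i := by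
  have := c.valid
  unfold isUp
  omega

theorem nUp_comp (c : Fin d → CL ℓ n i) (σ : Equiv.Perm (Fin d)) : nUp (c ∘ σ) = nUp c := by
  unfold nUp
  rw [← Fintype.card_subtype, ← Fintype.card_subtype]
  exact Fintype.card_congr (σ.subtypeEquiv fun a => Iff.rfl)

theorem nUp_le (c : Fin d → CL ℓ n i) : nUp c ≤ d :=
  (Finset.card_le_univ _).trans_eq (Fintype.card_fin d)

/-! ### Combinatorics of the generating words -/

section Gen

variable {hn : 0 < n} {hd : d ≤ n} {t : ℕ} {k : Fin d}

theorem crow_gen_lt (hk : (k : ℕ) < t) :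
    crow (gen hn hd t k : CL ℓ n i) = (i, k.castLE hd) := by
  rw [gen, if_pos hk]; rfl

theorem cdeg_gen_lt (hk : (k : ℕ) < t) : cdeg (gen hn hd t k : CL ℓ n i) = 1 := by
  rw [gen, if_pos hk]; rfl

theorem crow_gen_colour (hi : (i : ℕ) ≠ 0) (hk : ¬ (k : ℕ) < t) :
    ((crow (gen hn hd t k : CL ℓ n i)).1 : ℕ) + 1 = i := by
  rw [gen, if_neg hk]
  change (i : ℕ) - 1 + 1 = i
  omega

theorem crow_gen_row (hk : ¬ (k : ℕ) < t) :
    (crow (gen hn hd t k : CL ℓ n i)).2 = ⟨0, hn⟩ := by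
  rw [gen, if_neg hk]; rfl

theorem cdeg_gen (hi : (i : ℕ) ≠ 0) (hk : ¬ (k : ℕ) < t) :
    cdeg (gen hn hd t k : CL ℓ n i) = 0 := by
  rw [gen, if_neg hk]
  change ((if (i : ℕ) = 0 then (1 : Fin 3) else 0 : Fin 3) : ℕ) = 0
  rw [if_neg hi]
  rfl

/-- The odd letters sit in distinct rows and the repeated ones are even. The condition `ht` excludes
the placeholder that `lowTB` takes for `i = 0`, where there is no vertex `i - 1`. -/
theorem gen_seq (ht : t = d ∨ (i : ℕ) ≠ 0) : (colCal ℓ n i).Seq (gen hn hd t) := by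
  intro k l hkl h
  by_cases hk : (k : ℕ) < t
  · by_cases hl : (l : ℕ) < t
    · have := congrArg crow h
      rw [crow_gen_lt hk, crow_gen_lt hl] at this
      exact absurd (Fin.castLE_injective hd (Prod.ext_iff.mp this).2) hkl
    · have hi : (i : ℕ) ≠ 0 := by omega
      have h1 := congrArg cdeg h
      rw [cdeg_gen_lt hk, cdeg_gen hi hl] at h1
      exact absurd h1 one_ne_zero
  · have hi : (i : ℕ) ≠ 0 := by omega
    rw [cpar_zero_iff, cdeg_gen hi hk]
    exact zero_ne_one

theorem isUp_gen (ht : t = d ∨ (i : ℕ) ≠ 0) :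
    isUp (gen hn hd t k : CL ℓ n i) ↔ (k : ℕ) < t := by
  unfold isUp
  by_cases hk : (k : ℕ) < t
  · rw [crow_gen_lt hk, cdeg_gen_lt hk]
    simp [hk]
  · have hi : (i : ℕ) ≠ 0 := by omega
    have := crow_gen_colour (n := n) (hn := hn) (hd := hd) hi hk
    rw [cdeg_gen hi hk]
    omega

theorem card_lt (htd : t ≤ d) : (Finset.univ.filter fun k : Fin d => (k : ℕ) < t).card = t := by
  rw [Fin.card_filter_val_lt, min_eq_right htd]

theorem nUp_gen (htd : t ≤ d) (ht : t = d ∨ (i : ℕ) ≠ 0) :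
    nUp (gen hn hd t : Fin d → CL ℓ n i) = t := by
  rw [nUp, Finset.filter_congr fun k _ => isUp_gen ht, card_lt htd]

/-- Every word with `t` letters `a_{i,i-1}` and `c_{i-1}` can be rearranged such that these come
first. -/
theorem exists_perm_isUp (htd : t ≤ d) (c : Fin d → CL ℓ n i) (h : nUp c = t) :
    ∃ σ : Equiv.Perm (Fin d), ∀ k, isUp ((c ∘ σ) k) ↔ (k : ℕ) < t := by
  have e1 : {k : Fin d // (k : ℕ) < t} ≃ {k // isUp (c k)} :=
    Fintype.equivOfCardEq (by
      rw [Fintype.card_subtype, Fintype.card_subtype, card_lt htd]; exact h.symm)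
  exact ⟨e1.extendSubtype, fun k => ⟨fun h => by_contra fun hk => e1.extendSubtype_not_mem k hk h,
    fun hk => e1.extendSubtype_mem k hk⟩⟩

/-- Place by place the colours of `c` are at most those of the generating word; a strict inequality
settles the comparison. If all colours agree, the first `t` letters are the odd `a_{i,i-1}`, whose
rows must be distinct, so their weight is dominated by `(1^t)`; the other letters are dominated by a
single row. -/
theorem wt_le_gen {c : Fin d → CL ℓ n i} (hc : (colCal ℓ n i).Seq c)
    (h : ∀ k : Fin d, ¬ (k : ℕ) < t → ¬ isUp (c k)) :
    leI (wt (crow ∘ c)) (wt (crow ∘ (gen hn hd t : Fin d → CL ℓ n i))) := by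
  have hi : ∀ k : Fin d, ¬ (k : ℕ) < t → (i : ℕ) ≠ 0 := fun k hk => by
    have := (not_isUp _).mp (h k hk)
    omega
  have hle : ∀ m, ((crow ∘ c) m).1 ≤ ((crow ∘ (gen hn hd t : Fin d → CL ℓ n i)) m).1 := by
    intro m
    rw [Fin.le_def, Function.comp_apply, Function.comp_apply]
    by_cases hm : (m : ℕ) < t
    · rw [crow_gen_lt hm]
      have := (c m).valid
      change ((crow (c m)).1 : ℕ) ≤ (i : ℕ)
      omega
    · have h1 := crow_gen_colour (n := n) (hn := hn) (hd := hd) (hi m hm) hm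
      have h2 := (not_isUp _).mp (h m hm)
      omega
  by_cases hlt : ∃ m, ((crow ∘ c) m).1 < ((crow ∘ (gen hn hd t : Fin d → CL ℓ n i)) m).1
  · obtain ⟨m, hm⟩ := hlt
    exact (leI_of_colour hle hm).1
  have heq : ∀ m, (crow (c m)).1 = (crow (gen hn hd t m : CL ℓ n i)).1 := fun m =>
    le_antisymm (hle m) (not_lt.mp fun h' => hlt ⟨m, h'⟩)
  refine Or.inr ⟨fun κ => ?_, fun κ s => ?_⟩
  · rw [sum_wt_univ, sum_wt_univ]
    congr 1
    refine Finset.filter_congr fun m _ => ?_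
    rw [Function.comp_apply, Function.comp_apply, heq]
  rw [sum_wt, sum_wt]
  by_cases hs : κ = i ∧ (s : ℕ) < t ∧ (s : ℕ) < d
  · obtain ⟨rfl, hst, hsd⟩ := hs
    -- A letter of colour `i` is sent to the place numbered by its row. This is injective because
    -- these letters are odd and not repeated. Rows considered here are at most `s < d`, so the
    -- default value `m` is never taken.
    refine Finset.card_le_card_of_injOn
      (fun m => if hr : ((crow (c m)).2 : ℕ) < d then ⟨(crow (c m)).2, hr⟩ else m) ?_ ?_
    · intro m hm
      obtain ⟨-, h1, h2⟩ := Finset.mem_filter.mp hm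
      have h3 : ((crow (c m)).2 : ℕ) ≤ s := Fin.le_def.mp (Finset.mem_Iic.mp h2)
      have hr : ((crow (c m)).2 : ℕ) < d := by omega
      beta_reduce
      rw [dif_pos hr]
      refine Finset.mem_coe.mpr (Finset.mem_filter.mpr ⟨Finset.mem_univ _, ?_⟩)
      rw [Function.comp_apply, crow_gen_lt (by change ((crow (c m)).2 : ℕ) < t; omega)]
      exact ⟨rfl, h2⟩
    · intro m hm m' hm' hmm
      obtain ⟨-, h1, h2⟩ := Finset.mem_filter.mp hm
      obtain ⟨-, h1', h2'⟩ := Finset.mem_filter.mp hm'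
      have h3 : ((crow (c m)).2 : ℕ) ≤ s := Fin.le_def.mp (Finset.mem_Iic.mp h2)
      have h3' : ((crow (c m')).2 : ℕ) ≤ s := Fin.le_def.mp (Finset.mem_Iic.mp h2')
      have hr : ((crow (c m)).2 : ℕ) < d := by omega
      have hr' : ((crow (c m')).2 : ℕ) < d := by omega
      beta_reduce at hmm
      rw [dif_pos hr, dif_pos hr'] at hmm
      by_contra hne
      have hrow : crow (c m) = crow (c m') :=
        Prod.ext (h1.trans h1'.symm) (Fin.ext (Fin.mk.inj hmm))
      have h4 := (c m).valid
      have h4' := (c m').valid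
      have h5 : ((crow (c m)).1 : ℕ) = κ := congrArg Fin.val h1
      have h5' : ((crow (c m')).1 : ℕ) = κ := congrArg Fin.val h1'
      have h6 := hc m m' hne (CL.ext' hrow (by omega))
      rw [cpar_zero_iff] at h6
      omega
  -- Otherwise every place of the generating word with colour `κ` lies in a row at most `s`: either
  -- `κ = i` and `s` is beyond all the rows used, or the row is zero.
  · refine Finset.card_le_card fun m hm => ?_
    obtain ⟨-, h1, h2⟩ := Finset.mem_filter.mp hm
    refine Finset.mem_filter.mpr ⟨Finset.mem_univ _, (heq m).symm.trans h1, ?_⟩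
    rw [Function.comp_apply, Finset.mem_Iic]
    by_cases hmt : (m : ℕ) < t
    · have h3 := heq m
      rw [crow_gen_lt hmt] at h3 ⊢
      have h4 : κ = i := h1.symm.trans h3
      change (m : ℕ) ≤ s
      have := m.2
      by_contra h5
      exact hs ⟨h4, by omega, by omega⟩
    · rw [crow_gen_row hmt]
      exact Nat.zero_le _

theorem wt_gen_top (htd : t ≤ d) (ht : t = d ∨ (i : ℕ) ≠ 0) (r : Fin n) :
    wt (crow ∘ (gen hn hd t : Fin d → CL ℓ n i)) i r = if (r : ℕ) < t then 1 else 0 := by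
  have h0 : ∀ m : Fin d, (crow ∘ (gen hn hd t : Fin d → CL ℓ n i)) m = (i, r) ↔ (m : ℕ) = r ∧ (r : ℕ) < t := by
    intro m
    rw [Function.comp_apply]
    by_cases hm : (m : ℕ) < t
    · rw [crow_gen_lt hm, Prod.ext_iff, Fin.ext_iff (a := m.castLE hd)]
      change (i = i ∧ (m : ℕ) = r) ↔ _
      constructor
      · rintro ⟨-, h⟩; exact ⟨h, by omega⟩
      · rintro ⟨h, -⟩; exact ⟨rfl, h⟩
    · have h1 := crow_gen_colour (n := n) (hn := hn) (hd := hd) (i := i) (t := t) (k := m)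
        (by omega) hm
      constructor
      · intro h; rw [h] at h1; simp at h1
      · rintro ⟨h, h'⟩; omega
  rw [wt_apply, Finset.filter_congr fun m _ => h0 m]
  split_ifs with hr
  · rw [Finset.card_eq_one]
    refine ⟨⟨r, by omega⟩, Finset.ext fun m => ?_⟩
    rw [Finset.mem_filter, Finset.mem_singleton, Fin.ext_iff]
    simp [hr]
  · rw [Finset.card_eq_zero, Finset.filter_eq_empty_iff]
    exact fun m _ h => hr h.2

theorem wt_gen_low {κ : Fin (ℓ + 1)} (hκ : (κ : ℕ) + 1 = i) (htd : t ≤ d) (r : Fin n) :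
    wt (crow ∘ (gen hn hd t : Fin d → CL ℓ n i)) κ r = if (r : ℕ) = 0 then d - t else 0 := by
  have h0 : ∀ m : Fin d, (crow ∘ (gen hn hd t : Fin d → CL ℓ n i)) m = (κ, r) ↔
      (r : ℕ) = 0 ∧ ¬ (m : ℕ) < t := by
    intro m
    rw [Function.comp_apply]
    by_cases hm : (m : ℕ) < t
    · rw [crow_gen_lt hm, Prod.ext_iff, Fin.ext_iff]
      change ((i : ℕ) = κ ∧ _) ↔ _
      constructor
      · rintro ⟨h, -⟩; omega
      · rintro ⟨-, h⟩; exact absurd hm h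
    · have h1 := crow_gen_colour (n := n) (hn := hn) (hd := hd) (i := i) (t := t) (k := m)
        (by omega) hm
      rw [Prod.ext_iff, crow_gen_row hm, Fin.ext_iff, Fin.ext_iff]
      change (_ ∧ 0 = (r : ℕ)) ↔ _
      constructor
      · rintro ⟨-, h⟩; exact ⟨h.symm, hm⟩
      · rintro ⟨h, -⟩; exact ⟨add_right_cancel (h1.trans hκ.symm), h.symm⟩
  rw [wt_apply, Finset.filter_congr fun m _ => h0 m]
  split_ifs with hr
  · simp only [hr, true_and]
    have := Finset.card_filter_add_card_filter_not (s := Finset.univ) (fun k : Fin d => (k : ℕ) < t)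
    rw [card_lt htd, Finset.card_univ, Fintype.card_fin] at this
    omega
  · rw [Finset.card_eq_zero, Finset.filter_eq_empty_iff]
    exact fun m _ h => hr h.1

theorem wt_gen_other {κ : Fin (ℓ + 1)} (h1 : κ ≠ i) (h2 : (κ : ℕ) + 1 ≠ i)
    (ht : t = d ∨ (i : ℕ) ≠ 0) (r : Fin n) :
    wt (crow ∘ (gen hn hd t : Fin d → CL ℓ n i)) κ r = 0 := by
  rw [wt_apply, Finset.card_eq_zero, Finset.filter_eq_empty_iff]
  intro m _ h
  rw [Function.comp_apply] at h
  by_cases hm : (m : ℕ) < t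
  · rw [crow_gen_lt hm] at h
    exact h1 (Prod.ext_iff.mp h).1.symm
  · have h3 := crow_gen_colour (n := n) (hn := hn) (hd := hd) (i := i) (t := t) (k := m)
        (by omega) hm
    rw [h] at h3
    exact h2 h3

theorem antitone_wt_gen (htd : t ≤ d) (ht : t = d ∨ (i : ℕ) ≠ 0) (κ : Fin (ℓ + 1)) :
    Antitone (wt (crow ∘ (gen hn hd t : Fin d → CL ℓ n i)) κ) := by
  intro r r' hr
  have hr' : (r : ℕ) ≤ r' := hr
  by_cases h1 : κ = i
  · subst h1
    rw [wt_gen_top htd ht, wt_gen_top htd ht]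
    split_ifs <;> omega
  by_cases h2 : (κ : ℕ) + 1 = i
  · rw [wt_gen_low h2 htd, wt_gen_low h2 htd]
    split_ifs <;> omega
  · rw [wt_gen_other h1 h2 ht, wt_gen_other h1 h2 ht]

theorem wt_gen_eq_iotaOnes :
    wt (crow ∘ (gen hn hd d : Fin d → CL ℓ n i)) = iotaOnes n d i := by
  funext κ r
  unfold iotaOnes
  by_cases h1 : κ = i
  · subst h1
    rw [wt_gen_top le_rfl (Or.inl rfl)]
    simp
  rw [if_neg fun h => h1 h.1]
  by_cases h2 : (κ : ℕ) + 1 = i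
  · rw [wt_gen_low h2 le_rfl, Nat.sub_self, ite_self]
  · exact wt_gen_other h1 h2 (Or.inl rfl) r

theorem wt_gen_eq_iotaRow {j : Fin (ℓ + 1)} (hj : (j : ℕ) + 1 = i) :
    wt (crow ∘ (gen hn hd 0 : Fin d → CL ℓ n i)) = iotaRow n d j := by
  funext κ r
  unfold iotaRow
  by_cases h1 : κ = i
  · subst h1
    rw [wt_gen_top (Nat.zero_le d) (Or.inr (by omega)), if_neg (by omega), if_neg]
    rintro ⟨rfl, -⟩
    omega
  by_cases h2 : (κ : ℕ) + 1 = i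
  · rw [wt_gen_low h2 (Nat.zero_le d)]
    have : κ = j := Fin.ext (by omega)
    simp [this]
  · rw [wt_gen_other h1 h2 (Or.inr (by omega)), if_neg]
    rintro ⟨rfl, -⟩
    exact h2 hj

end Gen

end Weights


/-! ### Products with orbit sums -/

section Products

open scoped Classical

variable {R F : Type*} [CommRing R] [IsDomain R] [CharZero R] [Field F] [Algebra R F]
  {ℓ n d : ℕ} {i : Fin (ℓ + 1)}

theorem exists_ML (p q : CR ℓ n) (g : ℕ) (h : ZValid ℓ p.1 q.1 g) :
    ∃ x : ML ℓ n, mrow x = p ∧ mcol x = q ∧ mdeg x = g :=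
  ⟨mkM p q g h, rfl, rfl, rfl⟩

theorem exists_CL (p : CR ℓ n) (g : ℕ) (h : (g = 0 ∧ (p.1 : ℕ) + 1 = i) ∨
    (g = 1 ∧ ((p.1 : ℕ) = i ∨ (p.1 : ℕ) + 2 = i)) ∨ (g = 2 ∧ (p.1 : ℕ) + 1 = i)) :
    ∃ c : CL ℓ n i, crow c = p ∧ cdeg c = g := by
  refine ⟨(p.2, ⟨(p.1, ⟨g, by omega⟩), ?_⟩), rfl, rfl⟩
  rcases h with ⟨rfl, h⟩ | ⟨rfl, h⟩ | ⟨rfl, h⟩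
  · exact Or.inl ⟨rfl, h⟩
  · exact Or.inr (Or.inl ⟨rfl, h.imp_left Fin.ext⟩)
  · exact Or.inr (Or.inr ⟨rfl, h⟩)

theorem Calib.cFact_eq_one {B : Type*} [Fintype B] (κ : Calib B) {b : Fin d → B}
    (h : ∀ k, ¬ κ.isC (b k)) : κ.cFact b = 1 := by
  refine Finset.prod_eq_one fun β _ => ?_
  split_ifs with hβ
  · have : IsEmpty {k // b k = β} := ⟨fun ⟨k, hk⟩ => h k (hk ▸ hβ)⟩
    simp
  · rfl

theorem mpar_zero_iff (b : ML ℓ n) : (matCal ℓ n).par b = 0 ↔ mdeg b ≠ 1 := by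
  change ((mdeg b : ℕ) : ZMod 2) = 0 ↔ _
  have := mdeg_le b
  interval_cases mdeg b <;> decide

theorem mat_swap_isC {b : ML ℓ n} : (matCal ℓ n).swap.isC b ↔ mdeg b = 0 := by
  change ((matCal ℓ n).par b = 0 ∧ ¬ (matCal ℓ n).isC b) ↔ _
  rw [mpar_zero_iff, mat_isC]
  have := mdeg_le b
  omega

theorem col_swap_isC {b : CL ℓ n i} : (colCal ℓ n i).swap.isC b ↔ cdeg b = 0 := by
  change ((colCal ℓ n i).par b = 0 ∧ ¬ (colCal ℓ n i).isC b) ↔ _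
  rw [cpar_zero_iff, col_isC]
  have := cdeg_le b
  omega

theorem mat_seq_iff {b : Fin d → ML ℓ n} :
    (matCal ℓ n).Seq b ↔ ∀ k l, k ≠ l → b k = b l → mdeg (b k) ≠ 1 := by
  simp only [Calib.Seq, mpar_zero_iff]

theorem col_seq_iff {b : Fin d → CL ℓ n i} :
    (colCal ℓ n i).Seq b ↔ ∀ k l, k ≠ l → b k = b l → cdeg (b k) ≠ 1 := by
  simp only [Calib.Seq, cpar_zero_iff]

theorem mY_mul_mY_val {q r : Fin d → ML ℓ n} (hq : (matCal ℓ n).Seq q) (hr : (matCal ℓ n).Seq r) :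
    (mY R q * mY R r).1 = mmul R ((matCal ℓ n).y R q) ((matCal ℓ n).y R r) := by
  have h1 := TZR_mul_val R (mY R q) (mY R r)
  have h2 : mmul R (mY R q).1 (mY R r).1 = mmul R ((matCal ℓ n).y R q) ((matCal ℓ n).y R r) :=
    congrArg₂ (mmul R) (mY_val hq) (mY_val hr)
  exact h1.trans h2

theorem mY_smul_cY_val {q : Fin d → ML ℓ n} {r : Fin d → CL ℓ n i} (hq : (matCal ℓ n).Seq q)
    (hr : (colCal ℓ n i).Seq r) :
    (mY R q • cY R r).1 = cmul R ((matCal ℓ n).y R q) ((colCal ℓ n i).y R r) := by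
  have h1 := TTR_smul_val R (mY R q) (cY R r)
  have h2 : cmul R (mY R q).1 (cY R r).1 = cmul R ((matCal ℓ n).y R q) ((colCal ℓ n i).y R r) :=
    congrArg₂ (cmul R) (mY_val hq) (cY_val hr)
  exact h1.trans h2

variable (R F) in
-- The letters of a product are determined by those of the factors, so in `tAct_y_y` only
-- rearrangements of `r` matching the columns of `q` need control (`hu`). Condition `hc` gives `r`
-- the coefficient one in `y_r`, and `hA` matches the multiplicities of repeated degree-zero
-- letters.
theorem MY_mul_MY_eq {q r b : Fin d → ML ℓ n} (hq : (matCal ℓ n).Seq q) (hr : (matCal ℓ n).Seq r)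
    (hb : (matCal ℓ n).Seq b) (hc : ∀ k, mdeg (r k) ≠ 2)
    (hA : ∀ k l, k ≠ l → ((mdeg (q k) = 0 ∧ q k = q l) ↔ (mdeg (b k) = 0 ∧ b k = b l)))
    (hQ : ∀ k, MQ (q k) (r k) (b k))
    (hu : ∀ σ : Equiv.Perm (Fin d), (∀ k, mcol (q k) = mrow (r (σ k))) → r ∘ σ = r) :
    ∃ ε : F, IsSign ε ∧ MY R F q * MY R F r = ε • MY R F b := by
  obtain ⟨ε, hε, h⟩ := tAct_y_y (R := R) (cA := matCal ℓ n) (cV := matCal ℓ n) (Q := MQ)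
    (fun a c b h => h.par) hq hr hb
    ((matCal ℓ n).cFact_eq_one fun k hk => hc k (mat_isC.mp hk))
    (Calib.cFact_congr _ _ _ _ fun k l hkl => by rw [mat_swap_isC, mat_swap_isC]; exact hA k l hkl)
    hQ (fun σ b' h => by
      have hσ := hu σ fun k => (h k).1
      refine ⟨hσ, funext fun k => ?_⟩
      have h1 := h k
      rw [show r (σ k) = r k from congrFun hσ k] at h1
      exact h1.unique (hQ k))
  rw [MY_mul_MY]
  refine MY_of_mY_smul ⟨ε, hε, Subtype.ext ((mY_mul_mY_val hq hr).trans (h.trans ?_))⟩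
  exact congrArg (ε • ·) (mY_val hb).symm

variable (R F) in
theorem MY_smul_CY_eq {q : Fin d → ML ℓ n} {r b : Fin d → CL ℓ n i} (hq : (matCal ℓ n).Seq q)
    (hr : (colCal ℓ n i).Seq r) (hb : (colCal ℓ n i).Seq b) (hc : ∀ k, cdeg (r k) ≠ 2)
    (hA : ∀ k l, k ≠ l → ((mdeg (q k) = 0 ∧ q k = q l) ↔ (cdeg (b k) = 0 ∧ b k = b l)))
    (hQ : ∀ k, CQ (q k) (r k) (b k))
    (hu : ∀ σ : Equiv.Perm (Fin d), (∀ k, mcol (q k) = crow (r (σ k))) → r ∘ σ = r) :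
    ∃ ε : F, IsSign ε ∧ MY R F q • CY R F r = ε • CY R F b := by
  obtain ⟨ε, hε, h⟩ := tAct_y_y (R := R) (cA := matCal ℓ n) (cV := colCal ℓ n i) (Q := CQ)
    (fun a c b h => h.par) hq hr hb
    ((colCal ℓ n i).cFact_eq_one fun k hk => hc k (col_isC.mp hk))
    (Calib.cFact_congr _ _ _ _ fun k l hkl => by rw [mat_swap_isC, col_swap_isC]; exact hA k l hkl)
    hQ (fun σ b' h => by
      have hσ := hu σ fun k => (h k).1
      refine ⟨hσ, funext fun k => ?_⟩
      have h1 := h k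
      rw [show r (σ k) = r k from congrFun hσ k] at h1
      exact h1.unique (hQ k))
  rw [MY_smul_CY]
  refine CY_of_cY_smul ⟨ε, hε, Subtype.ext ((mY_smul_cY_val hq hr).trans (h.trans ?_))⟩
  exact congrArg (ε • ·) (cY_val hb).symm

/-! ### The filtration of `𝒯_i^d` -/

/-- A path of length `g` lowers the colour by at most `g` and raises the degree by `g`, so colour
plus degree does not decrease; `i + 1` is its larger value. -/
theorem CQ.isUp {a : ML ℓ n} {c b : CL ℓ n i} (h : CQ a c b) (hc : isUp c) : isUp b := by
  obtain ⟨h1, h2, h3⟩ := h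
  have ha := a.valid
  have hb := isUp_or b
  unfold ZigSchur.isUp at *
  rw [h1, ← h2] at ha
  unfold ZValid at ha
  have := mdeg_le a
  omega

variable (R F d i) in
/-- The span of the `y_c` with at least `T` letters `a_{i,i-1}` and `c_{i-1}` (or `v_0`). -/
noncomputable def upSub (n T : ℕ) : Submodule F (TT R F ℓ n d i) where
  carrier := {v | ∀ c : Fin d → CL ℓ n i, nUp c < T → ccoF R F c v = 0}
  add_mem' := fun hv hw c hc => by rw [map_add, hv c hc, hw c hc, add_zero]
  zero_mem' := fun c _ => map_zero _
  smul_mem' := fun r v hv c hc => by rw [map_smul, hv c hc, smul_zero]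

theorem CY_mem_upSub {c : Fin d → CL ℓ n i} {T : ℕ} (h : T ≤ nUp c) :
    CY R F c ∈ upSub R F d i n T := by
  intro c' hc'
  refine ccoF_CY_of_ne ?_
  rintro ⟨σ, rfl⟩
  rw [nUp_comp] at hc'
  omega

theorem coef_smul_CY_mem {v : TT R F ℓ n d i} {T : ℕ} (hv : v ∈ upSub R F d i n T)
    (c : Fin d → CL ℓ n i) : ccoF R F c v • CY R F c ∈ upSub R F d i n T := by
  by_cases h : T ≤ nUp c
  · exact Submodule.smul_mem _ _ (CY_mem_upSub h)
  · rw [hv c (not_le.mp h), zero_smul]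
    exact Submodule.zero_mem _

/-- By `CQ.isUp` every up letter stays up, so no word in the product has fewer of them. -/
theorem smul_cY_apply {s : TZR R ℓ n d} {c c' : Fin d → CL ℓ n i} (h : nUp c' < nUp c) :
    cco R c' (s • cY R c) = 0 := by
  refine cco_eq_zero ?_
  have h1 := congrFun (TTR_smul_val R s (cY R c)) c'
  refine h1.trans (Finset.sum_eq_zero fun a _ => Finset.sum_eq_zero fun b _ => ?_)
  by_contra h0
  have h2 := right_ne_zero_of_mul (left_ne_zero_of_mul h0)
  have h3 : ∀ k, CQ (a k) (b k) (c' k) := fun k => by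
    by_contra h'
    exact factor_ne_zero (right_ne_zero_of_mul (right_ne_zero_of_mul h0)) k (if_neg h')
  by_cases hb : ∃ σ : Equiv.Perm (Fin d), c ∘ σ = b
  · obtain ⟨σ, rfl⟩ := hb
    rw [← nUp_comp c σ] at h
    refine absurd h (not_lt.mpr (Finset.card_le_card fun k hk => ?_))
    rw [Finset.mem_filter] at hk ⊢
    exact ⟨hk.1, (h3 k).isUp hk.2⟩
  · exact h2 (cY_apply_eq_zero hb)

theorem smul_CY_mem {x : TZ R F ℓ n d} {c : Fin d → CL ℓ n i} {T : ℕ} (h : T ≤ nUp c) :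
    x • CY R F c ∈ upSub R F d i n T := by
  refine TensorProduct.induction_on (motive := fun x : TZ R F ℓ n d =>
    x • CY R F c ∈ upSub R F d i n T) x ?_ (fun r s => ?_) fun x y hx hy => ?_
  · exact (zero_smul (TZ R F ℓ n d) (CY R F c)).symm ▸ Submodule.zero_mem _
  · rw [CY, tt_smul]
    intro c' hc'
    rw [ccoF_ttmk, smul_cY_apply (by omega), map_zero, mul_zero]
  · exact (add_smul x y (CY R F c)).symm ▸ Submodule.add_mem _ hx hy

theorem smul_mem_upSub (x : TZ R F ℓ n d) {v : TT R F ℓ n d i} {T : ℕ}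
    (hv : v ∈ upSub R F d i n T) : x • v ∈ upSub R F d i n T := by
  rw [TT_eq_sum v, Finset.smul_sum]
  refine Submodule.sum_mem _ fun q _ => ?_
  rw [smul_comm x]
  by_cases h : T ≤ nUp (rep q)
  · exact Submodule.smul_mem _ _ (smul_CY_mem h)
  · rw [hv (rep q) (not_le.mp h), zero_smul]
    exact Submodule.zero_mem _

variable (R F d i) in
/-- The span of the `y_c` with at least `T` letters `a_{i,i-1}` and `c_{i-1}` (or `v_0`). -/
noncomputable def upMod (n T : ℕ) : Submodule (TZ R F ℓ n d) (TT R F ℓ n d i) where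
  __ := (upSub R F d i n T).toAddSubmonoid
  smul_mem' := fun x _ hv => smul_mem_upSub x hv

theorem upMod_homogeneous (T : ℕ) :
    IsHomogeneousSub (TTgr R F ℓ n d i) (upMod R F d i n T) := by
  intro v hv
  refine ⟨∑ q : Quotient (wordSetoid (CL ℓ n i) d),
      if (colCal ℓ n i).tpar (rep q) = 0 then ccoF R F (rep q) v • CY R F (rep q) else 0,
    Submodule.sum_mem _ fun q _ => ?_, ∑ q : Quotient (wordSetoid (CL ℓ n i) d),
      if (colCal ℓ n i).tpar (rep q) = 0 then 0 else ccoF R F (rep q) v • CY R F (rep q),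
    Submodule.sum_mem _ fun q _ => ?_, ?_, ?_, ?_⟩
  · split_ifs with h
    · have := CY_mem (R := R) (F := F) (rep q)
      rw [h] at this
      exact Submodule.smul_mem _ _ this
    · exact Submodule.zero_mem _
  · split_ifs with h
    · exact Submodule.zero_mem _
    · have := CY_mem (R := R) (F := F) (rep q)
      rw [(zmod2_cases _).resolve_left h] at this
      exact Submodule.smul_mem _ _ this
  · refine Submodule.sum_mem (upSub R F d i n T) fun q _ => ?_
    split_ifs
    · exact coef_smul_CY_mem hv _
    · exact Submodule.zero_mem _
  · refine Submodule.sum_mem (upSub R F d i n T) fun q _ => ?_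
    split_ifs
    · exact Submodule.zero_mem _
    · exact coef_smul_CY_mem hv _
  · conv_lhs => rw [TT_eq_sum v]
    rw [← Finset.sum_add_distrib]
    refine Finset.sum_congr rfl fun q _ => ?_
    split_ifs
    · rw [add_zero]
    · rw [zero_add]

theorem upMod_anti {T T' : ℕ} (h : T ≤ T') : upMod R F d i n T' ≤ upMod R F d i n T :=
  fun _ hv c hc => hv c (by omega)

theorem upMod_eq_bot {T : ℕ} (h : d < T) : upMod R F d i n T = ⊥ := by
  rw [eq_bot_iff]
  intro v hv
  rw [Submodule.mem_bot]
  exact TT_eq_zero fun c => hv c ((nUp_le c).trans_lt h)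

theorem upMod_eq_top {T : ℕ} (h : T = 0 ∨ T = d ∧ (i : ℕ) = 0) : upMod R F d i n T = ⊤ := by
  rw [eq_top_iff]
  intro v _ c hc
  exfalso
  rcases h with rfl | ⟨rfl, hi⟩
  · omega
  · have : nUp c = T := by
      rw [nUp, Finset.filter_true_of_mem, Finset.card_univ, Fintype.card_fin]
      -- For `i = 0` the only basis vector is `v_0`, which is up.
      intro k _
      exact (isUp_or (c k)).resolve_right (by omega)
    exact absurd this hc.ne

end Products


/-! ### Intermediate words -/

section Middle

open scoped Classical

variable {ℓ n d : ℕ} {i : Fin (ℓ + 1)}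

/-- Coloured rows with prescribed colours: the row is zero for the colours in `low`, and for the
other colours the rows are pairwise distinct. -/
theorem exists_pack (hn : 0 < n) (hd : d ≤ n) (γ : Fin d → Fin (ℓ + 1)) (low : Fin (ℓ + 1) → Prop) :
    ∃ p : Fin d → CR ℓ n, (∀ m, (p m).1 = γ m) ∧ (∀ m, low (γ m) → (p m).2 = ⟨0, hn⟩) ∧
      (∀ m m', p m = p m' → m = m' ∨ low (γ m)) ∧ ∀ κ, Antitone (wt p κ) := by
  -- Within each colour the places are numbered, and outside `low` the number is the row. There are
  -- at most `d ≤ n` of them, and they fill an initial segment of rows, so the weight is a partition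
  -- `(1, …, 1, 0, …)`.
  let e : ∀ κ, {m // γ m = κ} ≃ Fin (Fintype.card {m // γ m = κ}) := fun κ => Fintype.equivFin _
  have hcard : ∀ κ, Fintype.card {m // γ m = κ} ≤ n := fun κ =>
    (Fintype.card_subtype_le _).trans ((Fintype.card_fin d).trans_le hd)
  let f : Fin d → Fin n := fun m => (e (γ m) ⟨m, rfl⟩).castLE (hcard _)
  have hf : ∀ κ m (h : γ m = κ), f m = (e κ ⟨m, h⟩).castLE (hcard _) := by
    rintro κ m rfl; rfl
  have hinj : ∀ m m', γ m = γ m' → f m = f m' → m = m' := by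
    intro m m' h h'
    rw [hf (γ m') m h, hf (γ m') m' rfl] at h'
    exact congrArg Subtype.val ((e _).injective (Fin.castLE_injective _ h'))
  let p : Fin d → CR ℓ n := fun m => (γ m, if low (γ m) then ⟨0, hn⟩ else f m)
  have hp : ∀ m m', p m = p m' → m = m' ∨ low (γ m) := by
    intro m m' h
    by_cases hl : low (γ m)
    · exact Or.inr hl
    · obtain ⟨h1, h2⟩ := Prod.ext_iff.mp h
      change γ m = γ m' at h1
      change (if low (γ m) then _ else f m) = (if low (γ m') then _ else f m') at h2
      rw [← h1, if_neg hl, if_neg hl] at h2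
      exact Or.inl (hinj m m' h1 h2)
  refine ⟨p, fun m => rfl, fun m h => if_pos h, hp, fun κ r r' hr => ?_⟩
  have hr' : (r : ℕ) ≤ r' := hr
  by_cases h0 : ∃ m', p m' = (κ, r')
  swap
  · rw [wt_apply p κ r', Finset.filter_false_of_mem fun m _ h => h0 ⟨m, h⟩, Finset.card_empty]
    exact Nat.zero_le _
  obtain ⟨m', hm'⟩ := h0
  obtain ⟨h1, h2⟩ := Prod.ext_iff.mp hm'
  change γ m' = κ at h1
  change (if low (γ m') then _ else f m') = r' at h2
  by_cases hl : low κ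
  · rw [h1, if_pos hl] at h2
    have : r = r' := by
      rw [← h2] at hr' ⊢
      exact Fin.ext (Nat.le_zero.mp hr')
    rw [this]
  · rw [h1, if_neg hl, hf κ m' h1] at h2
    have h3 : wt p κ r' ≤ 1 := by
      rw [wt_apply, Finset.card_le_one]
      intro a ha a' ha'
      have ha1 := (Finset.mem_filter.mp ha).2
      refine (hp a a' (ha1.trans (Finset.mem_filter.mp ha').2.symm)).resolve_right ?_
      rw [show γ a = κ from (Prod.ext_iff.mp ha1).1]
      exact hl
    have hlt : (r : ℕ) < Fintype.card {m // γ m = κ} := by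
      have h5 := (e κ ⟨m', h1⟩).2
      have h6 : ((e κ ⟨m', h1⟩ : Fin _) : ℕ) = r' := congrArg Fin.val h2
      omega
    have h4 : 1 ≤ wt p κ r := by
      rw [wt_apply, Finset.one_le_card]
      refine ⟨((e κ).symm ⟨r, hlt⟩).1, Finset.mem_filter.mpr ⟨Finset.mem_univ _, ?_⟩⟩
      have h5 := ((e κ).symm ⟨r, hlt⟩).2
      refine Prod.ext h5 ?_
      change (if low (γ _) then _ else f _) = r
      rw [h5, if_neg hl, hf κ _ h5]
      refine Fin.ext ?_
      change ((e κ ((e κ).symm ⟨r, hlt⟩) : Fin _) : ℕ) = r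
      rw [Equiv.apply_symm_apply]
    omega

/-- Either all `s + 1` entries up to `s` are positive, or the entries from `s` on vanish and the
partial sum is the full one. This is why every partition of `t` dominates `(1^t)`. -/
theorem le_sum_Iic_of_antitone {f : Fin n → ℕ} (hf : Antitone f) (s : Fin n) :
    min ((s : ℕ) + 1) (∑ r, f r) ≤ ∑ r ∈ Finset.Iic s, f r := by
  by_cases h : f s = 0
  · refine (min_le_right _ _).trans_eq (Finset.sum_subset (Finset.subset_univ _) fun r _ hr => ?_).symm
    have : s ≤ r := (not_le.mp fun h' => hr (Finset.mem_Iic.mpr h')).le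
    exact Nat.le_zero.mp ((hf this).trans_eq h)
  · refine (min_le_left _ _).trans ?_
    calc (s : ℕ) + 1 = ∑ r ∈ Finset.Iic s, 1 := by rw [Finset.sum_const, Fin.card_Iic]; simp
      _ ≤ _ := Finset.sum_le_sum fun r hr => by
        have := hf (Finset.mem_Iic.mp hr)
        omega

/-- The rows of the intermediate word for a transposition: `k` and `l` are moved to the row
zero. -/
def mergeRow (k l m : ℕ) : ℕ :=
  if m = k ∨ m = l then 0 else if m < k then m + 1 else if m < l then m else m - 1

/-- Moving two of the first `t` places to a common row turns `(1^t)` into `(2, 1^(t-2))`, which is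
strictly larger. The other rows are shifted to close the gaps, so the weight remains a partition;
the colours and the other places are untouched. -/
theorem exists_merge {hn : 0 < n} {hd : d ≤ n} {t : ℕ} (htd : t ≤ d) (ht : t = d ∨ (i : ℕ) ≠ 0)
    {k l : Fin d} (hkl : k < l) (hl : (l : ℕ) < t) :
    ∃ p : Fin d → CR ℓ n,
      (∀ m, (p m).1 = (crow (gen hn hd t m : CL ℓ n i)).1) ∧ p k = p l ∧
      (∀ m : Fin d, ¬ (m : ℕ) < t → p m = crow (gen hn hd t m : CL ℓ n i)) ∧
      (∀ m m', p m = p m' → m = m' ∨ (¬ (m : ℕ) < t ∧ ¬ (m' : ℕ) < t) ∨ (m = k ∧ m' = l) ∨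
        (m = l ∧ m' = k)) ∧
      (∀ κ, Antitone (wt p κ)) ∧
      leI (wt (crow ∘ (gen hn hd t : Fin d → CL ℓ n i))) (wt p) ∧
      wt (crow ∘ (gen hn hd t : Fin d → CL ℓ n i)) ≠ wt p := by
  have hkl' : (k : ℕ) < l := hkl
  have hln := l.2
  have hrow : ∀ m : Fin d, (m : ℕ) < t → mergeRow k l m < n := fun m hm => by
    have := m.2
    unfold mergeRow
    split_ifs <;> omega
  let p : Fin d → CR ℓ n := fun m =>
    if h : (m : ℕ) < t then (i, ⟨mergeRow k l m, hrow m h⟩) else crow (gen hn hd t m : CL ℓ n i)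
  have p1 : ∀ (m : Fin d) (h : (m : ℕ) < t), p m = (i, ⟨mergeRow k l m, hrow m h⟩) := fun m h => dif_pos h
  have p2 : ∀ m : Fin d, ¬ (m : ℕ) < t → p m = crow (gen hn hd t m : CL ℓ n i) := fun m h => dif_neg h
  have hcol : ∀ m, (p m).1 = (crow (gen hn hd t m : CL ℓ n i)).1 := fun m => by
    by_cases h : (m : ℕ) < t
    · rw [p1 m h, crow_gen_lt h]
    · rw [p2 m h]
  have hlow : ∀ m : Fin d, ¬ (m : ℕ) < t → (p m).1 ≠ i := fun m h h' => by
    rw [hcol] at h'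
    have := crow_gen_colour (n := n) (hn := hn) (hd := hd) (i := i) (t := t) (k := m) (by omega) h
    rw [h'] at this
    omega
  have hp : ∀ (m : Fin d) (r : Fin n), p m = (i, r) ↔ (m : ℕ) < t ∧ mergeRow k l m = r := by
    intro m r
    by_cases h : (m : ℕ) < t
    · rw [p1 m h, Prod.ext_iff, Fin.ext_iff (n := n)]
      exact ⟨fun h' => ⟨h, h'.2⟩, fun h' => ⟨rfl, h'.2⟩⟩
    · exact ⟨fun h' => absurd (congrArg Prod.fst h') (hlow m h), fun h' => absurd h'.1 h⟩
  have hinj : ∀ m m', p m = p m' → m = m' ∨ (¬ (m : ℕ) < t ∧ ¬ (m' : ℕ) < t) ∨ (m = k ∧ m' = l) ∨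
        (m = l ∧ m' = k) := by
    intro m m' h
    by_cases hm : (m : ℕ) < t
    · rw [p1 m hm, eq_comm, hp] at h
      obtain ⟨hm', h⟩ := h
      change mergeRow k l m' = mergeRow k l m at h
      unfold mergeRow at h
      simp only [Fin.ext_iff]
      split_ifs at h <;> omega
    · by_cases hm' : (m' : ℕ) < t
      · rw [p1 m' hm', hp] at h
        exact absurd h.1 hm
      · exact Or.inr (Or.inl ⟨hm, hm'⟩)
  have hoth : ∀ κ, κ ≠ i → wt p κ = wt (crow ∘ (gen hn hd t : Fin d → CL ℓ n i)) κ := by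
    intro κ hκ
    funext r
    rw [wt_apply, wt_apply]
    congr 1
    refine Finset.filter_congr fun m _ => ?_
    rw [Function.comp_apply]
    by_cases h : (m : ℕ) < t
    · rw [p1 m h, crow_gen_lt h]
      exact ⟨fun h' => absurd (congrArg Prod.fst h').symm hκ,
        fun h' => absurd (congrArg Prod.fst h').symm hκ⟩
    · rw [p2 m h]
  have hsum : ∀ κ, ∑ r, wt p κ r = ∑ r, wt (crow ∘ (gen hn hd t : Fin d → CL ℓ n i)) κ r := by
    intro κ
    rw [sum_wt_univ, sum_wt_univ]
    congr 1
    exact Finset.filter_congr fun m _ => by rw [hcol]; rfl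
  have h0 : 2 ≤ wt p i ⟨0, hn⟩ := by
    rw [wt_apply]
    refine (Finset.card_pair hkl.ne).symm.trans_le (Finset.card_le_card fun m hm => ?_)
    rw [Finset.mem_filter, hp]
    rw [Finset.mem_insert, Finset.mem_singleton] at hm
    refine ⟨Finset.mem_univ _, ?_⟩
    rcases hm with rfl | rfl
    · exact ⟨by omega, if_pos (Or.inl rfl)⟩
    · exact ⟨hl, if_pos (Or.inr rfl)⟩
  have hanti : ∀ κ, Antitone (wt p κ) := by
    intro κ
    by_cases hκ : κ = i
    swap
    · rw [hoth κ hκ]; exact antitone_wt_gen htd ht κ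
    subst hκ
    intro r r' hr
    rcases eq_or_lt_of_le hr with rfl | hlt
    · exact le_rfl
    have hlt' : (r : ℕ) < r' := hlt
    by_cases h1 : ∃ m', p m' = (κ, r')
    swap
    · rw [wt_apply p κ r', Finset.filter_false_of_mem fun m _ h => h1 ⟨m, h⟩, Finset.card_empty]
      exact Nat.zero_le _
    obtain ⟨m', hm'⟩ := h1
    rw [hp] at hm'
    obtain ⟨hmt, hmr⟩ := hm'
    have h2 : wt p κ r' ≤ 1 := by
      rw [wt_apply, Finset.card_le_one]
      intro a ha a' ha'
      have ha1 := (Finset.mem_filter.mp ha).2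
      have ha2 := (Finset.mem_filter.mp ha').2
      rw [hp] at ha1 ha2
      obtain ⟨-, ha1⟩ := ha1
      obtain ⟨-, ha2⟩ := ha2
      unfold mergeRow at ha1 ha2
      refine Fin.ext ?_
      split_ifs at ha1 ha2 <;> omega
    -- The rows in use have no gaps: this inverts `mergeRow` on each of its ranges.
    have h3 : ∃ m : ℕ, m < t ∧ mergeRow k l m = r := by
      unfold mergeRow at hmr
      by_cases r0 : (r : ℕ) = 0
      · exact ⟨k, by omega, by rw [r0]; exact if_pos (Or.inl rfl)⟩
      by_cases r1 : (r : ℕ) ≤ k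
      · refine ⟨r - 1, by omega, ?_⟩
        unfold mergeRow
        split_ifs <;> omega
      by_cases r2 : (r : ℕ) < l
      · refine ⟨r, by omega, ?_⟩
        unfold mergeRow
        split_ifs <;> omega
      · refine ⟨r + 1, ?_, ?_⟩
        · split_ifs at hmr <;> omega
        · unfold mergeRow
          split_ifs <;> omega
    obtain ⟨m, hm, hmr'⟩ := h3
    have h4 : 1 ≤ wt p κ r := by
      rw [wt_apply, Finset.one_le_card]
      exact ⟨⟨m, by omega⟩, Finset.mem_filter.mpr ⟨Finset.mem_univ _, (hp _ _).mpr ⟨hm, hmr'⟩⟩⟩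
    omega
  refine ⟨p, hcol, ?_, p2, hinj, hanti, Or.inr ⟨fun κ => (hsum κ).symm, fun κ s => ?_⟩, ?_⟩
  · rw [p1 l hl, hp]
    refine ⟨by omega, ?_⟩
    change mergeRow k l k = mergeRow k l l
    simp [mergeRow]
  · by_cases hκ : κ = i
    · subst hκ
      -- Partial sums of `(1^t)` are bounded both by the number of rows and by the total.
      refine le_trans (le_min ?_ ?_) (le_sum_Iic_of_antitone (hanti κ) s)
      · calc _ ≤ ∑ r ∈ Finset.Iic s, 1 := Finset.sum_le_sum fun r _ => by
              rw [wt_gen_top htd ht]; split_ifs <;> omega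
          _ = _ := by rw [Finset.sum_const, Fin.card_Iic]; simp
      · rw [hsum]
        exact Finset.sum_le_sum_of_subset (Finset.subset_univ _)
    · rw [hoth κ hκ]
  · intro h
    rw [← h, wt_gen_top htd ht] at h0
    split_ifs at h0 <;> omega

end Middle


/-! ### Lifting column words to matrix words -/

section Lift

open scoped Classical

variable {R F : Type*} [CommRing R] [IsDomain R] [CharZero R] [Field F] [Algebra R F]
  {ℓ n d : ℕ} {i : Fin (ℓ + 1)} {hn : 0 < n} {hd : d ≤ n} {t : ℕ}

theorem gen_eq_of_crow_eq {k m : Fin d}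
    (h : crow (gen hn hd t k : CL ℓ n i) = crow (gen hn hd t m : CL ℓ n i))
    (ht : t = d ∨ (i : ℕ) ≠ 0) : k = m ∨ (¬ (k : ℕ) < t ∧ ¬ (m : ℕ) < t) := by
  by_cases hk : (k : ℕ) < t
  · by_cases hm : (m : ℕ) < t
    · rw [crow_gen_lt hk, crow_gen_lt hm] at h
      exact Or.inl (Fin.castLE_injective hd (Prod.ext_iff.mp h).2)
    · have h1 := crow_gen_colour (n := n) (hn := hn) (hd := hd) (i := i) (t := t) (k := m)
        (by omega) hm
      rw [← h, crow_gen_lt hk] at h1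
      exact absurd h1 (by change ¬ ((i : ℕ) + 1 = i); omega)
  · by_cases hm : (m : ℕ) < t
    · have h1 := crow_gen_colour (n := n) (hn := hn) (hd := hd) (i := i) (t := t) (k := k)
        (by omega) hk
      rw [h, crow_gen_lt hm] at h1
      exact absurd h1 (by change ¬ ((i : ℕ) + 1 = i); omega)
    · exact Or.inr ⟨hk, hm⟩

theorem gen_low_eq {k m : Fin d} (hk : ¬ (k : ℕ) < t) (hm : ¬ (m : ℕ) < t) :
    (gen hn hd t k : CL ℓ n i) = gen hn hd t m := by
  rw [gen, gen, if_neg hk, if_neg hm]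

/-- `b` times the generating word is `c`, letter by letter. -/
def IsLift (hn : 0 < n) (hd : d ≤ n) (t : ℕ) (b : Fin d → ML ℓ n) (c : Fin d → CL ℓ n i) : Prop :=
  ∀ k, CQ (b k) (gen hn hd t k) (c k)

theorem IsLift.col {b : Fin d → ML ℓ n} {c : Fin d → CL ℓ n i} (h : IsLift hn hd t b c) (k : Fin d) :
    mcol (b k) = crow (gen hn hd t k : CL ℓ n i) := (h k).1

theorem IsLift.unique {b b' : Fin d → ML ℓ n} {c c' : Fin d → CL ℓ n i} {k m : Fin d}
    (h : IsLift hn hd t b c) (h' : IsLift hn hd t b' c')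
    (hkm : (gen hn hd t k : CL ℓ n i) = gen hn hd t m) (hc : c k = c' m) : b k = b' m := by
  obtain ⟨h1, h2, h3⟩ := h k
  obtain ⟨h1', h2', h3'⟩ := h' m
  rw [← hkm] at h1' h3'
  rw [← hc] at h2' h3'
  exact ML.ext' (h2.symm.trans h2') (h1.trans h1'.symm) (by omega)

theorem IsLift.eq {b : Fin d → ML ℓ n} {c : Fin d → CL ℓ n i} {k m : Fin d}
    (h : IsLift hn hd t b c) (hkm : (gen hn hd t k : CL ℓ n i) = gen hn hd t m) (hb : b k = b m) :
    c k = c m := by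
  obtain ⟨h1, h2, h3⟩ := h k
  obtain ⟨h1', h2', h3'⟩ := h m
  rw [← hkm, ← hb] at h3'
  rw [← hb] at h2'
  exact CL.ext' (h2.trans h2'.symm) (by omega)

/-- The vector `e_{i-1}` generates `ΠT(i)` for `i > 0`, so the tail imposes no condition, while
`a_{i,i-1}` reaches exactly the up letters, by a path one shorter than the target. -/
theorem exists_lift {c : Fin d → CL ℓ n i} (ht : t = d ∨ (i : ℕ) ≠ 0)
    (hc : ∀ k : Fin d, (k : ℕ) < t → isUp (c k)) : ∃ b, IsLift hn hd t b c := by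
  have h : ∀ k, ∃ x, CQ x (gen hn hd t k) (c k) := fun k => by
    have hv := (c k).valid
    have := (crow (c k)).1.2
    by_cases hk : (k : ℕ) < t
    · have hup := hc k hk
      unfold isUp at hup
      obtain ⟨x, h1, h2, h3⟩ := exists_ML (crow (c k)) (crow (gen hn hd t k : CL ℓ n i))
        (cdeg (c k) - 1) (by
          rw [crow_gen_lt hk]
          change ZValid ℓ (crow (c k)).1 i _
          unfold ZValid
          omega)
      refine ⟨x, h2, h1.symm, ?_⟩
      rw [h3, cdeg_gen_lt hk]
      omega
    · have hi : (i : ℕ) ≠ 0 := by omega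
      have hg := crow_gen_colour (n := n) (hn := hn) (hd := hd) (i := i) (t := t) (k := k) hi hk
      obtain ⟨x, h1, h2, h3⟩ := exists_ML (crow (c k)) (crow (gen hn hd t k : CL ℓ n i))
        (cdeg (c k)) (by unfold ZValid; omega)
      refine ⟨x, h2, h1.symm, ?_⟩
      rw [h3, cdeg_gen hi hk, add_zero]
  choose b hb using h
  exact ⟨b, hb⟩

/-- If all letters of `b` in the columns of `a_{i,i-1}` lower the colour by their degree, then `b`
times the generating word is a word. -/
theorem exists_isLift {b : Fin d → ML ℓ n} (ht : t = d ∨ (i : ℕ) ≠ 0)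
    (hcol : ∀ k, mcol (b k) = crow (gen hn hd t k : CL ℓ n i))
    (hb : ∀ k : Fin d, (k : ℕ) < t → ((mrow (b k)).1 : ℕ) + mdeg (b k) = (mcol (b k)).1) :
    ∃ c : Fin d → CL ℓ n i, IsLift hn hd t b c := by
  have h : ∀ k, ∃ x, CQ (b k) (gen hn hd t k : CL ℓ n i) x := fun k => by
    have hv := (b k).valid
    rw [hcol] at hv
    unfold ZValid at hv
    by_cases hk : (k : ℕ) < t
    · have hg := hb k hk
      rw [hcol] at hg
      rw [crow_gen_lt hk] at hv hg
      change (_ : ℕ) + _ = (i : ℕ) at hg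
      obtain ⟨x, h1, h2⟩ := exists_CL (i := i) (mrow (b k)) (mdeg (b k) + 1)
        (by simp only at hv hg; omega)
      exact ⟨x, hcol k, h1, by rw [h2, cdeg_gen_lt hk]⟩
    · have hi : (i : ℕ) ≠ 0 := by omega
      have hg := crow_gen_colour (n := n) (hn := hn) (hd := hd) (i := i) (t := t) (k := k) hi hk
      obtain ⟨x, h1, h2⟩ := exists_CL (i := i) (mrow (b k)) (mdeg (b k)) (by omega)
      exact ⟨x, hcol k, h1, by rw [h2, cdeg_gen hi hk, add_zero]⟩
  choose c hc using h
  exact ⟨c, hc⟩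

/-- A letter that lowers the colour by its degree preserves colour plus degree, which is `i + 1` at
the first `t` places of the generating word and `i - 1` afterwards. -/
theorem IsLift.isUp_iff {b : Fin d → ML ℓ n} {c : Fin d → CL ℓ n i} (h : IsLift hn hd t b c)
    (ht : t = d ∨ (i : ℕ) ≠ 0)
    (hb : ∀ k : Fin d, ((mrow (b k)).1 : ℕ) + mdeg (b k) = (mcol (b k)).1) (k : Fin d) :
    isUp (c k) ↔ (k : ℕ) < t := by
  obtain ⟨h1, h2, h3⟩ := h k
  have hg := hb k
  rw [h1, ← h2] at hg
  unfold isUp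
  by_cases hk : (k : ℕ) < t
  · rw [crow_gen_lt hk] at hg
    rw [cdeg_gen_lt hk] at h3
    change (_ : ℕ) + _ = (i : ℕ) at hg
    omega
  · have hi : (i : ℕ) ≠ 0 := by omega
    have hg' := crow_gen_colour (n := n) (hn := hn) (hd := hd) (i := i) (t := t) (k := k) hi hk
    rw [cdeg_gen hi hk] at h3
    omega

theorem IsLift.seq {b : Fin d → ML ℓ n} {c : Fin d → CL ℓ n i} (h : IsLift hn hd t b c)
    (ht : t = d ∨ (i : ℕ) ≠ 0) (hc : (colCal ℓ n i).Seq c) : (matCal ℓ n).Seq b := by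
  rw [mat_seq_iff]
  rw [col_seq_iff] at hc
  intro k l hkl hb h1
  have h2 := congrArg mcol hb
  rw [h.col, h.col] at h2
  obtain ⟨hk, hl⟩ := (gen_eq_of_crow_eq h2 ht).resolve_left hkl
  refine hc k l hkl (h.eq (gen_low_eq hk hl) hb) ?_
  rw [(h k).2.2, h1, cdeg_gen (by omega) hk]

variable (R F) in
-- The coloured rows of the generating word distinguish its letters, so no other rearrangement fits
-- the columns of `b`. Repeated degree-zero letters occur in the tail only, where the generating
-- letter is constant and `b` and `c` show the same repetitions.
theorem IsLift.smul_gen {b : Fin d → ML ℓ n} {c : Fin d → CL ℓ n i} (h : IsLift hn hd t b c)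
    (ht : t = d ∨ (i : ℕ) ≠ 0) (hc : (colCal ℓ n i).Seq c) :
    ∃ ε : F, IsSign ε ∧ MY R F b • CY R F (gen hn hd t : Fin d → CL ℓ n i) = ε • CY R F c := by
  refine MY_smul_CY_eq R F (h.seq ht hc) (gen_seq ht) hc (fun k hk => ?_) (fun k l hkl => ?_) h
    fun σ hσ => ?_
  · by_cases hk' : (k : ℕ) < t
    · rw [cdeg_gen_lt hk'] at hk
      omega
    · rw [cdeg_gen (by omega) hk'] at hk
      omega
  · constructor
    · rintro ⟨h1, h2⟩
      have h3 := congrArg mcol h2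
      rw [h.col, h.col] at h3
      obtain ⟨hk, hl⟩ := (gen_eq_of_crow_eq h3 ht).resolve_left hkl
      refine ⟨?_, h.eq (gen_low_eq hk hl) h2⟩
      rw [(h k).2.2, h1, cdeg_gen (by omega) hk]
    · rintro ⟨h1, h2⟩
      have h1' := h1
      rw [h2] at h1'
      have hlow : ∀ m, cdeg (c m) = 0 → ¬ (m : ℕ) < t := fun m hm hm' => by
        rw [(h m).2.2, cdeg_gen_lt hm'] at hm
        omega
      refine ⟨?_, h.unique h (gen_low_eq (hlow k h1) (hlow l h1')) h2⟩
      rw [(h k).2.2] at h1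
      omega
  · funext k
    have h3 := hσ k
    rw [h.col] at h3
    rcases gen_eq_of_crow_eq h3 ht with h4 | ⟨h4, h5⟩
    · rw [Function.comp_apply, ← h4]
    · exact gen_low_eq h5 h4

/-- Elements of `T η` are determined by their action on the generating vector, up to `J`. -/
theorem mul_eta_mem (ht : t = d ∨ (i : ℕ) ≠ 0) (P : (Fin d → CL ℓ n i) → Prop)
    (J : Submodule F (TZ R F ℓ n d)) (U : Submodule F (TT R F ℓ n d i))
    (hJ : ∀ b : Fin d → ML ℓ n, (∀ k, mcol (b k) = crow (gen hn hd t k : CL ℓ n i)) →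
      MY R F b ∈ J ∨ ∃ c, (colCal ℓ n i).Seq c ∧ P c ∧ IsLift hn hd t b c)
    (hlift : ∀ c, (colCal ℓ n i).Seq c → P c → ∃ b, IsLift hn hd t b c)
    (hperm : ∀ (b b' : Fin d → ML ℓ n) (c : Fin d → CL ℓ n i) (σ : Equiv.Perm (Fin d)),
      (colCal ℓ n i).Seq c → P c → P (c ∘ σ) → IsLift hn hd t b c → IsLift hn hd t b' (c ∘ σ) →
      ∃ ε : F, MY R F b' - ε • MY R F b ∈ J)
    (hJU : ∀ x ∈ J, x • CY R F (gen hn hd t : Fin d → CL ℓ n i) ∈ U)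
    (hU : ∀ v ∈ U, ∀ c, (colCal ℓ n i).Seq c → P c → ccoF R F c v = 0) (x : TZ R F ℓ n d)
    (hx : x • CY R F (gen hn hd t : Fin d → CL ℓ n i) ∈ U) :
    x * eta R F ℓ n d (wt (crow ∘ (gen hn hd t : Fin d → CL ℓ n i))) ∈ J := by
  set w : TT R F ℓ n d i := CY R F (gen hn hd t : Fin d → CL ℓ n i) with hw
  set η := eta R F ℓ n d (wt (crow ∘ (gen hn hd t : Fin d → CL ℓ n i))) with hη
  have hηw : η • w = w := by rw [hη, hw, eta_smul_CY, if_pos rfl]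
  -- One lift is fixed for each orbit of words satisfying `P`. By `hJ` and `hperm` these lifts span
  -- `T η` modulo `J`.
  let X := {q : Quotient (wordSetoid (CL ℓ n i) d) //
    (colCal ℓ n i).Seq (rep q) ∧ ∃ σ : Equiv.Perm (Fin d), P (rep q ∘ σ)}
  choose σ hσ using fun q : X => q.2.2
  choose B hB using fun q : X => hlift _ (q.2.1.comp (σ q)) (hσ q)
  have key : x * η ∈ J ⊔ Submodule.span F (Set.range fun q : X => MY R F (B q)) := by
    rw [TZ_eq_sum x, Finset.sum_mul]
    refine Submodule.sum_mem _ fun q _ => ?_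
    rw [smul_mul_assoc, hη, MY_mul_eta]
    refine Submodule.smul_mem _ _ ?_
    split_ifs with h
    swap
    · exact Submodule.zero_mem _
    obtain ⟨τ, hτ⟩ := exists_perm_of_wt_eq h.symm
    obtain ⟨ε, hε, h1⟩ := MY_comp (R := R) (F := F) (rep q) τ
    suffices h2 : MY R F (rep q ∘ τ) ∈
        J ⊔ Submodule.span F (Set.range fun q : X => MY R F (B q)) by
      have h3 := Submodule.smul_mem _ ε h2
      rwa [h1, smul_smul, hε.mul_self, one_smul] at h3
    rcases hJ (rep q ∘ τ) (fun k => congrFun hτ k) with h2 | ⟨c, hc, hPc, h2⟩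
    · exact Submodule.mem_sup_left h2
    obtain ⟨q', ρ, rfl⟩ := exists_rep c
    have hs : (colCal ℓ n i).Seq (rep q') := by
      have h3 : (rep q' ∘ ρ) ∘ (ρ⁻¹ : Equiv.Perm (Fin d)) = rep q' := by
        funext k
        simp
      exact h3 ▸ hc.comp ρ⁻¹
    let q'' : X := ⟨q', hs, ρ, hPc⟩
    have e : rep q' ∘ ρ = (rep q' ∘ σ q'') ∘ ((σ q'')⁻¹ * ρ : Equiv.Perm (Fin d)) := by
      funext k
      simp
    rw [e] at h2 hPc
    obtain ⟨ε', h3⟩ := hperm _ _ _ _ (hs.comp _) (hσ q'') hPc (hB q'') h2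
    rw [← sub_add_cancel (MY R F (rep q ∘ τ)) (ε' • MY R F (B q''))]
    exact Submodule.add_mem_sup h3 (Submodule.smul_mem _ _ (Submodule.subset_span ⟨q'', rfl⟩))
  obtain ⟨y, hy, z, hz, hyz⟩ := Submodule.mem_sup.mp key
  obtain ⟨a, ha⟩ := (Submodule.mem_span_range_iff_exists_fun F).mp hz
  have hzU : z • w ∈ U := by
    have h1 : z • w = x • w - y • w := by
      rw [eq_sub_iff_add_eq', ← add_smul y z w, hyz, mul_smul, hηw]
    rw [h1]
    exact U.sub_mem hx (hJU y hy)
  -- The lifts send the generating vector to signs times orbit sums of different orbits, so the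
  -- coordinate at the orbit of `q` isolates the coefficient `a q`; it vanishes on `U`.
  have ha0 : ∀ q, a q = 0 := fun q => by
    have h1 := hU _ hzU (rep q.1 ∘ σ q) (q.2.1.comp _) (hσ q)
    rw [← ha, Finset.sum_smul, map_sum, Finset.sum_eq_single q] at h1
    · obtain ⟨ε, hε, h2⟩ := (hB q).smul_gen R F ht (q.2.1.comp _)
      rw [smul_assoc, h2, map_smul, map_smul, ccoF_CY_self (q.2.1.comp _), smul_eq_mul,
        smul_eq_mul, mul_one] at h1
      exact (mul_eq_zero.mp h1).resolve_right fun h => by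
        have := hε.mul_self
        rw [h, mul_zero] at this
        exact zero_ne_one this
    · intro q' _ hne
      obtain ⟨ε, hε, h2⟩ := (hB q').smul_gen R F ht (q'.2.1.comp _)
      rw [smul_assoc, h2, map_smul, map_smul, ccoF_CY_of_ne, smul_zero, smul_zero]
      rintro ⟨τ, hτ⟩
      refine hne (Subtype.ext ?_)
      have e : rep q'.1 ∘ ((σ q') * τ * (σ q)⁻¹ : Equiv.Perm (Fin d)) = rep q.1 := by
        funext k
        have := congrFun hτ ((σ q)⁻¹ k)
        simpa using this
      exact Quotient.out_equiv_out.mp ⟨_, e⟩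
    · simp
  rw [← hyz, ← ha, Finset.sum_eq_zero fun q _ => by rw [ha0 q, zero_smul], add_zero]
  exact hy

end Lift


/-! ### Relations in the standard modules -/

section Standard

open scoped Classical

/-- The ideal `T^{>l}` as a subspace. -/
def HWData.idealSub {F T L : Type*} [Field F] [Ring T] [Algebra F T] (H : HWData F T L) (l : L) :
    Submodule F T where
  carrier := {x | x ∈ H.ideal l}
  add_mem' := (H.ideal l).add_mem
  zero_mem' := (H.ideal l).zero_mem
  smul_mem' := fun r _ hx => H.smul_mem_ideal r hx

variable {R F : Type*} [CommRing R] [IsDomain R] [CharZero R] [Field F] [Algebra R F]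
  {ℓ n d : ℕ} {i : Fin (ℓ + 1)} {hn : 0 < n} {hd : d ≤ n} {t : ℕ}

/-- The weight of the generating word. -/
noncomputable def genPart (i : Fin (ℓ + 1)) (hn : 0 < n) (hd : d ≤ n) (htd : t ≤ d)
    (ht : t = d ∨ (i : ℕ) ≠ 0) : MPart ℓ n d :=
  ⟨wt (crow ∘ (gen hn hd t : Fin d → CL ℓ n i)), isMComp_wt _, antitone_wt_gen htd ht⟩

variable (R F) in
-- The orbit sum is fixed by the idempotent of its row weight, which by `ha` is the weight of a
-- multipartition and so a generator of the ideal.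
theorem MY_mem_ideal {l : MPart ℓ n d} {r : Fin d → ML ℓ n} (ha : ∀ κ, Antitone (wt (mrow ∘ r) κ))
    (h : leI l.1 (wt (mrow ∘ r))) (h' : l.1 ≠ wt (mrow ∘ r)) :
    MY R F r ∈ (TZdata R F ℓ n d).idealSub l := by
  have h1 := eta_mul_MY (R := R) (F := F) (wt (mrow ∘ r)) r
  rw [if_pos rfl] at h1
  rw [← h1]
  exact TwoSidedIdeal.mul_mem_right _ _ _ ((TZdata R F ℓ n d).e_mem_ideal
    (m := ⟨wt (mrow ∘ r), isMComp_wt _, ha⟩) ⟨h, fun h'' => h' (congrArg Subtype.val h'')⟩)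

theorem mul_mem_idealSub {l : MPart ℓ n d} (x : TZ R F ℓ n d) {y : TZ R F ℓ n d}
    (hy : y ∈ (TZdata R F ℓ n d).idealSub l) : x * y ∈ (TZdata R F ℓ n d).idealSub l :=
  ((TZdata R F ℓ n d).ideal l).mul_mem_left x y hy

/-- The colour between the row and the column of a letter: it is higher than that of the column
unless the letter lowers the colour by its degree. -/
theorem exists_middle (b : ML ℓ n) : ∃ (κ : Fin (ℓ + 1)) (g h : ℕ), g + h = mdeg b ∧
    ZValid ℓ (mrow b).1 κ g ∧ ZValid ℓ κ (mcol b).1 h ∧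
    ((((mrow b).1 : ℕ) + mdeg b = (mcol b).1 ∧ κ = (mcol b).1 ∧ h = 0) ∨
      (((mrow b).1 : ℕ) + mdeg b ≠ (mcol b).1 ∧ (κ : ℕ) = (mcol b).1 + 1 ∧ h = 1)) := by
  have hv := b.valid
  have h1 := (mrow b).1.2
  have h2 := (mcol b).1.2
  by_cases hg : ((mrow b).1 : ℕ) + mdeg b = (mcol b).1
  · refine ⟨(mcol b).1, mdeg b, 0, add_zero _, hv, ?_, Or.inl ⟨hg, rfl, rfl⟩⟩
    unfold ZValid
    omega
  · unfold ZValid at hv ⊢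
    obtain ⟨κ, hκ⟩ : ∃ κ : Fin (ℓ + 1), (κ : ℕ) = (mcol b).1 + 1 := ⟨⟨_, by omega⟩, rfl⟩
    refine ⟨κ, mdeg b - 1, 1, ?_, ?_, ?_, Or.inr ⟨hg, hκ, rfl⟩⟩ <;> omega

variable (R F) in
-- Factor each letter as in `exists_middle`. The middle colours are at least the column colours, and
-- larger at `k₀`, so the right factor `r` has a row weight above `λ_t`. The rows of the middle word
-- are chosen such that the product of the orbit sums of `q` and `r` is a sign times that of `b`.
theorem MY_mem_ideal_of_bad (htd : t ≤ d) (ht : t = d ∨ (i : ℕ) ≠ 0) {b : Fin d → ML ℓ n}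
    (hb : (matCal ℓ n).Seq b)
    (hcol : ∀ k, mcol (b k) = crow (gen hn hd t k : CL ℓ n i)) {k₀ : Fin d}
    (hbad : ((mrow (b k₀)).1 : ℕ) + mdeg (b k₀) ≠ (mcol (b k₀)).1) :
    MY R F b ∈ (TZdata R F ℓ n d).idealSub (genPart i hn hd htd ht) := by
  choose γ g h hgh hv1 hv2 hγ using fun k => exists_middle (b k)
  -- Distinct rows leave only one way to multiply. The colour `i - 1` keeps row zero: it arises only
  -- from tail letters that are not raised, and there `q = b`, so repeated letters of `b` keep their
  -- multiplicities.
  obtain ⟨p, hp1, hp2, hp3, hp4⟩ := exists_pack hn hd γ fun κ => (κ : ℕ) + 1 = i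
  choose q hq1 hq2 hq3 using fun k => exists_ML (mrow (b k)) (p k) (g k) (by rw [hp1]; exact hv1 k)
  choose r hr1 hr2 hr3 using fun k => exists_ML (p k) (mcol (b k)) (h k) (by rw [hp1]; exact hv2 k)
  have hlow : ∀ k, (γ k : ℕ) + 1 = i → ¬ (k : ℕ) < t ∧ h k = 0 ∧ p k = mcol (b k) := fun k hk => by
    have hk1 := hcol k
    by_cases hkt : (k : ℕ) < t
    · rw [crow_gen_lt hkt] at hk1
      have : ((mcol (b k)).1 : ℕ) = i := by rw [hk1]
      rcases hγ k with ⟨-, h2, -⟩ | ⟨-, h2, -⟩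
      · rw [h2] at hk
        omega
      · omega
    · have h3 := crow_gen_colour (n := n) (hn := hn) (hd := hd) (i := i) (t := t) (k := k)
        (by omega) hkt
      rw [← hk1] at h3
      rcases hγ k with ⟨-, h2, h4⟩ | ⟨-, h2, -⟩
      · refine ⟨hkt, h4, Prod.ext ((hp1 k).trans h2) ?_⟩
        rw [hp2 k hk, hk1, crow_gen_row hkt]
      · omega
  have hlowq : ∀ k, (γ k : ℕ) + 1 = i → q k = b k := fun k hk => by
    obtain ⟨h1, h2, h3⟩ := hlow k hk
    have := hgh k
    exact ML.ext' (hq1 k) ((hq2 k).trans h3) (by rw [hq3]; omega)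
  have hlowr : ∀ k m, p k = p m → r k = r m := fun k m hkm => by
    rcases hp3 k m hkm with rfl | hk
    · rfl
    · have hm : (γ m : ℕ) + 1 = i := by rw [← hp1, ← hkm, hp1]; exact hk
      obtain ⟨-, h2, h3⟩ := hlow k hk
      obtain ⟨-, h2', h3'⟩ := hlow m hm
      exact ML.ext' ((hr1 k).trans (hkm.trans (hr1 m).symm))
        ((hr2 k).trans (h3.symm.trans (hkm.trans (h3'.trans (hr2 m).symm))))
        ((hr3 k).trans (h2.trans (h2'.symm.trans (hr3 m).symm)))
  have hpq : ∀ {k m}, k ≠ m → p k = p m → q k = b k ∧ q m = b m := fun {k m} hkm h => by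
    have h1 := (hp3 k m h).resolve_left hkm
    exact ⟨hlowq k h1, hlowq m (by rw [← hp1, ← h, hp1]; exact h1)⟩
  rw [mat_seq_iff] at hb
  have hmul : ∃ ε : F, IsSign ε ∧ MY R F q * MY R F r = ε • MY R F b := by
    refine MY_mul_MY_eq R F ?_ ?_ (mat_seq_iff.mpr hb)
      (fun k => ?_) (fun k m hkm => ?_) (fun k => ?_) (fun σ hσ => ?_)
    · rw [mat_seq_iff]
      intro k m hkm h1
      obtain ⟨e1, e2⟩ := hpq hkm (by rw [← hq2, ← hq2, h1])
      rw [e1, e2] at h1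
      rw [e1]
      exact hb k m hkm h1
    · rw [mat_seq_iff]
      intro k m hkm h1
      have h2 := (hp3 k m (by rw [← hr1, ← hr1, h1])).resolve_left hkm
      rw [hr3, (hlow k h2).2.1]
      exact zero_ne_one
    · rw [hr3]
      rcases hγ k with ⟨-, -, h2⟩ | ⟨-, -, h2⟩ <;> omega
    · constructor
      · rintro ⟨h1, h2⟩
        obtain ⟨e1, e2⟩ := hpq hkm (by rw [← hq2, ← hq2, h2])
        rw [← e1, ← e2]
        exact ⟨h1, h2⟩
      · rintro ⟨h1, h2⟩
        have h3 := congrArg mcol h2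
        rw [hcol, hcol] at h3
        obtain ⟨hk, hm⟩ := (gen_eq_of_crow_eq h3 ht).resolve_left hkm
        have key : ∀ a : Fin d, mdeg (b a) = 0 → ¬ (a : ℕ) < t → q a = b a := fun a ha hat => by
          refine hlowq a ?_
          have h4 := crow_gen_colour (n := n) (hn := hn) (hd := hd) (i := i) (t := t) (k := a)
            (by omega) hat
          rw [← hcol] at h4
          rcases hγ a with ⟨-, h2, -⟩ | ⟨-, h2, h5⟩
          · rw [h2, h4]
          · have := hgh a
            omega
        rw [key k h1 hk, key m (by rw [← h2, h1]) hm]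
        exact ⟨h1, h2⟩
    · exact ⟨(hq2 k).trans (hr1 k).symm, (hq1 k).symm, (hr2 k).symm, by rw [hq3, hr3, hgh]⟩
    · funext k
      refine (hlowr k (σ k) ?_).symm
      have := hσ k
      rwa [hq2, hr1] at this
  obtain ⟨ε, hε, hmul⟩ := hmul
  have h1 : MY R F r ∈ (TZdata R F ℓ n d).idealSub (genPart i hn hd htd ht) := by
    have e : mrow ∘ r = p := funext hr1
    have h2 := leI_of_colour (p := crow ∘ (gen hn hd t : Fin d → CL ℓ n i)) (p' := p) (m₀ := k₀)
      (fun m => ?_) ?_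
    · refine MY_mem_ideal R F ?_ ?_ ?_ <;> rw [e]
      · exact hp4
      · exact h2.1
      · exact h2.2
    · rw [Function.comp_apply, ← hcol, hp1, Fin.le_def]
      rcases hγ m with ⟨-, h2, -⟩ | ⟨-, h2, -⟩
      · rw [h2]
      · omega
    · rw [Function.comp_apply, ← hcol, hp1, Fin.lt_def]
      rcases hγ k₀ with ⟨h1, -⟩ | ⟨-, h2, -⟩
      · exact absurd h1 hbad
      · omega
  have h2 := Submodule.smul_mem _ ε (mul_mem_idealSub (MY R F q) h1)
  rwa [hmul, smul_smul, hε.mul_self, one_smul] at h2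

/-! #### Transpositions -/

variable (R F) in
-- Here `q` carries the degrees of `b` and has the merged columns, while `r` consists of degree-zero
-- letters leading from the merged rows to the original columns. The merged weight strictly
-- dominates, which puts `r` into the ideal.
theorem exists_merge_words (htd : t ≤ d) (ht : t = d ∨ (i : ℕ) ≠ 0) {b : Fin d → ML ℓ n}
    (hcol : ∀ k, mcol (b k) = crow (gen hn hd t k : CL ℓ n i)) {k l : Fin d} (hkl : k < l)
    (hl : (l : ℕ) < t) :
    ∃ q r : Fin d → ML ℓ n, MY R F r ∈ (TZdata R F ℓ n d).idealSub (genPart i hn hd htd ht) ∧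
      (∀ m, mrow (q m) = mrow (b m)) ∧ (∀ m, mdeg (q m) = mdeg (b m)) ∧
      (∀ m, mcol (q m) = mrow (r m)) ∧ (∀ m, mcol (r m) = mcol (b m)) ∧
      (∀ m, mdeg (r m) = 0) ∧ mcol (q k) = mcol (q l) ∧ (∀ m : Fin d, ¬ (m : ℕ) < t → q m = b m) ∧
      ∀ m m', mcol (q m) = mcol (q m') → m = m' ∨ (¬ (m : ℕ) < t ∧ ¬ (m' : ℕ) < t) ∨
        (m = k ∧ m' = l) ∨ (m = l ∧ m' = k) := by
  obtain ⟨p, hp1, hp2, hp3, hp4, hp5, hp6, hp7⟩ :=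
    exists_merge (i := i) (hn := hn) (hd := hd) htd ht hkl hl
  have hp1' : ∀ m, (p m).1 = (mcol (b m)).1 := fun m => by rw [hp1, hcol]
  choose q hq1 hq2 hq3 using fun m => exists_ML (mrow (b m)) (p m) (mdeg (b m)) (by
    rw [hp1']; exact (b m).valid)
  choose r hr1 hr2 hr3 using fun m => exists_ML (p m) (mcol (b m)) 0 (by
    rw [hp1']; unfold ZValid; omega)
  have e : mrow ∘ r = p := funext hr1
  refine ⟨q, r, ?_, hq1, hq3, fun m => (hq2 m).trans (hr1 m).symm, hr2, hr3, by rw [hq2, hq2, hp2],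
    fun m hm => ML.ext' (hq1 m) ((hq2 m).trans ((hp3 m hm).trans (hcol m).symm)) (hq3 m),
    fun m m' h => hp4 m m' (by rwa [hq2, hq2] at h)⟩
  refine MY_mem_ideal R F ?_ ?_ ?_ <;> rw [e]
  · exact hp5
  · exact hp6
  · exact hp7

/-- After merging, the columns of `q` agree only at `k` and `l` or within the tail. So, up to tail
places where `r` has equal letters, only the identity and the transposition of `k` and `l` can be
applied to `r`; they give `b` and `b'`. All letters of `r` have degree zero, so no Koszul signs
occur. -/
theorem smul_mY_mul_mY (ht : t = d ∨ (i : ℕ) ≠ 0) {b b' q r : Fin d → ML ℓ n} {k l : Fin d}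
    (hkl : k < l) (hl : (l : ℕ) < t)
    (hcol : ∀ k, mcol (b k) = crow (gen hn hd t k : CL ℓ n i))
    (hq1 : ∀ m, mrow (q m) = mrow (b m)) (hq3 : ∀ m, mdeg (q m) = mdeg (b m))
    (hqr : ∀ m, mcol (q m) = mrow (r m)) (hr2 : ∀ m, mcol (r m) = mcol (b m))
    (hr3 : ∀ m, mdeg (r m) = 0) (hqkl : mcol (q k) = mcol (q l))
    (hinj : ∀ m m', mcol (q m) = mcol (q m') → m = m' ∨ (¬ (m : ℕ) < t ∧ ¬ (m' : ℕ) < t) ∨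
        (m = k ∧ m' = l) ∨ (m = l ∧ m' = k))
    (hb1 : ∀ m, mrow (b' m) = mrow (b m)) (hb2 : ∀ m, mcol (b' m) = mcol (b (Equiv.swap k l m)))
    (hb3 : ∀ m, mdeg (b' m) = mdeg (b m))
    (hq : (matCal ℓ n).Seq q) (hb : (matCal ℓ n).Seq b) (hb' : (matCal ℓ n).Seq b') :
    ((matCal ℓ n).swap.cFact q : R) • (mY R q * mY R r) =
      ((matCal ℓ n).swap.cFact b : R) • mY R b + ((matCal ℓ n).swap.cFact b' : R) • mY R b' := by
  have hkt : (k : ℕ) < t := lt_trans hkl hl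
  have hpar : (matCal ℓ n).par ∘ r = 0 := funext fun m => (mpar_zero_iff _).mpr (by
    rw [hr3]; exact zero_ne_one)
  have hr : (matCal ℓ n).Seq r := fun m m' _ _ => congrFun hpar m
  have hQ : ∀ m, MQ (q m) (r m) (b m) := fun m =>
    ⟨hqr m, (hq1 m).symm, (hr2 m).symm, by rw [hq3, hr3, add_zero]⟩
  have hqσ : ∀ m, mcol (q (Equiv.swap k l m)) = mcol (q m) := fun m => by
    rw [Equiv.swap_apply_def]
    split_ifs with h1 h2
    · rw [h1, hqkl]
    · rw [h2, hqkl]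
    · rfl
  have hQ' : ∀ m, MQ (q m) (r (Equiv.swap k l m)) (b' m) := fun m =>
    ⟨by rw [← hqr, hqσ], (hb1 m).trans (hq1 m).symm, by rw [hr2, hb2], by
      rw [hq3, hr3, add_zero, hb3]⟩
  have hrkl : r ∘ Equiv.swap k l ≠ r := fun h => by
    have h1 := congrArg mcol (congrFun h k)
    rw [Function.comp_apply, Equiv.swap_apply_left, hr2, hr2, hcol, hcol] at h1
    rcases gen_eq_of_crow_eq h1 ht with h2 | h2
    · exact hkl.ne h2.symm
    · exact h2.1 hl
  have hlow : ∀ m m' : Fin d, ¬ (m : ℕ) < t → ¬ (m' : ℕ) < t → mcol (q m) = mcol (q m') →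
      r m = r m' := fun m m' h1 h2 h3 => ML.ext' (by rw [← hqr, ← hqr, h3])
    (by rw [hr2, hr2, hcol, hcol, gen_low_eq h1 h2]) (by rw [hr3, hr3])
  have h := smul_tAct_y_y (R := R) (cA := matCal ℓ n) (cV := matCal ℓ n) (Q := MQ) (q := q) (r := r)
    (b := b) (b' := b') (σ := Equiv.swap k l) (fun a c b h => h.par) hq hr hb hb'
    ((matCal ℓ n).cFact_eq_one fun m hm => by rw [mat_isC, hr3] at hm; omega)
    (fun m hm => absurd ((congrFun hpar m).symm.trans hm) zero_ne_one) hrkl hQ hQ'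
    (fun ρ u hu => ?_)
  · rw [← Function.comp_assoc, hpar, show (0 : Fin d → ZMod 2) ∘ Equiv.swap k l = 0 from rfl,
      koszul_zero_right, pow_zero, one_smul, one_smul] at h
    have h1 : (mY R q * mY R r).1 = _ := mY_mul_mY_val hq hr
    refine Subtype.ext ?_
    change ((matCal ℓ n).swap.cFact q : R) • (mY R q * mY R r).1 =
      ((matCal ℓ n).swap.cFact b : R) • (mY R b).1 + ((matCal ℓ n).swap.cFact b' : R) • (mY R b').1
    rw [h1]
    refine h.trans ?_
    exact (congrArg₂ (fun x y => ((matCal ℓ n).swap.cFact b : R) • x +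
      ((matCal ℓ n).swap.cFact b' : R) • y) (mY_val hb) (mY_val hb')).symm
  · have hρ : ∀ m, mcol (q m) = mcol (q (ρ m)) := fun m => (hu m).1.trans (hqr _).symm
    have hother : ∀ m, m ≠ k → m ≠ l → r (ρ m) = r m := fun m h1 h2 => by
      rcases hinj m (ρ m) (hρ m) with h3 | ⟨h3, h4⟩ | ⟨h3, -⟩ | ⟨h3, -⟩
      · rw [← h3]
      · exact hlow _ _ h4 h3 (hρ m).symm
      · exact absurd h3 h1
      · exact absurd h3 h2
    have hk : ρ k = k ∨ ρ k = l := by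
      rcases hinj k (ρ k) (hρ k) with h3 | ⟨h3, h4⟩ | ⟨-, h3⟩ | ⟨h3, -⟩
      · exact Or.inl h3.symm
      · exact absurd hkt h3
      · exact Or.inr h3
      · exact absurd h3 hkl.ne
    have hl' : ρ l = k ∨ ρ l = l := by
      rcases hinj l (ρ l) (hρ l) with h3 | ⟨h3, h4⟩ | ⟨h3, -⟩ | ⟨-, h3⟩
      · exact Or.inr h3.symm
      · exact absurd hl h3
      · exact absurd h3 hkl.ne'
      · exact Or.inl h3
    rcases hk with hk | hk
    · have hl'' : ρ l = l := hl'.resolve_left fun h' => hkl.ne (ρ.injective (hk.trans h'.symm))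
      have e : r ∘ ρ = r := funext fun m => by
        by_cases h1 : m = k
        · rw [h1, Function.comp_apply, hk]
        by_cases h2 : m = l
        · rw [h2, Function.comp_apply, hl'']
        exact hother m h1 h2
      refine Or.inl ⟨e, funext fun m => ?_⟩
      have h1 := hu m
      rw [show r (ρ m) = r m from congrFun e m] at h1
      exact h1.unique (hQ m)
    · have hl'' : ρ l = k := hl'.resolve_right fun h' => hkl.ne (ρ.injective (hk.trans h'.symm))
      have e : r ∘ ρ = r ∘ Equiv.swap k l := funext fun m => by
        by_cases h1 : m = k
        · rw [h1, Function.comp_apply, hk, Function.comp_apply, Equiv.swap_apply_left]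
        by_cases h2 : m = l
        · rw [h2, Function.comp_apply, hl'', Function.comp_apply, Equiv.swap_apply_right]
        rw [Function.comp_apply, Function.comp_apply, Equiv.swap_apply_of_ne_of_ne h1 h2]
        exact hother m h1 h2
      refine Or.inr ⟨e, funext fun m => ?_⟩
      have h1 := hu m
      rw [show r (ρ m) = r (Equiv.swap k l m) from congrFun e m] at h1
      exact h1.unique (hQ' m)

end Standard


/-! ### Permuting and repeating letters modulo the ideal -/

section Standard

open scoped Classical

variable {R F : Type*} [CommRing R] [IsDomain R] [CharZero R] [Field F] [Algebra R F]
  {ℓ n d : ℕ} {i : Fin (ℓ + 1)} {hn : 0 < n} {hd : d ≤ n} {t : ℕ}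

theorem TZR_smul_cancel {r : R} (hr : r ≠ 0) {x y : TZR R ℓ n d} (h : r • x = r • y) : x = y := by
  have h1 : r • x.1 = r • y.1 := congrArg Subtype.val h
  exact Subtype.ext (smul_right_injective ((Fin d → ML ℓ n) → R) hr h1)

/-- If the letters of `c` at `k` and `l` agree, both lifts coincide. Otherwise merging creates no
new repetition, so the three multiplicity factors are equal and cancel over `R`. The sum of the two
products of `smul_mY_mul_mY` is then in the ideal, one being the vector of `b` and the other that of
`b'` up to sign. -/
theorem IsLift.swap_mem (htd : t ≤ d) (ht : t = d ∨ (i : ℕ) ≠ 0) {b b' : Fin d → ML ℓ n}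
    {c : Fin d → CL ℓ n i} {k l : Fin d} (hkl : k < l) (hl : (l : ℕ) < t)
    (hc : (colCal ℓ n i).Seq c) (h : IsLift hn hd t b c)
    (h' : IsLift hn hd t b' (c ∘ Equiv.swap k l)) :
    ∃ ε : F, MY R F b' - ε • MY R F b ∈
      (TZdata R F ℓ n d).idealSub (genPart i hn hd htd ht) := by
  have hkt : (k : ℕ) < t := lt_trans hkl hl
  by_cases hckl : c k = c l
  · have e : b' = b := funext fun m => h'.unique h (m := m) (k := m) rfl (by
      rw [Function.comp_apply, Equiv.swap_apply_def]
      split_ifs with h1 h2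
      · rw [h1, hckl]
      · rw [h2, hckl]
      · rfl)
    refine ⟨1, ?_⟩
    rw [e, one_smul, sub_self]
    exact Submodule.zero_mem _
  obtain ⟨q, r, hJ, hq1, hq3, hqr, hr2, hr3, hqkl, hqlow, hinj⟩ :=
    exists_merge_words R F htd ht h.col hkl hl
  have hcol := h.col
  have hcdeg : ∀ m, cdeg (gen hn hd t (Equiv.swap k l m) : CL ℓ n i) =
      cdeg (gen hn hd t m : CL ℓ n i) := fun m => by
    rw [Equiv.swap_apply_def]
    split_ifs with h1 h2
    · rw [h1, cdeg_gen_lt hl, cdeg_gen_lt hkt]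
    · rw [h2, cdeg_gen_lt hl, cdeg_gen_lt hkt]
    · rfl
  -- Rearranged in this way, `b'` has the rows and degrees of `b`, and just the columns at `k` and
  -- `l` are exchanged.
  set b'' := b' ∘ Equiv.swap k l with hb''
  have h'' : ∀ m, CQ (b'' m) (gen hn hd t (Equiv.swap k l m)) (c m) := fun m => by
    have := h' (Equiv.swap k l m)
    rwa [Function.comp_apply, Equiv.swap_apply_self] at this
  have hb1 : ∀ m, mrow (b'' m) = mrow (b m) := fun m => by rw [← (h'' m).2.1, ← (h m).2.1]
  have hb2 : ∀ m, mcol (b'' m) = mcol (b (Equiv.swap k l m)) := fun m => by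
    rw [(h'' m).1, hcol]
  have hb3 : ∀ m, mdeg (b'' m) = mdeg (b m) := fun m => by
    have h1 := (h m).2.2
    have h2 := (h'' m).2.2
    rw [hcdeg] at h2
    omega
  have hswap : ∀ m : Fin d, ¬ (m : ℕ) < t → Equiv.swap k l m = m := fun m hm =>
    Equiv.swap_apply_of_ne_of_ne (fun h => hm (h ▸ hkt)) (fun h => hm (h ▸ hl))
  have hblow : ∀ m : Fin d, ¬ (m : ℕ) < t → b'' m = b m := fun m hm =>
    ML.ext' (hb1 m) (by rw [hb2, hswap m hm]) (hb3 m)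
  have hbseq := h.seq ht hc
  have hlowb : ∀ {m m' : Fin d}, m ≠ m' → b m = b m' → ¬ (m : ℕ) < t ∧ ¬ (m' : ℕ) < t :=
    fun {m m'} hmm hb => by
      have h3 := congrArg mcol hb
      rw [hcol, hcol] at h3
      exact (gen_eq_of_crow_eq h3 ht).resolve_left hmm
  have hlowb'' : ∀ {m m' : Fin d}, m ≠ m' → b'' m = b'' m' → ¬ (m : ℕ) < t ∧ ¬ (m' : ℕ) < t :=
    fun {m m'} hmm hb => by
      have h3 := congrArg mcol hb
      rw [hb2, hb2, hcol, hcol] at h3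
      obtain ⟨h4, h5⟩ := (gen_eq_of_crow_eq h3 ht).resolve_left
        fun h => hmm ((Equiv.swap k l).injective h)
      have key : ∀ a : Fin d, ¬ ((Equiv.swap k l a : Fin d) : ℕ) < t → ¬ (a : ℕ) < t := fun a ha => by
        have := hswap _ ha
        rw [Equiv.swap_apply_self] at this
        rwa [← this] at ha
      exact ⟨key _ h4, key _ h5⟩
  have hlowq : ∀ {m m' : Fin d}, m ≠ m' → q m = q m' → ¬ (m : ℕ) < t ∧ ¬ (m' : ℕ) < t :=
    fun {m m'} hmm hq => by
      have hne : ¬ q k = q l := fun h1 => hckl (CL.ext'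
        (by rw [(h k).2.1, (h l).2.1, ← hq1, ← hq1, h1])
        (by rw [(h k).2.2, (h l).2.2, ← hq3, ← hq3, h1, cdeg_gen_lt hl, cdeg_gen_lt hkt]))
      rcases (hinj m m' (congrArg mcol hq)).resolve_left hmm with h3 | ⟨rfl, rfl⟩ | ⟨rfl, rfl⟩
      · exact h3
      · exact absurd hq hne
      · exact absurd hq.symm hne
  have hb''seq : (matCal ℓ n).Seq b'' := fun m m' hmm hb => by
    obtain ⟨h1, h2⟩ := hlowb'' hmm hb
    rw [hblow m h1, hblow m' h2] at hb
    rw [hblow m h1]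
    exact hbseq m m' hmm hb
  have hqseq : (matCal ℓ n).Seq q := fun m m' hmm hb => by
    obtain ⟨h1, h2⟩ := hlowq hmm hb
    rw [hqlow m h1, hqlow m' h2] at hb
    rw [hqlow m h1]
    exact hbseq m m' hmm hb
  have hA : (matCal ℓ n).swap.cFact q = (matCal ℓ n).swap.cFact b :=
    Calib.cFact_congr _ _ _ _ fun m m' hmm => by
      constructor
      · rintro ⟨h1, h2⟩
        obtain ⟨h3, h4⟩ := hlowq hmm h2
        rw [← hqlow m h3, ← hqlow m' h4]
        exact ⟨h1, h2⟩
      · rintro ⟨h1, h2⟩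
        obtain ⟨h3, h4⟩ := hlowb hmm h2
        rw [hqlow m h3, hqlow m' h4]
        exact ⟨h1, h2⟩
  have hA' : (matCal ℓ n).swap.cFact b'' = (matCal ℓ n).swap.cFact b :=
    Calib.cFact_congr _ _ _ _ fun m m' hmm => by
      constructor
      · rintro ⟨h1, h2⟩
        obtain ⟨h3, h4⟩ := hlowb'' hmm h2
        rw [← hblow m h3, ← hblow m' h4]
        exact ⟨h1, h2⟩
      · rintro ⟨h1, h2⟩
        obtain ⟨h3, h4⟩ := hlowb hmm h2
        rw [hblow m h3, hblow m' h4]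
        exact ⟨h1, h2⟩
  have hmul := smul_mY_mul_mY (R := R) ht hkl hl hcol hq1 hq3 hqr hr2 hr3 hqkl hinj hb1 hb2 hb3
    hqseq hbseq hb''seq
  rw [hA, hA', ← smul_add] at hmul
  have hmul' := TZR_smul_cancel ((matCal ℓ n).swap.cFact_ne_zero (R := R) b) hmul
  have h1 : MY R F q * MY R F r = MY R F b + MY R F b'' := by
    rw [MY_mul_MY, hmul', TensorProduct.tmul_add]
    rfl
  have h2 := mul_mem_idealSub (MY R F q) hJ
  obtain ⟨ε, hε, h3⟩ := MY_comp (R := R) (F := F) b' (Equiv.swap k l)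
  rw [h1, hb'', h3] at h2
  refine ⟨-ε, ?_⟩
  have h4 := Submodule.smul_mem _ ε h2
  rw [smul_add, smul_smul, hε.mul_self, one_smul] at h4
  have h5 : MY R F b' - -ε • MY R F b = ε • MY R F b + MY R F b' := by module
  rwa [h5]

/-- Merging creates one new repetition, the degree-zero letter `q k = q l` with multiplicity two;
all other degree-zero multiplicities are those of `b`. -/
theorem cFact_eq_two_mul (ht : t = d ∨ (i : ℕ) ≠ 0) {b q : Fin d → ML ℓ n} {k l : Fin d}
    (hkl : k < l) (hl : (l : ℕ) < t) (hcol : ∀ k, mcol (b k) = crow (gen hn hd t k : CL ℓ n i))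
    (hqk : mdeg (q k) = 0) (hqkl : q k = q l) (hqlow : ∀ m : Fin d, ¬ (m : ℕ) < t → q m = b m)
    (hinj : ∀ m m', mcol (q m) = mcol (q m') → m = m' ∨ (¬ (m : ℕ) < t ∧ ¬ (m' : ℕ) < t) ∨
        (m = k ∧ m' = l) ∨ (m = l ∧ m' = k)) :
    (matCal ℓ n).swap.cFact q = 2 * (matCal ℓ n).swap.cFact b := by
  have hkt : (k : ℕ) < t := lt_trans hkl hl
  have hlowb : ∀ {m m' : Fin d}, m ≠ m' → b m = b m' → ¬ (m : ℕ) < t ∧ ¬ (m' : ℕ) < t :=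
    fun {m m'} hmm hb => by
      have h3 := congrArg mcol hb
      rw [hcol, hcol] at h3
      exact (gen_eq_of_crow_eq h3 ht).resolve_left hmm
  have hone : ∀ {β : ML ℓ n} {u : Fin d → ML ℓ n}, (∀ m m', u m = β → u m' = β → m = m') →
      (Fintype.card {m // u m = β}).factorial = 1 := fun {β u} h => by
    have : Fintype.card {m // u m = β} ≤ 1 := Fintype.card_le_one_iff.mpr
      fun x y => Subtype.ext (h x y x.2 y.2)
    rw [Nat.factorial_eq_one]
    omega
  have key : ∀ β, (if (matCal ℓ n).swap.isC β then (Fintype.card {m // q m = β}).factorial else 1) =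
      (if β = q k then 2 else 1) *
        if (matCal ℓ n).swap.isC β then (Fintype.card {m // b m = β}).factorial else 1 := by
    intro β
    by_cases hβ : β = q k
    · subst hβ
      have h1 : (matCal ℓ n).swap.isC (q k) := mat_swap_isC.mpr hqk
      have h2 : Fintype.card {m // q m = q k} = 2 := by
        rw [Fintype.card_subtype, Finset.card_eq_two]
        refine ⟨k, l, hkl.ne, Finset.ext fun m => ?_⟩
        rw [Finset.mem_filter, Finset.mem_insert, Finset.mem_singleton]
        constructor
        · rintro ⟨-, h3⟩
          rcases hinj m k (congrArg mcol h3) with h4 | h4 | h4 | h4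
          · exact Or.inl h4
          · exact absurd hkt h4.2
          · exact Or.inl h4.1
          · exact Or.inr h4.1
        · rintro (rfl | rfl)
          · exact ⟨Finset.mem_univ _, rfl⟩
          · exact ⟨Finset.mem_univ _, hqkl.symm⟩
      rw [if_pos h1, if_pos rfl, if_pos h1, h2, hone, mul_one, Nat.factorial_two]
      intro m m' hm hm'
      by_contra hmm
      obtain ⟨h3, -⟩ := hlowb hmm (hm.trans hm'.symm)
      rw [← hqlow m h3] at hm
      rcases hinj m k (congrArg mcol hm) with rfl | h4 | ⟨rfl, -⟩ | ⟨rfl, -⟩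
      · exact h3 hkt
      · exact h4.2 hkt
      · exact h3 hkt
      · exact h3 hl
    · rw [if_neg hβ, one_mul]
      refine ite_congr rfl (fun _ => ?_) fun _ => rfl
      by_cases h0 : ∃ m : Fin d, ¬ (m : ℕ) < t ∧ b m = β
      · obtain ⟨m, hm, rfl⟩ := h0
        refine congrArg Nat.factorial (Fintype.card_congr (Equiv.subtypeEquivRight fun m' => ?_))
        by_cases hmm : m' = m
        · rw [hmm, hqlow m hm]
        constructor
        · intro h1
          rw [← hqlow m hm] at h1
          rcases hinj m' m (congrArg mcol h1) with h4 | h4 | ⟨-, rfl⟩ | ⟨-, rfl⟩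
          · exact absurd h4 hmm
          · rw [← hqlow m' h4.1, h1, hqlow m hm]
          · exact absurd hl hm
          · exact absurd hkt hm
        · intro h1
          rw [hqlow m' (hlowb hmm h1).1, h1]
      · rw [hone, hone]
        · intro m m' hm hm'
          by_contra hmm
          exact h0 ⟨m, (hlowb hmm (hm.trans hm'.symm)).1, hm⟩
        · intro m m' hm hm'
          rcases hinj m m' (congrArg mcol (hm.trans hm'.symm)) with h4 | h4 | ⟨rfl, -⟩ | ⟨-, rfl⟩
          · exact h4
          · exact absurd ⟨m, h4.1, (hqlow m h4.1).symm.trans hm⟩ h0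
          · exact absurd hm.symm hβ
          · exact absurd hm'.symm hβ
  have hcF : ∀ u : Fin d → ML ℓ n, (matCal ℓ n).swap.cFact u = ∏ β : ML ℓ n,
      if (matCal ℓ n).swap.isC β then (Fintype.card {m // u m = β}).factorial else 1 := fun u => by
    unfold Calib.cFact
    congr!
  rw [hcF, hcF, Finset.prod_congr rfl fun β _ => key β, Finset.prod_mul_distrib, Finset.prod_ite_eq',
    if_pos (Finset.mem_univ _)]

theorem mY_comp_of_fix {b : Fin d → ML ℓ n} (hb : (matCal ℓ n).Seq b) {σ : Equiv.Perm (Fin d)}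
    (h : ∀ m, (matCal ℓ n).par (b m) = 1 → σ m = m) : mY R (b ∘ σ) = mY R b := by
  have h1 : (matCal ℓ n).y R (b ∘ σ) = (matCal ℓ n).y R b := by
    rw [(matCal ℓ n).y_comp hb, permKoszul_eq_zero (p := (matCal ℓ n).par ∘ b) h, pow_zero, one_smul]
  exact Subtype.ext ((mY_val (hb.comp σ)).trans (h1.trans (mY_val hb).symm))

/-- Exchanging `k` and `l` in `b` amounts to permuting even letters, so the two terms of
`smul_mY_mul_mY` coincide. The resulting factor two also appears on the left by `cFact_eq_two_mul`.
It is cancelled over `R`, so the relation holds even where `2 = 0` in `F`. -/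
theorem IsLift.mem_of_eq (htd : t ≤ d) (ht : t = d ∨ (i : ℕ) ≠ 0) {b : Fin d → ML ℓ n}
    {c : Fin d → CL ℓ n i} {k l : Fin d} (hkl : k < l) (hl : (l : ℕ) < t)
    (hbseq : (matCal ℓ n).Seq b) (h : IsLift hn hd t b c) (hckl : c k = c l)
    (hbk : mdeg (b k) = 0) :
    MY R F b ∈ (TZdata R F ℓ n d).idealSub (genPart i hn hd htd ht) := by
  have hkt : (k : ℕ) < t := lt_trans hkl hl
  obtain ⟨q, r, hJ, hq1, hq3, hqr, hr2, hr3, hqkl, hqlow, hinj⟩ :=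
    exists_merge_words R F htd ht h.col hkl hl
  have hrow : mrow (b k) = mrow (b l) := by rw [← (h k).2.1, ← (h l).2.1, hckl]
  have hdeg : mdeg (b l) = mdeg (b k) := by
    have h1 := (h k).2.2
    have h2 := (h l).2.2
    rw [cdeg_gen_lt hkt, hckl] at h1
    rw [cdeg_gen_lt hl] at h2
    omega
  have hqq : q k = q l := ML.ext' (by rw [hq1, hq1, hrow]) hqkl (by rw [hq3, hq3, hdeg])
  have hqk : mdeg (q k) = 0 := (hq3 k).trans hbk
  have hqseq : (matCal ℓ n).Seq q := by
    rw [mat_seq_iff] at hbseq ⊢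
    intro m m' hmm hq
    rcases (hinj m m' (congrArg mcol hq)).resolve_left hmm with h3 | ⟨rfl, rfl⟩ | ⟨rfl, rfl⟩
    · rw [hqlow m h3.1, hqlow m' h3.2] at hq
      rw [hqlow m h3.1]
      exact hbseq m m' hmm hq
    · rw [hqk]
      exact zero_ne_one
    · rw [← hqq, hqk]
      exact zero_ne_one
  have hmul := smul_mY_mul_mY (R := R) (b' := b ∘ Equiv.swap k l) ht hkl hl h.col hq1 hq3 hqr hr2 hr3
    hqkl hinj
    (fun m => by
      rw [Function.comp_apply, Equiv.swap_apply_def]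
      split_ifs with h1 h2
      · rw [h1, hrow]
      · rw [h2, hrow]
      · rfl) (fun m => rfl) (fun m => by
      rw [Function.comp_apply, Equiv.swap_apply_def]
      split_ifs with h1 h2
      · rw [h1, hdeg]
      · rw [h2, hdeg]
      · rfl) hqseq hbseq (hbseq.comp _)
  rw [(matCal ℓ n).swap.cFact_comp, mY_comp_of_fix hbseq, ← two_smul R, smul_smul,
    cFact_eq_two_mul ht hkl hl h.col hqk hqq hqlow hinj, Nat.cast_mul, Nat.cast_two] at hmul
  · have hmul' := TZR_smul_cancel (mul_ne_zero two_ne_zero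
      ((matCal ℓ n).swap.cFact_ne_zero (R := R) b)) hmul
    have h1 : MY R F q * MY R F r = MY R F b := by
      rw [MY_mul_MY, hmul']
      rfl
    rw [← h1]
    exact mul_mem_idealSub _ hJ
  · intro m hm
    have h1 : ∀ a, mdeg (b a) = 0 → m ≠ a := fun a ha hma => by
      rw [hma] at hm
      exact absurd (((mpar_zero_iff _).mpr (by rw [ha]; exact zero_ne_one)).symm.trans hm) zero_ne_one
    exact Equiv.swap_apply_of_ne_of_ne (h1 k hbk) (h1 l (hdeg.trans hbk))

/-! #### Permutations -/

theorem exists_smul_trans {J : Submodule F (TZ R F ℓ n d)} {x y z : TZ R F ℓ n d}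
    (h : ∃ ε : F, y - ε • x ∈ J) (h' : ∃ ε : F, z - ε • y ∈ J) : ∃ ε : F, z - ε • x ∈ J := by
  obtain ⟨ε, h⟩ := h
  obtain ⟨ε', h'⟩ := h'
  refine ⟨ε' * ε, ?_⟩
  have := J.add_mem h' (J.smul_mem ε' h)
  rwa [smul_sub, smul_smul, sub_add_sub_cancel] at this

theorem IsLift.comp {b b' : Fin d → ML ℓ n} {c : Fin d → CL ℓ n i} {σ : Equiv.Perm (Fin d)}
    (h : IsLift hn hd t b c) (h' : IsLift hn hd t b' (c ∘ σ))
    (hσ : ∀ k, (gen hn hd t k : CL ℓ n i) = gen hn hd t (σ k)) : b' = b ∘ σ :=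
  funext fun k => (h'.unique h (m := σ k) (hσ k) rfl : b' k = b (σ k))

/-- Induction on transpositions: the intermediate words still have up letters in the first `t`
places and hence lift. -/
theorem IsLift.upPerm_mem (htd : t ≤ d) (ht : t = d ∨ (i : ℕ) ≠ 0)
    (τ : Equiv.Perm {k : Fin d // (k : ℕ) < t}) :
    ∀ (b b' : Fin d → ML ℓ n) (c : Fin d → CL ℓ n i), (colCal ℓ n i).Seq c →
      (∀ k : Fin d, (k : ℕ) < t → isUp (c k)) → IsLift hn hd t b c →
      IsLift hn hd t b' (c ∘ Equiv.Perm.ofSubtype τ) →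
      ∃ ε : F, MY R F b' - ε • MY R F b ∈
        (TZdata R F ℓ n d).idealSub (genPart i hn hd htd ht) := by
  induction τ using Equiv.Perm.swap_induction_on with
  | one =>
    intro b b' c hc _ h h'
    have e : b' = b := h.comp (σ := 1) (by simpa using h') fun k => rfl
    refine ⟨1, ?_⟩
    rw [e, one_smul, sub_self]
    exact Submodule.zero_mem _
  | swap_mul f x y hxy ih =>
    intro b b' c hc hup h h'
    have e : (Equiv.Perm.ofSubtype (Equiv.swap x y * f) : Fin d → Fin d) =
        Equiv.swap (x : Fin d) y ∘ Equiv.Perm.ofSubtype f := by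
      rw [map_mul, Equiv.Perm.ofSubtype_swap_eq, Equiv.Perm.coe_mul]
    rw [e, ← Function.comp_assoc] at h'
    have hup' : ∀ k : Fin d, (k : ℕ) < t → isUp ((c ∘ Equiv.swap (x : Fin d) y) k) := fun k hk => by
      refine hup _ ?_
      rw [Equiv.swap_apply_def]
      split_ifs
      · exact y.2
      · exact x.2
      · exact hk
    obtain ⟨b₁, hb₁⟩ := exists_lift (hn := hn) (hd := hd) ht hup'
    refine exists_smul_trans ?_ (ih b₁ b' _ (hc.comp _) hup' hb₁ h')
    rcases lt_or_gt_of_ne (fun h => hxy (Subtype.ext h) : (x : Fin d) ≠ y) with hlt | hlt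
    · exact h.swap_mem htd ht hlt y.2 hc hb₁
    · rw [Equiv.swap_comm] at hb₁
      exact h.swap_mem htd ht hlt x.2 hc hb₁

/-- The permutation preserves the first `t` places, so it is the product of a permutation of these
and one of the tail. The latter only rearranges the lift, since the generating letters in the tail
are equal. -/
theorem IsLift.perm_mem (htd : t ≤ d) (ht : t = d ∨ (i : ℕ) ≠ 0) {b b' : Fin d → ML ℓ n}
    {c : Fin d → CL ℓ n i} {σ : Equiv.Perm (Fin d)} (hc : (colCal ℓ n i).Seq c)
    (hup : ∀ k : Fin d, isUp (c k) ↔ (k : ℕ) < t)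
    (hup' : ∀ k : Fin d, isUp ((c ∘ σ) k) ↔ (k : ℕ) < t) (h : IsLift hn hd t b c)
    (h' : IsLift hn hd t b' (c ∘ σ)) :
    ∃ ε : F, MY R F b' - ε • MY R F b ∈
      (TZdata R F ℓ n d).idealSub (genPart i hn hd htd ht) := by
  have hσ : ∀ k : Fin d, ((σ k : Fin d) : ℕ) < t ↔ (k : ℕ) < t := fun k =>
    (hup (σ k)).symm.trans (hup' k)
  let τ : Equiv.Perm {k : Fin d // (k : ℕ) < t} := σ.subtypePerm hσ
  have hτ : ∀ k : Fin d, (k : ℕ) < t → Equiv.Perm.ofSubtype τ k = σ k := fun k hk =>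
    Equiv.Perm.ofSubtype_apply_of_mem τ hk
  have hτ' : ∀ k : Fin d, ¬ (k : ℕ) < t → Equiv.Perm.ofSubtype τ k = k := fun k hk =>
    Equiv.Perm.ofSubtype_apply_of_not_mem τ hk
  have hτlt : ∀ k : Fin d, ((Equiv.Perm.ofSubtype τ k : Fin d) : ℕ) < t ↔ (k : ℕ) < t := fun k => by
    by_cases hk : (k : ℕ) < t
    · rw [hτ k hk, hσ]
    · rw [hτ' k hk]
  have hup₁ : ∀ k : Fin d, (k : ℕ) < t → isUp ((c ∘ Equiv.Perm.ofSubtype τ) k) := fun k hk =>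
    (hup _).mpr ((hτlt k).mpr hk)
  obtain ⟨b₁, hb₁⟩ := exists_lift (hn := hn) (hd := hd) ht hup₁
  refine exists_smul_trans (h.upPerm_mem htd ht τ b b₁ c hc (fun k hk => (hup k).mpr hk) hb₁) ?_
  let ρ : Equiv.Perm (Fin d) := (Equiv.Perm.ofSubtype τ)⁻¹ * σ
  have hρ : ∀ k : Fin d, Equiv.Perm.ofSubtype τ (ρ k) = σ k := fun k => by simp [ρ]
  have e : c ∘ σ = (c ∘ Equiv.Perm.ofSubtype τ) ∘ ρ := funext fun k => by
    rw [Function.comp_apply, Function.comp_apply, Function.comp_apply, hρ]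
  rw [e] at h'
  have e' : b' = b₁ ∘ ρ := hb₁.comp h' fun k => by
    have h1 := hρ k
    by_cases hk : (k : ℕ) < t
    · rw [← hτ k hk] at h1
      rw [(Equiv.Perm.ofSubtype τ).injective h1]
    · refine gen_low_eq hk fun h2 => hk ?_
      rwa [← hτlt, h1, hσ] at h2
  obtain ⟨ε, -, h2⟩ := MY_comp (R := R) (F := F) b₁ ρ
  refine ⟨ε, ?_⟩
  rw [e', h2, sub_self]
  exact Submodule.zero_mem _

/-- A letter that fails to lower its colour by its degree puts the orbit sum into the ideal. If
there is none, `b` lifts a word `c`, and the remaining obstruction is an odd letter repeated in `c`.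
-/
theorem MY_mem_ideal_or_exists_lift (htd : t ≤ d) (ht : t = d ∨ (i : ℕ) ≠ 0) (b : Fin d → ML ℓ n)
    (hcol : ∀ k, mcol (b k) = crow (gen hn hd t k : CL ℓ n i)) :
    MY R F b ∈ (TZdata R F ℓ n d).idealSub (genPart i hn hd htd ht) ∨
      ∃ c, (colCal ℓ n i).Seq c ∧ (∀ k : Fin d, isUp (c k) ↔ (k : ℕ) < t) ∧
        IsLift hn hd t b c := by
  by_cases hb : (matCal ℓ n).Seq b
  swap
  · rw [MY_of_not hb]
    exact Or.inl (Submodule.zero_mem _)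
  by_cases hgood : ∀ k, ((mrow (b k)).1 : ℕ) + mdeg (b k) = (mcol (b k)).1
  swap
  · obtain ⟨k, hk⟩ := not_forall.mp hgood
    exact Or.inl (MY_mem_ideal_of_bad R F htd ht hb hcol hk)
  obtain ⟨c, hc⟩ := exists_isLift ht hcol fun k _ => hgood k
  have hup := hc.isUp_iff ht hgood
  by_cases hs : (colCal ℓ n i).Seq c
  · exact Or.inr ⟨c, hs, hup, hc⟩
  rw [col_seq_iff] at hs
  push Not at hs
  obtain ⟨k, l, hkl, hckl, hdeg⟩ := hs
  have hiff : (k : ℕ) < t ↔ (l : ℕ) < t := by rw [← hup, ← hup, hckl]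
  -- In the tail a repeated odd letter of `c` would come from one of `b`, which is excluded. Among
  -- the first `t` places it comes from letters of degree zero, and `IsLift.mem_of_eq` applies.
  have hkt : (k : ℕ) < t := by
    by_contra hkt
    have h1 := hc.unique hc (gen_low_eq hkt fun h => hkt (hiff.mpr h)) hckl
    refine (mat_seq_iff.mp hb) k l hkl h1 ?_
    have h2 := (hc k).2.2
    rw [cdeg_gen (by have := (not_isUp _).mp (fun h => hkt ((hup k).mp h)); omega) hkt] at h2
    omega
  left
  have h1 : ∀ a : Fin d, (a : ℕ) < t → cdeg (c a) = 1 → mdeg (b a) = 0 := fun a ha h2 => by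
    have h3 := (hc a).2.2
    rw [cdeg_gen_lt ha] at h3
    omega
  rcases lt_or_gt_of_ne hkl with h | h
  · exact hc.mem_of_eq htd ht h (hiff.mp hkt) hb hckl (h1 k hkt hdeg)
  · exact hc.mem_of_eq htd ht h hkt hb hckl.symm (h1 l (hiff.mp hkt) (hckl ▸ hdeg))

/-- `Δ(λ)` maps injectively onto the `T`-submodule generated by the generating vector. -/
theorem mul_eta_mem_ideal (htd : t ≤ d) (ht : t = d ∨ (i : ℕ) ≠ 0)
    (hJU : ∀ x ∈ (TZdata R F ℓ n d).ideal (genPart i hn hd htd ht),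
      x • CY R F (gen hn hd t : Fin d → CL ℓ n i) ∈ upMod R F d i n (t + 1)) (x : TZ R F ℓ n d)
    (hx : x • CY R F (gen hn hd t : Fin d → CL ℓ n i) ∈ upMod R F d i n (t + 1)) :
    x * (TZdata R F ℓ n d).e (genPart i hn hd htd ht) ∈
      (TZdata R F ℓ n d).ideal (genPart i hn hd htd ht) :=
  mul_eta_mem ht (fun c => ∀ k : Fin d, isUp (c k) ↔ (k : ℕ) < t)
    ((TZdata R F ℓ n d).idealSub (genPart i hn hd htd ht)) (upSub R F d i n (t + 1))
    (MY_mem_ideal_or_exists_lift htd ht) (fun c _ hc => exists_lift ht fun k hk => (hc k).mpr hk)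
    (fun b b' c σ hc hup hup' h h' => h.perm_mem htd ht hc hup hup' h') hJU
    (fun v hv c _ hc => hv c (by
      have : nUp c = t := by rw [nUp, Finset.filter_congr fun k _ => hc k, card_lt htd]
      omega)) x hx

end Standard


/-! ### The tilting modules -/

section Tilting

open scoped Classical

variable {R F : Type*} [CommRing R] [IsDomain R] [CharZero R] [Field F] [Algebra R F]
  {ℓ n d : ℕ} {i : Fin (ℓ + 1)} {hn : 0 < n} {hd : d ≤ n} {t : ℕ}

theorem mem_of_CY_mem {U : Submodule (TZ R F ℓ n d) (TT R F ℓ n d i)} {c : Fin d → CL ℓ n i} (r : F)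
    (h : CY R F c ∈ U) : r • CY R F c ∈ U := by
  rw [← algebraMap_smul (TZ R F ℓ n d) r (CY R F c)]
  exact U.smul_mem _ h

/-- The weights `> λ` do not occur in the layer generated by the vector of weight `λ`. -/
theorem e_smul_mem (htd : t ≤ d) (ht : t = d ∨ (i : ℕ) ≠ 0) {k : MPart ℓ n d}
    (hk : (TZdata R F ℓ n d).lt (genPart i hn hd htd ht) k) {u : TT R F ℓ n d i}
    (hu : u ∈ upMod R F d i n t) :
    (TZdata R F ℓ n d).e k • u ∈ upMod R F d i n (t + 1) := by
  rw [TT_eq_sum u, Finset.smul_sum]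
  refine Submodule.sum_mem _ fun q _ => ?_
  rw [smul_comm]
  rcases lt_trichotomy (nUp (rep q)) t with h | h | h
  · rw [hu (rep q) h, zero_smul]
    exact Submodule.zero_mem _
  · suffices h' : (TZdata R F ℓ n d).e k • CY R F (rep q) = 0 by
      rw [h', smul_zero]
      exact Submodule.zero_mem _
    refine (eta_smul_CY k.1 (rep q)).trans ?_
    split_ifs with hw
    swap
    · rfl
    by_cases hs : (colCal ℓ n i).Seq (rep q)
    swap
    · exact CY_of_not hs
    obtain ⟨σ, hσ⟩ := exists_perm_isUp htd (rep q) h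
    -- The word is rearranged so that its up letters come first; its weight is then at most `λ_t`,
    -- which contradicts the strict inequality.
    have h1 := wt_le_gen (hn := hn) (hd := hd) (hs.comp σ) fun m hm h => hm ((hσ m).mp h)
    rw [← Function.comp_assoc, wt_comp, hw] at h1
    exact absurd (Subtype.ext (leI_antisymm hk.1 h1)) hk.2
  · refine Submodule.smul_mem (upSub R F d i n (t + 1)) _ ?_
    exact (upMod R F d i n (t + 1)).smul_mem _ (CY_mem_upSub (by omega))

/-- The layers are generated by the generating vectors. -/
theorem exists_sub_smul_mem (htd : t ≤ d) (ht : t = d ∨ (i : ℕ) ≠ 0) {u : TT R F ℓ n d i}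
    (hu : u ∈ upMod R F d i n t) : ∃ x : TZ R F ℓ n d,
      u - x • CY R F (gen hn hd t : Fin d → CL ℓ n i) ∈ upMod R F d i n (t + 1) := by
  have key : ∀ q : Quotient (wordSetoid (CL ℓ n i) d), ∃ x : TZ R F ℓ n d,
      ccoF R F (rep q) u • CY R F (rep q) - x • CY R F (gen hn hd t : Fin d → CL ℓ n i) ∈
        upMod R F d i n (t + 1) := by
    intro q
    have h0 : ccoF R F (rep q) u • CY R F (rep q) ∈ upMod R F d i n (t + 1) →
        ∃ x : TZ R F ℓ n d, ccoF R F (rep q) u • CY R F (rep q) -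
          x • CY R F (gen hn hd t : Fin d → CL ℓ n i) ∈ upMod R F d i n (t + 1) := fun h =>
      ⟨0, by
        rw [zero_smul (TZ R F ℓ n d) (CY R F (gen hn hd t : Fin d → CL ℓ n i)), sub_zero]
        exact h⟩
    by_cases hs : (colCal ℓ n i).Seq (rep q)
    swap
    · refine h0 ?_
      rw [CY_of_not hs, smul_zero]
      exact Submodule.zero_mem _
    rcases lt_trichotomy (nUp (rep q)) t with h | h | h
    · refine h0 ?_
      rw [hu (rep q) h, zero_smul]
      exact Submodule.zero_mem _
    · obtain ⟨σ, hσ⟩ := exists_perm_isUp htd (rep q) h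
      obtain ⟨b, hb⟩ := exists_lift (hn := hn) (hd := hd) ht fun m hm => (hσ m).mpr hm
      obtain ⟨ε, hε, h1⟩ := hb.smul_gen R F ht (hs.comp σ)
      obtain ⟨ε', hε', h2⟩ := CY_comp (R := R) (F := F) (rep q) σ
      refine ⟨(ccoF R F (rep q) u * (ε * ε')) • MY R F b, ?_⟩
      rw [smul_assoc, h1, h2, smul_smul, smul_smul,
        show ccoF R F (rep q) u * (ε * ε') * ε * ε' =
          ccoF R F (rep q) u * ((ε * ε) * (ε' * ε')) by ring, hε.mul_self, hε'.mul_self, mul_one,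
        mul_one, sub_self]
      exact Submodule.zero_mem _
    · exact h0 (mem_of_CY_mem _ (CY_mem_upSub (by omega)))
  choose x hx using key
  refine ⟨∑ q, x q, ?_⟩
  rw [Finset.sum_smul]
  conv => enter [2, 1]; rw [TT_eq_sum u]
  rw [← Finset.sum_sub_distrib]
  exact Submodule.sum_mem _ fun q _ => hx q

theorem e_smul_gen (htd : t ≤ d) (ht : t = d ∨ (i : ℕ) ≠ 0) :
    (TZdata R F ℓ n d).e (genPart i hn hd htd ht) • CY R F (gen hn hd t : Fin d → CL ℓ n i) =
      CY R F (gen hn hd t) :=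
  (eta_smul_CY _ _).trans (if_pos rfl)

theorem CY_gen_mem (htd : t ≤ d) (ht : t = d ∨ (i : ℕ) ≠ 0) :
    CY R F (gen hn hd t : Fin d → CL ℓ n i) ∈ upMod R F d i n t :=
  CY_mem_upSub (nUp_gen htd ht).ge

variable (R F ℓ i) in
theorem isTilting (hn : 0 < n) (hd : d ≤ n) : TTIsTilting R F ℓ n d i := by
  -- The layers are `t = d, …, 0`; for `i = 0` all letters are up and only `t = d` occurs.
  let m : ℕ := if (i : ℕ) = 0 then 1 else d + 1
  have hm : ∀ r : Fin m, (r : ℕ) ≤ d ∧ (d - r = d ∨ (i : ℕ) ≠ 0) := fun r => by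
    have h := r.2
    by_cases h0 : (i : ℕ) = 0
    · have : m = 1 := if_pos h0
      omega
    · have : m = d + 1 := if_neg h0
      omega
  refine isTilting_of_chain (TZ_super R F ℓ n d) (TT_superMod R F ℓ n d i)
    (TZ_antiInv R F ℓ n d) (TT_contra ℓ n d i R F) (m := m)
    -- The chain starts at `d + 1` up letters, which is the zero module, and the step number `r`
    -- adds the layer `t = d - r`.
    (fun r => upMod R F d i n (d + 1 - r)) (fun r s hrs => ?_) ?_ ?_
    (fun r => upMod_homogeneous _) fun r => ?_
  · have : (r : ℕ) ≤ s := hrs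
    exact upMod_anti (by omega)
  · exact upMod_eq_bot (by simp)
  · refine upMod_eq_top ?_
    rw [Fin.val_last]
    by_cases h0 : (i : ℕ) = 0
    · have : m = 1 := if_pos h0
      exact Or.inr ⟨by omega, h0⟩
    · have : m = d + 1 := if_neg h0
      exact Or.inl (by omega)
  · obtain ⟨h1, ht⟩ := hm r
    have htd : d - r ≤ d := Nat.sub_le _ _
    have e1 : d + 1 - (r.succ : ℕ) = d - r := by rw [Fin.val_succ]; omega
    have e2 : d + 1 - (r.castSucc : ℕ) = d - r + 1 := by rw [Fin.val_castSucc]; omega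
    simp only [e1, e2]
    have h3 := fun k hk u hu => e_smul_mem (R := R) (F := F) (hn := hn) (hd := hd) htd ht
      (k := k) hk (u := u) hu
    exact ⟨genPart i hn hd htd ht, _, CY R F (gen hn hd (d - r)), CY_gen_mem htd ht, CY_mem _,
      e_smul_gen htd ht, h3, fun u hu => exists_sub_smul_mem htd ht hu,
      fun x hx => mul_eta_mem_ideal htd ht (fun y hy =>
        (TZdata R F ℓ n d).ideal_smul_mem h3 hy (CY_gen_mem htd ht)) x hx⟩

/-! ### Weights -/

theorem CY_ne_zero {c : Fin d → CL ℓ n i} (hc : (colCal ℓ n i).Seq c) : CY R F c ≠ 0 := fun h => by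
  have := ccoF_CY_self (R := R) (F := F) hc
  rw [h, map_zero] at this
  exact zero_ne_one this

variable (R F ℓ i) in
theorem isWeight_iotaOnes (hn : 0 < n) (hd : d ≤ n) :
    TTIsWeight R F ℓ n d i (iotaOnes n d i) := by
  rw [← wt_gen_eq_iotaOnes (hn := hn) (hd := hd)]
  refine ⟨isMComp_wt _, CY R F (gen hn hd d), ?_⟩
  rw [eta_smul_CY, if_pos rfl]
  exact CY_ne_zero (gen_seq (Or.inl rfl))

/-- A weight comes from a basis vector, and for `t = d` the condition of `wt_le_gen` on the tail is
empty. -/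
theorem leI_iotaOnes (hn : 0 < n) (hd : d ≤ n) {μ : MComp ℓ n} (h : TTIsWeight R F ℓ n d i μ) :
    leI μ (iotaOnes n d i) := by
  obtain ⟨-, v, hv⟩ := h
  rw [TT_eq_sum v, Finset.smul_sum] at hv
  obtain ⟨q, -, hq⟩ := Finset.exists_ne_zero_of_sum_ne_zero hv
  rw [smul_comm, eta_smul_CY] at hq
  have hw : wt (crow ∘ rep q) = μ := by
    by_contra h
    rw [if_neg h, smul_zero] at hq
    exact hq rfl
  have hs : (colCal ℓ n i).Seq (rep q) := by
    by_contra h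
    rw [CY_of_not h, ite_self, smul_zero] at hq
    exact hq rfl
  rw [← wt_gen_eq_iotaOnes (hn := hn) (hd := hd), ← hw]
  exact wt_le_gen hs fun k hk => absurd k.2 hk

theorem isMaxWeight_iff (hn : 0 < n) (hd : d ≤ n) (μ : MComp ℓ n) :
    TTIsMaxWeight R F ℓ n d i μ ↔ μ = iotaOnes n d i := by
  constructor
  · rintro ⟨h1, h2⟩
    exact (h2 _ (isWeight_iotaOnes R F ℓ i hn hd) (leI_iotaOnes hn hd h1)).symm
  · rintro rfl
    exact ⟨isWeight_iotaOnes R F ℓ i hn hd, fun ν hν h => leI_antisymm (leI_iotaOnes hn hd hν) h⟩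

/-! ### Projectivity -/

/-- For `t = 0` no place demands an up letter: every word has a lift and every nonzero orbit sum
with the right columns lifts some word without repeated odd letters. Thus `mul_eta_mem` applies with
both subspaces zero. -/
theorem eq_zero_of_smul_gen (hi : (i : ℕ) ≠ 0) (x : TZ R F ℓ n d)
    (hx : x • CY R F (gen hn hd 0 : Fin d → CL ℓ n i) = 0) :
    x * eta R F ℓ n d (wt (crow ∘ (gen hn hd 0 : Fin d → CL ℓ n i))) = 0 := by
  have h := mul_eta_mem (hn := hn) (hd := hd) (Or.inr hi) (fun _ => True)
    (⊥ : Submodule F (TZ R F ℓ n d)) (⊥ : Submodule F (TT R F ℓ n d i)) (fun b hcol => ?_)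
    (fun c _ _ => exists_lift (Or.inr hi) fun k hk => absurd hk (Nat.not_lt_zero _))
    (fun b b' c σ _ _ _ h h' => ?_) (fun y hy => ?_) (fun v hv c _ _ => ?_) x hx
  · exact h
  · by_cases hb : (matCal ℓ n).Seq b
    swap
    · exact Or.inl (MY_of_not hb)
    obtain ⟨c, hc⟩ := exists_isLift (Or.inr hi) hcol fun k hk => absurd hk (Nat.not_lt_zero _)
    refine Or.inr ⟨c, ?_, trivial, hc⟩
    rw [col_seq_iff]
    rw [mat_seq_iff] at hb
    intro k l hkl hckl h1
    have h2 := hc.unique hc (gen_low_eq (Nat.not_lt_zero _) (Nat.not_lt_zero _)) hckl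
    refine hb k l hkl h2 ?_
    rw [← h1, (hc k).2.2, cdeg_gen hi (Nat.not_lt_zero _), add_zero]
  · obtain ⟨ε, -, h2⟩ := MY_comp (R := R) (F := F) b σ
    refine ⟨ε, ?_⟩
    rw [h.comp h' fun k => gen_low_eq (Nat.not_lt_zero _) (Nat.not_lt_zero _), h2, sub_self]
    exact Submodule.zero_mem _
  · rw [(Submodule.mem_bot F).mp hy]
    exact zero_smul (TZ R F ℓ n d) (CY R F (gen hn hd 0 : Fin d → CL ℓ n i))
  · rw [(Submodule.mem_bot F).mp hv, map_zero]

theorem exists_smul_gen_eq (hi : (i : ℕ) ≠ 0) (v : TT R F ℓ n d i) :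
    ∃ x : TZ R F ℓ n d, x • CY R F (gen hn hd 0 : Fin d → CL ℓ n i) = v := by
  have key : ∀ q : Quotient (wordSetoid (CL ℓ n i) d), ∃ x : TZ R F ℓ n d,
      x • CY R F (gen hn hd 0 : Fin d → CL ℓ n i) = CY R F (rep q) := by
    intro q
    by_cases hs : (colCal ℓ n i).Seq (rep q)
    swap
    · exact ⟨0, by
        rw [CY_of_not hs]
        exact zero_smul (TZ R F ℓ n d) (CY R F (gen hn hd 0 : Fin d → CL ℓ n i))⟩
    obtain ⟨b, hb⟩ := exists_lift (c := rep q) (hn := hn) (hd := hd) (Or.inr hi)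
      fun k hk => absurd hk (Nat.not_lt_zero _)
    obtain ⟨ε, hε, h1⟩ := hb.smul_gen R F (Or.inr hi) hs
    exact ⟨ε • MY R F b, by rw [smul_assoc, h1, smul_smul, hε.mul_self, one_smul]⟩
  choose x hx using key
  refine ⟨∑ q, ccoF R F (rep q) v • x q, ?_⟩
  conv_rhs => rw [TT_eq_sum v]
  rw [Finset.sum_smul]
  exact Finset.sum_congr rfl fun q _ => by rw [smul_assoc, hx]

/-- The map `x ↦ x y` from `T η` to `𝒯_i^d`, where `y` is the generating vector of weight `η`. -/
noncomputable def ofProj (R F : Type*) [CommRing R] [IsDomain R] [CharZero R] [Field F] [Algebra R F]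
    (hn : 0 < n) (hd : d ≤ n) (i : Fin (ℓ + 1)) (μ : MComp ℓ n) :
    (Ideal.span {eta R F ℓ n d μ} : Ideal (TZ R F ℓ n d)) →ₗ[TZ R F ℓ n d] TT R F ℓ n d i :=
  (LinearMap.toSpanSingleton (TZ R F ℓ n d) (TT R F ℓ n d i)
    (CY R F (gen hn hd 0 : Fin d → CL ℓ n i))).comp (Submodule.subtype _)

theorem mul_eta_of_mem {μ : MComp ℓ n} {x : TZ R F ℓ n d}
    (hx : x ∈ (Ideal.span {eta R F ℓ n d μ} : Ideal (TZ R F ℓ n d))) :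
    x * eta R F ℓ n d μ = x := by
  obtain ⟨y, rfl⟩ := Ideal.mem_span_singleton'.mp hx
  rw [mul_assoc, eta_mul_eta]

theorem ofProj_bijective {μ : MComp ℓ n} (hi : (i : ℕ) ≠ 0)
    (hμ : wt (crow ∘ (gen hn hd 0 : Fin d → CL ℓ n i)) = μ) :
    Function.Bijective (ofProj R F hn hd i μ) := by
  constructor
  · refine (injective_iff_map_eq_zero _).mpr ?_
    rintro ⟨x, hx⟩ h
    have h1 := eq_zero_of_smul_gen (hn := hn) (hd := hd) hi x h
    rw [hμ, mul_eta_of_mem hx] at h1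
    exact Subtype.ext h1
  · intro v
    obtain ⟨x, hx⟩ := exists_smul_gen_eq (hn := hn) (hd := hd) hi v
    refine ⟨⟨x * eta R F ℓ n d μ, Ideal.mul_mem_left _ _ (Ideal.subset_span rfl)⟩, ?_⟩
    change (x * eta R F ℓ n d μ) • CY R F (gen hn hd 0 : Fin d → CL ℓ n i) = v
    rw [mul_smul, eta_smul_CY, if_pos hμ, hx]

theorem tpar_gen_zero (hi : (i : ℕ) ≠ 0) :
    (colCal ℓ n i).tpar (gen hn hd 0 : Fin d → CL ℓ n i) = 0 :=
  Finset.sum_eq_zero fun k _ => by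
    rw [cpar_zero_iff, cdeg_gen hi (Nat.not_lt_zero _)]
    exact zero_ne_one

/-- The isomorphism is the inverse of `x ↦ x y` with `y` the even generator. If `x y` is
homogeneous, the part of `x` of the other parity annihilates `y`, so by `eq_zero_of_smul_gen` it
does not contribute to `x = x η`. -/
theorem isoProj {μ : MComp ℓ n} (hi : (i : ℕ) ≠ 0)
    (hμ : wt (crow ∘ (gen hn hd 0 : Fin d → CL ℓ n i)) = μ) : TTIsoProj R F ℓ n d i μ := by
  let e := LinearEquiv.ofBijective _ (ofProj_bijective (R := R) (F := F) hi hμ)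
  refine ⟨e.symm, fun δ v hv => ?_⟩
  obtain ⟨⟨x, hx⟩, rfl⟩ := e.surjective v
  rw [LinearEquiv.symm_apply_apply]
  change x • CY R F (gen hn hd 0 : Fin d → CL ℓ n i) ∈ TTgr R F ℓ n d i δ at hv
  obtain ⟨a, ha, b, hb, hab⟩ := (TZ_super R F ℓ n d).split δ x
  have hgen : CY R F (gen hn hd 0 : Fin d → CL ℓ n i) ∈ TTgr R F ℓ n d i 0 := by
    have := CY_mem (R := R) (F := F) (gen hn hd 0 : Fin d → CL ℓ n i)
    rwa [tpar_gen_zero hi] at this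
  have hM := TT_superMod R F ℓ n d i
  have ha' := hM.smul_mem ha hgen
  have hb' := hM.smul_mem hb hgen
  rw [add_zero] at ha' hb'
  have h1 : b • CY R F (gen hn hd 0 : Fin d → CL ℓ n i) = 0 := by
    refine hM.disj (δ := δ) ?_ hb'
    have h2 := Submodule.sub_mem _ hv ha'
    rwa [hab, add_smul a b, add_sub_cancel_left] at h2
  have h2 := eq_zero_of_smul_gen hi b h1
  have h3 : x = a * eta R F ℓ n d μ := by
    rw [hμ] at h2
    rw [← mul_eta_of_mem hx, hab, add_mul, h2, add_zero]
  have h4 := (TZ_super R F ℓ n d).e_mem (genPart i hn hd (Nat.zero_le d) (Or.inr hi))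
  have h5 := (TZ_super R F ℓ n d).mul_mem ha h4
  rw [add_zero] at h5
  change x ∈ TZgr R F ℓ n d δ
  rw [h3, ← hμ]
  exact h5

/-- The surjection `x ↦ x y` from `T` is split by the inverse isomorphism followed by the inclusion
of `T η`. -/
theorem projective {μ : MComp ℓ n} (hi : (i : ℕ) ≠ 0)
    (hμ : wt (crow ∘ (gen hn hd 0 : Fin d → CL ℓ n i)) = μ) :
    Module.Projective (TZ R F ℓ n d) (TT R F ℓ n d i) := by
  let e := LinearEquiv.ofBijective _ (ofProj_bijective (R := R) (F := F) hi hμ)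
  refine Module.Projective.of_split ((Submodule.subtype _).comp e.symm.toLinearMap)
    (LinearMap.toSpanSingleton (TZ R F ℓ n d) (TT R F ℓ n d i)
      (CY R F (gen hn hd 0 : Fin d → CL ℓ n i))) ?_
  exact LinearMap.ext fun v => e.apply_symm_apply v

end Tilting

end ZigSchur

theorem mainTheorem4 {R F : Type*} [CommRing R] [IsDomain R] [IsPrincipalIdealRing R] [CharZero R]
    [Field F] [Algebra R F] (ℓ n d : ℕ) (hℓ : 1 ≤ ℓ) (hn : 0 < n) (hd : d ≤ n) (i : Fin (ℓ + 1)) :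
    ZigSchur.TTIsTilting R F ℓ n d i ∧
    (∀ μ : ZigSchur.MComp ℓ n,
      ZigSchur.TTIsMaxWeight R F ℓ n d i μ ↔ μ = ZigSchur.iotaOnes n d i) ∧
    ∀ j : Fin (ℓ + 1), (j : ℕ) + 1 = i →
      ZigSchur.TTIsoProj R F ℓ n d i (ZigSchur.iotaRow n d j) ∧
      Module.Projective (ZigSchur.TZ R F ℓ n d) (ZigSchur.TT R F ℓ n d i) ∧
      ∃ B : LinearMap.BilinForm F (ZigSchur.TT R F ℓ n d i),
        ZigSchur.TTIsContra R F ℓ n d i B := by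
  refine ⟨ZigSchur.isTilting R F ℓ i hn hd, ZigSchur.isMaxWeight_iff hn hd, fun j hj => ?_⟩
  have hi : (i : ℕ) ≠ 0 := by omega
  have hμ := ZigSchur.wt_gen_eq_iotaRow (n := n) (d := d) (hn := hn) (hd := hd) hj
  exact ⟨ZigSchur.isoProj hi hμ, ZigSchur.projective hi hμ, _, ZigSchur.TT_isContra ℓ n d i R F⟩
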